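/- **Setting.** A real symmetric composition algebra $(S,*,n)$ is a real algebra with a nondegenerate multiplicative quadratic form whose polar form $q(x,y)=n(x+y)-n(x)-n(y)$ satisfies $q(x*y,z)=q(x,y*z)$. Let $\mathfrak{tri}(S)$ be the Lie algebra of triples $(d_0,d_1,d_2)$ of $q$-skew endomorphisms of $S$ with $d_0(x*y)=d_1(x)*y+x*d_2(y)$, let $\vartheta(d_0,d_1,d_2)=(d_2,d_0,d_1)$, and put $$t_{x,y}=\bigl(\sigma_{x,y},\ \tfrac12 q(x,y)\,\mathrm{id}-r_xl_y,\ \tfrac12 q(x,y)\,\mathrm{id}-l_xr_y\bigr)\in\mathfrak{tri}(S),\quad \sigma_{x,y}(z)=q(x,z)y-q(y,z)x,\ l_x(z)=x*z,\ r_x(z)=z*x.$$ For two such algebras $S,S'$ and $\varepsilon\in(\mathbb R^\times)^3$, $\mathfrak g_\varepsilon(S,S')=\mathfrak{tri}(S)\oplus\mathfrak{tri}(S')\oplus\bigoplus_{i=0}^2\iota_i(S\otimes S')$ is the Lie algebra in which $\mathfrak{tri}(S)\oplus\mathfrak{tri}(S')$ is a subalgebra acting by $[(d_j),\iota_i(x\otimes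 x')]=\iota_i(d_i(x)\otimes x')$, $[(d'_j),\iota_i(x\otimes x')]=\iota_i(x\otimes d'_i(x'))$, and (indices mod 3) $$[\iota_i(x\otimes x'),\iota_{i+1}(y\otimes y')]=\varepsilon_{i+2}\,\iota_{i+2}((x*y)\otimes(x'*y')),$$ $$[\iota_i(x\otimes x'),\iota_i(y\otimes y')]=\varepsilon_{i+1}\varepsilon_{i+2}\bigl(q'(x',y')\vartheta^i(t_{x,y})+q(x,y)\vartheta'^i(t'_{x',y'})\bigr).$$ Let $\mathbb O_s$ be the split octonions with standard basis $e_1,e_2,u_i,v_i$ ($e_1,e_2$ orthogonal idempotents with sum $1$; $e_1u_j=u_j=u_je_2$, $e_2v_j=v_j=v_je_1$, $u_iv_i=-e_1$, $v_iu_i=-e_2$, $u_iu_{i+1}=v_{i+2}=-u_{i+1}u_i$, $v_iv_{i+1}=u_{i+2}=-v_{i+1}v_i$, other products $0$; $q(e_1,e_2)=1=q(u_i,v_i)$, other pairs of basis elements orthogonal), and let $p\mathbb O_s$, $p\mathbb C$ be $\mathbb O_s$, $\mathbb C$ with the product $x*y=\bar x\bar y$ and the usual norm. Put $\mathfrak g=\mathfrak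 g_{(1,1,1)}(p\mathbb O_s,p\mathbb C)$. Write $e'_0=1$, $e'_1=\mathbf i$ for the basis of $p\mathbb C$, $d=\sigma'_{e'_0,e'_1}$, and $$h_1=t_{e_1,e_2},\quad h_{j+1}=t_{u_j,v_j}\ (j=1,2,3),\quad h_5=\tfrac14(d,d,-2d),\quad h_6=\tfrac14(d,-2d,d),$$ $\mathfrak h_0=\langle h_1,\dots,h_4\rangle$, $\mathfrak h=\langle h_1,\dots,h_6\rangle$, $\mathfrak g_0=\mathfrak{tri}(p\mathbb O_s)\oplus\bigoplus_i\iota_i(p\mathbb O_s\otimes\mathbb R e'_0)$. A functional is written by its value at $\sum w_ih_i$. Let $\Phi_l=\{\pm w_j\pm w_k\mid 1\le j<k\le4\}$, $\Phi_0=\{\pm w_j\mid 1\le j\le 4\}$, and let $\Phi_1$, $\Phi_2$ be the sets of $\frac12\sum_{j\le4}\epsilon_jw_j$, $\epsilon_j=\pm1$, with $\prod\epsilon_j=1$, respectively $-1$; $\Phi=\Phi_l\cup\Phi_0\cup\Phi_1\cup\Phi_2$ and $\Phi^+=\{w_j\pm w_k\mid j<k\}\cup\{w_j\}\cup\{\frac12(w_1\pm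 w_2\pm w_3\pm w_4)\}$. Let $\Psi_i:\mathfrak g\to\mathfrak g$ be the linear map that is $\mathrm{id}$ on $\mathfrak{tri}(p\mathbb O_s)\oplus\mathfrak{tri}(p\mathbb C)$, $-\mathrm{id}$ on $\iota_i(p\mathbb O_s\otimes p\mathbb C)$, and for $j\ne i$ sends $\iota_j(x\otimes e'_0)\mapsto-\iota_j(x\otimes e'_1)$, $\iota_j(x\otimes e'_1)\mapsto\iota_j(x\otimes e'_0)$. A Cartan decomposition of a real semisimple Lie algebra $L$ is a decomposition $L=\mathfrak t\oplus\mathfrak p$ with $\mathfrak t=L\cap\mathfrak u$, $\mathfrak p=L\cap\mathbf i\mathfrak u$ for a compact real form $\mathfrak u$ of $L^{\mathbb C}$. For $\mathfrak a$ maximal abelian in $\mathfrak p$, a maximal abelian subalgebra $\mathfrak h\supseteq\mathfrak a$, and a basis $B$ of the roots $\Delta$ of $(L^{\mathbb C},\mathfrak h^{\mathbb C})$ such that $\{\alpha\in B:\alpha|_{\mathfrak a}=0\}$ is a basis of $\{\alpha\in\Delta:\alpha|_{\mathfrak a}=0\}$, the Satake diagram is the Dynkin diagram of $B$ with the nodes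 $\alpha|_{\mathfrak a}=0$ black, the others white, and distinct white nodes with the same restriction $\bar\alpha=\alpha|_{\mathfrak a}$ joined by an arrow. The restricted roots are the nonzero $\lambda\in\mathfrak a^*$ with $L_\lambda=\{x:[a,x]=\lambda(a)x\ \forall a\in\mathfrak a\}\neq0$, and $m_\lambda=\dim L_\lambda$. **Theorem.** 1. $\mathfrak g$ is semisimple, $\mathfrak g^{\mathbb C}$ is simple of type $E_6$, and the Killing form of $\mathfrak g$ has signature $2$. Each $\Psi_i$ is an automorphism of $\mathfrak g$. 2. $\mathfrak g_0$ is a split real subalgebra of type $F_4$, with (split) Cartan subalgebra $\mathfrak h_0$, root system $\Phi$, and basis of roots $w_2-w_3,\ w_3-w_4,\ w_4,\ \frac12(w_1-w_2-w_3-w_4)$. 3. There are $e_\alpha\in(\mathfrak g_0)_\alpha$, $f_\alpha\in(\mathfrak g_0)_{-\alpha}$ $(\alpha\in\Phi^+)$ with $[e_\alpha,f_\alpha]=h_\alpha\in\mathfrak h_0$, $\alpha(h_\alpha)=2$, such that $-\mathrm{id}$ on $\mathfrak h_0$ and $e_\alpha\mapsto -f_\alpha$ extend to an automorphism of $\mathfrak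 g_0$. For every such choice, $\langle e_\alpha-f_\alpha\rangle_{\alpha\in\Phi^+}\oplus(\mathfrak h_0\oplus\langle e_\alpha+f_\alpha\rangle_{\alpha\in\Phi^+})$ is a Cartan decomposition of $\mathfrak g_0$, and $\mathfrak g=\mathfrak t\oplus\mathfrak p$ with $$\mathfrak t=\mathfrak{tri}(p\mathbb C)\oplus\langle e_\alpha-f_\alpha\mid\alpha\in\Phi^+\rangle\oplus\bigoplus_{i=0}^2\langle\Psi_i(e_\alpha-f_\alpha)\mid\alpha\in\Phi^+\cap\Phi_{i+1}\rangle,$$ $$\mathfrak p=\mathfrak h_0\oplus\langle e_\alpha+f_\alpha\mid\alpha\in\Phi^+\rangle\oplus\bigoplus_{i=0}^2\langle\Psi_i(e_\alpha+f_\alpha)\mid\alpha\in\Phi^+\cap\Phi_{i+1}\rangle$$ (indices of $\Phi_{i+1}$ mod 3) is a Cartan decomposition of $\mathfrak g$, with $\dim\mathfrak t=38$, $\dim\mathfrak p=40$. 4. $h_1,\dots,h_6$ are linearly independent, $\mathfrak h=\mathfrak h_0\oplus\mathfrak{tri}(p\mathbb C)$ is a maximal abelian subalgebra of $\mathfrak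 g$, $\mathfrak h^{\mathbb C}$ is a Cartan subalgebra of $\mathfrak g^{\mathbb C}$, $\mathfrak a=\mathfrak h_0$ (of dimension $4$) is a maximal abelian subspace of $\mathfrak p$, $\mathfrak h\cap\mathfrak p=\mathfrak a$ and $\mathfrak h\cap\mathfrak t=\mathfrak{tri}(p\mathbb C)$. The root system $\Delta$ of $\mathfrak g^{\mathbb C}$ relative to $\mathfrak h^{\mathbb C}$ is $$\Phi_l\cup\{\beta\pm\tfrac{\mathbf i}2(w_5+w_6)\mid\beta\in\Phi_0\}\cup\{\beta\pm\mathbf i(\tfrac12w_5-w_6)\mid\beta\in\Phi_1\}\cup\{\beta\pm\mathbf i(w_5-\tfrac12w_6)\mid\beta\in\Phi_2\}.$$ 5. The functionals $$\alpha_{1}=\tfrac12(w_1-w_2-w_3-w_4+\mathbf i(2w_5-w_6)),\quad \alpha_2=w_2-w_3,\quad \alpha_3=\tfrac12(2w_4-\mathbf iw_5-\mathbf iw_6),$$ $$\alpha_4=w_3-w_4,\quad \alpha_5=\tfrac12(2w_4+\mathbf iw_5+\mathbf iw_6),\quad \alpha_6=\tfrac12(w_1-w_2-w_3-w_4-\mathbf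 i(2w_5-w_6))$$ form an adapted basis of $\Delta$, and the resulting Satake diagram is the Dynkin diagram of $E_6$ (chain $\alpha_1,\alpha_3,\alpha_4,\alpha_5,\alpha_6$, with $\alpha_2$ attached to $\alpha_4$), all nodes white, with exactly two arrows, joining $\alpha_1$ to $\alpha_6$ and $\alpha_3$ to $\alpha_5$. 6. The set of restricted roots is $\Phi$, a root system of type $F_4$ with basis $\bar\alpha_1,\bar\alpha_2,\bar\alpha_3,\bar\alpha_4$ (chain $\bar\alpha_2,\bar\alpha_4,\bar\alpha_3,\bar\alpha_1$, the first two long), and $m_{\bar\alpha_2}=m_{\bar\alpha_4}=1$, $m_{\bar\alpha_1}=m_{\bar\alpha_3}=2$. -/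

import Mathlib

open scoped TensorProduct

/-- A real symmetric composition algebra: a bilinear product together with a nondegenerate
multiplicative quadratic form whose polar form `n(x, y) = n(x + y) - n(x) - n(y)` is associative. -/
structure SymCompAlg (S : Type*) [AddCommGroup S] [Module ℝ S] where
  mul : S →ₗ[ℝ] S →ₗ[ℝ] S
  norm : QuadraticForm ℝ S
  norm_mul : ∀ x y, norm (mul x y) = norm x * norm y
  polar_assoc : ∀ x y z, QuadraticMap.polar norm (mul x y) z = QuadraticMap.polar norm x (mul y z)
  nondegenerate : ∀ x, (∀ y, QuadraticMap.polar norm x y = 0) → x = 0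

section Triality

attribute [local instance] LieRing.ofAssociativeRing

namespace SymCompAlg

variable {S : Type*} [AddCommGroup S] [Module ℝ S] (A : SymCompAlg S)

/-- The polar form of the norm, as a bilinear form. -/
noncomputable def q : LinearMap.BilinForm ℝ S := A.norm.polarBilin

lemma q_apply (x y : S) : A.q x y = QuadraticMap.polar A.norm x y := rfl

lemma q_comm (x y : S) : A.q x y = A.q y x := by
  simp only [q_apply, QuadraticMap.polar_comm]

lemma q_assoc (x y z : S) : A.q (A.mul x y) z = A.q x (A.mul y z) := A.polar_assoc x y z

lemma q_cyc (x y z : S) : A.q (A.mul x y) z = A.q (A.mul y z) x := by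
  rw [q_assoc, q_comm]

lemma ext_q {x y : S} (h : ∀ z, A.q x z = A.q y z) : x = y := by
  refine sub_eq_zero.mp (A.nondegenerate _ fun z ↦ ?_)
  have := h z
  rw [← q_apply, map_sub, LinearMap.sub_apply, this, sub_self]

lemma norm_add (x y : S) : A.norm (x + y) = A.norm x + A.norm y + A.q x y := by
  rw [q_apply, QuadraticMap.polar]; ring

lemma q_self (x : S) : A.q x x = 2 * A.norm x := by
  rw [q_apply, QuadraticMap.polar_self]; simp

lemma q_mul_left (x y z : S) : A.q (A.mul x y) (A.mul x z) = A.norm x * A.q y z := by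
  have h := A.norm_mul x (y + z)
  rw [map_add, norm_add, norm_add, A.norm_mul, A.norm_mul] at h
  linarith

lemma q_mul_right (x y z : S) : A.q (A.mul y x) (A.mul z x) = A.norm x * A.q y z := by
  have h := A.norm_mul (y + z) x
  rw [map_add, LinearMap.add_apply, norm_add, norm_add, A.norm_mul, A.norm_mul] at h
  linarith

lemma mul_mul_self (x y : S) : A.mul (A.mul x y) x = A.norm x • y := by
  refine A.ext_q fun z ↦ ?_
  rw [q_assoc, q_mul_left]; simp

lemma self_mul_mul (x y : S) : A.mul x (A.mul y x) = A.norm x • y := by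
  refine A.ext_q fun z ↦ ?_
  rw [q_comm, ← q_assoc, q_mul_right, q_comm]; simp

lemma mul_mul_add (x y z : S) :
    A.mul (A.mul x y) z + A.mul (A.mul z y) x = A.q x z • y := by
  have h := A.mul_mul_self (x + z) y
  simp only [map_add, LinearMap.add_apply, norm_add, mul_mul_self] at h
  linear_combination (norm := module) h

lemma add_mul_mul (x y z : S) :
    A.mul x (A.mul y z) + A.mul z (A.mul y x) = A.q x z • y := by
  have h := A.self_mul_mul (x + z) y
  simp only [map_add, LinearMap.add_apply, norm_add, self_mul_mul] at h
  linear_combination (norm := module) h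

/-- The triality Lie algebra: triples `(d₀, d₁, d₂)` of skew transformations such that
`d₀ (x * y) = d₁ x * y + x * d₂ y`. -/
noncomputable def tri : LieSubalgebra ℝ (Fin 3 → Module.End ℝ S) where
  carrier := {d | (∀ i x y, A.q (d i x) y + A.q x (d i y) = 0) ∧
    ∀ x y, d 0 (A.mul x y) = A.mul (d 1 x) y + A.mul x (d 2 y)}
  add_mem' {d e} hd he := by
    refine ⟨fun i x y ↦ ?_, fun x y ↦ ?_⟩
    · have h1 := hd.1 i x y
      have h2 := he.1 i x y
      simp only [Pi.add_apply, LinearMap.add_apply, map_add]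
      linarith
    · simp only [Pi.add_apply, LinearMap.add_apply, map_add, hd.2, he.2]
      abel
  zero_mem' := by simp
  smul_mem' c d hd := by
    refine ⟨fun i x y ↦ ?_, fun x y ↦ ?_⟩
    · have h1 := hd.1 i x y
      simp only [Pi.smul_apply, LinearMap.smul_apply, map_smul, smul_eq_mul]
      linear_combination c * h1
    · simp only [Pi.smul_apply, LinearMap.smul_apply, map_smul, hd.2, smul_add]
  lie_mem' {d e} hd he := by
    refine ⟨fun i x y ↦ ?_, fun x y ↦ ?_⟩
    · have h1 := hd.1 i (e i x) y
      have h2 := he.1 i (d i x) y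
      have h3 := hd.1 i x (e i y)
      have h4 := he.1 i x (d i y)
      simp only [LieRing.lie_apply, Ring.lie_def, LinearMap.sub_apply, Module.End.mul_apply, map_sub]
      linarith
    · simp only [LieRing.lie_apply, Ring.lie_def, LinearMap.sub_apply, Module.End.mul_apply, map_sub,
        map_add, hd.2, he.2]
      abel

variable {A}

lemma tri_skew (d : A.tri) (i : Fin 3) (x y : S) :
    A.q (d.1 i x) y = - A.q x (d.1 i y) := by
  linarith [d.2.1 i x y]

lemma tri_zero (d : A.tri) (x y : S) :
    d.1 0 (A.mul x y) = A.mul (d.1 1 x) y + A.mul x (d.1 2 y) := d.2.2 x y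

lemma tri_two (d : A.tri) (x y : S) :
    d.1 2 (A.mul x y) = A.mul (d.1 0 x) y + A.mul x (d.1 1 y) := by
  refine A.ext_q fun z ↦ ?_
  have h := congrArg (fun w ↦ A.q w x) (tri_zero d y z)
  simp only [map_add, LinearMap.add_apply] at h ⊢
  rw [tri_skew] at h ⊢
  rw [A.q_cyc x y, A.q_cyc (d.1 0 x), A.q_cyc x]
  linarith

lemma tri_one (d : A.tri) (x y : S) :
    d.1 1 (A.mul x y) = A.mul (d.1 2 x) y + A.mul x (d.1 0 y) := by
  refine A.ext_q fun z ↦ ?_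
  have h := congrArg (fun w ↦ A.q w x) (tri_two d y z)
  simp only [map_add, LinearMap.add_apply] at h ⊢
  rw [tri_skew] at h ⊢
  rw [A.q_cyc x y, A.q_cyc (d.1 2 x), A.q_cyc x]
  linarith

lemma tri_mul (d : A.tri) (i : Fin 3) (x y : S) :
    d.1 i (A.mul x y) = A.mul (d.1 (i + 1) x) y + A.mul x (d.1 (i + 2) y) := by
  fin_cases i
  · exact tri_zero d x y
  · exact tri_one d x y
  · exact tri_two d x y

variable (A)

/-- The triality automorphism `(d₀, d₁, d₂) ↦ (d₂, d₀, d₁)`. -/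
noncomputable def theta : A.tri →ₗ[ℝ] A.tri where
  toFun d := ⟨![d.1 2, d.1 0, d.1 1], by
    refine ⟨fun i x y ↦ ?_, fun x y ↦ ?_⟩
    · fin_cases i
      · exact d.2.1 2 x y
      · exact d.2.1 0 x y
      · exact d.2.1 1 x y
    · exact tri_two d x y⟩
  map_add' d e := by ext i : 2; fin_cases i <;> rfl
  map_smul' c d := by ext i : 2; fin_cases i <;> rfl

lemma theta_apply (d : A.tri) (j : Fin 3) : (A.theta d).1 j = d.1 (j + 2) := by
  fin_cases j <;> rfl

lemma theta_pow_apply (i : Fin 3) (d : A.tri) (j : Fin 3) :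
    ((A.theta ^ (i : ℕ)) d).1 j = d.1 (j - i) := by
  fin_cases i <;> fin_cases j <;> rfl

/-- The triple `t_{x,y} = (σ_{x,y}, ½ q(x,y) id - r_x l_y, ½ q(x,y) id - l_x r_y)`, where
`σ_{x,y} z = q(x,z) y - q(y,z) x`, `l_x z = x * z` and `r_x z = z * x`. -/
noncomputable def tTriple (x y : S) : Fin 3 → Module.End ℝ S :=
  ![(A.q x).smulRight y - (A.q y).smulRight x,
    (2⁻¹ * A.q x y) • LinearMap.id - A.mul.flip x ∘ₗ A.mul y,
    (2⁻¹ * A.q x y) • LinearMap.id - A.mul x ∘ₗ A.mul.flip y]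

lemma tTriple_zero (x y z : S) : A.tTriple x y 0 z = A.q x z • y - A.q y z • x := rfl

lemma tTriple_one (x y z : S) :
    A.tTriple x y 1 z = (2⁻¹ * A.q x y) • z - A.mul (A.mul y z) x := rfl

lemma tTriple_two (x y z : S) :
    A.tTriple x y 2 z = (2⁻¹ * A.q x y) • z - A.mul x (A.mul z y) := rfl

lemma tTriple_mem (x y : S) : A.tTriple x y ∈ A.tri := by
  refine ⟨fun i u v ↦ ?_, fun u v ↦ ?_⟩
  · have e1 : A.q (A.mul (A.mul y u) x) v = A.q u (A.mul (A.mul x v) y) := by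
      rw [q_assoc, q_cyc, q_assoc]
    have e2 : A.q (A.mul x (A.mul u y)) v = A.q u (A.mul y (A.mul v x)) := by
      rw [q_cyc, q_assoc, q_assoc]
    have h1 := congrArg (A.q u) (A.mul_mul_add x v y)
    have h2 := congrArg (A.q u) (A.add_mul_mul x v y)
    simp only [map_add, map_smul, smul_eq_mul] at h1 h2
    fin_cases i
    · change A.q (A.tTriple x y 0 u) v + A.q u (A.tTriple x y 0 v) = 0
      simp only [tTriple_zero, map_sub, map_smul, LinearMap.sub_apply, LinearMap.smul_apply,
        smul_eq_mul, A.q_comm u]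
      ring
    · change A.q (A.tTriple x y 1 u) v + A.q u (A.tTriple x y 1 v) = 0
      simp only [tTriple_one, map_sub, map_smul, LinearMap.sub_apply, LinearMap.smul_apply,
        smul_eq_mul, e1]
      linarith
    · change A.q (A.tTriple x y 2 u) v + A.q u (A.tTriple x y 2 v) = 0
      simp only [tTriple_two, map_sub, map_smul, LinearMap.sub_apply, LinearMap.smul_apply,
        smul_eq_mul, e2]
      linarith
  · have h1 := A.mul_mul_add (A.mul y u) x v
    have h2 := A.add_mul_mul (A.mul v x) y u
    have h3 := congrArg (A.mul u) (A.add_mul_mul x v y)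
    have e1 : A.q (A.mul y u) v = A.q y (A.mul u v) := by rw [q_assoc]
    have e2 : A.q (A.mul v x) u = A.q x (A.mul u v) := by rw [q_cyc, q_assoc]
    simp only [map_add, map_smul] at h3
    rw [e1] at h1
    rw [e2] at h2
    simp only [tTriple_zero, tTriple_one, tTriple_two, map_sub, map_smul, LinearMap.sub_apply,
      LinearMap.smul_apply]
    linear_combination (norm := module) h1 - h2 + h3

/-- The element `t_{x,y}` of the triality algebra, as a bilinear map. -/
noncomputable def t : S →ₗ[ℝ] S →ₗ[ℝ] A.tri :=
  LinearMap.mk₂ ℝ (fun x y ↦ ⟨A.tTriple x y, A.tTriple_mem x y⟩)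
    (fun x x' y ↦ by
      refine Subtype.ext (funext fun i ↦ LinearMap.ext fun z ↦ ?_)
      fin_cases i <;> simp [tTriple] <;> module)
    (fun c x y ↦ by
      refine Subtype.ext (funext fun i ↦ LinearMap.ext fun z ↦ ?_)
      fin_cases i <;> simp [tTriple] <;> module)
    (fun x y y' ↦ by
      refine Subtype.ext (funext fun i ↦ LinearMap.ext fun z ↦ ?_)
      fin_cases i <;> simp [tTriple] <;> module)
    (fun c x y ↦ by
      refine Subtype.ext (funext fun i ↦ LinearMap.ext fun z ↦ ?_)
      fin_cases i <;> simp [tTriple] <;> module)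

lemma t_zero (x y z : S) : (A.t x y).1 0 z = A.q x z • y - A.q y z • x := rfl

lemma t_one (x y z : S) :
    (A.t x y).1 1 z = (2⁻¹ * A.q x y) • z - A.mul (A.mul y z) x := rfl

lemma t_two (x y z : S) :
    (A.t x y).1 2 z = (2⁻¹ * A.q x y) • z - A.mul x (A.mul z y) := rfl

lemma tri_ext {d e : A.tri} (h : ∀ i z, d.1 i z = e.1 i z) : d = e :=
  Subtype.ext (funext fun i ↦ LinearMap.ext (h i))

lemma t_swap (x y : S) : A.t y x = - A.t x y := by
  refine A.tri_ext fun i z ↦ ?_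
  fin_cases i
  · change (A.t y x).1 0 z = -((A.t x y).1 0 z)
    rw [t_zero, t_zero]; abel
  · change (A.t y x).1 1 z = -((A.t x y).1 1 z)
    have := A.mul_mul_add x z y
    rw [t_one, t_one, A.q_comm y x]
    linear_combination (norm := module) -this
  · change (A.t y x).1 2 z = -((A.t x y).1 2 z)
    have := A.add_mul_mul x z y
    rw [t_two, t_two, A.q_comm y x]
    linear_combination (norm := module) -this

lemma tri_lie_apply (d e : A.tri) (i : Fin 3) (z : S) :
    (⁅d, e⁆ : A.tri).1 i z = d.1 i (e.1 i z) - e.1 i (d.1 i z) := rfl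

lemma lie_t (d : A.tri) (x y : S) :
    ⁅d, A.t x y⁆ = A.t (d.1 0 x) y + A.t x (d.1 0 y) := by
  refine A.tri_ext fun i z ↦ ?_
  rw [tri_lie_apply]
  have h : A.q (d.1 0 x) y + A.q x (d.1 0 y) = 0 := d.2.1 0 x y
  fin_cases i
  · change d.1 0 ((A.t x y).1 0 z) - (A.t x y).1 0 (d.1 0 z) =
      (A.t (d.1 0 x) y).1 0 z + (A.t x (d.1 0 y)).1 0 z
    simp only [t_zero, map_sub, map_smul, tri_skew]
    module
  · change d.1 1 ((A.t x y).1 1 z) - (A.t x y).1 1 (d.1 1 z) =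
      (A.t (d.1 0 x) y).1 1 z + (A.t x (d.1 0 y)).1 1 z
    simp only [t_one, map_sub, map_smul, tri_one, tri_two, map_add, LinearMap.add_apply]
    linear_combination (norm := module) (-2⁻¹ : ℝ) • congrArg (· • z) h
  · change d.1 2 ((A.t x y).1 2 z) - (A.t x y).1 2 (d.1 2 z) =
      (A.t (d.1 0 x) y).1 2 z + (A.t x (d.1 0 y)).1 2 z
    simp only [t_two, map_sub, map_smul, tri_one, tri_two, map_add]
    linear_combination (norm := module) (-2⁻¹ : ℝ) • congrArg (· • z) h

lemma t_cyc_aux (x y z w : S) :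
    (A.t x (A.mul y z)).1 0 w + (A.t y (A.mul z x)).1 2 w + (A.t z (A.mul x y)).1 1 w = 0 := by
  have h1 := congrArg (A.mul y) (A.add_mul_mul w z x)
  have h3 := A.add_mul_mul y x (A.mul z w)
  have h5 := A.mul_mul_add (A.mul x y) w z
  rw [A.q_comm w x, map_add, map_smul] at h1
  rw [← q_assoc] at h3
  rw [q_assoc] at h5
  have e1 : A.q z (A.mul x y) = A.q x (A.mul y z) := by rw [q_comm, q_assoc]
  have e2 : A.q y (A.mul z x) = A.q x (A.mul y z) := by rw [← q_assoc, q_comm]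
  rw [t_zero, t_one, t_two, e1, e2]
  linear_combination (norm := module) -h1 + h3 - h5

lemma t_cyc (x y z : S) :
    A.t x (A.mul y z) + A.theta (A.t y (A.mul z x)) + (A.theta ^ 2) (A.t z (A.mul x y)) = 0 := by
  refine A.tri_ext fun i w ↦ ?_
  fin_cases i
  · exact A.t_cyc_aux x y z w
  · have h := A.t_cyc_aux y z x w
    change (A.t x (A.mul y z)).1 1 w + (A.t y (A.mul z x)).1 0 w + (A.t z (A.mul x y)).1 2 w = 0
    linear_combination (norm := module) h
  · have h := A.t_cyc_aux z x y w
    change (A.t x (A.mul y z)).1 2 w + (A.t y (A.mul z x)).1 1 w + (A.t z (A.mul x y)).1 0 w = 0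
    linear_combination (norm := module) h

/-- `ϑ^i` applied to `t_{x,y}`. -/
noncomputable def tPow (i : Fin 3) : S →ₗ[ℝ] S →ₗ[ℝ] A.tri := A.t.compr₂ (A.theta ^ (i : ℕ))

lemma tPow_apply (i j : Fin 3) (x y z : S) :
    (A.tPow i x y).1 j z = (A.t x y).1 (j - i) z :=
  LinearMap.congr_fun (A.theta_pow_apply i (A.t x y) j) z

lemma tPow_swap (i : Fin 3) (x y : S) : A.tPow i y x = - A.tPow i x y := by
  simp only [tPow, LinearMap.compr₂_apply, A.t_swap x y, map_neg]

lemma lie_tPow (d : A.tri) (i : Fin 3) (x y : S) :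
    ⁅d, A.tPow i x y⁆ = A.tPow i (d.1 i x) y + A.tPow i x (d.1 i y) := by
  have key (e : A.tri) (h : ∀ j, e.1 (j - i) = d.1 j) (h0 : e.1 0 = d.1 i) :
      ⁅d, A.tPow i x y⁆ = A.tPow i (d.1 i x) y + A.tPow i x (d.1 i y) := by
    have hl := A.lie_t e x y
    rw [h0] at hl
    refine A.tri_ext fun j z ↦ ?_
    have := congrArg (fun f ↦ f.1 (j - i) z) hl
    change _ = (A.tPow i (d.1 i x) y).1 j z + (A.tPow i x (d.1 i y)).1 j z
    rw [tri_lie_apply, tPow_apply, tPow_apply, tPow_apply, tPow_apply, ← h j]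
    exact this
  fin_cases i
  · exact key d (fun j ↦ by fin_cases j <;> rfl) rfl
  · exact key (A.theta (A.theta d)) (fun j ↦ by fin_cases j <;> rfl) rfl
  · exact key (A.theta d) (fun j ↦ by fin_cases j <;> rfl) rfl

lemma tPow_cyc (i : Fin 3) (x y z : S) :
    A.tPow i x (A.mul y z) + A.tPow (i + 1) y (A.mul z x) + A.tPow (i + 2) z (A.mul x y) = 0 := by
  have h := A.t_cyc x y z
  refine A.tri_ext fun j w ↦ ?_
  have h1 := congrArg (fun f ↦ f.1 (j - i) w) h
  change (A.t x (A.mul y z)).1 (j - i) w + (A.theta (A.t y (A.mul z x))).1 (j - i) w +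
    ((A.theta ^ 2) (A.t z (A.mul x y))).1 (j - i) w = 0 at h1
  change (A.tPow i x (A.mul y z)).1 j w + (A.tPow (i + 1) y (A.mul z x)).1 j w +
    (A.tPow (i + 2) z (A.mul x y)).1 j w = 0
  rw [tPow_apply, tPow_apply, tPow_apply]
  refine Eq.trans ?_ h1
  fin_cases i <;> fin_cases j <;> rfl

end SymCompAlg

end Triality

section Magic

variable {S S' : Type*} [AddCommGroup S] [Module ℝ S] [AddCommGroup S'] [Module ℝ S']

/-- The vector space `tri(S) ⊕ tri(S') ⊕ ι₀(S ⊗ S') ⊕ ι₁(S ⊗ S') ⊕ ι₂(S ⊗ S')` underlying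
`g_ε(S, S')`. -/
def MagicAlg (A : SymCompAlg S) (A' : SymCompAlg S') (_ε : Fin 3 → ℝ) : Type _ :=
  A.tri × A'.tri × (Fin 3 → S ⊗[ℝ] S')

namespace MagicAlg

variable (A : SymCompAlg S) (A' : SymCompAlg S') (ε : Fin 3 → ℝ)

noncomputable instance : AddCommGroup (MagicAlg A A' ε) :=
  inferInstanceAs (AddCommGroup (A.tri × A'.tri × (Fin 3 → S ⊗[ℝ] S')))

noncomputable instance : Module ℝ (MagicAlg A A' ε) :=
  inferInstanceAs (Module ℝ (A.tri × A'.tri × (Fin 3 → S ⊗[ℝ] S')))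

/-- `x ⊗ x', y ⊗ y' ↦ q'(x', y') ϑ^i(t_{x,y})`. -/
noncomputable def K (i : Fin 3) : S ⊗[ℝ] S' →ₗ[ℝ] S ⊗[ℝ] S' →ₗ[ℝ] A.tri :=
  (TensorProduct.map₂ (A.tPow i) A'.q).compr₂ (TensorProduct.rid ℝ A.tri).toLinearMap

/-- `x ⊗ x', y ⊗ y' ↦ q(x, y) ϑ'^i(t'_{x',y'})`. -/
noncomputable def K' (i : Fin 3) : S ⊗[ℝ] S' →ₗ[ℝ] S ⊗[ℝ] S' →ₗ[ℝ] A'.tri :=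
  (TensorProduct.map₂ A.q (A'.tPow i)).compr₂ (TensorProduct.lid ℝ A'.tri).toLinearMap

/-- `x ⊗ x', y ⊗ y' ↦ (x * y) ⊗ (x' ⋆ y')`. -/
noncomputable def M : S ⊗[ℝ] S' →ₗ[ℝ] S ⊗[ℝ] S' →ₗ[ℝ] S ⊗[ℝ] S' :=
  TensorProduct.map₂ A.mul A'.mul

variable {A A'} in
/-- The action of an element of `tri(S)` on `ι_i(S ⊗ S')`. -/
noncomputable def act (d : A.tri) (i : Fin 3) : S ⊗[ℝ] S' →ₗ[ℝ] S ⊗[ℝ] S' :=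
  LinearMap.rTensor S' (d.1 i)

variable {A A'} in
/-- The action of an element of `tri(S')` on `ι_i(S ⊗ S')`. -/
noncomputable def act' (d : A'.tri) (i : Fin 3) : S ⊗[ℝ] S' →ₗ[ℝ] S ⊗[ℝ] S' :=
  LinearMap.lTensor S (d.1 i)

lemma K_tmul (i : Fin 3) (x y : S) (x' y' : S') :
    K A A' i (x ⊗ₜ x') (y ⊗ₜ y') = A'.q x' y' • A.tPow i x y := rfl

lemma K'_tmul (i : Fin 3) (x y : S) (x' y' : S') :
    K' A A' i (x ⊗ₜ x') (y ⊗ₜ y') = A.q x y • A'.tPow i x' y' := rfl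

lemma M_tmul (x y : S) (x' y' : S') :
    M A A' (x ⊗ₜ x') (y ⊗ₜ y') = A.mul x y ⊗ₜ A'.mul x' y' := rfl

variable {A A'}

lemma act_tmul (d : A.tri) (i : Fin 3) (x : S) (x' : S') :
    act d i (x ⊗ₜ[ℝ] x') = d.1 i x ⊗ₜ x' := rfl

lemma act'_tmul (d : A'.tri) (i : Fin 3) (x : S) (x' : S') :
    act' d i (x ⊗ₜ[ℝ] x') = x ⊗ₜ d.1 i x' := rfl

lemma act_add (d e : A.tri) (i : Fin 3) (a : S ⊗[ℝ] S') :
    act (d + e) i a = act d i a + act e i a := by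
  change LinearMap.rTensor S' (d.1 i + e.1 i) a = _
  rw [LinearMap.rTensor_add]; rfl

lemma act'_add (d e : A'.tri) (i : Fin 3) (a : S ⊗[ℝ] S') :
    act' (d + e) i a = act' d i a + act' e i a := by
  change LinearMap.lTensor S (d.1 i + e.1 i) a = _
  rw [LinearMap.lTensor_add]; rfl

lemma act_smul (c : ℝ) (d : A.tri) (i : Fin 3) (a : S ⊗[ℝ] S') :
    act (c • d) i a = c • act d i a := by
  change LinearMap.rTensor S' (c • d.1 i) a = _
  rw [LinearMap.rTensor_smul]; rfl

lemma act'_smul (c : ℝ) (d : A'.tri) (i : Fin 3) (a : S ⊗[ℝ] S') :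
    act' (c • d) i a = c • act' d i a := by
  change LinearMap.lTensor S (c • d.1 i) a = _
  rw [LinearMap.lTensor_smul]; rfl

lemma act_zero (i : Fin 3) (a : S ⊗[ℝ] S') : act (0 : A.tri) i a = 0 := by
  simpa using act_smul 0 (0 : A.tri) i a

lemma act'_zero (i : Fin 3) (a : S ⊗[ℝ] S') : act' (0 : A'.tri) i a = 0 := by
  simpa using act'_smul 0 (0 : A'.tri) i a

lemma act_lie (d e : A.tri) (i : Fin 3) (a : S ⊗[ℝ] S') :
    act ⁅d, e⁆ i a = act d i (act e i a) - act e i (act d i a) := by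
  induction a using TensorProduct.induction_on with
  | zero => simp
  | tmul x x' => simp only [act_tmul, SymCompAlg.tri_lie_apply, TensorProduct.sub_tmul]
  | add a b ha hb => simp only [map_add, ha, hb]; abel

lemma act'_lie (d e : A'.tri) (i : Fin 3) (a : S ⊗[ℝ] S') :
    act' ⁅d, e⁆ i a = act' d i (act' e i a) - act' e i (act' d i a) := by
  induction a using TensorProduct.induction_on with
  | zero => simp
  | tmul x x' => simp only [act'_tmul, SymCompAlg.tri_lie_apply, TensorProduct.tmul_sub]
  | add a b ha hb => simp only [map_add, ha, hb]; abel

lemma act_act' (d : A.tri) (d' : A'.tri) (i : Fin 3) (a : S ⊗[ℝ] S') :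
    act d i (act' d' i a) = act' d' i (act d i a) := by
  induction a using TensorProduct.induction_on with
  | zero => simp
  | tmul x x' => simp only [act_tmul, act'_tmul]
  | add a b ha hb => simp only [map_add, ha, hb]

lemma act_M (d : A.tri) (i : Fin 3) (a b : S ⊗[ℝ] S') :
    act d i (M A A' a b) = M A A' (act d (i + 1) a) b + M A A' a (act d (i + 2) b) := by
  induction a using TensorProduct.induction_on with
  | zero => simp
  | add a a' ha hb => simp only [map_add, LinearMap.add_apply, ha, hb]; abel
  | tmul x x' =>
    induction b using TensorProduct.induction_on with
    | zero => simp
    | add a a' ha hb => simp only [map_add, ha, hb]; abel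
    | tmul y y' => simp only [act_tmul, M_tmul, SymCompAlg.tri_mul, TensorProduct.add_tmul]

lemma act'_M (d : A'.tri) (i : Fin 3) (a b : S ⊗[ℝ] S') :
    act' d i (M A A' a b) = M A A' (act' d (i + 1) a) b + M A A' a (act' d (i + 2) b) := by
  induction a using TensorProduct.induction_on with
  | zero => simp
  | add a a' ha hb => simp only [map_add, LinearMap.add_apply, ha, hb]; abel
  | tmul x x' =>
    induction b using TensorProduct.induction_on with
    | zero => simp
    | add a a' ha hb => simp only [map_add, ha, hb]; abel
    | tmul y y' => simp only [act'_tmul, M_tmul, SymCompAlg.tri_mul, TensorProduct.tmul_add]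

lemma K_swap (i : Fin 3) (a b : S ⊗[ℝ] S') : K A A' i b a = - K A A' i a b := by
  induction a using TensorProduct.induction_on with
  | zero => simp
  | add a a' ha hb => simp only [map_add, LinearMap.add_apply, ha, hb]; abel
  | tmul x x' =>
    induction b using TensorProduct.induction_on with
    | zero => simp
    | add a a' ha hb => simp only [map_add, LinearMap.add_apply, ha, hb]; abel
    | tmul y y' => rw [K_tmul, K_tmul, A.tPow_swap, A'.q_comm, smul_neg]

lemma K'_swap (i : Fin 3) (a b : S ⊗[ℝ] S') : K' A A' i b a = - K' A A' i a b := by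
  induction a using TensorProduct.induction_on with
  | zero => simp
  | add a a' ha hb => simp only [map_add, LinearMap.add_apply, ha, hb]; abel
  | tmul x x' =>
    induction b using TensorProduct.induction_on with
    | zero => simp
    | add a a' ha hb => simp only [map_add, LinearMap.add_apply, ha, hb]; abel
    | tmul y y' => rw [K'_tmul, K'_tmul, A'.tPow_swap, A.q_comm, smul_neg]

lemma lie_K (d : A.tri) (i : Fin 3) (a b : S ⊗[ℝ] S') :
    ⁅d, K A A' i a b⁆ = K A A' i (act d i a) b + K A A' i a (act d i b) := by
  induction a using TensorProduct.induction_on with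
  | zero => simp
  | add a a' ha hb => simp only [map_add, LinearMap.add_apply, lie_add, ha, hb]; abel
  | tmul x x' =>
    induction b using TensorProduct.induction_on with
    | zero => simp
    | add a a' ha hb => simp only [map_add, lie_add, ha, hb]; abel
    | tmul y y' => simp only [act_tmul, K_tmul, lie_smul, A.lie_tPow, smul_add]

lemma lie_K' (d : A'.tri) (i : Fin 3) (a b : S ⊗[ℝ] S') :
    ⁅d, K' A A' i a b⁆ = K' A A' i (act' d i a) b + K' A A' i a (act' d i b) := by
  induction a using TensorProduct.induction_on with
  | zero => simp
  | add a a' ha hb => simp only [map_add, LinearMap.add_apply, lie_add, ha, hb]; abel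
  | tmul x x' =>
    induction b using TensorProduct.induction_on with
    | zero => simp
    | add a a' ha hb => simp only [map_add, lie_add, ha, hb]; abel
    | tmul y y' => simp only [act'_tmul, K'_tmul, lie_smul, A'.lie_tPow, smul_add]

lemma K_act' (d : A'.tri) (i : Fin 3) (a b : S ⊗[ℝ] S') :
    K A A' i (act' d i a) b + K A A' i a (act' d i b) = 0 := by
  induction a using TensorProduct.induction_on with
  | zero => simp
  | add a a' ha hb =>
    simp only [map_add, LinearMap.add_apply]; linear_combination (norm := module) ha + hb
  | tmul x x' =>
    induction b using TensorProduct.induction_on with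
    | zero => simp
    | add a a' ha hb => simp only [map_add]; linear_combination (norm := module) ha + hb
    | tmul y y' => simp only [act'_tmul, K_tmul, SymCompAlg.tri_skew]; module

lemma K'_act (d : A.tri) (i : Fin 3) (a b : S ⊗[ℝ] S') :
    K' A A' i (act d i a) b + K' A A' i a (act d i b) = 0 := by
  induction a using TensorProduct.induction_on with
  | zero => simp
  | add a a' ha hb =>
    simp only [map_add, LinearMap.add_apply]; linear_combination (norm := module) ha + hb
  | tmul x x' =>
    induction b using TensorProduct.induction_on with
    | zero => simp
    | add a a' ha hb => simp only [map_add]; linear_combination (norm := module) ha + hb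
    | tmul y y' => simp only [act_tmul, K'_tmul, SymCompAlg.tri_skew]; module

lemma K_cyc (i : Fin 3) (a b c : S ⊗[ℝ] S') :
    K A A' i a (M A A' b c) + K A A' (i + 1) b (M A A' c a) +
      K A A' (i + 2) c (M A A' a b) = 0 := by
  induction a using TensorProduct.induction_on with
  | zero => simp
  | add a a' ha hb =>
    simp only [map_add, LinearMap.add_apply]; linear_combination (norm := module) ha + hb
  | tmul x x' =>
    induction b using TensorProduct.induction_on with
    | zero => simp
    | add a a' ha hb =>
      simp only [map_add, LinearMap.add_apply]; linear_combination (norm := module) ha + hb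
    | tmul y y' =>
      induction c using TensorProduct.induction_on with
      | zero => simp
      | add a a' ha hb =>
        simp only [map_add, LinearMap.add_apply]; linear_combination (norm := module) ha + hb
      | tmul z z' =>
        have h := A.tPow_cyc i x y z
        have e1 : A'.q z' (A'.mul x' y') = A'.q x' (A'.mul y' z') := by
          rw [A'.q_comm, A'.q_assoc]
        have e2 : A'.q y' (A'.mul z' x') = A'.q x' (A'.mul y' z') := by
          rw [← A'.q_assoc, A'.q_comm]
        simp only [M_tmul, K_tmul, e1, e2]
        rw [← smul_add, ← smul_add, h, smul_zero]

lemma K'_cyc (i : Fin 3) (a b c : S ⊗[ℝ] S') :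
    K' A A' i a (M A A' b c) + K' A A' (i + 1) b (M A A' c a) +
      K' A A' (i + 2) c (M A A' a b) = 0 := by
  induction a using TensorProduct.induction_on with
  | zero => simp
  | add a a' ha hb =>
    simp only [map_add, LinearMap.add_apply]; linear_combination (norm := module) ha + hb
  | tmul x x' =>
    induction b using TensorProduct.induction_on with
    | zero => simp
    | add a a' ha hb =>
      simp only [map_add, LinearMap.add_apply]; linear_combination (norm := module) ha + hb
    | tmul y y' =>
      induction c using TensorProduct.induction_on with
      | zero => simp
      | add a a' ha hb =>
        simp only [map_add, LinearMap.add_apply]; linear_combination (norm := module) ha + hb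
      | tmul z z' =>
        have h := A'.tPow_cyc i x' y' z'
        have e1 : A.q z (A.mul x y) = A.q x (A.mul y z) := by
          rw [A.q_comm, A.q_assoc]
        have e2 : A.q y (A.mul z x) = A.q x (A.mul y z) := by
          rw [← A.q_assoc, A.q_comm]
        simp only [M_tmul, K'_tmul, e1, e2]
        rw [← smul_add, ← smul_add, h, smul_zero]

/-- The action of `[ι_i(a), ι_i(b)]`, up to the scalar, on `ι_j(c)`. -/
noncomputable def W (A : SymCompAlg S) (A' : SymCompAlg S') (i j : Fin 3) (a b c : S ⊗[ℝ] S') :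
    S ⊗[ℝ] S' := act (K A A' i a b) j c + act' (K' A A' i a b) j c

lemma W_add_left (i j : Fin 3) (a a' b c : S ⊗[ℝ] S') :
    W A A' i j (a + a') b c = W A A' i j a b c + W A A' i j a' b c := by
  simp only [W, map_add, LinearMap.add_apply, act_add, act'_add]; abel

lemma W_add_mid (i j : Fin 3) (a b b' c : S ⊗[ℝ] S') :
    W A A' i j a (b + b') c = W A A' i j a b c + W A A' i j a b' c := by
  simp only [W, map_add, act_add, act'_add]; abel

lemma W_add_right (i j : Fin 3) (a b c c' : S ⊗[ℝ] S') :
    W A A' i j a b (c + c') = W A A' i j a b c + W A A' i j a b c' := by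
  simp only [W, map_add]; abel

lemma W_zero_left (i j : Fin 3) (b c : S ⊗[ℝ] S') : W A A' i j 0 b c = 0 := by
  simp [W, act_zero, act'_zero]

lemma W_zero_mid (i j : Fin 3) (b c : S ⊗[ℝ] S') : W A A' i j b 0 c = 0 := by
  simp [W, act_zero, act'_zero]

lemma W_zero_right (i j : Fin 3) (b c : S ⊗[ℝ] S') : W A A' i j b c 0 = 0 := by
  simp [W]

lemma W_tmul (i j : Fin 3) (x y z : S) (x' y' z' : S') :
    W A A' i j (x ⊗ₜ x') (y ⊗ₜ y') (z ⊗ₜ z') =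
      A'.q x' y' • ((A.t x y).1 (j - i) z ⊗ₜ z') +
        A.q x y • (z ⊗ₜ (A'.t x' y').1 (j - i) z') := by
  rw [W, K_tmul, K'_tmul, act_smul, act'_smul, act_tmul, act'_tmul, A.tPow_apply, A'.tPow_apply]

lemma W_self (i : Fin 3) (a b c : S ⊗[ℝ] S') :
    W A A' i i a b c + W A A' i i b c a + W A A' i i c a b = 0 := by
  induction a using TensorProduct.induction_on with
  | zero => simp only [W_zero_left, W_zero_mid, W_zero_right, add_zero]
  | add a a' ha hb =>
    simp only [W_add_left, W_add_mid, W_add_right]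
    linear_combination (norm := module) ha + hb
  | tmul x x' =>
    induction b using TensorProduct.induction_on with
    | zero => simp only [W_zero_left, W_zero_mid, W_zero_right, add_zero]
    | add a a' ha hb =>
      simp only [W_add_left, W_add_mid, W_add_right]
      linear_combination (norm := module) ha + hb
    | tmul y y' =>
      induction c using TensorProduct.induction_on with
      | zero => simp only [W_zero_left, W_zero_mid, W_zero_right, add_zero]
      | add a a' ha hb =>
        simp only [W_add_left, W_add_mid, W_add_right]
        linear_combination (norm := module) ha + hb
      | tmul z z' =>
        simp only [W_tmul, sub_self, A.t_zero, A'.t_zero, TensorProduct.sub_tmul,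
          TensorProduct.tmul_sub, TensorProduct.smul_tmul', TensorProduct.tmul_smul]
        rw [A.q_comm y x, A.q_comm z x, A.q_comm z y, A'.q_comm y' x', A'.q_comm z' x',
          A'.q_comm z' y']
        simp only [← TensorProduct.smul_tmul']
        module

lemma W_one (i : Fin 3) (a b c : S ⊗[ℝ] S') :
    W A A' i (i + 1) a b c = M A A' (M A A' a c) b - M A A' (M A A' b c) a := by
  induction a using TensorProduct.induction_on with
  | zero => simp [W_zero_left]
  | add a a' ha hb =>
    simp only [W_add_left, map_add, LinearMap.add_apply, ha, hb]; abel
  | tmul x x' =>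
    induction b using TensorProduct.induction_on with
    | zero => simp [W_zero_mid]
    | add a a' ha hb =>
      simp only [W_add_mid, map_add, LinearMap.add_apply, ha, hb]; abel
    | tmul y y' =>
      induction c using TensorProduct.induction_on with
      | zero => simp [W_zero_right]
      | add a a' ha hb =>
        simp only [W_add_right, map_add, LinearMap.add_apply, ha, hb]; abel
      | tmul z z' =>
        have h1 : A.mul (A.mul x z) y = A.q x y • z - A.mul (A.mul y z) x :=
          eq_sub_of_add_eq (A.mul_mul_add x z y)
        have h2 : A'.mul (A'.mul x' z') y' = A'.q x' y' • z' - A'.mul (A'.mul y' z') x' :=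
          eq_sub_of_add_eq (A'.mul_mul_add x' z' y')
        simp only [W_tmul, M_tmul, add_sub_cancel_left, A.t_one, A'.t_one, h1, h2]
        simp only [TensorProduct.sub_tmul, TensorProduct.tmul_sub, TensorProduct.tmul_smul,
          ← TensorProduct.smul_tmul']
        module

lemma W_two (i : Fin 3) (a b c : S ⊗[ℝ] S') :
    W A A' i (i + 2) a b c = M A A' b (M A A' c a) - M A A' a (M A A' c b) := by
  induction a using TensorProduct.induction_on with
  | zero => simp [W_zero_left]
  | add a a' ha hb =>
    simp only [W_add_left, map_add, LinearMap.add_apply, ha, hb]; abel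
  | tmul x x' =>
    induction b using TensorProduct.induction_on with
    | zero => simp [W_zero_mid]
    | add a a' ha hb =>
      simp only [W_add_mid, map_add, LinearMap.add_apply, ha, hb]; abel
    | tmul y y' =>
      induction c using TensorProduct.induction_on with
      | zero => simp [W_zero_right]
      | add a a' ha hb =>
        simp only [W_add_right, map_add, LinearMap.add_apply, ha, hb]; abel
      | tmul z z' =>
        have h1 : A.mul y (A.mul z x) = A.q x y • z - A.mul x (A.mul z y) :=
          eq_sub_of_add_eq ((add_comm _ _).trans (A.add_mul_mul x z y))
        have h2 : A'.mul y' (A'.mul z' x') = A'.q x' y' • z' - A'.mul x' (A'.mul z' y') :=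
          eq_sub_of_add_eq ((add_comm _ _).trans (A'.add_mul_mul x' z' y'))
        simp only [W_tmul, M_tmul, add_sub_cancel_left, A.t_two, A'.t_two, h1, h2]
        simp only [TensorProduct.sub_tmul, TensorProduct.tmul_sub, TensorProduct.tmul_smul,
          ← TensorProduct.smul_tmul']
        module

variable (A A')

end MagicAlg

end Magic

section Magic

variable {S S' : Type*} [AddCommGroup S] [Module ℝ S] [AddCommGroup S'] [Module ℝ S']

namespace MagicAlg

variable (A : SymCompAlg S) (A' : SymCompAlg S') (ε : Fin 3 → ℝ)

/-- The bracket of `g_ε(S, S')`. With indices modulo 3 it is determined by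
`[ι_i(a), ι_{i+1}(b)] = ε_{i+2} ι_{i+2}(a b)`,
`[ι_i(a), ι_i(b)] = ε_{i+1} ε_{i+2} (K_i(a, b) + K'_i(a, b))`, and the natural actions of
`tri(S)` and `tri(S')`. -/
noncomputable instance : Bracket (MagicAlg A A' ε) (MagicAlg A A' ε) where
  bracket x y :=
    (⁅x.1, y.1⁆ + ∑ i, (ε (i + 1) * ε (i + 2)) • K A A' i (x.2.2 i) (y.2.2 i),
      ⁅x.2.1, y.2.1⁆ + ∑ i, (ε (i + 1) * ε (i + 2)) • K' A A' i (x.2.2 i) (y.2.2 i),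
      fun i ↦ act x.1 i (y.2.2 i) + act' x.2.1 i (y.2.2 i)
        - act y.1 i (x.2.2 i) - act' y.2.1 i (x.2.2 i)
        + ε i • (M A A' (x.2.2 (i + 1)) (y.2.2 (i + 2)) - M A A' (y.2.2 (i + 1)) (x.2.2 (i + 2))))

variable {A A' ε}

lemma ext' {x y : MagicAlg A A' ε} (h1 : x.1 = y.1) (h2 : x.2.1 = y.2.1)
    (h3 : ∀ i, x.2.2 i = y.2.2 i) : x = y :=
  Prod.ext h1 (Prod.ext h2 (funext h3))

lemma add_fst (x y : MagicAlg A A' ε) : (x + y).1 = x.1 + y.1 := rfl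
lemma add_snd (x y : MagicAlg A A' ε) : (x + y).2.1 = x.2.1 + y.2.1 := rfl
lemma add_thd (x y : MagicAlg A A' ε) (i : Fin 3) :
    (x + y).2.2 i = x.2.2 i + y.2.2 i := rfl
lemma smul_fst (c : ℝ) (y : MagicAlg A A' ε) : (c • y).1 = c • y.1 := rfl
lemma smul_snd (c : ℝ) (y : MagicAlg A A' ε) : (c • y).2.1 = c • y.2.1 := rfl
lemma smul_thd (c : ℝ) (y : MagicAlg A A' ε) (i : Fin 3) :
    (c • y).2.2 i = c • y.2.2 i := rfl

lemma sum_three {V : Type*} [AddCommMonoid V] (f : Fin 3 → V) (k : Fin 3) :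
    ∑ i, f i = f k + f (k + 1) + f (k + 2) := by
  rw [Fin.sum_univ_three]
  fin_cases k
  · rfl
  · change f 0 + f 1 + f 2 = f 1 + f 2 + f 0
    abel
  · change f 0 + f 1 + f 2 = f 2 + f 0 + f 1
    abel

lemma idx11 : ∀ k : Fin 3, k + 1 + 1 = k + 2 := by decide
lemma idx12 : ∀ k : Fin 3, k + 1 + 2 = k := by decide
lemma idx21 : ∀ k : Fin 3, k + 2 + 1 = k := by decide
lemma idx22 : ∀ k : Fin 3, k + 2 + 2 = k + 1 := by decide

lemma lie_fst (x y : MagicAlg A A' ε) (k : Fin 3) :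
    ⁅x, y⁆.1 = ⁅x.1, y.1⁆ + ((ε (k + 1) * ε (k + 2)) • K A A' k (x.2.2 k) (y.2.2 k)
      + (ε (k + 2) * ε k) • K A A' (k + 1) (x.2.2 (k + 1)) (y.2.2 (k + 1))
      + (ε k * ε (k + 1)) • K A A' (k + 2) (x.2.2 (k + 2)) (y.2.2 (k + 2))) := by
  change ⁅x.1, y.1⁆ + ∑ i, (ε (i + 1) * ε (i + 2)) • K A A' i (x.2.2 i) (y.2.2 i) = _
  rw [sum_three _ k, idx11, idx12, idx21, idx22]

lemma lie_snd (x y : MagicAlg A A' ε) (k : Fin 3) :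
    ⁅x, y⁆.2.1 = ⁅x.2.1, y.2.1⁆ + ((ε (k + 1) * ε (k + 2)) • K' A A' k (x.2.2 k) (y.2.2 k)
      + (ε (k + 2) * ε k) • K' A A' (k + 1) (x.2.2 (k + 1)) (y.2.2 (k + 1))
      + (ε k * ε (k + 1)) • K' A A' (k + 2) (x.2.2 (k + 2)) (y.2.2 (k + 2))) := by
  change ⁅x.2.1, y.2.1⁆ + ∑ i, (ε (i + 1) * ε (i + 2)) • K' A A' i (x.2.2 i) (y.2.2 i) = _
  rw [sum_three _ k, idx11, idx12, idx21, idx22]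

lemma lie_thd (x y : MagicAlg A A' ε) (i : Fin 3) :
    ⁅x, y⁆.2.2 i = act x.1 i (y.2.2 i) + act' x.2.1 i (y.2.2 i)
        - act y.1 i (x.2.2 i) - act' y.2.1 i (x.2.2 i)
        + ε i • (M A A' (x.2.2 (i + 1)) (y.2.2 (i + 2))
          - M A A' (y.2.2 (i + 1)) (x.2.2 (i + 2))) := rfl

lemma lie_act (x y : MagicAlg A A' ε) (k : Fin 3) (c : S ⊗[ℝ] S') :
    act ⁅x, y⁆.1 k c + act' ⁅x, y⁆.2.1 k c =
      act ⁅x.1, y.1⁆ k c + act' ⁅x.2.1, y.2.1⁆ k c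
      + ((ε (k + 1) * ε (k + 2)) • W A A' k k (x.2.2 k) (y.2.2 k) c
      + (ε (k + 2) * ε k) • W A A' (k + 1) k (x.2.2 (k + 1)) (y.2.2 (k + 1)) c
      + (ε k * ε (k + 1)) • W A A' (k + 2) k (x.2.2 (k + 2)) (y.2.2 (k + 2)) c) := by
  rw [lie_fst x y k, lie_snd x y k]
  simp only [act_add, act'_add, act_smul, act'_smul, W]
  module

lemma W_one' (k : Fin 3) (a b c : S ⊗[ℝ] S') :
    W A A' (k + 2) k a b c = M A A' (M A A' a c) b - M A A' (M A A' b c) a := by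
  have := W_one (A := A) (A' := A') (k + 2) a b c
  rwa [idx21] at this

lemma W_two' (k : Fin 3) (a b c : S ⊗[ℝ] S') :
    W A A' (k + 1) k a b c = M A A' b (M A A' c a) - M A A' a (M A A' c b) := by
  have := W_two (A := A) (A' := A') (k + 1) a b c
  rwa [idx12] at this

lemma W_swap (i j : Fin 3) (a b c : S ⊗[ℝ] S') :
    W A A' i j b a c = - W A A' i j a b c := by
  rw [W, W, K_swap, K'_swap, ← neg_one_smul ℝ, ← neg_one_smul ℝ (K' A A' i a b), act_smul,
    act'_smul]
  module

set_option maxHeartbeats 2000000 in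
lemma leibniz_fst (x y z : MagicAlg A A' ε) (k : Fin 3) :
    ⁅x, ⁅y, z⁆⁆.1 = ⁅⁅x, y⁆, z⁆.1 + ⁅y, ⁅x, z⁆⁆.1 := by
  have key : ⁅x.1, ⁅y.1, z.1⁆⁆ = ⁅⁅x.1, y.1⁆, z.1⁆ + ⁅y.1, ⁅x.1, z.1⁆⁆ :=
    leibniz_lie _ _ _
  have flip (i : Fin 3) (a b : S ⊗[ℝ] S') :
      ⁅K A A' i a b, z.1⁆ = -⁅z.1, K A A' i a b⁆ := (lie_skew _ _).symm
  have h1 := K_cyc (A := A) (A' := A') k (x.2.2 k) (y.2.2 (k + 1)) (z.2.2 (k + 2))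
  have g1 := K_cyc (A := A) (A' := A') k (x.2.2 k) (z.2.2 (k + 1)) (y.2.2 (k + 2))
  have h2 := K_cyc (A := A) (A' := A') (k + 1) (x.2.2 (k + 1)) (y.2.2 (k + 2)) (z.2.2 k)
  have g2 := K_cyc (A := A) (A' := A') (k + 1) (x.2.2 (k + 1)) (z.2.2 (k + 2)) (y.2.2 k)
  have h3 := K_cyc (A := A) (A' := A') (k + 2) (x.2.2 (k + 2)) (y.2.2 k) (z.2.2 (k + 1))
  have g3 := K_cyc (A := A) (A' := A') (k + 2) (x.2.2 (k + 2)) (z.2.2 k) (y.2.2 (k + 1))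
  simp only [idx11, idx12, idx21, idx22] at h2 g2 h3 g3
  simp only [lie_fst _ _ k, lie_thd, lie_add, add_lie, lie_smul, smul_lie, flip, lie_K, map_add,
    map_sub, map_smul, LinearMap.add_apply, LinearMap.sub_apply, LinearMap.smul_apply, idx11,
    idx12, idx21, idx22]
  linear_combination (norm := module) key
      + (ε (k + 1) * ε (k + 2)) • (K_swap (A := A) (A' := A') k (act z.1 k (x.2.2 k)) (y.2.2 k) + K_swap (A := A) (A' := A') k (act' z.2.1 k (x.2.2 k)) (y.2.2 k)
        + K_act' y.2.1 k (x.2.2 k) (z.2.2 k) - K_act' x.2.1 k (y.2.2 k) (z.2.2 k) - K_act' z.2.1 k (x.2.2 k) (y.2.2 k))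
      + (ε (k + 2) * ε k) • (K_swap (A := A) (A' := A') (k + 1) (act z.1 (k + 1) (x.2.2 (k + 1))) (y.2.2 (k + 1)) + K_swap (A := A) (A' := A') (k + 1) (act' z.2.1 (k + 1) (x.2.2 (k + 1))) (y.2.2 (k + 1))
        + K_act' y.2.1 (k + 1) (x.2.2 (k + 1)) (z.2.2 (k + 1)) - K_act' x.2.1 (k + 1) (y.2.2 (k + 1)) (z.2.2 (k + 1)) - K_act' z.2.1 (k + 1) (x.2.2 (k + 1)) (y.2.2 (k + 1)))
      + (ε k * ε (k + 1)) • (K_swap (A := A) (A' := A') (k + 2) (act z.1 (k + 2) (x.2.2 (k + 2))) (y.2.2 (k + 2)) + K_swap (A := A) (A' := A') (k + 2) (act' z.2.1 (k + 2) (x.2.2 (k + 2))) (y.2.2 (k + 2))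
        + K_act' y.2.1 (k + 2) (x.2.2 (k + 2)) (z.2.2 (k + 2)) - K_act' x.2.1 (k + 2) (y.2.2 (k + 2)) (z.2.2 (k + 2)) - K_act' z.2.1 (k + 2) (x.2.2 (k + 2)) (y.2.2 (k + 2)))
      + (ε k * ε (k + 1) * ε (k + 2)) • (h1 - g1 - K_swap (A := A) (A' := A') k (M A A' (x.2.2 (k + 1)) (y.2.2 (k + 2))) (z.2.2 k) + K_swap (A := A) (A' := A') k (M A A' (y.2.2 (k + 1)) (x.2.2 (k + 2))) (z.2.2 k)
      + h2 - g2 - K_swap (A := A) (A' := A') (k + 1) (M A A' (x.2.2 (k + 2)) (y.2.2 k)) (z.2.2 (k + 1)) + K_swap (A := A) (A' := A') (k + 1) (M A A' (y.2.2 (k + 2)) (x.2.2 k)) (z.2.2 (k + 1))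
      + h3 - g3 - K_swap (A := A) (A' := A') (k + 2) (M A A' (x.2.2 k) (y.2.2 (k + 1))) (z.2.2 (k + 2)) + K_swap (A := A) (A' := A') (k + 2) (M A A' (y.2.2 k) (x.2.2 (k + 1))) (z.2.2 (k + 2)))

set_option maxHeartbeats 2000000 in
lemma leibniz_snd (x y z : MagicAlg A A' ε) (k : Fin 3) :
    ⁅x, ⁅y, z⁆⁆.2.1 = ⁅⁅x, y⁆, z⁆.2.1 + ⁅y, ⁅x, z⁆⁆.2.1 := by
  have key : ⁅x.2.1, ⁅y.2.1, z.2.1⁆⁆ = ⁅⁅x.2.1, y.2.1⁆, z.2.1⁆ + ⁅y.2.1, ⁅x.2.1, z.2.1⁆⁆ :=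
    leibniz_lie _ _ _
  have flip (i : Fin 3) (a b : S ⊗[ℝ] S') :
      ⁅K' A A' i a b, z.2.1⁆ = -⁅z.2.1, K' A A' i a b⁆ := (lie_skew _ _).symm
  have h1 := K'_cyc (A := A) (A' := A') k (x.2.2 k) (y.2.2 (k + 1)) (z.2.2 (k + 2))
  have g1 := K'_cyc (A := A) (A' := A') k (x.2.2 k) (z.2.2 (k + 1)) (y.2.2 (k + 2))
  have h2 := K'_cyc (A := A) (A' := A') (k + 1) (x.2.2 (k + 1)) (y.2.2 (k + 2)) (z.2.2 k)
  have g2 := K'_cyc (A := A) (A' := A') (k + 1) (x.2.2 (k + 1)) (z.2.2 (k + 2)) (y.2.2 k)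
  have h3 := K'_cyc (A := A) (A' := A') (k + 2) (x.2.2 (k + 2)) (y.2.2 k) (z.2.2 (k + 1))
  have g3 := K'_cyc (A := A) (A' := A') (k + 2) (x.2.2 (k + 2)) (z.2.2 k) (y.2.2 (k + 1))
  simp only [idx11, idx12, idx21, idx22] at h2 g2 h3 g3
  simp only [lie_snd _ _ k, lie_thd, lie_add, add_lie, lie_smul, smul_lie, flip, lie_K', map_add,
    map_sub, map_smul, LinearMap.add_apply, LinearMap.sub_apply, LinearMap.smul_apply, idx11,
    idx12, idx21, idx22]
  linear_combination (norm := module) key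
      + (ε (k + 1) * ε (k + 2)) • (K'_swap (A := A) (A' := A') k (act' z.2.1 k (x.2.2 k)) (y.2.2 k) + K'_swap (A := A) (A' := A') k (act z.1 k (x.2.2 k)) (y.2.2 k)
        + K'_act y.1 k (x.2.2 k) (z.2.2 k) - K'_act x.1 k (y.2.2 k) (z.2.2 k) - K'_act z.1 k (x.2.2 k) (y.2.2 k))
      + (ε (k + 2) * ε k) • (K'_swap (A := A) (A' := A') (k + 1) (act' z.2.1 (k + 1) (x.2.2 (k + 1))) (y.2.2 (k + 1)) + K'_swap (A := A) (A' := A') (k + 1) (act z.1 (k + 1) (x.2.2 (k + 1))) (y.2.2 (k + 1))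
        + K'_act y.1 (k + 1) (x.2.2 (k + 1)) (z.2.2 (k + 1)) - K'_act x.1 (k + 1) (y.2.2 (k + 1)) (z.2.2 (k + 1)) - K'_act z.1 (k + 1) (x.2.2 (k + 1)) (y.2.2 (k + 1)))
      + (ε k * ε (k + 1)) • (K'_swap (A := A) (A' := A') (k + 2) (act' z.2.1 (k + 2) (x.2.2 (k + 2))) (y.2.2 (k + 2)) + K'_swap (A := A) (A' := A') (k + 2) (act z.1 (k + 2) (x.2.2 (k + 2))) (y.2.2 (k + 2))
        + K'_act y.1 (k + 2) (x.2.2 (k + 2)) (z.2.2 (k + 2)) - K'_act x.1 (k + 2) (y.2.2 (k + 2)) (z.2.2 (k + 2)) - K'_act z.1 (k + 2) (x.2.2 (k + 2)) (y.2.2 (k + 2)))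
      + (ε k * ε (k + 1) * ε (k + 2)) • (h1 - g1 - K'_swap (A := A) (A' := A') k (M A A' (x.2.2 (k + 1)) (y.2.2 (k + 2))) (z.2.2 k) + K'_swap (A := A) (A' := A') k (M A A' (y.2.2 (k + 1)) (x.2.2 (k + 2))) (z.2.2 k)
      + h2 - g2 - K'_swap (A := A) (A' := A') (k + 1) (M A A' (x.2.2 (k + 2)) (y.2.2 k)) (z.2.2 (k + 1)) + K'_swap (A := A) (A' := A') (k + 1) (M A A' (y.2.2 (k + 2)) (x.2.2 k)) (z.2.2 (k + 1))
      + h3 - g3 - K'_swap (A := A) (A' := A') (k + 2) (M A A' (x.2.2 k) (y.2.2 (k + 1))) (z.2.2 (k + 2)) + K'_swap (A := A) (A' := A') (k + 2) (M A A' (y.2.2 k) (x.2.2 (k + 1))) (z.2.2 (k + 2)))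

lemma leibniz_thd (x y z : MagicAlg A A' ε) (k : Fin 3) :
    ⁅x, ⁅y, z⁆⁆.2.2 k = ⁅⁅x, y⁆, z⁆.2.2 k + ⁅y, ⁅x, z⁆⁆.2.2 k := by
  have h (u v w : MagicAlg A A' ε) : ⁅⁅u, v⁆, w⁆.2.2 k =
      (act ⁅u, v⁆.1 k (w.2.2 k) + act' ⁅u, v⁆.2.1 k (w.2.2 k))
        - act w.1 k (⁅u, v⁆.2.2 k) - act' w.2.1 k (⁅u, v⁆.2.2 k)
        + ε k • (M A A' (⁅u, v⁆.2.2 (k + 1)) (w.2.2 (k + 2))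
          - M A A' (w.2.2 (k + 1)) (⁅u, v⁆.2.2 (k + 2))) := rfl
  have h' (u v w : MagicAlg A A' ε) : ⁅w, ⁅u, v⁆⁆.2.2 k =
      act w.1 k (⁅u, v⁆.2.2 k) + act' w.2.1 k (⁅u, v⁆.2.2 k)
        - (act ⁅u, v⁆.1 k (w.2.2 k) + act' ⁅u, v⁆.2.1 k (w.2.2 k))
        + ε k • (M A A' (w.2.2 (k + 1)) (⁅u, v⁆.2.2 (k + 2))
          - M A A' (⁅u, v⁆.2.2 (k + 1)) (w.2.2 (k + 2))) := by
    rw [lie_thd]; abel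
  rw [h, h', h']
  simp only [lie_act, W_one', W_two', act_lie, act'_lie]
  simp only [lie_thd, map_add, map_sub, map_smul, act_act', act_M, act'_M, LinearMap.add_apply,
    LinearMap.sub_apply, LinearMap.smul_apply, idx11, idx12, idx21, idx22]
  have e1 := W_self (A := A) (A' := A') k (x.2.2 k) (y.2.2 k) (z.2.2 k)
  have e2 := W_swap (A := A) (A' := A') k k (x.2.2 k) (z.2.2 k) (y.2.2 k)
  linear_combination (norm := module) (-(ε (k + 1) * ε (k + 2))) • (e1 - e2)

noncomputable instance : LieRing (MagicAlg A A' ε) where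
  add_lie x y z := by
    refine ext' ?_ ?_ fun i ↦ ?_
    · simp only [lie_fst _ _ 0, add_fst, add_thd, add_lie, map_add, LinearMap.add_apply, smul_add]
      abel
    · simp only [lie_snd _ _ 0, add_snd, add_thd, add_lie, map_add, LinearMap.add_apply, smul_add]
      abel
    · simp only [lie_thd, add_fst, add_snd, add_thd, act_add, act'_add, map_add,
        LinearMap.add_apply]
      module
  lie_add x y z := by
    refine ext' ?_ ?_ fun i ↦ ?_
    · simp only [lie_fst _ _ 0, add_fst, add_thd, lie_add, map_add, smul_add]
      abel
    · simp only [lie_snd _ _ 0, add_snd, add_thd, lie_add, map_add, smul_add]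
      abel
    · simp only [lie_thd, add_fst, add_snd, add_thd, act_add, act'_add, map_add,
        LinearMap.add_apply]
      module
  lie_self x := by
    have hK (i : Fin 3) (a : S ⊗[ℝ] S') : K A A' i a a = 0 := by
      have h := K_swap (A := A) (A' := A') i a a
      linear_combination (norm := module) (2⁻¹ : ℝ) • h
    have hK' (i : Fin 3) (a : S ⊗[ℝ] S') : K' A A' i a a = 0 := by
      have h := K'_swap (A := A) (A' := A') i a a
      linear_combination (norm := module) (2⁻¹ : ℝ) • h
    refine ext' ?_ ?_ fun i ↦ ?_
    · rw [lie_fst _ _ 0]; simp only [hK, lie_self, smul_zero, add_zero]; rfl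
    · rw [lie_snd _ _ 0]; simp only [hK', lie_self, smul_zero, add_zero]; rfl
    · rw [lie_thd]; simp only [sub_self, smul_zero, add_zero, add_sub_cancel_left]; rfl
  leibniz_lie x y z :=
    ext' (leibniz_fst x y z 0) (leibniz_snd x y z 0) (leibniz_thd x y z)

noncomputable instance : LieAlgebra ℝ (MagicAlg A A' ε) where
  lie_smul c x y := by
    refine ext' ?_ ?_ fun i ↦ ?_
    · simp only [lie_fst _ _ 0, smul_fst, smul_thd, lie_smul, map_smul]
      module
    · simp only [lie_snd _ _ 0, smul_snd, smul_thd, lie_smul, map_smul]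
      module
    · simp only [lie_thd, smul_fst, smul_snd, smul_thd, act_smul, act'_smul, map_smul,
        LinearMap.smul_apply]
      module

end MagicAlg

end Magic

section Concrete

/-- The split octonions, with coordinates `((a, b), u, v)` standing for
`a e₁ + b e₂ + ∑ uᵢ uᵢ + ∑ vᵢ vᵢ` in the standard basis `e₁, e₂, u₁, u₂, u₃, v₁, v₂, v₃`. -/
abbrev Os : Type := (ℝ × ℝ) × (Fin 3 → ℝ) × (Fin 3 → ℝ)

namespace Os

/-- The product of the split octonions: `e₁, e₂` are orthogonal idempotents, `e₁ uⱼ = uⱼ = uⱼ e₂`,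
`e₂ vⱼ = vⱼ = vⱼ e₁`, `uᵢ vᵢ = -e₁`, `vᵢ uᵢ = -e₂`, `uᵢ uᵢ₊₁ = vᵢ₊₂ = -uᵢ₊₁ uᵢ`,
`vᵢ vᵢ₊₁ = uᵢ₊₂ = -vᵢ₊₁ vᵢ`, and all other products of basis elements vanish. -/
def octMul (x y : Os) : Os :=
  ((x.1.1 * y.1.1 - (x.2.1 0 * y.2.2 0 + x.2.1 1 * y.2.2 1 + x.2.1 2 * y.2.2 2),
    x.1.2 * y.1.2 - (x.2.2 0 * y.2.1 0 + x.2.2 1 * y.2.1 1 + x.2.2 2 * y.2.1 2)),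
   fun k ↦ x.1.1 * y.2.1 k + x.2.1 k * y.1.2
     + (x.2.2 (k + 1) * y.2.2 (k + 2) - x.2.2 (k + 2) * y.2.2 (k + 1)),
   fun k ↦ x.1.2 * y.2.2 k + x.2.2 k * y.1.1
     + (x.2.1 (k + 1) * y.2.1 (k + 2) - x.2.1 (k + 2) * y.2.1 (k + 1)))

/-- The standard involution `x ↦ t(x) 1 - x`, where `1 = e₁ + e₂`. -/
def octConj (x : Os) : Os := ((x.1.2, x.1.1), -x.2.1, -x.2.2)

/-- Half of the polar form of the norm, for which `n(e₁, e₂) = 1 = n(uᵢ, vᵢ)` and all other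
pairs of basis elements are orthogonal. -/
noncomputable def octForm : LinearMap.BilinForm ℝ Os :=
  LinearMap.mk₂ ℝ
    (fun x y ↦ 2⁻¹ * (x.1.1 * y.1.2 + x.1.2 * y.1.1
      + (x.2.1 0 * y.2.2 0 + x.2.1 1 * y.2.2 1 + x.2.1 2 * y.2.2 2)
      + (x.2.2 0 * y.2.1 0 + x.2.2 1 * y.2.1 1 + x.2.2 2 * y.2.1 2)))
    (fun x x' y ↦ by simp only [Prod.fst_add, Prod.snd_add, Pi.add_apply]; ring)
    (fun c x y ↦ by
      simp only [Prod.smul_fst, Prod.smul_snd, Pi.smul_apply, smul_eq_mul]; ring)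
    (fun x y y' ↦ by simp only [Prod.fst_add, Prod.snd_add, Pi.add_apply]; ring)
    (fun c x y ↦ by
      simp only [Prod.smul_fst, Prod.smul_snd, Pi.smul_apply, smul_eq_mul]; ring)

/-- The norm of the split octonions. -/
noncomputable def octNorm : QuadraticForm ℝ Os := octForm.toQuadraticMap

lemma octNorm_apply (x : Os) :
    octNorm x = x.1.1 * x.1.2 + (x.2.1 0 * x.2.2 0 + x.2.1 1 * x.2.2 1 + x.2.1 2 * x.2.2 2) := by
  change (2⁻¹ : ℝ) * (x.1.1 * x.1.2 + x.1.2 * x.1.1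
      + (x.2.1 0 * x.2.2 0 + x.2.1 1 * x.2.2 1 + x.2.1 2 * x.2.2 2)
      + (x.2.2 0 * x.2.1 0 + x.2.2 1 * x.2.1 1 + x.2.2 2 * x.2.1 2)) = _
  ring

lemma polar_octNorm (x y : Os) :
    QuadraticMap.polar octNorm x y = x.1.1 * y.1.2 + x.1.2 * y.1.1
      + (x.2.1 0 * y.2.2 0 + x.2.1 1 * y.2.2 1 + x.2.1 2 * y.2.2 2)
      + (x.2.2 0 * y.2.1 0 + x.2.2 1 * y.2.1 1 + x.2.2 2 * y.2.1 2) := by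
  simp only [QuadraticMap.polar, octNorm_apply, Prod.fst_add, Prod.snd_add, Pi.add_apply]
  ring

lemma ext_coord {x y : Os} (h1 : x.1.1 = y.1.1) (h2 : x.1.2 = y.1.2)
    (h3 : ∀ k, x.2.1 k = y.2.1 k) (h4 : ∀ k, x.2.2 k = y.2.2 k) : x = y :=
  Prod.ext (Prod.ext h1 h2) (Prod.ext (funext h3) (funext h4))

/-- The product `x̄ ȳ` of the para-octonions. -/
noncomputable def paraMul : Os →ₗ[ℝ] Os →ₗ[ℝ] Os :=
  LinearMap.mk₂ ℝ (fun x y ↦ octMul (octConj x) (octConj y))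
    (fun x x' y ↦ by
      refine ext_coord ?_ ?_ (fun k ↦ ?_) (fun k ↦ ?_) <;>
      simp only [octMul, octConj, Prod.fst_add, Prod.snd_add, Pi.add_apply, Pi.neg_apply] <;> ring)
    (fun c x y ↦ by
      refine ext_coord ?_ ?_ (fun k ↦ ?_) (fun k ↦ ?_) <;>
      simp only [octMul, octConj, Prod.smul_fst, Prod.smul_snd, Pi.smul_apply, Pi.neg_apply,
        smul_eq_mul] <;> ring)
    (fun x y y' ↦ by
      refine ext_coord ?_ ?_ (fun k ↦ ?_) (fun k ↦ ?_) <;>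
      simp only [octMul, octConj, Prod.fst_add, Prod.snd_add, Pi.add_apply, Pi.neg_apply] <;> ring)
    (fun c x y ↦ by
      refine ext_coord ?_ ?_ (fun k ↦ ?_) (fun k ↦ ?_) <;>
      simp only [octMul, octConj, Prod.smul_fst, Prod.smul_snd, Pi.smul_apply, Pi.neg_apply,
        smul_eq_mul] <;> ring)

lemma paraMul_apply (x y : Os) : paraMul x y = octMul (octConj x) (octConj y) := rfl

lemma idx : (0 : Fin 3) + 1 = 1 ∧ (0 : Fin 3) + 2 = 2 ∧ (1 : Fin 3) + 1 = 2 ∧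
    (1 : Fin 3) + 2 = 0 ∧ (2 : Fin 3) + 1 = 0 ∧ (2 : Fin 3) + 2 = 1 := by decide

/-- The idempotent `e₁`. -/
def e₁ : Os := ((1, 0), 0, 0)

/-- The idempotent `e₂`. -/
def e₂ : Os := ((0, 1), 0, 0)

/-- The elements `u₁, u₂, u₃`. -/
def u (i : Fin 3) : Os := ((0, 0), Pi.single i 1, 0)

/-- The elements `v₁, v₂, v₃`. -/
def v (i : Fin 3) : Os := ((0, 0), 0, Pi.single i 1)

end Os

/-- The para-octonion algebra `pO_s`: the split octonions with the product `x̄ ȳ`. -/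
noncomputable def paraOs : SymCompAlg Os where
  mul := Os.paraMul
  norm := Os.octNorm
  norm_mul x y := by
    simp only [Os.octNorm_apply, Os.paraMul_apply, Os.octMul, Os.octConj, Pi.neg_apply, Os.idx]
    ring
  polar_assoc x y z := by
    simp only [Os.polar_octNorm, Os.paraMul_apply, Os.octMul, Os.octConj, Pi.neg_apply, Os.idx]
    ring
  nondegenerate x h := by
    have h1 := h Os.e₁
    have h2 := h Os.e₂
    have h3 := fun i ↦ h (Os.u i)
    have h4 := fun i ↦ h (Os.v i)
    simp only [Os.polar_octNorm, Os.e₁, Os.e₂, Os.u, Os.v, Pi.zero_apply, mul_zero, mul_one,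
      add_zero, zero_add] at h1 h2 h3 h4
    refine Os.ext_coord h2 h1 (fun k ↦ ?_) (fun k ↦ ?_)
    · have := h4 k
      fin_cases k <;> simpa using this
    · have := h3 k
      fin_cases k <;> simpa using this

/-- The bilinear form `Re (x ȳ)` on `ℂ`, half of the polar form of the norm. -/
noncomputable def complexForm : LinearMap.BilinForm ℝ ℂ :=
  LinearMap.mk₂ ℝ (fun x y : ℂ ↦ x.re * y.re + x.im * y.im)
    (fun x x' y ↦ by simp only [Complex.add_re, Complex.add_im]; ring)
    (fun c x y ↦ by simp only [Complex.smul_re, Complex.smul_im, smul_eq_mul]; ring)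
    (fun x x' y ↦ by simp only [Complex.add_re, Complex.add_im]; ring)
    (fun c x y ↦ by
      simp only [Complex.smul_re, Complex.smul_im, smul_eq_mul]; ring)

/-- The norm `n(z) = |z|²` of the real algebra `ℂ`. -/
noncomputable def complexNorm : QuadraticForm ℝ ℂ := complexForm.toQuadraticMap

lemma complexNorm_apply (x : ℂ) : complexNorm x = x.re * x.re + x.im * x.im := rfl

lemma polar_complexNorm (x y : ℂ) :
    QuadraticMap.polar complexNorm x y = 2 * (x.re * y.re + x.im * y.im) := by
  simp only [QuadraticMap.polar, complexNorm_apply, Complex.add_re, Complex.add_im]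
  ring

open scoped ComplexConjugate in
/-- The paracomplex algebra `pC`: the complex numbers with the product `x̄ ȳ`. -/
noncomputable def paraC : SymCompAlg ℂ where
  mul := LinearMap.mk₂ ℝ (fun x y : ℂ ↦ conj x * conj y)
    (fun x x' y ↦ by rw [map_add, add_mul])
    (fun c x y ↦ by simp [mul_assoc])
    (fun x y y' ↦ by rw [map_add, mul_add])
    (fun c x y ↦ by simp [mul_left_comm])
  norm := complexNorm
  norm_mul x y := by
    simp only [complexNorm_apply, LinearMap.mk₂_apply, Complex.mul_re, Complex.mul_im,
      Complex.conj_re, Complex.conj_im]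
    ring
  polar_assoc x y z := by
    simp only [polar_complexNorm, LinearMap.mk₂_apply, Complex.mul_re, Complex.mul_im,
      Complex.conj_re, Complex.conj_im]
    ring
  nondegenerate x h := by
    have h1 := h 1
    have h2 := h Complex.I
    simp only [polar_complexNorm, Complex.one_re, Complex.one_im, Complex.I_re,
      Complex.I_im] at h1 h2
    exact Complex.ext (by simpa using h1) (by simpa using h2)

/-- The algebra `g = g_{(1,1,1)}(pO_s, pC)`. -/
abbrev E62 : Type := MagicAlg paraOs paraC (fun _ ↦ 1)

namespace E62

/-- The inclusion of `tri(pO_s)`. -/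
noncomputable def inTri (d : paraOs.tri) : E62 := (d, 0, 0)

/-- The inclusion of `tri(pC)`. -/
noncomputable def inTri' (d : paraC.tri) : E62 := (0, d, 0)

/-- The skew map `d = σ'_{e₀,e₁}` of `pC`, where `e₀ = 1` and `e₁ = i`. -/
noncomputable def sigma' : Module.End ℝ ℂ :=
  (paraC.q 1).smulRight Complex.I - (paraC.q Complex.I).smulRight 1

lemma sigma'_apply (z : ℂ) : sigma' z = 2 * Complex.I * z := by
  change QuadraticMap.polar complexNorm 1 z • Complex.I
    - QuadraticMap.polar complexNorm Complex.I z • (1 : ℂ) = _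
  rw [polar_complexNorm, polar_complexNorm]
  apply Complex.ext <;> simp

/-- The element `(β₀ d, β₁ d, β₂ d)` of `tri(pC)`. -/
noncomputable def triC (β : Fin 3 → ℝ) (hβ : β 0 + β 1 + β 2 = 0) : paraC.tri :=
  ⟨fun i ↦ β i • sigma', by
    refine ⟨fun i x y ↦ ?_, fun x y ↦ ?_⟩
    · change QuadraticMap.polar complexNorm _ _ + QuadraticMap.polar complexNorm _ _ = 0
      simp only [polar_complexNorm, LinearMap.smul_apply, sigma'_apply, Complex.smul_re,
        Complex.smul_im, Complex.mul_re, Complex.mul_im, Complex.I_re, Complex.I_im, smul_eq_mul]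
      simp
      ring
    · change β 0 • sigma' (_ * _) = _ * _ + _ * _
      have h0 : β 0 = - β 1 - β 2 := by linarith
      have h2 : (starRingEnd ℂ) 2 = 2 := Complex.conj_ofNat 2
      simp only [LinearMap.smul_apply, sigma'_apply, h0]
      simp [h2]
      ring⟩

/-- The elements `h₁ = t_{e₁,e₂}`, `h₂ = t_{u₁,v₁}`, `h₃ = t_{u₂,v₂}`, `h₄ = t_{u₃,v₃}` of
`tri(pO_s)`, and `h₅ = ¼ (d, d, -2d)`, `h₆ = ¼ (d, -2d, d)` of `tri(pC)`. -/
noncomputable def h : Fin 6 → E62 :=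
  ![inTri (paraOs.t Os.e₁ Os.e₂), inTri (paraOs.t (Os.u 0) (Os.v 0)),
    inTri (paraOs.t (Os.u 1) (Os.v 1)), inTri (paraOs.t (Os.u 2) (Os.v 2)),
    inTri' (triC ![1 / 4, 1 / 4, -(1 / 2)] (by
      simp only [Matrix.cons_val_zero, Matrix.cons_val_one, Matrix.cons_val]; norm_num)),
    inTri' (triC ![1 / 4, -(1 / 2), 1 / 4] (by
      simp only [Matrix.cons_val_zero, Matrix.cons_val_one, Matrix.cons_val]; norm_num))]

/-- The map `x ⊗ e_k ↦ (-1)^(k+1) x ⊗ e_{k+1}` (indices modulo 2) of `pO_s ⊗ pC`: multiplication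
by `-i` on the second factor, that is, `e₀ ↦ -e₁`, `e₁ ↦ e₀`. -/
noncomputable def rot : Os ⊗[ℝ] ℂ →ₗ[ℝ] Os ⊗[ℝ] ℂ :=
  LinearMap.lTensor Os (LinearMap.mulLeft ℝ (-Complex.I))

/-- The linear map `Ψ_i`: the identity on `tri(pO_s) ⊕ tri(pC)`, minus the identity on
`ι_i(pO_s ⊗ pC)`, and `ι_j(x ⊗ e_k) ↦ (-1)^(k+1) ι_j(x ⊗ e_{k+1})` for `j ≠ i`. -/
noncomputable def Psi (i : Fin 3) : E62 →ₗ[ℝ] E62 where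
  toFun x := (x.1, x.2.1, fun j ↦ if j = i then - x.2.2 j else
    rot (x.2.2 j))
  map_add' x y := by
    refine MagicAlg.ext' rfl rfl fun j ↦ ?_
    change (if j = i then -(x.2.2 j + y.2.2 j) else rot (x.2.2 j + y.2.2 j)) =
      (if j = i then -x.2.2 j else rot (x.2.2 j)) + (if j = i then -y.2.2 j else rot (y.2.2 j))
    split_ifs
    · exact neg_add _ _
    · exact map_add _ _ _
  map_smul' c x := by
    refine MagicAlg.ext' rfl rfl fun j ↦ ?_
    change (if j = i then -(c • x.2.2 j) else rot (c • x.2.2 j)) =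
      c • (if j = i then -x.2.2 j else rot (x.2.2 j))
    split_ifs
    · exact (smul_neg _ _).symm
    · exact map_smul _ _ _

/-- The space `ι_j(pO_s ⊗ ℝ e₀)`, seen inside `pO_s ⊗ pC`. -/
noncomputable def realPart : Submodule ℝ (Os ⊗[ℝ] ℂ) :=
  LinearMap.range ((TensorProduct.mk ℝ Os ℂ).flip 1)

/-- The subalgebra `g₀ = g_{(1,1,1)}(pO_s, ℝ e₀) = tri(pO_s) ⊕ ⨁ ι_i(pO_s ⊗ ℝ e₀)`. -/
noncomputable def g₀ : LieSubalgebra ℝ E62 where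
  carrier := {x | x.2.1 = 0 ∧ ∀ i, x.2.2 i ∈ realPart}
  add_mem' {x y} hx hy := by
    refine ⟨?_, fun i ↦ add_mem (hx.2 i) (hy.2 i)⟩
    rw [MagicAlg.add_snd, hx.1, hy.1, add_zero]
  zero_mem' := ⟨rfl, fun _ ↦ zero_mem _⟩
  smul_mem' c x hx := by
    refine ⟨?_, fun i ↦ Submodule.smul_mem _ c (hx.2 i)⟩
    rw [MagicAlg.smul_snd, hx.1, smul_zero]
  lie_mem' {x y} hx hy := by
    have hact (d : paraOs.tri) (i : Fin 3) (a : Os ⊗[ℝ] ℂ) (ha : a ∈ realPart) :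
        MagicAlg.act d i a ∈ realPart := by
      obtain ⟨s, rfl⟩ := ha
      exact ⟨d.1 i s, rfl⟩
    have hM (a b : Os ⊗[ℝ] ℂ) (ha : a ∈ realPart) (hb : b ∈ realPart) :
        MagicAlg.M paraOs paraC a b ∈ realPart := by
      obtain ⟨s, rfl⟩ := ha
      obtain ⟨r, rfl⟩ := hb
      refine ⟨paraOs.mul s r, ?_⟩
      have h1 : paraC.mul 1 1 = 1 := by
        change (starRingEnd ℂ) 1 * (starRingEnd ℂ) 1 = 1
        simp
      change _ = paraOs.mul s r ⊗ₜ[ℝ] paraC.mul 1 1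
      rw [h1]
      rfl
    have hK (i : Fin 3) (a b : Os ⊗[ℝ] ℂ) (ha : a ∈ realPart) (hb : b ∈ realPart) :
        MagicAlg.K' paraOs paraC i a b = 0 := by
      obtain ⟨s, rfl⟩ := ha
      obtain ⟨r, rfl⟩ := hb
      have h1 : paraC.t 1 1 = 0 := by
        have := paraC.t_swap 1 1
        linear_combination (norm := module) (2⁻¹ : ℝ) • this
      change paraOs.q s r • paraC.tPow i 1 1 = 0
      rw [SymCompAlg.tPow, LinearMap.compr₂_apply, h1, map_zero, smul_zero]
    have hz (i : Fin 3) (a : Os ⊗[ℝ] ℂ) : MagicAlg.act' (0 : paraC.tri) i a = 0 :=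
      MagicAlg.act'_zero i a
    refine ⟨?_, fun i ↦ ?_⟩
    · rw [MagicAlg.lie_snd x y 0, hx.1, hy.1]
      simp only [hK _ _ _ (hx.2 _) (hy.2 _), smul_zero, add_zero, lie_self]
    · rw [MagicAlg.lie_thd, hx.1, hy.1, hz, hz]
      refine add_mem (sub_mem (sub_mem (add_mem (hact _ _ _ (hy.2 i)) (zero_mem _))
        (hact _ _ _ (hx.2 i))) (zero_mem _)) (Submodule.smul_mem _ _ (sub_mem ?_ ?_))
      · exact hM _ _ (hx.2 _) (hy.2 _)
      · exact hM _ _ (hy.2 _) (hx.2 _)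

end E62

end Concrete

section LieNotions

/-- The simultaneous eigenspace `{x | [h, x] = λ(h) x for all h ∈ A}`. -/
def weightSpace {K L : Type*} [Field K] [LieRing L] [LieAlgebra K L] (A : Submodule K L)
    (lam : Module.Dual K A) : Submodule K L where
  carrier := {x | ∀ h : A, ⁅(h : L), x⁆ = lam h • x}
  add_mem' {x y} hx hy h := by rw [lie_add, hx h, hy h, smul_add]
  zero_mem' h := by rw [lie_zero, smul_zero]
  smul_mem' c x hx h := by rw [lie_smul, hx h, smul_comm]

/-- The nonzero functionals on `A` with nonzero eigenspace: the roots relative to `A` if `A` is a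
Cartan subalgebra, the restricted roots if `A` is maximal abelian in `p`. -/
def roots {K L : Type*} [Field K] [LieRing L] [LieAlgebra K L] (A : Submodule K L) :
    Set (Module.Dual K A) :=
  {lam | lam ≠ 0 ∧ weightSpace A lam ≠ ⊥}

/-- `R` is a (finite, reduced, crystallographic) root system in `V`, and the family `β` is a basis
of it whose Cartan matrix `⟨βᵢ, βⱼ^∨⟩` is `C`. -/
def IsRootBasis (K : Type*) {V ι : Type*} [Field K] [AddCommGroup V] [Module K V]
    (R : Set V) (β : ι → V) (C : Matrix ι ι ℤ) : Prop :=
  R.Finite ∧ ∃ P : RootPairing R K V (Module.Dual K V),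
    (∀ r : R, P.root r = r) ∧ P.IsRootSystem ∧ P.IsCrystallographic ∧ P.IsReduced ∧
    ∃ (b : P.Base) (s : ι ≃ b.support), (∀ i, P.root (s i) = β i) ∧
      ∀ i j, P.pairing (s i) (s j) = (C i j : K)

/-- The subspace `H` is a Cartan subalgebra. -/
def IsCartanSubspace {K L : Type*} [Field K] [LieRing L] [LieAlgebra K L]
    (H : Submodule K L) : Prop :=
  ∃ H' : LieSubalgebra K L, H'.toSubmodule = H ∧ H'.IsCartanSubalgebra

/-- The subspace `H` is a Cartan subalgebra and `ad h` is diagonalizable over `K` for `h ∈ H`. -/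
def IsSplitCartan {K L : Type*} [Field K] [LieRing L] [LieAlgebra K L]
    (H : Submodule K L) : Prop :=
  IsCartanSubspace H ∧
    ∀ h ∈ H, ⨆ μ : K, Module.End.eigenspace (LieAlgebra.ad K L h : Module.End K L) μ = ⊤

/-- The signature of the Killing form of a real Lie algebra. -/
noncomputable def killingSignature (L : Type*) [LieRing L] [LieAlgebra ℝ L] : ℤ :=
  let Q : QuadraticForm ℝ L := LinearMap.BilinMap.toQuadraticMap (killingForm ℝ L)
  (sigPos Q : ℤ) - (sigNeg Q : ℤ)

variable {L : Type*} [LieRing L] [LieAlgebra ℝ L]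

/-- Multiplication by the imaginary unit on the complexification. -/
noncomputable def mulI (L : Type*) [LieRing L] [LieAlgebra ℝ L] :
    (ℂ ⊗[ℝ] L) →ₗ[ℝ] (ℂ ⊗[ℝ] L) :=
  (LinearMap.lsmul ℂ (ℂ ⊗[ℝ] L) Complex.I).restrictScalars ℝ

/-- A real subalgebra `u` of the complexification of `L` is a compact real form of it if
`L^ℂ = u ⊕ i u` and the Killing form of `u` is negative definite. -/
def IsCompactRealForm (u : LieSubalgebra ℝ (ℂ ⊗[ℝ] L)) : Prop :=
  IsCompl u.toSubmodule (u.toSubmodule.map (mulI L)) ∧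
    ∀ x : u, x ≠ 0 → killingForm ℝ u x x < 0

/-- `L = t ⊕ p` is a Cartan decomposition: there is a compact real form `u` of the complexification
with `t = L ∩ u` and `p = L ∩ i u`. -/
def IsCartanDecomposition (t p : Submodule ℝ L) : Prop :=
  IsCompl t p ∧ ∃ u : LieSubalgebra ℝ (ℂ ⊗[ℝ] L), IsCompactRealForm u ∧
    t = u.toSubmodule.comap (TensorProduct.mk ℝ ℂ L 1) ∧
    p = (u.toSubmodule.map (mulI L)).comap (TensorProduct.mk ℝ ℂ L 1)

/-- `a` is maximal among the abelian subspaces of `p`. -/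
def IsMaximalAbelianIn (p a : Submodule ℝ L) : Prop :=
  Maximal (fun b : Submodule ℝ L ↦ b ≤ p ∧ ∀ x ∈ b, ∀ y ∈ b, ⁅x, y⁆ = 0) a

/-- An element of `h`, as an element of `h^ℂ`. -/
noncomputable def toComplex {h : Submodule ℝ L} (x : h) : h.baseChange ℂ :=
  ⟨1 ⊗ₜ[ℝ] (x : L), Submodule.tmul_mem_baseChange_of_mem 1 x.2⟩

/-- Two functionals on `h^ℂ` have the same restriction to `a`. -/
def SameRestriction (a : Submodule ℝ L) {h : Submodule ℝ L}
    (α β : Module.Dual ℂ (h.baseChange ℂ)) : Prop :=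
  ∀ x : h, (x : L) ∈ a → α (toComplex x) = β (toComplex x)

/-- The real functional `lam` on `a` is the restriction of the functional `α` on `h^ℂ`. -/
def IsRestriction {a h : Submodule ℝ L} (α : Module.Dual ℂ (h.baseChange ℂ))
    (lam : Module.Dual ℝ a) : Prop :=
  a ≤ h ∧ ∀ (x : h) (hx : (x : L) ∈ a), α (toComplex x) = (lam ⟨x, hx⟩ : ℂ)

/-- The Satake diagram of `L`, computed from a Cartan decomposition `L = t ⊕ p`, a maximal abelian
subspace `a` of `p`, a maximal abelian subalgebra `h` containing `a` and an adapted basis `α` of the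
root system of `L^ℂ` relative to `h^ℂ`, has Dynkin diagram with Cartan matrix `C`, its black nodes
are those in `black`, and the pairs of nodes joined by an arrow are those in `arrows`. -/
structure IsSatakeDiagram {ι : Type*} (t p a h : Submodule ℝ L)
    (α : ι → Module.Dual ℂ (h.baseChange ℂ)) (C : Matrix ι ι ℤ) (black : Set ι)
    (arrows : Set (Sym2 ι)) : Prop where
  cartan : IsCartanDecomposition t p
  maximal_a : IsMaximalAbelianIn p a
  le_h : a ≤ h
  maximal_h : IsMaximalAbelianIn ⊤ h
  basis : IsRootBasis ℂ (roots (h.baseChange ℂ)) α C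
  /-- The simple roots vanishing on `a` form a basis of the system of roots vanishing on `a`. -/
  adapted : ∀ β ∈ roots (h.baseChange ℂ), SameRestriction a β 0 →
    β ∈ AddSubmonoid.closure {γ | ∃ i, α i = γ ∧ SameRestriction a γ 0} ∨
    -β ∈ AddSubmonoid.closure {γ | ∃ i, α i = γ ∧ SameRestriction a γ 0}
  black_iff : ∀ i, i ∈ black ↔ SameRestriction a (α i) 0
  arrow_iff : ∀ i j, s(i, j) ∈ arrows ↔
    i ≠ j ∧ i ∉ black ∧ j ∉ black ∧ SameRestriction a (α i) (α j)

/-- Root vectors `e_α ∈ L_α`, `f_α ∈ L_{-α}` for the roots `α` in `pos`, with `[e_α, f_α] = h_α`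
(that is, `[e_α, f_α] ∈ H` and `α([e_α, f_α]) = 2`), normalized so that `-id` on `H` and
`e_α ↦ -f_α` extend to an automorphism of `L`. -/
def IsChevalleyFamily (H : Submodule ℝ L) (pos : Set (Module.Dual ℝ H))
    (e f : Module.Dual ℝ H → L) : Prop :=
  (∀ α ∈ pos, e α ∈ weightSpace H α ∧ f α ∈ weightSpace H (-α) ∧
    ∃ hm : ⁅e α, f α⁆ ∈ H, α ⟨⁅e α, f α⁆, hm⟩ = 2) ∧
  ∃ θ : L ≃ₗ⁅ℝ⁆ L, (∀ x ∈ H, θ x = -x) ∧ ∀ α ∈ pos, θ (e α) = -f α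

end LieNotions

section Roots

/-- Coordinate vectors of the functionals `±w_j ± w_k`, `j ≠ k`. -/
def PhiLong : Set (Fin 4 → ℝ) :=
  {v | ∃ j k : Fin 4, j ≠ k ∧ ∃ s r : ℝ, (s = 1 ∨ s = -1) ∧ (r = 1 ∨ r = -1) ∧
    v = Pi.single j s + Pi.single k r}

/-- Coordinate vectors of the functionals `±w_j`. -/
def PhiZero : Set (Fin 4 → ℝ) :=
  {v | ∃ (j : Fin 4) (s : ℝ), (s = 1 ∨ s = -1) ∧ v = Pi.single j s}

/-- Coordinate vectors of the functionals `½ (ε₁ w₁ + ε₂ w₂ + ε₃ w₃ + ε₄ w₄)` with `εᵢ = ±1` and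
`∏ εᵢ = c`. -/
def PhiHalf (c : ℝ) : Set (Fin 4 → ℝ) :=
  {v | ∃ s : Fin 4 → ℝ, (∀ i, s i = 1 ∨ s i = -1) ∧ ∏ i, s i = c ∧ v = (1 / 2 : ℝ) • s}

/-- The sets `Φ₀`, `Φ₁`, `Φ₂` of short roots. -/
def PhiShort : Fin 3 → Set (Fin 4 → ℝ) := ![PhiZero, PhiHalf 1, PhiHalf (-1)]

/-- The 48 roots of `g₀`. -/
def Phi : Set (Fin 4 → ℝ) := PhiLong ∪ ⋃ i, PhiShort i

/-- The positive roots `w_j ± w_k` (`j < k`), `w_j` and `½ (w₁ ± w₂ ± w₃ ± w₄)`. -/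
def PhiPos : Set (Fin 4 → ℝ) :=
  {v | ∃ j k : Fin 4, j < k ∧ ∃ r : ℝ, (r = 1 ∨ r = -1) ∧ v = Pi.single j 1 + Pi.single k r} ∪
  {v | ∃ j : Fin 4, v = Pi.single j 1} ∪
  {v | ∃ s : Fin 4 → ℝ, s 0 = 1 ∧ (∀ i, s i = 1 ∨ s i = -1) ∧ v = (1 / 2 : ℝ) • s}

/-- The coordinate vector `(w₁, w₂, w₃, w₄, x, y)`. -/
noncomputable def extend (w : Fin 4 → ℝ) (x y : ℂ) : Fin 6 → ℂ :=
  ![(w 0 : ℂ), (w 1 : ℂ), (w 2 : ℂ), (w 3 : ℂ), x, y]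

/-- Coordinate vectors of the 72 roots `±w_j ± w_k`, `±w_j ± (i/2)(w₅ + w₆)`,
`½ ∑ εⱼ wⱼ ± i (½ w₅ - w₆)` with `∏ εⱼ = 1`, and `½ ∑ εⱼ wⱼ ± i (w₅ - ½ w₆)` with
`∏ εⱼ = -1`. -/
def Delta : Set (Fin 6 → ℂ) :=
  {v | ∃ w ∈ PhiLong, v = extend w 0 0} ∪
  {v | ∃ w ∈ PhiShort 0, ∃ s : ℂ, (s = Complex.I ∨ s = -Complex.I) ∧
    v = extend w (s * (1 / 2)) (s * (1 / 2))} ∪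
  {v | ∃ w ∈ PhiShort 1, ∃ s : ℂ, (s = Complex.I ∨ s = -Complex.I) ∧
    v = extend w (s * (1 / 2)) (s * (-1))} ∪
  {v | ∃ w ∈ PhiShort 2, ∃ s : ℂ, (s = Complex.I ∨ s = -Complex.I) ∧
    v = extend w (s * 1) (s * (-(1 / 2)))}

/-- Coordinate vectors of the simple roots `α₁, …, α₆`. -/
noncomputable def simpleRoots : Fin 6 → Fin 6 → ℂ :=
  ![![1 / 2, -(1 / 2), -(1 / 2), -(1 / 2), Complex.I, -(Complex.I / 2)],
    ![0, 1, -1, 0, 0, 0],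
    ![0, 0, 0, 1, -(Complex.I / 2), -(Complex.I / 2)],
    ![0, 0, 1, -1, 0, 0],
    ![0, 0, 0, 1, Complex.I / 2, Complex.I / 2],
    ![1 / 2, -(1 / 2), -(1 / 2), -(1 / 2), -Complex.I, Complex.I / 2]]

/-- Coordinate vectors of the basis `w₂ - w₃, w₃ - w₄, w₄, ½ (w₁ - w₂ - w₃ - w₄)` of `Φ`. -/
noncomputable def simplePhi : Fin 4 → Fin 4 → ℝ :=
  ![![0, 1, -1, 0], ![0, 0, 1, -1], ![0, 0, 0, 1], ![1 / 2, -(1 / 2), -(1 / 2), -(1 / 2)]]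

end Roots

namespace E62

lemma inTri_mem (d : paraOs.tri) : inTri d ∈ g₀ := ⟨rfl, fun _ ↦ zero_mem _⟩

/-- The elements `h₁, h₂, h₃, h₄`. -/
noncomputable def hReal (k : Fin 4) : E62 := h (Fin.castLE (by decide) k)

lemma hReal_mem (k : Fin 4) : hReal k ∈ g₀ := by
  fin_cases k <;> exact inTri_mem _

/-- The subspace `h₀ = ⟨h₁, h₂, h₃, h₄⟩`. -/
noncomputable def h₀ : Submodule ℝ E62 := Submodule.span ℝ (Set.range hReal)

/-- The subspace `h = ⟨h₁, …, h₆⟩`. -/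
noncomputable def hFull : Submodule ℝ E62 := Submodule.span ℝ (Set.range h)

/-- The subspace `tri(pC)` of `g`. -/
noncomputable def triPC : Submodule ℝ E62 := Submodule.span ℝ (Set.range inTri')

/-- The subspace `h₀`, inside `g₀`. -/
noncomputable def h₀' : Submodule ℝ g₀ := h₀.comap g₀.toSubmodule.subtype

/-- The values of a functional on `h₀` at `h₁, h₂, h₃, h₄`. -/
noncomputable def coords (lam : Module.Dual ℝ h₀) (k : Fin 4) : ℝ :=
  lam ⟨hReal k, Submodule.subset_span ⟨k, rfl⟩⟩

/-- The values of a functional on `h₀`, inside `g₀`, at `h₁, h₂, h₃, h₄`. -/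
noncomputable def coords' (lam : Module.Dual ℝ h₀') (k : Fin 4) : ℝ :=
  lam ⟨⟨hReal k, hReal_mem k⟩, Submodule.subset_span ⟨k, rfl⟩⟩

/-- The values of a functional on `h^ℂ` at `h₁, …, h₆`. -/
noncomputable def coordsC (α : Module.Dual ℂ (hFull.baseChange ℂ)) (k : Fin 6) : ℂ :=
  α (toComplex ⟨h k, Submodule.subset_span ⟨k, rfl⟩⟩)

/-- The set `Φ⁺` of positive roots of `g₀`. -/
def positive : Set (Module.Dual ℝ h₀') := {α | coords' α ∈ PhiPos}

variable (e f : Module.Dual ℝ h₀' → g₀)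

/-- The subspace `⟨e_α - f_α | α ∈ Φ⁺⟩` of `g₀`. -/
noncomputable def t₀ : Submodule ℝ g₀ :=
  Submodule.span ℝ {x | ∃ α ∈ positive, x = e α - f α}

/-- The subspace `h₀ ⊕ ⟨e_α + f_α | α ∈ Φ⁺⟩` of `g₀`. -/
noncomputable def p₀ : Submodule ℝ g₀ :=
  h₀' ⊔ Submodule.span ℝ {x | ∃ α ∈ positive, x = e α + f α}

/-- `t = tri(pC) ⊕ ⟨e_α - f_α | α ∈ Φ⁺⟩ ⊕ ⨁ᵢ ⟨Ψᵢ(e_α - f_α) | α ∈ Φ⁺ ∩ Φᵢ₊₁⟩`. -/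
noncomputable def t : Submodule ℝ E62 :=
  triPC ⊔ (t₀ e f).map g₀.toSubmodule.subtype ⊔
    ⨆ i : Fin 3, Submodule.span ℝ
      {x | ∃ α ∈ positive, coords' α ∈ PhiShort (i + 1) ∧ x = Psi i (e α - f α : g₀)}

/-- `p = h₀ ⊕ ⟨e_α + f_α | α ∈ Φ⁺⟩ ⊕ ⨁ᵢ ⟨Ψᵢ(e_α + f_α) | α ∈ Φ⁺ ∩ Φᵢ₊₁⟩`. -/
noncomputable def p : Submodule ℝ E62 :=
  (p₀ e f).map g₀.toSubmodule.subtype ⊔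
    ⨆ i : Fin 3, Submodule.span ℝ
      {x | ∃ α ∈ positive, coords' α ∈ PhiShort (i + 1) ∧ x = Psi i (e α + f α : g₀)}

end E62

/-! Everything is read off from the adjoint action of explicit commuting elements. The projection `d
↦ d₀` identifies tri(pO_s) with the `q`-skew endomorphisms, since a triple with `d₀ = 0` vanishes
(`Os.tri_eq_zero`). Hence the `t_{b,c}` attached to pairs of standard basis vectors form a basis of
tri(pO_s), and h₁, …, h₄ act diagonally on it and on every ι_i. A basis of simultaneous eigenvectors
(`IsWeightBasis`) turns roots, multiplicities, centralizers and the Killing form on h₀ into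
statements about a finite table of half-integral weights. tri(pC) acts on the second tensor factor
by rotations, which the vectors ι_i(x ⊗ 1) ∓ i ι_i(x ⊗ **i**) of the complexification diagonalize.
That the tables are root systems of type F₄ and E₆ follows from `isRootBasis_of_simple_reflections`,
which tests only the reflections in simple roots and leaves finite checks.

For the Cartan decompositions, let θ be the automorphism accompanying a Chevalley family. It is -1
on h₀, so it reverses weights; since the nonzero weights of g₀ have multiplicity one, θ(f_α) = -e_α
and θ is an involution. For the same reason it preserves tri(pO_s) and each ι_i, and sends every
standard basis vector of pO_s to a multiple of its dual. So θ consists of a map F of tri(pO_s) and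
maps T_i of pO_s. The brackets of g₀ force each T_i to preserve `q`, and F, the identity of tri(pC)
and the maps T_i ⊗ id together form an involution Θ of g that commutes with every Ψ_i
(`E62.exists_extension`).

The standard basis is orthogonal for -κ(x, Θ y), with positive squares. On h₀ the Killing form is a
sum of products of weights; on tri(pC) it is negative definite because the elements act by
rotations; for root vectors 2 κ(e, f) = κ(h, h) > 0 with h = [e, f]; and Ψ carries this from ι_i(x ⊗
1) to ι_i(x ⊗ **i**). Thus Θ is a Cartan involution, which gives semisimplicity, the compact form
and the signature. The spaces t and p lie in the two eigenspaces of Θ and together span g, so they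
are these eigenspaces; their dimensions follow from tr Θ = -2.

Finally, the centralizer of h₀ in g is h. This gives the maximality of h and of a = h₀, and no root
vanishes on h₀, so no node is black. Arrows and restricted multiplicities are read off from the
table, and simplicity of the complexification follows from the connectedness of the Dynkin diagram
(`isSimple_of_roots`). -/

/-! ### Bases of simultaneous eigenvectors. -/

section WeightBases

open Module

variable {K L : Type*} [Field K] [LieRing L] [LieAlgebra K L] {J : Type*} {n : ℕ}

/-- The vectors `g k` span `H`, and the basis `b` consists of simultaneous eigenvectors of their
adjoint actions, with eigenvalues `wt j k`. -/
structure IsWeightBasis (H : Submodule K L) (g : Fin n → H) (b : Basis J K L)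
    (wt : J → Fin n → K) : Prop where
  span : Submodule.span K (Set.range g) = ⊤
  lie : ∀ k j, ⁅(g k : L), b j⁆ = wt j k • b j

namespace IsWeightBasis

variable {H : Submodule K L} {g : Fin n → H} {b : Basis J K L} {wt : J → Fin n → K}
  (hb : IsWeightBasis H g b wt)

lemma repr_lie_of_forall {x : L} {c : J → K} (h : ∀ j, ⁅x, b j⁆ = c j • b j) (y : L) (j : J) :
    b.repr ⁅x, y⁆ j = c j * b.repr y j := by
  have key : Finsupp.lapply j ∘ₗ b.repr.toLinearMap ∘ₗ LieAlgebra.ad K L x =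
      c j • (Finsupp.lapply j ∘ₗ b.repr.toLinearMap) := by
    refine b.ext fun i ↦ ?_
    classical
    change b.repr ⁅x, b i⁆ j = c j * b.repr (b i) j
    rw [h, map_smul, Finsupp.smul_apply, smul_eq_mul, Basis.repr_self, Finsupp.single_apply]
    split_ifs with hij
    · rw [hij]
    · rw [mul_zero, mul_zero]
  exact LinearMap.congr_fun key y

include hb

lemma repr_lie (k : Fin n) (x : L) (j : J) :
    b.repr ⁅(g k : L), x⁆ j = wt j k * b.repr x j :=
  repr_lie_of_forall (hb.lie k) x j

lemma mem_weightSpace_iff_lie (lam : Dual K H) (x : L) :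
    x ∈ weightSpace H lam ↔ ∀ k, ⁅(g k : L), x⁆ = lam (g k) • x := by
  refine ⟨fun h k ↦ h (g k), fun h y ↦ ?_⟩
  have hy : y ∈ Submodule.span K (Set.range g) := hb.span ▸ Submodule.mem_top
  induction hy using Submodule.span_induction with
  | mem y hy => obtain ⟨k, rfl⟩ := hy; exact h k
  | zero => simp
  | add y z _ _ h1 h2 => simp only [Submodule.coe_add, add_lie, h1, h2, map_add, add_smul]
  | smul c y _ h1 => simp only [Submodule.coe_smul, smul_lie, h1, map_smul, smul_assoc]

/-- Comparing coordinates of the eigenvalue equation shows that a weight vector involves only basis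
vectors of its own weight. Spans, dimensions and roots all follow from this. -/
lemma mem_weightSpace_iff (lam : Dual K H) (x : L) :
    x ∈ weightSpace H lam ↔ ∀ j, b.repr x j ≠ 0 → wt j = fun k ↦ lam (g k) := by
  rw [hb.mem_weightSpace_iff_lie]
  refine ⟨fun h j hj ↦ funext fun k ↦ ?_, fun h k ↦ b.repr.injective (Finsupp.ext fun j ↦ ?_)⟩
  · have := congrArg (fun y ↦ b.repr y j) (h k)
    simp only [hb.repr_lie, map_smul, Finsupp.smul_apply, smul_eq_mul] at this
    exact mul_right_cancel₀ hj this
  · rw [hb.repr_lie, map_smul, Finsupp.smul_apply, smul_eq_mul]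
    by_cases hj : b.repr x j = 0
    · rw [hj, mul_zero, mul_zero]
    · rw [h j hj]

lemma basis_mem_weightSpace {lam : Dual K H} {j : J} (h : wt j = fun k ↦ lam (g k)) :
    b j ∈ weightSpace H lam :=
  (hb.mem_weightSpace_iff_lie _ _).mpr fun k ↦ by rw [hb.lie, h]

lemma weightSpace_eq_span (lam : Dual K H) :
    weightSpace H lam = Submodule.span K (b '' {j | wt j = fun k ↦ lam (g k)}) := by
  ext x
  rw [hb.mem_weightSpace_iff, Basis.mem_span_image]
  simp only [Set.subset_def, Finset.mem_coe, Finsupp.mem_support_iff, Set.mem_ofPred_eq]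

/-- Multiplicities of weights become cardinalities of sets of indices. -/
lemma finrank_weightSpace (lam : Dual K H) :
    finrank K (weightSpace H lam) = Nat.card {j | wt j = fun k ↦ lam (g k)} := by
  have h := b.linearIndependent.comp
    (Subtype.val : {j | wt j = fun k ↦ lam (g k)} → J) Subtype.val_injective
  rw [hb.weightSpace_eq_span, Set.image_eq_range]
  exact finrank_eq_nat_card_basis (Basis.span h)

lemma eq_zero_iff (lam : Dual K H) : lam = 0 ↔ (fun k ↦ lam (g k)) = 0 := by
  refine ⟨fun h ↦ by subst h; rfl, fun h ↦ LinearMap.ext fun y ↦ ?_⟩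
  have hy : y ∈ Submodule.span K (Set.range g) := hb.span ▸ Submodule.mem_top
  induction hy using Submodule.span_induction with
  | mem y hy => obtain ⟨k, rfl⟩ := hy; exact congrFun h k
  | zero => simp
  | add y z _ _ h1 h2 => rw [map_add, h1, h2]; simp
  | smul c y _ h1 => rw [map_smul, h1]; simp

lemma mem_roots_iff (lam : Dual K H) :
    lam ∈ roots H ↔ ∃ j, wt j ≠ 0 ∧ wt j = fun k ↦ lam (g k) := by
  refine ⟨fun ⟨h0, h1⟩ ↦ ?_, fun ⟨j, h0, h1⟩ ↦ ⟨?_, ?_⟩⟩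
  · obtain ⟨x, hx, hx0⟩ := Submodule.exists_mem_ne_zero_of_ne_bot h1
    obtain ⟨j, hj⟩ : ∃ j, b.repr x j ≠ 0 := by
      by_contra! h
      exact hx0 (b.repr.injective (by ext j; simp [h]))
    have hw := (hb.mem_weightSpace_iff lam x).mp hx j hj
    refine ⟨j, ?_, hw⟩
    rw [hw]
    exact fun h ↦ h0 ((hb.eq_zero_iff lam).mpr h)
  · rw [Ne, hb.eq_zero_iff, ← h1]; exact h0
  · intro h
    have := hb.basis_mem_weightSpace h1
    rw [h, Submodule.mem_bot] at this
    exact b.ne_zero j this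

lemma mem_of_lie_eq_zero (h0 : ∀ j, wt j = 0 → b j ∈ H) {x : L}
    (hx : ∀ k, ⁅(g k : L), x⁆ = 0) : x ∈ H := by
  have h1 : x ∈ weightSpace H (0 : Dual K H) :=
    (hb.mem_weightSpace_iff_lie _ _).mpr fun k ↦ by simp [hx]
  rw [hb.weightSpace_eq_span] at h1
  refine Submodule.span_le.mpr ?_ h1
  rintro _ ⟨j, hj, rfl⟩
  exact h0 j hj

/-- Nilpotency is clear for an abelian subspace. An element `x` of the normalizer is killed by `(ad
g_k)²`; as `ad g_k` is diagonalizable, it is already killed by `ad g_k`, so it lies in the span of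
the basis vectors of weight zero. -/
lemma isCartanSubspace (h0 : ∀ j, wt j = 0 → b j ∈ H) (hab : ∀ x ∈ H, ∀ y ∈ H, ⁅x, y⁆ = 0) :
    IsCartanSubspace H := by
  let H' : LieSubalgebra K L := { H with
    lie_mem' := fun {x y} hx hy ↦ (hab x hx y hy).symm ▸ H.zero_mem }
  refine ⟨H', rfl, ?_⟩
  have : IsLieAbelian H' := ⟨fun x y ↦ Subtype.ext (hab x x.2 y y.2)⟩
  refine ⟨inferInstance, le_antisymm (fun x hx ↦ ?_) H'.le_normalizer⟩
  rw [LieSubalgebra.mem_normalizer_iff'] at hx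
  refine hb.mem_of_lie_eq_zero h0 fun k ↦ b.repr.injective (Finsupp.ext fun j ↦ ?_)
  have h1 : ⁅(g k : L), ⁅(g k : L), x⁆⁆ = 0 := hab _ (g k).2 _ (hx _ (g k).2)
  have h2 := congrArg (fun y ↦ b.repr y j) h1
  simp only [hb.repr_lie, map_zero, Finsupp.zero_apply, mul_eq_zero] at h2 ⊢
  tauto

lemma exists_lie_eq {x : L} (hx : x ∈ H) : ∃ c : J → K, ∀ j, ⁅x, b j⁆ = c j • b j := by
  have hy : (⟨x, hx⟩ : H) ∈ Submodule.span K (Set.range g) := hb.span ▸ Submodule.mem_top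
  have key : ∀ y : H, y ∈ Submodule.span K (Set.range g) →
      ∃ c : J → K, ∀ j, ⁅(y : L), b j⁆ = c j • b j := by
    intro y hy
    induction hy using Submodule.span_induction with
    | mem y hy => obtain ⟨k, rfl⟩ := hy; exact ⟨_, fun j ↦ hb.lie k j⟩
    | zero => exact ⟨0, fun j ↦ by simp⟩
    | add y z _ _ h1 h2 =>
      obtain ⟨c, hc⟩ := h1
      obtain ⟨d, hd⟩ := h2
      exact ⟨c + d, fun j ↦ by rw [Submodule.coe_add, add_lie, hc, hd, Pi.add_apply, add_smul]⟩
    | smul a y _ h1 =>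
      obtain ⟨c, hc⟩ := h1
      exact ⟨a • c, fun j ↦ by
        rw [Submodule.coe_smul, smul_lie, hc, Pi.smul_apply, smul_eq_mul, mul_smul]⟩
  exact key _ hy

lemma isSplitCartan (h0 : ∀ j, wt j = 0 → b j ∈ H) (hab : ∀ x ∈ H, ∀ y ∈ H, ⁅x, y⁆ = 0) :
    IsSplitCartan H := by
  refine ⟨hb.isCartanSubspace h0 hab, fun h hh ↦ eq_top_iff.mpr ?_⟩
  rw [← b.span_eq, Submodule.span_le]
  rintro _ ⟨j, rfl⟩
  obtain ⟨c, hc⟩ := hb.exists_lie_eq hh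
  exact Submodule.mem_iSup_of_mem (c j) (Module.End.mem_eigenspace_iff.mpr (hc j))

end IsWeightBasis

/-- The values of a functional at the members of a basis, as a linear equivalence. -/
noncomputable def dualEquivFun {V : Type*} [AddCommGroup V] [Module K V] (g : Basis (Fin n) K V) :
    Dual K V ≃ₗ[K] (Fin n → K) := (g.constr K).symm

lemma dualEquivFun_apply {V : Type*} [AddCommGroup V] [Module K V] (g : Basis (Fin n) K V)
    (f : Dual K V) (k : Fin n) : dualEquivFun g f k = f (g k) := rfl

lemma trace_eq_sum_of_eigenbasis {V : Type*} [AddCommGroup V] [Module K V] [Fintype J]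
    (b : Basis J K V) (f : End K V) (c : J → K) (h : ∀ j, f (b j) = c j • b j) :
    LinearMap.trace K V f = ∑ j, c j := by
  classical
  rw [LinearMap.trace_eq_matrix_trace K b, Matrix.trace]
  refine Finset.sum_congr rfl fun j _ ↦ ?_
  rw [Matrix.diag_apply, LinearMap.toMatrix_apply, h]
  simp

end WeightBases

/-! ### Root systems from integral coordinates. -/

section RootBases

open Module

lemma IsRootBasis.congr {K V ι : Type*} [Field K] [AddCommGroup V] [Module K V] {R R' : Set V}
    {β β' : ι → V} {C : Matrix ι ι ℤ} (h : IsRootBasis K R β C) (hR : R = R')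
    (hβ : ∀ i, β i = β' i) : IsRootBasis K R' β' C := by
  obtain rfl : β = β' := funext hβ
  exact hR ▸ h

variable {K V ι : Type*} [Field K] [CharZero K] [AddCommGroup V] [Module K V] [Fintype ι]
  [DecidableEq ι]

/-- A criterion for a set of vectors with integral coordinates with respect to a basis to be a root
system with that basis; `cor c` are the coordinates of the coroot of the root with coordinates
`c`. -/
theorem isRootBasis_of_coefficients (β : Basis ι K V) (R : Set (ι → ℤ)) (hfin : R.Finite)
    (cor : (ι → ℤ) → (ι → ℤ)) (C : Matrix ι ι ℤ)
    (h2 : ∀ c ∈ R, c ⬝ᵥ cor c = 2)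
    (hrefl : ∀ c ∈ R, ∀ d ∈ R, d - (d ⬝ᵥ cor c) • c ∈ R)
    (hs : ∀ i, Pi.single i 1 ∈ R) (hC : ∀ i j, cor (Pi.single j 1) i = C i j)
    (hpos : ∀ c ∈ R, (∀ i, 0 ≤ c i) ∨ ∀ i, c i ≤ 0)
    (hred : ∀ c ∈ R, ∀ d ∈ R, (c ⬝ᵥ cor d) * (d ⬝ᵥ cor c) = 4 → c = d ∨ c = -d) :
    IsRootBasis K {v | ∃ c ∈ R, v = ∑ i, (c i : K) • β i} β C := by
  set S : Set V := {v | ∃ c ∈ R, v = ∑ i, (c i : K) • β i} with hS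
  have hSf : S.Finite := by
    have : S = (fun c : ι → ℤ ↦ ∑ i, (c i : K) • β i) '' R := by
      ext v; simp only [hS, Set.mem_ofPred_eq, Set.mem_image, eq_comm]
    rw [this]; exact hfin.image _
  have hfS : Finite S := hSf
  choose co hcoR hco using fun s : S ↦ s.2
  -- The coroot takes the values `cor (co s) i` at the basis vectors, so that by `hpair` every
  -- pairing is an integral dot product.
  let cr (s : S) : Dual K V := ∑ i, (cor (co s) i : K) • β.coord i
  have hpair (c : ι → ℤ) (s : S) : cr s (∑ i, (c i : K) • β i) = ((c ⬝ᵥ cor (co s) : ℤ) : K) := by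
    simp only [cr, LinearMap.coe_sum, Finset.sum_apply, LinearMap.smul_apply, map_sum, map_smul,
      Basis.coord_apply, Basis.repr_self, smul_eq_mul, dotProduct, Int.cast_sum, Int.cast_mul]
    refine Finset.sum_congr rfl fun i _ ↦ ?_
    rw [Finset.sum_eq_single i (fun j _ hj ↦ by simp [hj]) (by simp)]
    simp [mul_comm]
  have hpair' (r s : S) : cr s r = ((co r ⬝ᵥ cor (co s) : ℤ) : K) := by
    conv_lhs => rw [hco r]
    exact hpair _ _
  have hinj : ∀ c d : ι → ℤ, ∑ i, (c i : K) • β i = ∑ i, (d i : K) • β i → c = d := by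
    intro c d h
    funext i
    have := congrArg (β.coord i) h
    simpa [Finsupp.single_apply] using this
  -- Equal coroots give two pairings equal to 2, hence a product equal to 4, so the roots agree up
  -- to sign; the sign -1 would make one pairing -2.
  have hcrinj : Function.Injective cr := by
    intro r s hrs
    have e1 : co r ⬝ᵥ cor (co s) = 2 := by
      have h := hpair' r s
      rw [← hrs, hpair', h2 _ (hcoR r)] at h
      exact_mod_cast h.symm
    have e2 : co s ⬝ᵥ cor (co r) = 2 := by
      have h := hpair' s r
      rw [hrs, hpair', h2 _ (hcoR s)] at h
      exact_mod_cast h.symm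
    rcases hred _ (hcoR r) _ (hcoR s) (by rw [e1, e2]; norm_num) with h | h
    · exact Subtype.ext (by rw [hco r, hco s, h])
    · rw [h, neg_dotProduct, h2 _ (hcoR s)] at e1
      norm_num at e1
  have hfd : FiniteDimensional K V := β.finiteDimensional_of_finite
  have hp : ∀ i : S, Dual.eval K V (i : V) (cr i) = 2 := fun i ↦ by
    rw [Dual.eval_apply, hpair', h2 _ (hcoR i)]; norm_num
  have hr : ∀ i : S, Set.MapsTo (Module.preReflection (i : V) ((Dual.eval K V).flip (cr i)))
      (Set.range (Subtype.val : S → V)) (Set.range (Subtype.val : S → V)) := by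
    rintro s _ ⟨r, rfl⟩
    rw [Subtype.range_coe]
    refine ⟨_, hrefl _ (hcoR s) _ (hcoR r), ?_⟩
    rw [Module.preReflection_apply, LinearMap.flip_apply, Dual.eval_apply, hpair']
    conv_lhs => rw [hco r, hco s]
    simp only [Pi.sub_apply, Pi.smul_apply, smul_eq_mul, Int.cast_sub, Int.cast_mul, sub_smul,
      Finset.sum_sub_distrib, mul_smul, Finset.smul_sum]
  have hβS (i : ι) : β i ∈ S := ⟨Pi.single i 1, hs i, by
    rw [Finset.sum_eq_single i (fun j _ hj ↦ by simp [hj]) (by simp)]; simp⟩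
  have hsp : Submodule.span K (Set.range (Subtype.val : S → V)) = ⊤ := by
    rw [Subtype.range_coe, eq_top_iff, ← β.span_eq]
    refine Submodule.span_mono ?_
    rintro _ ⟨i, rfl⟩
    exact hβS i
  let P : RootPairing S K V (Dual K V) := RootPairing.mk'' (Dual.eval K V)
    (Function.Embedding.subtype (· ∈ S)) (Function.Embedding.mk cr hcrinj) hp hr hsp
  have hroot (s : S) : P.root s = s := rfl
  have hpairing (r s : S) : P.pairing r s = ((co r ⬝ᵥ cor (co s) : ℤ) : K) := hpair' r s
  have hcr : P.IsCrystallographic := ⟨fun i j ↦ ⟨_, (hpairing i j).symm⟩⟩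
  have hrs : P.IsRootSystem := RootPairing.isRootSystem_mk'' fun i j ↦ ⟨_, (hpairing i j).symm⟩
  have hredP : P.IsReduced := by
    refine ⟨fun r s h ↦ ?_⟩
    -- Two roots are linearly dependent exactly when their Coxeter weight is 4, which is the
    -- situation of `hred`.
    have h4 := P.coxeterWeight_eq_four_iff_not_linearIndependent.mpr h
    rw [RootPairing.coxeterWeight, hpairing, hpairing] at h4
    rcases hred _ (hcoR r) _ (hcoR s) (by exact_mod_cast h4) with h | h
    · left; rw [hroot, hroot, hco r, hco s, h]
    · right; rw [hroot, hroot, hco r, hco s, h]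
      simp [Finset.sum_neg_distrib]
  have hcl (c : ι → ℤ) (hc : ∀ i, 0 ≤ c i) :
      ∑ i, (c i : K) • β i ∈ AddSubmonoid.closure (Set.range β) := by
    refine sum_mem fun i _ ↦ ?_
    obtain ⟨m, hm⟩ := Int.eq_ofNat_of_zero_le (hc i)
    rw [hm, Int.cast_natCast, Nat.cast_smul_eq_nsmul]
    exact nsmul_mem (AddSubmonoid.subset_closure (Set.mem_range_self i)) m
  let b₀ : ι → S := fun i ↦ ⟨β i, hβS i⟩
  have hb₀ : Function.Injective b₀ := fun i j h ↦ β.injective (congrArg Subtype.val h)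
  have himg : P.root '' (Set.range b₀) = Set.range β := by
    rw [← Set.range_comp]; rfl
  let B : P.Base := RootPairing.Base.mk' P (Set.range b₀)
    ((linearIndepOn_range_iff hb₀ _).mpr β.linearIndependent) fun s ↦ by
      rw [himg, hroot, hco s]
      rcases hpos _ (hcoR s) with h | h
      · exact Or.inl (hcl _ h)
      · right
        have := hcl (-co s) fun i ↦ by simpa using h i
        simpa [Finset.sum_neg_distrib] using this
  have hsupp : ∀ s, s ∈ B.support ↔ s ∈ Set.range b₀ := fun s ↦ by
    simp [B, RootPairing.Base.mk']
  let e : ι ≃ B.support := (Equiv.ofInjective b₀ hb₀).trans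
    (Equiv.subtypeEquivRight fun s ↦ (hsupp s).symm)
  refine ⟨hSf, P, hroot, hrs, hcr, hredP, B, e, fun i ↦ rfl, fun i j ↦ ?_⟩
  have hcob (i : ι) : co (b₀ i) = Pi.single i 1 := by
    refine hinj _ _ ((hco (b₀ i)).symm.trans ?_)
    rw [Finset.sum_eq_single i (fun j _ hj ↦ by simp [hj]) (by simp)]; simp [b₀]
  change P.pairing (b₀ i) (b₀ j) = _
  rw [hpairing, hcob, hcob, single_dotProduct, one_mul, hC]


end RootBases

/-! ### Cartan involutions and the compact forms they define. -/

section CartanInvolutions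

open Module LieAlgebra

variable {L : Type*} [LieRing L] [LieAlgebra ℝ L]

section RealAndImaginaryParts

/-- The real part `ℂ ⊗ L → L`. -/
noncomputable def tensorRe (L : Type*) [AddCommGroup L] [Module ℝ L] : ℂ ⊗[ℝ] L →ₗ[ℝ] L :=
  (TensorProduct.lid ℝ L).toLinearMap ∘ₗ LinearMap.rTensor L Complex.reLm

/-- The imaginary part `ℂ ⊗ L → L`. -/
noncomputable def tensorIm (L : Type*) [AddCommGroup L] [Module ℝ L] : ℂ ⊗[ℝ] L →ₗ[ℝ] L :=
  (TensorProduct.lid ℝ L).toLinearMap ∘ₗ LinearMap.rTensor L Complex.imLm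

@[simp] lemma tensorRe_tmul (c : ℂ) (x : L) : tensorRe L (c ⊗ₜ x) = c.re • x := rfl
@[simp] lemma tensorIm_tmul (c : ℂ) (x : L) : tensorIm L (c ⊗ₜ x) = c.im • x := rfl

lemma tensor_eq_re_add_im (z : ℂ ⊗[ℝ] L) :
    z = (1 : ℂ) ⊗ₜ tensorRe L z + Complex.I ⊗ₜ tensorIm L z := by
  induction z using TensorProduct.induction_on with
  | zero => simp
  | add x y hx hy =>
    rw [map_add, map_add, TensorProduct.tmul_add, TensorProduct.tmul_add]
    nth_rewrite 1 [hx, hy]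
    abel
  | tmul c x =>
    rw [tensorRe_tmul, tensorIm_tmul, ← TensorProduct.smul_tmul, ← TensorProduct.smul_tmul,
      ← TensorProduct.add_tmul]
    congr 1
    apply Complex.ext <;> simp

lemma tensor_ext {z w : ℂ ⊗[ℝ] L} (h1 : tensorRe L z = tensorRe L w)
    (h2 : tensorIm L z = tensorIm L w) : z = w := by
  rw [tensor_eq_re_add_im z, tensor_eq_re_add_im w, h1, h2]

lemma tensorRe_lie (z w : ℂ ⊗[ℝ] L) : tensorRe L ⁅z, w⁆ =
    ⁅tensorRe L z, tensorRe L w⁆ - ⁅tensorIm L z, tensorIm L w⁆ := by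
  rw [tensor_eq_re_add_im z, tensor_eq_re_add_im w]
  simp [LieAlgebra.ExtendScalars.bracket_tmul, sub_eq_add_neg]

lemma tensorIm_lie (z w : ℂ ⊗[ℝ] L) : tensorIm L ⁅z, w⁆ =
    ⁅tensorRe L z, tensorIm L w⁆ + ⁅tensorIm L z, tensorRe L w⁆ := by
  rw [tensor_eq_re_add_im z, tensor_eq_re_add_im w]
  simp [LieAlgebra.ExtendScalars.bracket_tmul, add_comm]

lemma tensorRe_mulI (z : ℂ ⊗[ℝ] L) : tensorRe L (mulI L z) = -tensorIm L z := by
  rw [tensor_eq_re_add_im z]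
  simp [mulI, TensorProduct.smul_tmul']

lemma tensorIm_mulI (z : ℂ ⊗[ℝ] L) : tensorIm L (mulI L z) = tensorRe L z := by
  rw [tensor_eq_re_add_im z]
  simp [mulI, TensorProduct.smul_tmul']

end RealAndImaginaryParts

/-- The subspace of fixed points. -/
def fixedSpace (θ : L ≃ₗ⁅ℝ⁆ L) : Submodule ℝ L where
  carrier := {x | θ x = x}
  add_mem' {x y} hx hy := by
    change θ (x + y) = x + y
    rw [map_add, hx, hy]
  zero_mem' := map_zero θ
  smul_mem' c x hx := by
    change θ (c • x) = c • x
    rw [map_smul, hx]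

/-- The eigenspace for the eigenvalue `-1`. -/
def antiSpace (θ : L ≃ₗ⁅ℝ⁆ L) : Submodule ℝ L where
  carrier := {x | θ x = -x}
  add_mem' {x y} hx hy := by
    change θ (x + y) = -(x + y)
    rw [map_add, hx, hy, neg_add]
  zero_mem' := by
    change θ 0 = -0
    rw [map_zero, neg_zero]
  smul_mem' c x hx := by
    change θ (c • x) = -(c • x)
    rw [map_smul, hx, smul_neg]

variable {θ : L ≃ₗ⁅ℝ⁆ L}

lemma mem_fixedSpace {x : L} : x ∈ fixedSpace θ ↔ θ x = x := Iff.rfl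
lemma mem_antiSpace {x : L} : x ∈ antiSpace θ ↔ θ x = -x := Iff.rfl

/-- An involution `θ` for which `-κ(x, θ y)` is positive definite. -/
structure IsCartanInvolution (θ : L ≃ₗ⁅ℝ⁆ L) : Prop where
  invol : ∀ x, θ (θ x) = x
  neg : ∀ x, x ≠ 0 → killingForm ℝ L x (θ x) < 0

/-- The projection to the space of fixed points. -/
noncomputable def fixProj (θ : L ≃ₗ⁅ℝ⁆ L) : L →ₗ[ℝ] L :=
  (2⁻¹ : ℝ) • (LinearMap.id + (θ.toLinearEquiv : L →ₗ[ℝ] L))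

/-- The projection to the eigenspace for `-1`. -/
noncomputable def antiProj (θ : L ≃ₗ⁅ℝ⁆ L) : L →ₗ[ℝ] L :=
  (2⁻¹ : ℝ) • (LinearMap.id - (θ.toLinearEquiv : L →ₗ[ℝ] L))

lemma fixProj_apply (x : L) : fixProj θ x = (2⁻¹ : ℝ) • (x + θ x) := rfl
lemma antiProj_apply (x : L) : antiProj θ x = (2⁻¹ : ℝ) • (x - θ x) := rfl

lemma fixProj_add_antiProj (x : L) : fixProj θ x + antiProj θ x = x := by
  rw [fixProj_apply, antiProj_apply]; module

lemma eq_zero_of_fixed_of_anti {x : L} (h1 : θ x = x) (h2 : θ x = -x) : x = 0 := by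
  have : (2 : ℝ) • x = 0 := by
    rw [two_smul]; nth_rewrite 1 [← h1]; rw [h2, neg_add_cancel]
  simpa using this

namespace IsCartanInvolution

variable (hθ : IsCartanInvolution θ)
include hθ

lemma fixProj_mem (x : L) : θ (fixProj θ x) = fixProj θ x := by
  rw [fixProj_apply, map_smul, map_add, hθ.invol, add_comm]

lemma antiProj_mem (x : L) : θ (antiProj θ x) = -antiProj θ x := by
  rw [antiProj_apply, map_smul, map_sub, hθ.invol]; module

lemma isCompl : IsCompl (fixedSpace θ) (antiSpace θ) := by
  refine ⟨Submodule.disjoint_def.mpr fun x h1 h2 ↦ eq_zero_of_fixed_of_anti h1 h2,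
    codisjoint_iff_le_sup.mpr fun x _ ↦ ?_⟩
  rw [← fixProj_add_antiProj (θ := θ) x]
  exact Submodule.add_mem_sup (hθ.fixProj_mem x) (hθ.antiProj_mem x)

/-- A nonzero `x` in the radical of the Killing form would satisfy κ(θ x, x) = 0, against
definiteness. -/
lemma isKilling : IsKilling ℝ L := by
  refine ⟨(LieSubmodule.eq_bot_iff _).mpr fun x hx ↦ ?_⟩
  by_contra h0
  have h1 : killingForm ℝ L (θ x) x = 0 :=
    (LieIdeal.mem_killingCompl ℝ L ⊤).mp hx _ (LieSubmodule.mem_top _)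
  have h2 := hθ.neg x h0
  rw [LieModule.traceForm_comm, h1] at h2
  exact lt_irrefl _ h2

/-- The projection (1 + θ)/2 onto the fixed space has the dimension of that space as its trace. -/
lemma two_mul_finrank_fixedSpace [FiniteDimensional ℝ L] :
    2 * (finrank ℝ (fixedSpace θ) : ℝ) =
      finrank ℝ L + LinearMap.trace ℝ L (θ.toLinearEquiv : L →ₗ[ℝ] L) := by
  have hp : LinearMap.IsProj (fixedSpace θ) (fixProj θ) :=
    ⟨hθ.fixProj_mem, fun x hx ↦ by rw [fixProj_apply, mem_fixedSpace.mp hx]; module⟩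
  rw [← hp.trace, fixProj, map_smul, map_add, LinearMap.trace_id, smul_eq_mul]
  ring

/-- The Killing form is positive definite on the `-1`-eigenspace and negative definite on the fixed
space. Both indices are thereby bounded below, and the bounds are sharp because they already add up
to the dimension. -/
lemma killingSignature_eq [FiniteDimensional ℝ L] : killingSignature L =
    (finrank ℝ (antiSpace θ) : ℤ) - finrank ℝ (fixedSpace θ) := by
  set Q : QuadraticForm ℝ L := LinearMap.BilinMap.toQuadraticMap (killingForm ℝ L) with hQ
  have hQx (x : L) : Q x = killingForm ℝ L x x := rfl
  have h1 : finrank ℝ (antiSpace θ) ≤ sigPos Q := by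
    refine le_sigPos_of_posDef Q fun x hx ↦ ?_
    have h := hθ.neg (x : L) (by simpa using hx)
    rw [mem_antiSpace.mp x.2, map_neg] at h
    change 0 < Q x
    rw [hQx]; linarith
  have h2 : finrank ℝ (fixedSpace θ) ≤ sigNeg Q := by
    refine le_sigNeg_of_negDef Q fun x hx ↦ ?_
    have h := hθ.neg (x : L) (by simpa using hx)
    rw [mem_fixedSpace.mp x.2] at h
    change 0 < -Q x
    rw [hQx]; linarith
  have h3 := QuadraticForm.sigPos_add_sigNeg_add_radical (Q := Q)
  have h4 := Submodule.finrank_add_eq_of_isCompl hθ.isCompl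
  change (sigPos Q : ℤ) - sigNeg Q = _
  omega

/-- The real form `{z | θ (re z) = re z, θ (im z) = -im z}` of the complexification. -/
def compactForm (θ : L ≃ₗ⁅ℝ⁆ L) : LieSubalgebra ℝ (ℂ ⊗[ℝ] L) where
  carrier := {z | θ (tensorRe L z) = tensorRe L z ∧ θ (tensorIm L z) = -tensorIm L z}
  add_mem' {x y} hx hy := by
    change _ ∧ _
    simp only [map_add, hx.1, hx.2, hy.1, hy.2, neg_add, and_self]
  zero_mem' := by
    change _ ∧ _
    simp
  smul_mem' c x hx := by
    change _ ∧ _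
    simp only [map_smul, hx.1, hx.2, smul_neg, and_self]
  lie_mem' {x y} hx hy := by
    obtain ⟨h1, h2⟩ := hx
    obtain ⟨h3, h4⟩ := hy
    change _ ∧ _
    rw [tensorRe_lie, tensorIm_lie]
    simp only [map_sub, map_add, LieEquiv.map_lie, h1, h2, h3, h4, neg_lie, lie_neg, neg_neg,
      true_and]
    abel

omit hθ in
lemma mem_map_mulI {z : ℂ ⊗[ℝ] L} : z ∈ (compactForm θ).toSubmodule.map (mulI L) ↔
    θ (tensorRe L z) = -tensorRe L z ∧ θ (tensorIm L z) = tensorIm L z := by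
  constructor
  · rintro ⟨w, ⟨h1, h2⟩, rfl⟩
    rw [tensorRe_mulI, tensorIm_mulI, map_neg, h1, h2]
    simp
  · rintro ⟨h1, h2⟩
    refine ⟨-mulI L z, ⟨?_, ?_⟩, tensor_ext ?_ ?_⟩ <;>
    simp only [map_neg, tensorRe_mulI, tensorIm_mulI, h1, h2, neg_neg]

lemma isCompl_compactForm :
    IsCompl (compactForm θ).toSubmodule ((compactForm θ).toSubmodule.map (mulI L)) := by
  refine ⟨Submodule.disjoint_def.mpr fun z h1 h2 ↦ ?_,
    codisjoint_iff_le_sup.mpr fun z _ ↦ ?_⟩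
  · rw [mem_map_mulI] at h2
    refine tensor_ext ?_ ?_ <;> rw [map_zero]
    · exact eq_zero_of_fixed_of_anti h1.1 h2.1
    · exact eq_zero_of_fixed_of_anti h2.2 h1.2
  · have : z = ((1 : ℂ) ⊗ₜ fixProj θ (tensorRe L z) + Complex.I ⊗ₜ antiProj θ (tensorIm L z)) +
        ((1 : ℂ) ⊗ₜ antiProj θ (tensorRe L z) + Complex.I ⊗ₜ fixProj θ (tensorIm L z)) := by
      refine tensor_ext ?_ ?_ <;> simp [fixProj_add_antiProj, add_comm (antiProj θ _)]
    rw [this]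
    refine Submodule.add_mem_sup ?_ ?_
    · change _ ∧ _
      simp [hθ.fixProj_mem, hθ.antiProj_mem]
    · rw [mem_map_mulI]
      simp [hθ.fixProj_mem, hθ.antiProj_mem]

/-- `L ≃ compactForm θ`, `a + b ↦ a + i b` for `a` in the `1`-eigenspace and `b` in the
`-1`-eigenspace of `θ`. -/
noncomputable def compactEquiv : L ≃ₗ[ℝ] compactForm θ where
  toFun x := ⟨(1 : ℂ) ⊗ₜ fixProj θ x + Complex.I ⊗ₜ antiProj θ x, by
    change _ ∧ _
    simp [hθ.fixProj_mem, hθ.antiProj_mem]⟩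
  map_add' x y := by
    refine Subtype.ext ?_
    change _ = (_ + _) + (_ + _)
    simp only [map_add, TensorProduct.tmul_add]
    abel
  map_smul' c x := by
    refine Subtype.ext ?_
    change _ = c • (_ + _)
    simp only [map_smul, TensorProduct.tmul_smul, smul_add]
  invFun z := tensorRe L z + tensorIm L z
  left_inv x := by
    simp [fixProj_add_antiProj]
  right_inv z := by
    obtain ⟨h1, h2⟩ := z.2
    refine Subtype.ext (tensor_ext ?_ ?_)
    · simp only [map_add, tensorRe_tmul, fixProj_apply, h1, h2]
      simp
      module
    · simp only [map_add, tensorIm_tmul, antiProj_apply, h1, h2]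
      simp
      module

/-- Transported to `L`, the bracket of the compact form is [x₊, y] + [x₋, θ y], where x₊ and x₋ are
the components of `x` in the eigenspaces for 1 and -1: the sign of [x₋, y₋] produced by i² is
absorbed into θ. -/
lemma conj_ad (x : L) : ad ℝ (compactForm θ) (hθ.compactEquiv x) =
    hθ.compactEquiv.conj (ad ℝ L (fixProj θ x) +
      ad ℝ L (antiProj θ x) ∘ₗ (θ.toLinearEquiv : L →ₗ[ℝ] L)) := by
  refine LinearMap.ext fun w ↦ ?_
  obtain ⟨y, rfl⟩ := hθ.compactEquiv.surjective w
  refine hθ.compactEquiv.symm.injective ?_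
  rw [LinearEquiv.conj_apply_apply, LinearEquiv.symm_apply_apply, LinearEquiv.symm_apply_apply]
  change tensorRe L ⁅_, _⁆ + tensorIm L ⁅_, _⁆ = ⁅fixProj θ x, y⁆ + ⁅antiProj θ x, θ y⁆
  rw [tensorRe_lie, tensorIm_lie]
  have hR (u : L) : tensorRe L (hθ.compactEquiv u : ℂ ⊗[ℝ] L) = fixProj θ u := by
    change tensorRe L (_ + _) = _
    simp
  have hI (u : L) : tensorIm L (hθ.compactEquiv u : ℂ ⊗[ℝ] L) = antiProj θ u := by
    change tensorIm L (_ + _) = _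
    simp
  rw [hR, hI, hR, hI]
  have e1 : θ y = fixProj θ y - antiProj θ y := by
    rw [fixProj_apply, antiProj_apply]; module
  nth_rewrite 5 [← fixProj_add_antiProj (θ := θ) y]
  rw [e1, lie_add, lie_sub]
  abel

/-- With A = ad x₊, B = ad x₋ and T = θ, the operator A commutes with T and B anticommutes with it.
Hence (A + BT)² = A² - B² + ABT + BAT, and the mixed terms are traceless because they anticommute
with the involution T. -/
lemma killingForm_compactForm [FiniteDimensional ℝ L] (x : L) :
    killingForm ℝ (compactForm θ) (hθ.compactEquiv x) (hθ.compactEquiv x) =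
      killingForm ℝ L (fixProj θ x) (fixProj θ x) -
        killingForm ℝ L (antiProj θ x) (antiProj θ x) := by
  set T : End ℝ L := (θ.toLinearEquiv : L →ₗ[ℝ] L) with hT
  set A := ad ℝ L (fixProj θ x) with hA
  set B := ad ℝ L (antiProj θ x) with hB
  have hTT : T * T = 1 := LinearMap.ext hθ.invol
  have hTA : T * A = A * T := LinearMap.ext fun y ↦ by
    change θ ⁅fixProj θ x, y⁆ = ⁅fixProj θ x, θ y⁆
    rw [LieEquiv.map_lie, hθ.fixProj_mem]
  have hTB : T * B = -(B * T) := LinearMap.ext fun y ↦ by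
    change θ ⁅antiProj θ x, y⁆ = -⁅antiProj θ x, θ y⁆
    rw [LieEquiv.map_lie, hθ.antiProj_mem, neg_lie]
  -- Conjugation by T preserves the trace and changes the sign of an operator that anticommutes with
  -- T.
  have key (C D : End ℝ L) (hC : T * (C * D * T) = -((C * D * T) * T)) :
      LinearMap.trace ℝ L (C * D * T) = 0 := by
    have h1 : LinearMap.trace ℝ L (T * (C * D * T) * T) = LinearMap.trace ℝ L (C * D * T) := by
      rw [LinearMap.trace_mul_comm, ← mul_assoc, ← mul_assoc, hTT, one_mul]
    rw [hC, neg_mul, mul_assoc, hTT, mul_one, map_neg] at h1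
    linarith
  rw [killingForm_apply_apply, hθ.conj_ad, ← LinearEquiv.conj_comp, LinearMap.trace_conj']
  change LinearMap.trace ℝ L ((A + B * T) * (A + B * T)) =
    LinearMap.trace ℝ L (A * A) - LinearMap.trace ℝ L (B * B)
  have e : (A + B * T) * (A + B * T) = A * A + A * B * T + B * A * T - B * B := by
    have h1 : B * T * A = B * A * T := by rw [mul_assoc, hTA, mul_assoc]
    have h2 : B * T * (B * T) = -(B * B) := by
      rw [mul_assoc, ← mul_assoc T, hTB, neg_mul, mul_assoc, hTT, mul_one, mul_neg]
    rw [add_mul, mul_add, mul_add, h1, h2, mul_assoc A B T]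
    abel
  have h1 : LinearMap.trace ℝ L (A * B * T) = 0 := key A B (by
    rw [← mul_assoc, ← mul_assoc, hTA, mul_assoc A T B, hTB, mul_neg, neg_mul, mul_assoc A B])
  have h2 : LinearMap.trace ℝ L (B * A * T) = 0 := key B A (by
    rw [← mul_assoc, ← mul_assoc, hTB, neg_mul, mul_assoc B T A, hTA, neg_mul, ← mul_assoc])
  rw [e, map_sub, map_add, map_add, h1, h2]
  ring

/-- On the compact form the Killing form is κ(x₊, x₊) - κ(x₋, x₋). By hypothesis the first term is
negative when x₊ ≠ 0, and κ(x₋, x₋) is positive when x₋ ≠ 0. -/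
lemma isCartanDecomposition [FiniteDimensional ℝ L] :
    IsCartanDecomposition (fixedSpace θ) (antiSpace θ) := by
  refine ⟨hθ.isCompl, compactForm θ, ⟨hθ.isCompl_compactForm, fun z hz ↦ ?_⟩, ?_, ?_⟩
  · obtain ⟨x, rfl⟩ := hθ.compactEquiv.surjective z
    have hx : x ≠ 0 := fun h ↦ hz (by rw [h, map_zero])
    rw [hθ.killingForm_compactForm]
    have h1 := hθ.neg (fixProj θ x)
    have h2 := hθ.neg (antiProj θ x)
    rw [hθ.fixProj_mem] at h1
    rw [hθ.antiProj_mem, map_neg] at h2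
    by_cases e1 : fixProj θ x = 0
    · have e2 : antiProj θ x ≠ 0 := fun e2 ↦ hx (by
        rw [← fixProj_add_antiProj (θ := θ) x, e1, e2, add_zero])
      have := h2 e2
      rw [e1, map_zero]
      linarith
    · have := h1 e1
      by_cases e2 : antiProj θ x = 0
      · rw [e2, map_zero]
        linarith
      · have := h2 e2
        linarith
  · ext x
    rw [Submodule.mem_comap]
    change _ ↔ _ ∧ _
    simp [mem_fixedSpace]
  · ext x
    rw [Submodule.mem_comap, mem_map_mulI]
    simp [mem_antiSpace]

end IsCartanInvolution

/-- Positive definiteness of `-κ(x, θ y)` can be checked on an orthogonal basis. -/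
lemma isCartanInvolution_of_orthogonal_basis {J : Type*} [Fintype J] (b : Basis J ℝ L)
    (hinv : ∀ x, θ (θ x) = x)
    (h0 : ∀ i j, i ≠ j → killingForm ℝ L (b i) (θ (b j)) = 0)
    (h1 : ∀ i, killingForm ℝ L (b i) (θ (b i)) < 0) : IsCartanInvolution θ := by
  refine ⟨hinv, fun x hx ↦ ?_⟩
  have e : killingForm ℝ L x (θ x) = ∑ i, b.repr x i ^ 2 * killingForm ℝ L (b i) (θ (b i)) := by
    conv_lhs => rw [← b.sum_repr x]
    simp only [map_sum, map_smul, LinearMap.sum_apply, LinearMap.smul_apply, smul_eq_mul]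
    refine Finset.sum_congr rfl fun i _ ↦ ?_
    rw [Finset.sum_eq_single i (fun j _ hj ↦ by rw [h0 j i hj]; simp) (by simp)]
    ring
  obtain ⟨j, hj⟩ : ∃ j, b.repr x j ≠ 0 := by
    by_contra! h
    exact hx (b.repr.injective (by ext j; simp [h]))
  rw [e]
  refine Finset.sum_neg' (fun i _ ↦ ?_) ⟨j, Finset.mem_univ j, ?_⟩
  · exact mul_nonpos_of_nonneg_of_nonpos (sq_nonneg _) (h1 i).le
  · exact mul_neg_of_pos_of_neg (by positivity) (h1 j)

/-- The complexification of a Killing Lie algebra is Killing. -/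
lemma isKilling_complexification [FiniteDimensional ℝ L] [IsKilling ℝ L] :
    IsKilling ℂ (ℂ ⊗[ℝ] L) := by
  refine ⟨(LieSubmodule.eq_bot_iff _).mpr fun z hz ↦ ?_⟩
  -- Pairing with a real vector `1 ⊗ y` separates into real and imaginary parts, so both parts of
  -- `z` lie in the radical of the real Killing form.
  have h (y : L) : killingForm ℝ L y (tensorRe L z) = 0 ∧ killingForm ℝ L y (tensorIm L z) = 0 := by
    have h1 : killingForm ℂ (ℂ ⊗[ℝ] L) (1 ⊗ₜ y) z = 0 :=
      (LieIdeal.mem_killingCompl ℂ _ ⊤).mp hz _ (LieSubmodule.mem_top _)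
    rw [tensor_eq_re_add_im z, killingForm, LieModule.traceForm_baseChange, map_add,
      LinearMap.BilinForm.baseChange_tmul, LinearMap.BilinForm.baseChange_tmul] at h1
    have h2 := congrArg Complex.re h1
    have h3 := congrArg Complex.im h1
    simp at h2 h3
    exact ⟨h2, h3⟩
  have hnd := (LieAlgebra.IsKilling.killingForm_nondegenerate ℝ L).2
  refine tensor_ext ?_ ?_ <;> rw [map_zero]
  · exact hnd _ fun y ↦ (h y).1
  · exact hnd _ fun y ↦ (h y).2

/-- If `h = ⁅x, y⁆` satisfies `⁅h, x⁆ = 2 x`, then `2 κ(x, y) = κ(h, h)`. -/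
lemma two_mul_killingForm_of_sl2 {x y : L} (h : ⁅⁅x, y⁆, x⁆ = (2 : ℝ) • x) :
    2 * killingForm ℝ L x y = killingForm ℝ L ⁅x, y⁆ ⁅x, y⁆ := by
  have h1 := LieModule.traceForm_apply_lie_apply ℝ L L ⁅x, y⁆ x y
  rw [h, map_smul, LinearMap.smul_apply, smul_eq_mul] at h1
  exact h1

/-- Eigenspaces for eigenvalues that do not add up to zero are orthogonal. -/
lemma killingForm_eq_zero_of_lie_smul {x y h : L} {a c : ℝ} (hx : ⁅h, x⁆ = a • x)
    (hy : ⁅h, y⁆ = c • y) (hac : a + c ≠ 0) : killingForm ℝ L x y = 0 := by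
  have h1 := LieModule.traceForm_apply_lie_apply ℝ L L x h y
  rw [← lie_skew, hx, hy, map_smul, map_neg, map_smul, LinearMap.neg_apply, LinearMap.smul_apply,
    smul_eq_mul, smul_eq_mul] at h1
  have h2 : (a + c) * killingForm ℝ L x y = 0 := by
    change -(a * killingForm ℝ L x y) = c * killingForm ℝ L x y at h1
    linarith
  exact (mul_eq_zero.mp h2).resolve_left hac

end CartanInvolutions

/-! ### The split octonions and their triality algebra. -/

namespace Os

/-- The standard basis `e₁, u₁, u₂, u₃, e₂, v₁, v₂, v₃`; the vector dual to the one with index `b`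
has index `b + 4`. -/
def std : Fin 8 → Os := ![e₁, u 0, u 1, u 2, e₂, v 0, v 1, v 2]

/-- The coordinates with respect to the standard basis. -/
noncomputable def coordEquiv : Os ≃ₗ[ℝ] (Fin 8 → ℝ) where
  toFun x := ![x.1.1, x.2.1 0, x.2.1 1, x.2.1 2, x.1.2, x.2.2 0, x.2.2 1, x.2.2 2]
  map_add' x y := by ext b; fin_cases b <;> rfl
  map_smul' c x := by ext b; fin_cases b <;> rfl
  invFun c := ((c 0, c 4), ![c 1, c 2, c 3], ![c 5, c 6, c 7])
  left_inv x := ext_coord rfl rfl (fun k ↦ by fin_cases k <;> rfl) (fun k ↦ by fin_cases k <;> rfl)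
  right_inv c := by ext b; fin_cases b <;> rfl

/-- The standard basis. -/
noncomputable def basis : Module.Basis (Fin 8) ℝ Os := Module.Basis.ofEquivFun coordEquiv

lemma basis_apply (b : Fin 8) : basis b = std b := by
  rw [basis, Module.Basis.coe_ofEquivFun]
  fin_cases b <;>
  refine ext_coord ?_ ?_ (fun k ↦ ?_) (fun k ↦ ?_) <;> (try fin_cases k) <;>
  simp [coordEquiv, std, e₁, e₂, u, v]

lemma q_eq (x y : Os) : paraOs.q x y = x.1.1 * y.1.2 + x.1.2 * y.1.1
      + (x.2.1 0 * y.2.2 0 + x.2.1 1 * y.2.2 1 + x.2.1 2 * y.2.2 2)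
      + (x.2.2 0 * y.2.1 0 + x.2.2 1 * y.2.1 1 + x.2.2 2 * y.2.1 2) :=
  polar_octNorm x y

lemma q_std_left (b : Fin 8) (x : Os) : paraOs.q (std b) x = coordEquiv x (b + 4) := by
  fin_cases b <;> simp [q_eq, std, e₁, e₂, u, v, coordEquiv]

lemma coordEquiv_std (a b : Fin 8) : coordEquiv (std b) a = if b = a then 1 else 0 := by
  rw [← basis_apply, basis, Module.Basis.coe_ofEquivFun, LinearEquiv.apply_symm_apply,
    Pi.single_apply]
  simp only [eq_comm]

lemma q_std (a b : Fin 8) : paraOs.q (std a) (std b) = if b = a + 4 then 1 else 0 := by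
  rw [q_std_left, coordEquiv_std]

lemma mul_eq (x y : Os) : paraOs.mul x y = octMul (octConj x) (octConj y) := rfl

/-- Twice the weights of `h₀` on `ι_i(pO_s)`, in the standard basis. -/
def weight : Fin 3 → Fin 8 → Fin 4 → ℤ :=
  ![![![-2, 0, 0, 0], ![0, -2, 0, 0], ![0, 0, -2, 0], ![0, 0, 0, -2],
      ![2, 0, 0, 0], ![0, 2, 0, 0], ![0, 0, 2, 0], ![0, 0, 0, 2]],
    ![![1, 1, 1, 1], ![-1, -1, 1, 1], ![-1, 1, -1, 1], ![-1, 1, 1, -1],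
      ![-1, -1, -1, -1], ![1, 1, -1, -1], ![1, -1, 1, -1], ![1, -1, -1, 1]],
    ![![1, -1, -1, -1], ![1, -1, 1, 1], ![1, 1, -1, 1], ![1, 1, 1, -1],
      ![-1, 1, 1, 1], ![-1, 1, -1, -1], ![-1, -1, 1, -1], ![-1, -1, -1, 1]]]

/-- The elements `h₁, …, h₄` of `tri(pO_s)`. -/
noncomputable def torus (k : Fin 4) : paraOs.tri :=
  paraOs.t (std (Fin.castLE (by decide) k)) (std (Fin.castLE (by decide) k + 4))

lemma t_apply (x y z : Os) (i : Fin 3) : (paraOs.t x y).1 i z =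
    ![paraOs.q x z • y - paraOs.q y z • x,
      (2⁻¹ * paraOs.q x y) • z - paraOs.mul (paraOs.mul y z) x,
      (2⁻¹ * paraOs.q x y) • z - paraOs.mul x (paraOs.mul z y)] i := by
  fin_cases i <;> rfl

lemma ext_coordEquiv {x y : Os} (h1 : x.1.1 = y.1.1) (h2 : x.2.1 0 = y.2.1 0)
    (h3 : x.2.1 1 = y.2.1 1) (h4 : x.2.1 2 = y.2.1 2) (h5 : x.1.2 = y.1.2)
    (h6 : x.2.2 0 = y.2.2 0) (h7 : x.2.2 1 = y.2.2 1) (h8 : x.2.2 2 = y.2.2 2) : x = y :=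
  ext_coord h1 h5 (fun k ↦ by fin_cases k <;> assumption) (fun k ↦ by fin_cases k <;> assumption)

/-- Arranged so that applying it to a diagonal action leaves one scalar identity per coordinate. -/
lemma ext_weights {x z : Os} {w : Fin 8 → ℝ} (h1 : x.1.1 = w 0 * z.1.1)
    (h2 : x.2.1 0 = w 1 * z.2.1 0) (h3 : x.2.1 1 = w 2 * z.2.1 1) (h4 : x.2.1 2 = w 3 * z.2.1 2)
    (h5 : x.1.2 = w 4 * z.1.2) (h6 : x.2.2 0 = w 5 * z.2.2 0) (h7 : x.2.2 1 = w 6 * z.2.2 1)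
    (h8 : x.2.2 2 = w 7 * z.2.2 2) : x = coordEquiv.symm fun b ↦ w b * coordEquiv z b :=
  ext_coordEquiv h1 h2 h3 h4 h5 h6 h7 h8

lemma mul_fst (x y : Os) : (paraOs.mul x y).1 =
    (x.1.2 * y.1.2 - (x.2.1 0 * y.2.2 0 + x.2.1 1 * y.2.2 1 + x.2.1 2 * y.2.2 2),
      x.1.1 * y.1.1 - (x.2.2 0 * y.2.1 0 + x.2.2 1 * y.2.1 1 + x.2.2 2 * y.2.1 2)) := by
  refine Prod.ext ?_ ?_ <;> simp only [mul_eq, octMul, octConj, Pi.neg_apply] <;> ring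

lemma mul_snd_fst (x y : Os) (k : Fin 3) : (paraOs.mul x y).2.1 k =
    -(x.1.2 * y.2.1 k) - x.2.1 k * y.1.1
      + (x.2.2 (k + 1) * y.2.2 (k + 2) - x.2.2 (k + 2) * y.2.2 (k + 1)) := by
  simp only [mul_eq, octMul, octConj, Pi.neg_apply]; ring

lemma mul_snd_snd (x y : Os) (k : Fin 3) : (paraOs.mul x y).2.2 k =
    -(x.1.1 * y.2.2 k) - x.2.2 k * y.1.2
      + (x.2.1 (k + 1) * y.2.1 (k + 2) - x.2.1 (k + 2) * y.2.1 (k + 1)) := by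
  simp only [mul_eq, octMul, octConj, Pi.neg_apply]; ring

lemma u_apply (i j : Fin 3) : (u i).2.1 j = if j = i then 1 else 0 := Pi.single_apply _ _ _
lemma v_apply (i j : Fin 3) : (v i).2.2 j = if j = i then 1 else 0 := Pi.single_apply _ _ _
lemma u_fst (i : Fin 3) : (u i).1 = (0, 0) := rfl
lemma v_fst (i : Fin 3) : (v i).1 = (0, 0) := rfl
lemma u_snd (i j : Fin 3) : (u i).2.2 j = 0 := rfl
lemma v_snd (i j : Fin 3) : (v i).2.1 j = 0 := rfl

lemma torus_zero_apply (i : Fin 3) (z : Os) : (torus 0).1 i z =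
    coordEquiv.symm fun b ↦ (weight i b 0 : ℝ) / 2 * coordEquiv z b := by
  change (paraOs.t e₁ e₂).1 i z = _
  rw [t_apply]
  fin_cases i <;> apply ext_weights <;>
  simp [weight, q_eq, mul_fst, mul_snd_fst, mul_snd_snd, e₁, e₂] <;> ring

lemma torus_one_apply (i : Fin 3) (z : Os) : (torus 1).1 i z =
    coordEquiv.symm fun b ↦ (weight i b 1 : ℝ) / 2 * coordEquiv z b := by
  change (paraOs.t (u 0) (v 0)).1 i z = _
  rw [t_apply]
  fin_cases i <;> apply ext_weights <;>
  simp [weight, q_eq, mul_fst, mul_snd_fst, mul_snd_snd, u_apply, v_apply, u_fst, v_fst, u_snd, v_snd, idx] <;> ring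

lemma torus_two_apply (i : Fin 3) (z : Os) : (torus 2).1 i z =
    coordEquiv.symm fun b ↦ (weight i b 2 : ℝ) / 2 * coordEquiv z b := by
  change (paraOs.t (u 1) (v 1)).1 i z = _
  rw [t_apply]
  fin_cases i <;> apply ext_weights <;>
  simp [weight, q_eq, mul_fst, mul_snd_fst, mul_snd_snd, u_apply, v_apply, u_fst, v_fst, u_snd, v_snd, idx] <;> ring

lemma torus_three_apply (i : Fin 3) (z : Os) : (torus 3).1 i z =
    coordEquiv.symm fun b ↦ (weight i b 3 : ℝ) / 2 * coordEquiv z b := by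
  change (paraOs.t (u 2) (v 2)).1 i z = _
  rw [t_apply]
  fin_cases i <;> apply ext_weights <;>
  simp [weight, q_eq, mul_fst, mul_snd_fst, mul_snd_snd, u_apply, v_apply, u_fst, v_fst, u_snd, v_snd, idx] <;> ring

lemma torus_apply (k : Fin 4) (i : Fin 3) (z : Os) : (torus k).1 i z =
    coordEquiv.symm fun b ↦ (weight i b k : ℝ) / 2 * coordEquiv z b := by
  fin_cases k
  exacts [torus_zero_apply i z, torus_one_apply i z, torus_two_apply i z, torus_three_apply i z]

lemma torus_std (k : Fin 4) (i : Fin 3) (b : Fin 8) :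
    (torus k).1 i (std b) = ((weight i b k : ℝ) / 2) • std b := by
  rw [torus_apply]
  refine coordEquiv.injective ?_
  rw [LinearEquiv.apply_symm_apply, map_smul]
  funext a
  rw [Pi.smul_apply, coordEquiv_std, smul_eq_mul]
  split_ifs with h
  · rw [h]
  · simp

/-- An element of the triality algebra is determined by its component of index `0`. -/
lemma tri_eq_zero (d : paraOs.tri) (h : ∀ x, d.1 0 x = 0) : d = 0 := by
  -- This is the unit of the octonions, the para-unit of pO_s. With `d₀ = 0` the triality relations
  -- become d₁(x * y) = d₂(x) * y and d₂(x * y) = x * d₁(y).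
  set e : Os := ((1, 1), 0, 0) with he
  set p : Os := d.1 2 e with hp
  have hmm (x y : Os) : d.1 1 (paraOs.mul x y) = paraOs.mul (d.1 2 x) y := by
    rw [SymCompAlg.tri_one, h, map_zero, add_zero]
  have hmm' (x y : Os) : d.1 2 (paraOs.mul x y) = paraOs.mul x (d.1 1 y) := by
    rw [SymCompAlg.tri_two, h, map_zero, LinearMap.zero_apply, zero_add]
  have hne : paraOs.norm e = 1 := by
    change octNorm e = 1
    simp [octNorm_apply, he]
  -- Since n(e) = 1, every `y` equals e * (y * e) and (e * y) * e. So d₁, and then d₂, is determined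
  -- by the single vector p = d₂(e).
  have h1 (y : Os) : d.1 1 y = paraOs.mul p (paraOs.mul y e) := by
    rw [hp, ← hmm, paraOs.self_mul_mul, hne, one_smul]
  have h2 (y : Os) : d.1 2 y = paraOs.mul (paraOs.mul e y) (d.1 1 e) := by
    rw [← hmm', paraOs.mul_mul_self, hne, one_smul]
  have key (x y : Os) : paraOs.mul p (paraOs.mul (paraOs.mul x y) e) =
      paraOs.mul (paraOs.mul (paraOs.mul e x) (paraOs.mul p (paraOs.mul e e))) y := by
    rw [← h1, ← h1, ← h2, hmm]
  -- Skewness of d₂ makes `p` orthogonal to `e`. This is needed besides `key`, which expresses that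
  -- d₁ and d₂ are compatible.
  have hsk : paraOs.q p e = 0 := by
    have := SymCompAlg.tri_skew d 2 e e
    rw [paraOs.q_comm e] at this
    linarith
  have hp0 : p = 0 := by
    -- These three instances of `key` give linear equations in the coordinates of `p`, which
    -- together with `hsk` have only the zero solution.
    have k1 := key (u 0) (u 1)
    have k2 := key (u 1) (u 2)
    have k3 := key (v 0) (v 1)
    simp only [Prod.ext_iff, funext_iff, Fin.forall_fin_succ] at k1 k2 k3
    simp [mul_fst, mul_snd_fst, mul_snd_snd, he, u_apply, v_apply, u_fst, v_fst, u_snd, v_snd,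
      idx] at k1 k2 k3
    simp [q_eq, he] at hsk
    apply ext_coordEquiv <;> simp <;> linarith
  refine SymCompAlg.tri_ext _ fun i x ↦ ?_
  change d.1 i x = 0
  fin_cases i
  · exact h x
  · change d.1 1 x = 0
    rw [h1, hp0, map_zero, LinearMap.zero_apply]
  · change d.1 2 x = 0
    rw [h2, h1, hp0, map_zero, LinearMap.zero_apply, map_zero]

end Os

namespace Os

/-- Ordered pairs of basis indices: the indices of a basis of `tri(pO_s)`. -/
abbrev Pairs : Type := {p : Fin 8 × Fin 8 // p.1 < p.2}

/-- The matrix coefficients of the component of index `0`. -/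
noncomputable def coeff : paraOs.tri →ₗ[ℝ] (Pairs → ℝ) where
  toFun d p := paraOs.q (std (p.1.2 + 4)) (d.1 0 (std (p.1.1 + 4)))
  map_add' d e := by
    funext p
    change paraOs.q _ (d.1 0 _ + e.1 0 _) = paraOs.q _ (d.1 0 _) + paraOs.q _ (e.1 0 _)
    rw [map_add]
  map_smul' c d := by
    funext p
    change paraOs.q _ (c • d.1 0 _) = c • paraOs.q _ (d.1 0 _)
    rw [map_smul]

lemma coeff_apply (d : paraOs.tri) (p : Pairs) :
    coeff d p = paraOs.q (std (p.1.2 + 4)) (d.1 0 (std (p.1.1 + 4))) := rfl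

lemma add_four_add_four : ∀ a : Fin 8, a + 4 + 4 = a := by decide

/-- The shift by four pairs with dual vectors, so σ_{a,b} has a single coefficient 1 at (a, b). The
term with reversed roles cannot contribute, because both pairs of indices are increasing. -/
lemma coeff_t (p r : Pairs) :
    coeff (paraOs.t (std p.1.1) (std p.1.2)) r = if r = p then 1 else 0 := by
  obtain ⟨⟨a, b⟩, h⟩ := p
  obtain ⟨⟨c, d⟩, h'⟩ := r
  dsimp only at h h'
  rw [coeff_apply, SymCompAlg.t_zero, map_sub, map_smul, map_smul]
  simp only [q_std, add_four_add_four, add_left_inj, smul_eq_mul, Subtype.mk.injEq,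
    Prod.mk.injEq]
  by_cases h1 : c = a <;> by_cases h2 : b = d <;> by_cases h3 : c = b <;> by_cases h4 : a = d <;>
  simp [h1, h2, h3, h4, eq_comm] <;> omega

lemma eq_zero_of_q_std {x : Os} (h : ∀ c, paraOs.q (std c) x = 0) : x = 0 := by
  refine coordEquiv.injective (funext fun b ↦ ?_)
  have := h (b + 4)
  rw [q_std_left, add_four_add_four] at this
  rw [this, map_zero]; rfl

/-- Skewness recovers all matrix entries of `d₀` from those with increasing indices, and `d₀`
determines the triple by `tri_eq_zero`. Together with `coeff_surjective` this makes tri(pO_s) a copy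
of the skew endomorphisms, of dimension 28. -/
lemma coeff_injective : Function.Injective coeff := by
  rw [injective_iff_map_eq_zero]
  intro d hd
  have key (b c : Fin 8) (h : b < c) :
      paraOs.q (std (c + 4)) (d.1 0 (std (b + 4))) = 0 := congrFun hd ⟨(b, c), h⟩
  refine tri_eq_zero d fun x ↦ ?_
  have hb (b : Fin 8) : d.1 0 (std b) = 0 := by
    refine eq_zero_of_q_std fun c ↦ ?_
    rw [← add_four_add_four b, ← add_four_add_four c]
    have hs := SymCompAlg.tri_skew d 0 (std (c + 4 + 4)) (std (b + 4 + 4))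
    rw [paraOs.q_comm] at hs
    rcases lt_trichotomy (b + 4) (c + 4) with h | h | h
    · exact key _ _ h
    · rw [h] at hs ⊢; linarith
    · rw [key _ _ h] at hs; linarith
  have : d.1 0 = 0 := basis.ext fun b ↦ by rw [basis_apply, hb]; rfl
  rw [this]; rfl

lemma coeff_surjective : Function.Surjective coeff := by
  intro c
  refine ⟨∑ p : Pairs, c p • paraOs.t (std p.1.1) (std p.1.2), ?_⟩
  funext r
  rw [map_sum, Finset.sum_apply]
  simp only [map_smul, Pi.smul_apply, coeff_t, smul_eq_mul, mul_ite, mul_one, mul_zero,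
    Finset.sum_ite_eq, Finset.mem_univ, if_true]

/-- The basis of `tri(pO_s)` consisting of the elements `t_{b,c}`. -/
noncomputable def triBasis : Module.Basis Pairs ℝ paraOs.tri :=
  Module.Basis.ofEquivFun (LinearEquiv.ofBijective coeff ⟨coeff_injective, coeff_surjective⟩)

lemma triBasis_apply (p : Pairs) : triBasis p = paraOs.t (std p.1.1) (std p.1.2) := by
  rw [triBasis, Module.Basis.coe_ofEquivFun, LinearEquiv.symm_apply_eq]
  funext r
  exact (Pi.single_apply _ _ _).trans (coeff_t p r).symm

/-- Twice the weight of `h₀` on `t_{b,c}`. -/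
def triWeight (b c : Fin 8) (k : Fin 4) : ℤ := weight 0 b k + weight 0 c k

lemma torus_lie_t (k : Fin 4) (b c : Fin 8) : ⁅torus k, paraOs.t (std b) (std c)⁆ =
    ((triWeight b c k : ℝ) / 2) • paraOs.t (std b) (std c) := by
  rw [paraOs.lie_t, torus_std, torus_std, map_smul, map_smul, LinearMap.smul_apply, ← add_smul,
    triWeight]
  congr 1
  push_cast
  ring

end Os

/-! ### The triality algebra of pC. -/

namespace E62

lemma triC_apply (β : Fin 3 → ℝ) (hβ : β 0 + β 1 + β 2 = 0) (i : Fin 3) (z : ℂ) :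
    (triC β hβ).1 i z = β i • (2 * Complex.I * z) := by
  change β i • sigma' z = _
  rw [sigma'_apply]

lemma q_paraC (x y : ℂ) : paraC.q x y = 2 * (x.re * y.re + x.im * y.im) := polar_complexNorm x y

/-- A skew endomorphism of the Euclidean plane is a multiple of the infinitesimal rotation; the
multiple is read off from the image of 1. -/
lemma tri_apply (d : paraC.tri) (i : Fin 3) (z : ℂ) :
    d.1 i z = ((d.1 i 1).im / 2) • (2 * Complex.I * z) := by
  have h1 := SymCompAlg.tri_skew d i 1 1
  have h2 := SymCompAlg.tri_skew d i 1 Complex.I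
  have h3 := SymCompAlg.tri_skew d i Complex.I Complex.I
  simp only [q_paraC, Complex.one_re, Complex.one_im, Complex.I_re, Complex.I_im] at h1 h2 h3
  have hz : d.1 i z = z.re • d.1 i 1 + z.im • d.1 i Complex.I := by
    rw [← map_smul, ← map_smul, ← map_add]
    congr 1
    apply Complex.ext <;> simp
  rw [hz]
  have e1 : (d.1 i 1).re = 0 := by linarith
  have e2 : (d.1 i Complex.I).re = -(d.1 i 1).im := by linarith
  have e3 : (d.1 i Complex.I).im = 0 := by linarith
  apply Complex.ext
  · simp [e1, e2]; ring
  · simp [e1, e3]; ring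

/-- Evaluate the triality relation at x = y = 1. The para-product conjugates, so d₁(1) and d₂(1)
enter with reversed imaginary parts. -/
lemma tri_sum (d : paraC.tri) : (d.1 0 1).im / 2 + (d.1 1 1).im / 2 + (d.1 2 1).im / 2 = 0 := by
  have h := SymCompAlg.tri_zero d 1 1
  have hm (x y : ℂ) : paraC.mul x y = (starRingEnd ℂ) x * (starRingEnd ℂ) y := rfl
  simp only [hm, map_one, mul_one, one_mul] at h
  have := congrArg Complex.im h
  simp only [Complex.add_im, Complex.conj_im] at this
  linarith

lemma tri_eq_triC (d : paraC.tri) : d = triC (fun i ↦ (d.1 i 1).im / 2) (tri_sum d) :=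
  SymCompAlg.tri_ext _ fun i z ↦ by rw [triC_apply, ← tri_apply]

/-- Coordinates on `tri(pC)`. -/
noncomputable def triCEquiv : paraC.tri ≃ₗ[ℝ] (Fin 2 → ℝ) where
  toFun d := ![(d.1 0 1).im / 2, ((d.1 1 1).im - (d.1 2 1).im) / 4]
  map_add' d e := by
    funext k
    fin_cases k <;> simp <;> ring
  map_smul' c d := by
    funext k
    fin_cases k <;> simp <;> ring
  invFun c := triC ![c 0, -(c 0) / 2 + c 1, -(c 0) / 2 - c 1] (by simp; ring)
  left_inv d := by
    refine SymCompAlg.tri_ext _ fun i z ↦ ?_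
    have hs := tri_sum d
    rw [triC_apply, tri_apply d i z]
    congr 1
    fin_cases i <;> simp <;> linarith
  right_inv c := by
    funext k
    fin_cases k <;> simp [triC_apply] <;> ring

/-- A basis of `tri(pC)` that is orthogonal for the trace form. -/
noncomputable def triCBasis : Module.Basis (Fin 2) ℝ paraC.tri := Module.Basis.ofEquivFun triCEquiv

/-- Multiples of `d` defining the basis of `tri(pC)`. -/
noncomputable def triCCoeff : Fin 2 → Fin 3 → ℝ := ![![1, -1 / 2, -1 / 2], ![0, 1, -1]]

lemma triCCoeff_sum (k : Fin 2) : triCCoeff k 0 + triCCoeff k 1 + triCCoeff k 2 = 0 := by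
  fin_cases k <;> simp [triCCoeff] <;> norm_num

lemma triC_congr {β γ : Fin 3 → ℝ} (hβ : β 0 + β 1 + β 2 = 0) (hγ : γ 0 + γ 1 + γ 2 = 0)
    (h : β = γ) : triC β hβ = triC γ hγ := by subst h; rfl

lemma triCBasis_apply (k : Fin 2) : triCBasis k = triC (triCCoeff k) (triCCoeff_sum k) := by
  rw [triCBasis, Module.Basis.coe_ofEquivFun, LinearEquiv.symm_apply_eq]
  funext j
  change (Pi.single k 1 : Fin 2 → ℝ) j = ![((triC (triCCoeff k) _).1 0 1).im / 2,
    (((triC (triCCoeff k) _).1 1 1).im - ((triC (triCCoeff k) _).1 2 1).im) / 4] j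
  fin_cases k <;> fin_cases j <;> simp [triCCoeff, triC_apply] <;> norm_num

lemma triC_lie (d e : paraC.tri) : ⁅d, e⁆ = 0 := by
  refine SymCompAlg.tri_ext _ fun i z ↦ ?_
  rw [SymCompAlg.tri_lie_apply, tri_eq_triC d, tri_eq_triC e]
  simp only [triC_apply, Complex.real_smul]
  change _ = (0 : ℂ)
  ring

end E62

/-! ### Brackets between the summands and the standard basis of g. -/

namespace E62

open MagicAlg

/-- The inclusion `ι_i` of `pO_s ⊗ pC`. -/
noncomputable def iota (i : Fin 3) : Os ⊗[ℝ] ℂ →ₗ[ℝ] E62 where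
  toFun a := (0, 0, Pi.single i a)
  map_add' a b := by
    refine MagicAlg.ext' (add_zero _).symm (add_zero _).symm fun j ↦ ?_
    exact congrFun (Pi.single_add (f := fun _ ↦ Os ⊗[ℝ] ℂ) i a b) j
  map_smul' c a := by
    refine MagicAlg.ext' (smul_zero _).symm (smul_zero _).symm fun j ↦ ?_
    exact congrFun (Pi.single_smul (f := fun _ ↦ Os ⊗[ℝ] ℂ) i c a) j

lemma iota_fst (i : Fin 3) (a : Os ⊗[ℝ] ℂ) : (iota i a).1 = 0 := rfl
lemma iota_snd (i : Fin 3) (a : Os ⊗[ℝ] ℂ) : (iota i a).2.1 = 0 := rfl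
lemma iota_thd (i j : Fin 3) (a : Os ⊗[ℝ] ℂ) :
    (iota i a).2.2 j = if j = i then a else 0 := Pi.single_apply _ _ _
lemma inTri_fst (d : paraOs.tri) : (inTri d).1 = d := rfl
lemma inTri_snd (d : paraOs.tri) : (inTri d).2.1 = 0 := rfl
lemma inTri_thd (d : paraOs.tri) (j : Fin 3) : (inTri d).2.2 j = 0 := rfl
lemma inTri'_fst (d : paraC.tri) : (inTri' d).1 = 0 := rfl
lemma inTri'_snd (d : paraC.tri) : (inTri' d).2.1 = d := rfl
lemma inTri'_thd (d : paraC.tri) (j : Fin 3) : (inTri' d).2.2 j = 0 := rfl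

/-- `inTri` as a linear map. -/
noncomputable def inTriₗ : paraOs.tri →ₗ[ℝ] E62 where
  toFun := inTri
  map_add' _ _ := ext' rfl (add_zero _).symm fun _ ↦ (add_zero _).symm
  map_smul' c _ := ext' rfl (smul_zero _).symm fun _ ↦ (smul_zero c).symm

/-- `inTri'` as a linear map. -/
noncomputable def inTri'ₗ : paraC.tri →ₗ[ℝ] E62 where
  toFun := inTri'
  map_add' _ _ := ext' (add_zero _).symm rfl fun _ ↦ (add_zero _).symm
  map_smul' c _ := ext' (smul_zero _).symm rfl fun _ ↦ (smul_zero c).symm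

lemma inTri_smul (c : ℝ) (d : paraOs.tri) : inTri (c • d) = c • inTri d := inTriₗ.map_smul c d
lemma inTri'_smul (c : ℝ) (d : paraC.tri) : inTri' (c • d) = c • inTri' d := inTri'ₗ.map_smul c d
lemma inTri'_add (d e : paraC.tri) : inTri' (d + e) = inTri' d + inTri' e := inTri'ₗ.map_add d e

lemma eq_sum (x : E62) :
    x = inTri x.1 + inTri' x.2.1 + (iota 0 (x.2.2 0) + iota 1 (x.2.2 1) + iota 2 (x.2.2 2)) := by
  refine ext' ?_ ?_ fun j ↦ ?_
  · simp only [add_fst, inTri_fst, inTri'_fst, iota_fst, add_zero]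
  · simp only [add_snd, inTri_snd, inTri'_snd, iota_snd, add_zero, zero_add]
  · simp only [add_thd, inTri_thd, inTri'_thd, iota_thd, add_zero, zero_add]
    fin_cases j <;> simp

lemma lie_inTri_inTri (d e : paraOs.tri) : ⁅inTri d, inTri e⁆ = inTri ⁅d, e⁆ := by
  refine ext' ?_ ?_ fun j ↦ ?_
  · simp [lie_fst _ _ 0, inTri_fst, inTri_thd]
  · simp [lie_snd _ _ 0, inTri_snd, inTri_thd]
  · simp [lie_thd, inTri_snd, inTri_fst, inTri_thd]

lemma lie_inTri'_inTri' (d e : paraC.tri) : ⁅inTri' d, inTri' e⁆ = 0 := by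
  refine ext' ?_ ?_ fun j ↦ ?_
  · simp [lie_fst _ _ 0, inTri'_fst, inTri'_thd]; rfl
  · simp [lie_snd _ _ 0, inTri'_snd, inTri'_thd, triC_lie]; rfl
  · simp [lie_thd, inTri'_snd, inTri'_fst, inTri'_thd]; rfl

lemma lie_inTri_inTri' (d : paraOs.tri) (e : paraC.tri) : ⁅inTri d, inTri' e⁆ = 0 := by
  refine ext' ?_ ?_ fun j ↦ ?_
  · simp [lie_fst _ _ 0, inTri'_fst, inTri_fst, inTri'_thd]; rfl
  · simp [lie_snd _ _ 0, inTri'_snd, inTri_snd, inTri'_thd]; rfl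
  · simp [lie_thd, inTri'_snd, inTri'_fst, inTri'_thd, inTri_thd]; rfl

lemma lie_inTri'_inTri (d : paraC.tri) (e : paraOs.tri) : ⁅inTri' d, inTri e⁆ = 0 := by
  rw [← lie_skew, lie_inTri_inTri', neg_zero]

lemma lie_inTri_iota (d : paraOs.tri) (i : Fin 3) (a : Os ⊗[ℝ] ℂ) :
    ⁅inTri d, iota i a⁆ = iota i (act d i a) := by
  refine ext' ?_ ?_ fun j ↦ ?_
  · simp [lie_fst _ _ 0, iota_fst, inTri_thd]
  · simp [lie_snd _ _ 0, iota_snd, inTri_thd]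
  · rw [lie_thd]
    simp only [inTri_fst, inTri_snd, inTri_thd, iota_fst, iota_snd, iota_thd, act'_zero,
      map_zero, LinearMap.zero_apply]
    split_ifs with h
    · subst h; simp
    · simp

lemma lie_inTri'_iota (d : paraC.tri) (i : Fin 3) (a : Os ⊗[ℝ] ℂ) :
    ⁅inTri' d, iota i a⁆ = iota i (act' d i a) := by
  refine ext' ?_ ?_ fun j ↦ ?_
  · simp [lie_fst _ _ 0, iota_fst, inTri'_thd]
  · simp [lie_snd _ _ 0, iota_snd, inTri'_thd]
  · rw [lie_thd]
    simp only [inTri'_fst, inTri'_snd, inTri'_thd, iota_fst, iota_snd, iota_thd, act_zero,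
      map_zero, LinearMap.zero_apply]
    split_ifs with h
    · subst h; simp
    · simp

lemma succ_ne : ∀ i : Fin 3, i + 1 ≠ i ∧ i + 2 ≠ i ∧ i + 1 ≠ i + 2 := by decide

lemma lie_iota_self (i : Fin 3) (a b : Os ⊗[ℝ] ℂ) : ⁅iota i a, iota i b⁆ =
    inTri (K paraOs paraC i a b) + inTri' (K' paraOs paraC i a b) := by
  obtain ⟨n1, n2, n3⟩ := succ_ne i
  refine ext' ?_ ?_ fun j ↦ ?_
  · simp [lie_fst _ _ i, iota_fst, iota_thd, n1, n2, add_fst, inTri_fst, inTri'_fst]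
  · simp [lie_snd _ _ i, iota_snd, iota_thd, n1, n2, add_snd, inTri_snd, inTri'_snd]
  · obtain ⟨m1, m2, m3⟩ := succ_ne j
    simp only [lie_thd, iota_fst, iota_snd, iota_thd, act_zero, act'_zero, add_thd, inTri_thd,
      inTri'_thd]
    split_ifs with h h' <;> try simp
    · exact absurd (h.trans h'.symm) m3

lemma lie_iota_succ (i : Fin 3) (a b : Os ⊗[ℝ] ℂ) : ⁅iota (i + 1) a, iota (i + 2) b⁆ =
    iota i (M paraOs paraC a b) := by
  obtain ⟨n1, n2, n3⟩ := succ_ne i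
  refine ext' ?_ ?_ fun j ↦ ?_
  · simp [lie_fst _ _ i, iota_fst, iota_thd, n1.symm, n2.symm, n3, n3.symm]
  · simp [lie_snd _ _ i, iota_snd, iota_thd, n1.symm, n2.symm, n3, n3.symm]
  · simp only [lie_thd, iota_fst, iota_snd, iota_thd, act_zero, act'_zero, add_left_inj]
    by_cases h : j = i
    · subst h; simp [n3, n3.symm]
    · have : ∀ i j : Fin 3, j ≠ i → (j + 2 = i + 1 → j + 1 ≠ i + 2) := by decide
      by_cases h1 : j + 2 = i + 1
      · simp [h, this i j h h1]
      · simp [h, h1]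

/-- `g` as a direct sum. -/
noncomputable def prodEquiv : (paraOs.tri × paraC.tri × (Fin 3 → Os ⊗[ℝ] ℂ)) ≃ₗ[ℝ] E62 where
  toFun x := x
  invFun x := x
  map_add' _ _ := rfl
  map_smul' _ _ := rfl
  left_inv _ := rfl
  right_inv _ := rfl

/-- The indices of the standard basis of `g`. -/
abbrev Ind : Type := Os.Pairs ⊕ (Fin 2 ⊕ (Σ _ : Fin 3, Fin 8 × Fin 2))

/-- The standard basis of `g`. -/
noncomputable def basis : Module.Basis Ind ℝ E62 :=
  (Os.triBasis.prod (triCBasis.prod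
    (Pi.basis fun _ ↦ Os.basis.tensorProduct Complex.basisOneI))).map prodEquiv

lemma basis_inl (p : Os.Pairs) : basis (Sum.inl p) = inTri (Os.triBasis p) := by
  refine ext' ?_ ?_ fun j ↦ ?_ <;> simp [basis, Module.Basis.prod_apply] <;> rfl

lemma basis_inr_inl (k : Fin 2) : basis (Sum.inr (Sum.inl k)) = inTri' (triCBasis k) := by
  refine ext' ?_ ?_ fun j ↦ ?_ <;> simp [basis, Module.Basis.prod_apply] <;> rfl

lemma basis_inr_inr (i : Fin 3) (b : Fin 8) (k : Fin 2) :
    basis (Sum.inr (Sum.inr ⟨i, b, k⟩)) = iota i (Os.std b ⊗ₜ (![1, Complex.I] k)) := by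
  refine ext' ?_ ?_ fun j ↦ ?_ <;>
    simp [basis, Module.Basis.prod_apply, Pi.basis_apply, Os.basis_apply, Complex.coe_basisOneI] <;>
    rfl

lemma inTri_torus (k : Fin 4) : inTri (Os.torus k) = hReal k := by fin_cases k <;> rfl

lemma lie_hReal_inTri (k : Fin 4) (b c : Fin 8) :
    ⁅hReal k, inTri (paraOs.t (Os.std b) (Os.std c))⁆ =
      ((Os.triWeight b c k : ℝ) / 2) • inTri (paraOs.t (Os.std b) (Os.std c)) := by
  rw [← inTri_torus, lie_inTri_inTri, Os.torus_lie_t, inTri_smul]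

lemma lie_hReal_inTri' (k : Fin 4) (d : paraC.tri) : ⁅hReal k, inTri' d⁆ = 0 := by
  rw [← inTri_torus, lie_inTri_inTri']

lemma lie_hReal_iota (k : Fin 4) (i : Fin 3) (b : Fin 8) (z : ℂ) :
    ⁅hReal k, iota i (Os.std b ⊗ₜ z)⁆ =
      ((Os.weight i b k : ℝ) / 2) • iota i (Os.std b ⊗ₜ z) := by
  rw [← inTri_torus, lie_inTri_iota, act_tmul, Os.torus_std, ← map_smul,
    TensorProduct.smul_tmul']

/-- Twice the weights of `h₀` on the standard basis. -/
def indWeight : Ind → Fin 4 → ℤ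
  | Sum.inl p => Os.triWeight p.1.1 p.1.2
  | Sum.inr (Sum.inl _) => 0
  | Sum.inr (Sum.inr ⟨i, b, _⟩) => Os.weight i b

lemma lie_hReal_basis (k : Fin 4) (j : Ind) :
    ⁅hReal k, basis j⁆ = ((indWeight j k : ℝ) / 2) • basis j := by
  rcases j with p | k' | ⟨i, b, k'⟩
  · rw [basis_inl, Os.triBasis_apply, lie_hReal_inTri]; rfl
  · rw [basis_inr_inl, lie_hReal_inTri']; simp [indWeight]
  · rw [basis_inr_inr, lie_hReal_iota]; rfl

lemma finrank_eq : Module.finrank ℝ E62 = 78 := by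
  rw [Module.finrank_eq_card_basis basis]
  rfl

end E62

/-! ### The subspaces h₀ and h, and the subalgebra g₀. -/

namespace E62

open MagicAlg Module

noncomputable instance : Module.Finite ℝ E62 := Module.Finite.of_basis basis

/-- The elements `h₅`, `h₆` of `tri(pC)`. -/
noncomputable def torusC (k : Fin 2) : paraC.tri :=
  triC (![![1 / 4, 1 / 4, -(1 / 2)], ![1 / 4, -(1 / 2), 1 / 4]] k) (by
    fin_cases k <;> simp only [Fin.zero_eta, Fin.mk_one, Matrix.cons_val_zero,
      Matrix.cons_val_one, Matrix.cons_val] <;> norm_num)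

lemma h_eq : h = ![inTri (Os.torus 0), inTri (Os.torus 1), inTri (Os.torus 2),
    inTri (Os.torus 3), inTri' (torusC 0), inTri' (torusC 1)] := rfl

/-- The elements h₁, …, h₄ are the members t_{b,b+4} of the basis of tri(pO_s), which makes their
linear independence immediate. -/
lemma torus_eq (k : Fin 4) : Os.torus k = Os.triBasis
    ⟨(Fin.castLE (by decide) k, Fin.castLE (by decide) k + 4), by revert k; decide⟩ := by
  rw [Os.triBasis_apply]; rfl

lemma linearIndependent_torus : LinearIndependent ℝ Os.torus := by
  have := Os.triBasis.linearIndependent.comp (fun k : Fin 4 ↦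
    (⟨(Fin.castLE (by decide) k, Fin.castLE (by decide) k + 4), by revert k; decide⟩ : Os.Pairs))
    (fun k l hkl ↦ by
      have := congrArg (fun p : Os.Pairs ↦ p.1.1) hkl
      exact Fin.castLE_injective (by decide) this)
  exact (funext torus_eq : Os.torus = _) ▸ this

/-- The coefficients a, b solve a + b = 4 β₀ and a - 2b = 4 β₁; the third component follows from the
vanishing sum. -/
lemma triC_eq_torusC (β : Fin 3 → ℝ) (hβ : β 0 + β 1 + β 2 = 0) :
    triC β hβ = (4 * β 0 - 4 / 3 * (β 0 - β 1)) • torusC 0 + (4 / 3 * (β 0 - β 1)) • torusC 1 := by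
  refine SymCompAlg.tri_ext _ fun i z ↦ ?_
  change _ = (4 * β 0 - 4 / 3 * (β 0 - β 1)) • (torusC 0).1 i z +
    (4 / 3 * (β 0 - β 1)) • (torusC 1).1 i z
  have h2 : β 2 = -β 0 - β 1 := by linarith
  rw [torusC, torusC, triC_apply, triC_apply, triC_apply, smul_smul, smul_smul, ← add_smul]
  congr 1
  fin_cases i
  · simp; ring
  · simp; ring
  · simp [h2]; ring

lemma linearIndependent_h : LinearIndependent ℝ h := by
  rw [Fintype.linearIndependent_iff]
  intro c hc
  rw [Fin.sum_univ_six, h_eq] at hc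
  have h1 : ∑ k : Fin 4, c (Fin.castLE (by decide) k) • Os.torus k = 0 := by
    rw [Fin.sum_univ_four]
    have := congrArg Prod.fst hc
    change c 0 • Os.torus 0 + c 1 • Os.torus 1 + c 2 • Os.torus 2 + c 3 • Os.torus 3 +
      c 4 • (0 : paraOs.tri) + c 5 • (0 : paraOs.tri) = 0 at this
    rwa [smul_zero, smul_zero, add_zero, add_zero] at this
  have h2 : c 4 • torusC 0 + c 5 • torusC 1 = 0 := by
    have := congrArg (fun x : E62 ↦ x.2.1) hc
    change c 0 • (0 : paraC.tri) + c 1 • (0 : paraC.tri) + c 2 • (0 : paraC.tri) +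
      c 3 • (0 : paraC.tri) + c 4 • torusC 0 + c 5 • torusC 1 = 0 at this
    rwa [smul_zero, smul_zero, smul_zero, smul_zero, add_zero, add_zero, add_zero, zero_add] at this
  have h3 := Fintype.linearIndependent_iff.mp linearIndependent_torus _ h1
  have h4 (i : Fin 3) : ((c 4 • torusC 0 + c 5 • torusC 1).1 i 1).im = 0 := by rw [h2]; rfl
  have h5 (i : Fin 3) : (c 4 • (torusC 0).1 i 1 + c 5 • (torusC 1).1 i 1).im = 0 := h4 i
  have e0 := h5 0
  have e1 := h5 1
  simp only [torusC, triC_apply] at e0 e1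
  simp at e0 e1
  intro k
  fin_cases k
  · exact h3 0
  · exact h3 1
  · exact h3 2
  · exact h3 3
  · change c 4 = 0; linarith
  · change c 5 = 0; linarith

lemma linearIndependent_hReal : LinearIndependent ℝ hReal :=
  linearIndependent_h.comp _ (Fin.castLE_injective _)

lemma finrank_h₀ : finrank ℝ h₀ = 4 := finrank_span_eq_card linearIndependent_hReal

lemma inTri'_torusC (k : Fin 2) : inTri' (torusC k) = h (Fin.natAdd 4 k) := by
  fin_cases k <;> rfl

lemma hFull_eq : hFull = h₀ ⊔ triPC := by
  refine le_antisymm (Submodule.span_le.mpr ?_) (sup_le (Submodule.span_le.mpr ?_)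
    (Submodule.span_le.mpr ?_))
  · have key (k : Fin 4) : h (Fin.castLE (by decide) k) ∈ h₀ ⊔ triPC :=
      Submodule.mem_sup_left (Submodule.subset_span ⟨k, rfl⟩)
    have key' (d : paraC.tri) : inTri' d ∈ h₀ ⊔ triPC :=
      Submodule.mem_sup_right (Submodule.subset_span ⟨d, rfl⟩)
    rintro _ ⟨k, rfl⟩
    fin_cases k
    exacts [key 0, key 1, key 2, key 3, key' _, key' _]
  · rintro _ ⟨k, rfl⟩
    exact Submodule.subset_span ⟨_, rfl⟩
  · rintro _ ⟨d, rfl⟩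
    rw [tri_eq_triC d, triC_eq_torusC, inTri'_add, inTri'_smul, inTri'_smul, inTri'_torusC,
      inTri'_torusC]
    exact add_mem (Submodule.smul_mem _ _ (Submodule.subset_span ⟨_, rfl⟩))
      (Submodule.smul_mem _ _ (Submodule.subset_span ⟨_, rfl⟩))

/-- The basis `h₁, …, h₄` of `h₀`. -/
noncomputable def realGen : Basis (Fin 4) ℝ h₀ := Basis.span linearIndependent_hReal

lemma realGen_apply (k : Fin 4) : realGen k = ⟨hReal k, Submodule.subset_span ⟨k, rfl⟩⟩ :=
  Basis.span_apply _ k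

lemma isWeightBasis_real : IsWeightBasis h₀ realGen basis
    fun j k ↦ (indWeight j k : ℝ) / 2 where
  span := realGen.span_eq
  lie k j := by rw [realGen_apply]; exact lie_hReal_basis k j

lemma coords_eq (lam : Dual ℝ h₀) : coords lam = dualEquivFun realGen lam := by
  funext k
  rw [dualEquivFun_apply, realGen_apply]; rfl

/-! ### The subalgebra `g₀` -/

/-- The inclusion of `tri(pO_s)` into `g₀`. -/
noncomputable def inTri₀ : paraOs.tri →ₗ[ℝ] g₀ :=
  LinearMap.codRestrict g₀.toSubmodule inTriₗ inTri_mem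

lemma iota_mem (i : Fin 3) (x : Os) : iota i (x ⊗ₜ 1) ∈ g₀ := by
  refine ⟨rfl, fun j ↦ ?_⟩
  rw [iota_thd]
  split_ifs
  · exact ⟨x, rfl⟩
  · exact zero_mem _

/-- The inclusions of `pO_s` into `g₀`. -/
noncomputable def iota₀ (i : Fin 3) : Os →ₗ[ℝ] g₀ :=
  LinearMap.codRestrict g₀.toSubmodule (iota i ∘ₗ (TensorProduct.mk ℝ Os ℂ).flip 1) (iota_mem i)

lemma iota₀_coe (i : Fin 3) (x : Os) : (iota₀ i x : E62) = iota i (x ⊗ₜ 1) := rfl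

lemma exists_eq_sum (x : g₀) : ∃ (d : paraOs.tri) (s : Fin 3 → Os),
    x = inTri₀ d + (iota₀ 0 (s 0) + iota₀ 1 (s 1) + iota₀ 2 (s 2)) := by
  obtain ⟨x, hx, hr⟩ := x
  have hr' := hr
  choose s hs using hr'
  refine ⟨x.1, s, Subtype.ext ?_⟩
  have h1 (i : Fin 3) : iota i (x.2.2 i) = iota₀ i (s i) := by rw [iota₀_coe, ← hs i]; rfl
  have h2 : inTri' x.2.1 = 0 := by rw [hx]; rfl
  calc x = _ := eq_sum x
    _ = _ := by
      rw [h1, h1, h1, h2, add_zero]; rfl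

/-- The indices of the standard basis of `g₀`. -/
abbrev Ind₀ : Type := Os.Pairs ⊕ (Fin 3 × Fin 8)

/-- The index in the basis of `g` of an element of the basis of `g₀`. -/
def Ind₀.toInd : Ind₀ → Ind
  | Sum.inl p => Sum.inl p
  | Sum.inr (i, b) => Sum.inr (Sum.inr ⟨i, b, 0⟩)

lemma toInd_injective : Function.Injective Ind₀.toInd := by
  rintro (p | ⟨i, b⟩) (r | ⟨j, c⟩) h <;> simp_all [Ind₀.toInd]

/-- The vectors of the standard basis of `g₀`. -/
noncomputable def vec₀ : Ind₀ → g₀ :=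
  Sum.elim (fun p ↦ inTri₀ (Os.triBasis p)) fun p ↦ iota₀ p.1 (Os.basis p.2)

lemma vec₀_coe (j : Ind₀) : (vec₀ j : E62) = basis j.toInd := by
  rcases j with p | ⟨i, b⟩
  · exact (basis_inl p).symm
  · change iota i (Os.basis b ⊗ₜ 1) = basis (Sum.inr (Sum.inr ⟨i, b, 0⟩))
    rw [basis_inr_inr, Os.basis_apply]; rfl

/-- The standard basis of `g₀`. -/
noncomputable def basis₀ : Basis Ind₀ ℝ g₀ := by
  refine Basis.mk (v := vec₀) (LinearIndependent.of_comp g₀.toSubmodule.subtype ?_) fun x _ ↦ ?_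
  · have := basis.linearIndependent.comp _ toInd_injective
    exact (funext vec₀_coe : g₀.toSubmodule.subtype ∘ vec₀ = _) ▸ this
  · have key {J V : Type} [AddCommGroup V] [Module ℝ V] (b : Basis J ℝ V) (F : V →ₗ[ℝ] g₀)
        (h : ∀ j, F (b j) ∈ Submodule.span ℝ (Set.range vec₀)) (v : V) :
        F v ∈ Submodule.span ℝ (Set.range vec₀) := by
      have : Submodule.span ℝ (Set.range b) ≤ (Submodule.span ℝ (Set.range vec₀)).comap F :=
        Submodule.span_le.mpr (by rintro _ ⟨j, rfl⟩; exact h j)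
      exact this (b.mem_span v)
    obtain ⟨d, s, rfl⟩ := exists_eq_sum x
    have hi (i : Fin 3) := key Os.basis (iota₀ i)
      (fun b ↦ Submodule.subset_span ⟨Sum.inr (i, b), rfl⟩) (s i)
    exact add_mem (key Os.triBasis inTri₀ (fun p ↦ Submodule.subset_span ⟨Sum.inl p, rfl⟩) d)
      (add_mem (add_mem (hi 0) (hi 1)) (hi 2))

lemma basis₀_coe (j : Ind₀) : (basis₀ j : E62) = basis j.toInd := by
  rw [basis₀, Basis.mk_apply, vec₀_coe]

noncomputable instance : Module.Finite ℝ g₀ := Module.Finite.of_basis basis₀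

lemma h₀_le_g₀ : h₀ ≤ g₀.toSubmodule := Submodule.span_le.mpr (by rintro _ ⟨k, rfl⟩; exact hReal_mem k)

/-- The subspace `h₀` of `g₀` is `h₀`. -/
noncomputable def h₀Equiv : h₀' ≃ₗ[ℝ] h₀ := Submodule.comapSubtypeEquivOfLe h₀_le_g₀

/-- The basis `h₁, …, h₄` of `h₀` inside `g₀`. -/
noncomputable def realGen₀ : Basis (Fin 4) ℝ h₀' := realGen.map h₀Equiv.symm

lemma realGen₀_apply (k : Fin 4) :
    realGen₀ k = ⟨⟨hReal k, hReal_mem k⟩, Submodule.subset_span ⟨k, rfl⟩⟩ := by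
  rw [realGen₀, Basis.map_apply, LinearEquiv.symm_apply_eq, realGen_apply]; rfl

/-- Twice the weights of `h₀` on the standard basis of `g₀`. -/
def indWeight₀ (j : Ind₀) : Fin 4 → ℤ := indWeight j.toInd

lemma isWeightBasis_real₀ : IsWeightBasis h₀' realGen₀ basis₀
    fun j k ↦ (indWeight₀ j k : ℝ) / 2 where
  span := realGen₀.span_eq
  lie k j := by
    rw [realGen₀_apply]
    refine Subtype.ext ?_
    change ⁅hReal k, (basis₀ j : E62)⁆ = ((indWeight₀ j k : ℝ) / 2) • (basis₀ j : E62)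
    rw [basis₀_coe]
    exact lie_hReal_basis k j.toInd

lemma coords'_eq (lam : Dual ℝ h₀') : coords' lam = dualEquivFun realGen₀ lam := by
  funext k
  rw [dualEquivFun_apply, realGen₀_apply]; rfl

end E62

/-! ### The complexification and its root vectors. -/

namespace E62

open MagicAlg Module

/-- Up to the factor `i/2`, the weights of `h₅`, `h₆` on `ι_i(pO_s ⊗ pC)`. -/
def weightC : Fin 3 → Fin 2 → ℤ := ![![1, 1], ![1, -2], ![-2, 1]]

/-- On ι_i both h₅ and h₆ are nonzero real multiples of multiplication by **i** on the second
factor. They have no real eigenvectors there, which is why `vecC` lives in the complexification. -/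
lemma lie_torusC_iota (l : Fin 2) (i : Fin 3) (x : Os) (z : ℂ) :
    ⁅inTri' (torusC l), iota i (x ⊗ₜ z)⁆ =
      ((weightC i l : ℝ) / 2) • iota i (x ⊗ₜ (Complex.I * z)) := by
  rw [lie_inTri'_iota, act'_tmul, torusC, triC_apply, ← map_smul, ← TensorProduct.tmul_smul]
  congr 2
  rw [mul_assoc, show (2 : ℂ) * (Complex.I * z) = (2 : ℝ) • (Complex.I * z) by
    rw [Complex.real_smul]; norm_num, smul_smul]
  congr 1
  fin_cases l <;> fin_cases i <;> simp [weightC] <;> norm_num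

/-- The signs `1`, `-1`. -/
def sign : Fin 2 → ℤ := ![1, -1]

lemma sign_mul_sign (k : Fin 2) : (sign k : ℂ) * sign k = 1 := by
  fin_cases k <;> simp [sign]

/-- Root vectors of `g^ℂ` relative to `h^ℂ`, together with a basis of `h^ℂ`. -/
noncomputable def vecC : Ind → ℂ ⊗[ℝ] E62
  | Sum.inl p => 1 ⊗ₜ basis (Sum.inl p)
  | Sum.inr (Sum.inl k) => 1 ⊗ₜ basis (Sum.inr (Sum.inl k))
  | Sum.inr (Sum.inr ⟨i, b, k⟩) => 1 ⊗ₜ iota i (Os.std b ⊗ₜ 1) -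
      ((sign k : ℂ) * Complex.I) ⊗ₜ iota i (Os.std b ⊗ₜ Complex.I)

/-- The two vectors attached to (i, b) have the form X - iY and X + iY. Half their sum is X, and i/2
times their difference is Y. -/
lemma span_vecC : Submodule.span ℂ (Set.range vecC) = ⊤ := by
  have key (j : Ind) : (1 : ℂ) ⊗ₜ[ℝ] basis j ∈ Submodule.span ℂ (Set.range vecC) := by
    rcases j with p | k | ⟨i, b, k⟩
    · exact Submodule.subset_span ⟨Sum.inl p, rfl⟩
    · exact Submodule.subset_span ⟨Sum.inr (Sum.inl k), rfl⟩
    · have h0 : vecC (Sum.inr (Sum.inr ⟨i, b, 0⟩)) ∈ Submodule.span ℂ (Set.range vecC) :=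
        Submodule.subset_span ⟨_, rfl⟩
      have h1 : vecC (Sum.inr (Sum.inr ⟨i, b, 1⟩)) ∈ Submodule.span ℂ (Set.range vecC) :=
        Submodule.subset_span ⟨_, rfl⟩
      have e0 : vecC (Sum.inr (Sum.inr ⟨i, b, 0⟩)) = 1 ⊗ₜ iota i (Os.std b ⊗ₜ 1) -
          Complex.I • (1 ⊗ₜ iota i (Os.std b ⊗ₜ Complex.I)) := by
        rw [TensorProduct.smul_tmul', smul_eq_mul, mul_one]; simp [vecC, sign]
      have e1 : vecC (Sum.inr (Sum.inr ⟨i, b, 1⟩)) = 1 ⊗ₜ iota i (Os.std b ⊗ₜ 1) +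
          Complex.I • (1 ⊗ₜ iota i (Os.std b ⊗ₜ Complex.I)) := by
        rw [TensorProduct.smul_tmul', smul_eq_mul, mul_one]; simp [vecC, sign, TensorProduct.neg_tmul]
      rw [e0] at h0
      rw [e1] at h1
      fin_cases k
      · have := Submodule.smul_mem _ (1 / 2 : ℂ) (add_mem h0 h1)
        convert this using 1
        change 1 ⊗ₜ[ℝ] basis (Sum.inr (Sum.inr ⟨i, b, 0⟩)) = _
        rw [basis_inr_inr]
        change 1 ⊗ₜ iota i (Os.std b ⊗ₜ 1) = _
        module
      · have := Submodule.smul_mem _ (Complex.I / 2 : ℂ) (sub_mem h0 h1)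
        convert this using 1
        change 1 ⊗ₜ[ℝ] basis (Sum.inr (Sum.inr ⟨i, b, 1⟩)) = _
        rw [basis_inr_inr]
        change 1 ⊗ₜ iota i (Os.std b ⊗ₜ Complex.I) = _
        linear_combination (norm := module)
          Complex.I_mul_I • ((1 : ℂ) ⊗ₜ[ℝ] iota i (Os.std b ⊗ₜ Complex.I))
  rw [eq_top_iff, ← (basis.baseChange ℂ).span_eq]
  refine Submodule.span_le.mpr ?_
  rintro _ ⟨j, rfl⟩
  rw [Basis.baseChange_apply]
  exact key j

/-- Root vectors of `g^ℂ` relative to `h^ℂ`, together with a basis of `h^ℂ`. -/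
noncomputable def basisC : Basis Ind ℂ (ℂ ⊗[ℝ] E62) :=
  basisOfTopLeSpanOfCardEqFinrank vecC span_vecC.ge
    (finrank_eq_card_basis (basis.baseChange ℂ)).symm

lemma basisC_apply (j : Ind) : basisC j = vecC j := by
  rw [basisC, coe_basisOfTopLeSpanOfCardEqFinrank]

/-- The basis `h₁, …, h₆` of `h`. -/
noncomputable def gen : Basis (Fin 6) ℝ hFull := Basis.span linearIndependent_h

lemma gen_apply (k : Fin 6) : gen k = ⟨h k, Submodule.subset_span ⟨k, rfl⟩⟩ :=
  Basis.span_apply _ k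

lemma linearIndependent_toComplex : LinearIndependent ℂ fun k ↦ toComplex (gen k) := by
  refine LinearIndependent.of_comp (hFull.baseChange ℂ).subtype ?_
  have := Flat.linearIndependent_one_tmul (S := ℂ) linearIndependent_h
  convert this using 1
  funext k
  change 1 ⊗ₜ[ℝ] (gen k : E62) = _
  rw [gen_apply]

/-- The basis `h₁, …, h₆` of `h^ℂ`. -/
noncomputable def genC : Basis (Fin 6) ℂ (hFull.baseChange ℂ) := by
  refine Basis.mk linearIndependent_toComplex fun x _ ↦ ?_
  obtain ⟨x, hx⟩ := x
  obtain ⟨y, hy⟩ := Submodule.toBaseChange_surjective ℂ hFull ⟨x, hx⟩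
  rw [← hy]
  have hs : Submodule.span ℂ (Set.range (gen.baseChange ℂ)) ≤ (Submodule.span ℂ (Set.range
      fun k ↦ toComplex (gen k))).comap (hFull.toBaseChange ℂ) := by
    refine Submodule.span_le.mpr ?_
    rintro _ ⟨k, rfl⟩
    rw [Basis.baseChange_apply]
    exact Submodule.subset_span ⟨k, rfl⟩
  exact hs ((gen.baseChange ℂ).mem_span y)

lemma genC_apply (k : Fin 6) :
    genC k = toComplex (h := hFull) ⟨h k, Submodule.subset_span ⟨k, rfl⟩⟩ := by
  rw [genC, Basis.mk_apply]
  exact congrArg toComplex (gen_apply k)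

lemma coordsC_eq (lam : Dual ℂ (hFull.baseChange ℂ)) : coordsC lam = dualEquivFun genC lam := by
  funext k
  rw [dualEquivFun_apply, genC_apply]; rfl

/-- The factors relating integers to weights. -/
noncomputable def unit : Fin 6 → ℂ :=
  ![1 / 2, 1 / 2, 1 / 2, 1 / 2, Complex.I / 2, Complex.I / 2]

/-- Up to the factors `unit`, the weights of `h₅`, `h₆`. -/
def indWeightC' : Ind → Fin 2 → ℤ
  | Sum.inl _ => 0
  | Sum.inr (Sum.inl _) => 0
  | Sum.inr (Sum.inr ⟨i, _, k⟩) => fun l ↦ sign k * weightC i l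

/-- Up to the factors `unit`, the weights of `h^ℂ`. -/
def indWeightC (j : Ind) : Fin 6 → ℤ :=
  ![indWeight j 0, indWeight j 1, indWeight j 2, indWeight j 3, indWeightC' j 0, indWeightC' j 1]

lemma lie_tmul_sub_tmul (x y z : E62) (a c : ℂ) :
    ⁅(1 : ℂ) ⊗ₜ[ℝ] x, a ⊗ₜ[ℝ] y - c ⊗ₜ[ℝ] z⁆ = a ⊗ₜ[ℝ] ⁅x, y⁆ - c ⊗ₜ[ℝ] ⁅x, z⁆ := by
  refine (lie_sub ((1 : ℂ) ⊗ₜ[ℝ] x) (a ⊗ₜ[ℝ] y) (c ⊗ₜ[ℝ] z)).trans ?_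
  rw [LieAlgebra.ExtendScalars.bracket_tmul, LieAlgebra.ExtendScalars.bracket_tmul, one_mul,
    one_mul]

lemma lie_hReal_vecC (k : Fin 4) (j : Ind) :
    ⁅(1 : ℂ) ⊗ₜ[ℝ] hReal k, vecC j⁆ = ((indWeight j k : ℂ) / 2) • vecC j := by
  have hc (n : ℤ) (z : ℂ) (x : E62) :
      z ⊗ₜ[ℝ] (((n : ℝ) / 2) • x) = ((n : ℂ) / 2) • (z ⊗ₜ[ℝ] x) := by
    rw [← TensorProduct.smul_tmul, TensorProduct.smul_tmul', Complex.real_smul, smul_eq_mul]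
    push_cast; rfl
  rcases j with p | k' | ⟨i, b, k'⟩
  · change ⁅(1 : ℂ) ⊗ₜ[ℝ] hReal k, (1 : ℂ) ⊗ₜ[ℝ] basis (Sum.inl p)⁆ = _
    rw [LieAlgebra.ExtendScalars.bracket_tmul, lie_hReal_basis, hc, mul_one]; rfl
  · change ⁅(1 : ℂ) ⊗ₜ[ℝ] hReal k, (1 : ℂ) ⊗ₜ[ℝ] basis (Sum.inr (Sum.inl k'))⁆ = _
    rw [LieAlgebra.ExtendScalars.bracket_tmul, lie_hReal_basis, hc, mul_one]; rfl
  · rw [vecC, lie_tmul_sub_tmul, lie_hReal_iota, lie_hReal_iota, hc, hc, smul_sub]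
    rfl

/-- A rotation sends X to a multiple of Y and Y to the opposite multiple of X. Hence X - s i Y is an
eigenvector with eigenvalue s i times that multiple, for s = ±1, because (s i)² = -1. -/
lemma lie_torusC_vecC (l : Fin 2) (j : Ind) :
    ⁅(1 : ℂ) ⊗ₜ[ℝ] inTri' (torusC l), vecC j⁆ =
      ((indWeightC' j l : ℂ) * (Complex.I / 2)) • vecC j := by
  have hc (n : ℤ) (z : ℂ) (x : E62) :
      z ⊗ₜ[ℝ] (((n : ℝ) / 2) • x) = ((n : ℂ) / 2) • (z ⊗ₜ[ℝ] x) := by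
    rw [← TensorProduct.smul_tmul, TensorProduct.smul_tmul', Complex.real_smul, smul_eq_mul]
    push_cast; rfl
  rcases j with p | k' | ⟨i, b, k⟩
  · change ⁅(1 : ℂ) ⊗ₜ[ℝ] inTri' (torusC l), (1 : ℂ) ⊗ₜ[ℝ] basis (Sum.inl p)⁆ = _
    rw [LieAlgebra.ExtendScalars.bracket_tmul, basis_inl, lie_inTri'_inTri]; simp [indWeightC']
  · change ⁅(1 : ℂ) ⊗ₜ[ℝ] inTri' (torusC l), (1 : ℂ) ⊗ₜ[ℝ] basis (Sum.inr (Sum.inl k'))⁆ = _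
    rw [LieAlgebra.ExtendScalars.bracket_tmul, basis_inr_inl, lie_inTri'_inTri']
    simp [indWeightC']
  · have hI : iota i (Os.std b ⊗ₜ (Complex.I * Complex.I)) = -iota i (Os.std b ⊗ₜ 1) := by
      rw [Complex.I_mul_I, TensorProduct.tmul_neg, map_neg]
    rw [vecC, lie_tmul_sub_tmul, lie_torusC_iota, lie_torusC_iota, hc, hc, hI, mul_one,
      TensorProduct.tmul_neg, indWeightC']
    have e (y : E62) : ((sign k : ℂ) * Complex.I) ⊗ₜ[ℝ] y =
        ((sign k : ℂ) * Complex.I) • ((1 : ℂ) ⊗ₜ[ℝ] y) := by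
      rw [TensorProduct.smul_tmul', smul_eq_mul, mul_one]
    simp only [e]
    have e2 : (sign k : ℂ) * Complex.I * (sign k * Complex.I) = -1 := by
      rw [mul_mul_mul_comm, sign_mul_sign, Complex.I_mul_I]; ring
    push_cast
    linear_combination (norm := module) ((weightC i l : ℂ) / 2) • congrArg
      (· • ((1 : ℂ) ⊗ₜ[ℝ] iota i (Os.std b ⊗ₜ Complex.I))) e2

lemma isWeightBasis_complex : IsWeightBasis (hFull.baseChange ℂ) genC basisC
    fun j k ↦ (indWeightC j k : ℂ) * unit k where
  span := genC.span_eq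
  lie k j := by
    rw [genC_apply, basisC_apply]
    have key (k : Fin 4) : ⁅(1 : ℂ) ⊗ₜ[ℝ] hReal k, vecC j⁆ =
        ((indWeight j k : ℂ) * (1 / 2)) • vecC j := by
      rw [lie_hReal_vecC, mul_one_div]
    fin_cases k
    exacts [key 0, key 1, key 2, key 3, lie_torusC_vecC 0 j, lie_torusC_vecC 1 j]

end E62

/-! ### Block maps and the automorphisms Ψ_i. -/

namespace E62

open MagicAlg Module

/-- Compatible linear maps of the summands define a linear map of `g`. -/
noncomputable def blockMap (F : paraOs.tri →ₗ[ℝ] paraOs.tri)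
    (T : Fin 3 → Os ⊗[ℝ] ℂ →ₗ[ℝ] Os ⊗[ℝ] ℂ) : E62 →ₗ[ℝ] E62 where
  toFun x := (F x.1, x.2.1, fun i ↦ T i (x.2.2 i))
  map_add' x y := MagicAlg.ext' (map_add _ _ _) rfl fun _ ↦ map_add _ _ _
  map_smul' c x := MagicAlg.ext' (map_smul F c x.1) rfl fun i ↦ map_smul (T i) c (x.2.2 i)

section BlockMap

variable (F : paraOs.tri →ₗ[ℝ] paraOs.tri) (T : Fin 3 → Os ⊗[ℝ] ℂ →ₗ[ℝ] Os ⊗[ℝ] ℂ)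

lemma blockMap_fst (x : E62) : (blockMap F T x).1 = F x.1 := rfl
lemma blockMap_snd (x : E62) : (blockMap F T x).2.1 = x.2.1 := rfl
lemma blockMap_thd (x : E62) (i : Fin 3) : (blockMap F T x).2.2 i = T i (x.2.2 i) := rfl

lemma blockMap_inTri (d : paraOs.tri) : blockMap F T (inTri d) = inTri (F d) :=
  MagicAlg.ext' rfl rfl fun i ↦ map_zero (T i)

lemma blockMap_inTri' (d : paraC.tri) : blockMap F T (inTri' d) = inTri' d :=
  MagicAlg.ext' (map_zero F) rfl fun i ↦ map_zero (T i)

lemma blockMap_iota (i : Fin 3) (a : Os ⊗[ℝ] ℂ) : blockMap F T (iota i a) = iota i (T i a) := by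
  refine MagicAlg.ext' (map_zero F) rfl fun j ↦ ?_
  rw [blockMap_thd, iota_thd, iota_thd]
  split_ifs with h
  · rw [h]
  · exact map_zero _

/-- One hypothesis for each constituent of the bracket. The criterion serves for Ψ_i, for the
extension of an involution of g₀ and for the involution induced by `Os.swap`. -/
lemma blockMap_lie (h1 : ∀ d e, F ⁅d, e⁆ = ⁅F d, F e⁆)
    (h2 : ∀ d i a, T i (act d i a) = act (F d) i (T i a))
    (h3 : ∀ (d : paraC.tri) i a, T i (act' d i a) = act' d i (T i a))
    (h4 : ∀ i a b, F (K paraOs paraC i a b) = K paraOs paraC i (T i a) (T i b))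
    (h5 : ∀ i a b, K' paraOs paraC i a b = K' paraOs paraC i (T i a) (T i b))
    (h6 : ∀ i a b, T i (M paraOs paraC a b) = M paraOs paraC (T (i + 1) a) (T (i + 2) b))
    (x y : E62) : blockMap F T ⁅x, y⁆ = ⁅blockMap F T x, blockMap F T y⁆ := by
  refine MagicAlg.ext' ?_ ?_ fun i ↦ ?_
  · rw [blockMap_fst, lie_fst _ _ 0, lie_fst _ _ 0]
    simp only [map_add, map_smul, h1, h4, blockMap_fst, blockMap_thd]
  · rw [blockMap_snd, lie_snd _ _ 0, lie_snd _ _ 0]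
    simp only [blockMap_snd, blockMap_thd, ← h5]
  · rw [blockMap_thd, lie_thd, lie_thd]
    simp only [map_add, map_sub, map_smul, h2, h3, h6, blockMap_fst, blockMap_thd, blockMap_snd]

end BlockMap

/-- The maps of the summands `ι_j` underlying `Ψ_i`. -/
noncomputable def psiMap (i j : Fin 3) : Os ⊗[ℝ] ℂ →ₗ[ℝ] Os ⊗[ℝ] ℂ :=
  LinearMap.lTensor Os (LinearMap.mulLeft ℝ (if j = i then -1 else -Complex.I))

lemma psiMap_tmul (i j : Fin 3) (x : Os) (z : ℂ) :
    psiMap i j (x ⊗ₜ z) = x ⊗ₜ ((if j = i then -1 else -Complex.I) * z) := rfl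

lemma Psi_eq (i : Fin 3) : Psi i = blockMap LinearMap.id (psiMap i) := by
  refine LinearMap.ext fun x ↦ MagicAlg.ext' rfl rfl fun j ↦ ?_
  change (if j = i then - x.2.2 j else rot (x.2.2 j)) = psiMap i j (x.2.2 j)
  rw [psiMap]
  split_ifs with h
  · have : LinearMap.mulLeft ℝ (-1 : ℂ) = -LinearMap.id := by ext <;> simp
    rw [this, LinearMap.lTensor_neg, LinearMap.lTensor_id]; rfl
  · rfl

lemma paraC_mul (x y : ℂ) : paraC.mul x y = (starRingEnd ℂ) x * (starRingEnd ℂ) y := rfl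

lemma paraC_q_mul (c : ℂ) (hc : Complex.normSq c = 1) (x y : ℂ) :
    paraC.q (c * x) (c * y) = paraC.q x y := by
  rw [Complex.normSq_apply] at hc
  rw [q_paraC, q_paraC]
  simp only [Complex.mul_re, Complex.mul_im]
  linear_combination (2 * (x.re * y.re + x.im * y.im)) * hc

/-- On the plane t'_{x,y} depends on `x` and `y` only through the area form, so it is invariant
under a simultaneous rotation of both arguments. -/
lemma paraC_t (x y : ℂ) : paraC.t x y = triC
    ![x.re * y.im - x.im * y.re, -(x.re * y.im - x.im * y.re) / 2,
      -(x.re * y.im - x.im * y.re) / 2] (by simp; ring) := by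
  refine SymCompAlg.tri_ext _ fun i z ↦ ?_
  rw [triC_apply]
  fin_cases i
  · change (paraC.t x y).1 0 z = _
    rw [SymCompAlg.t_zero, q_paraC, q_paraC]
    apply Complex.ext <;> simp <;> ring
  · change (paraC.t x y).1 1 z = _
    rw [SymCompAlg.t_one, q_paraC, paraC_mul, paraC_mul]
    apply Complex.ext <;> simp <;> ring
  · change (paraC.t x y).1 2 z = _
    rw [SymCompAlg.t_two, q_paraC, paraC_mul, paraC_mul]
    apply Complex.ext <;> simp <;> ring

lemma paraC_t_mul (c : ℂ) (hc : Complex.normSq c = 1) (x y : ℂ) :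
    paraC.t (c * x) (c * y) = paraC.t x y := by
  rw [Complex.normSq_apply] at hc
  have e : (c * x).re * (c * y).im - (c * x).im * (c * y).re = x.re * y.im - x.im * y.re := by
    simp only [Complex.mul_re, Complex.mul_im]
    linear_combination (x.re * y.im - x.im * y.re) * hc
  rw [paraC_t, paraC_t]
  refine triC_congr _ _ ?_
  rw [e]

lemma tensor_induction {V : Type*} [AddCommGroup V] [Module ℝ V] {F G : Os ⊗[ℝ] ℂ →ₗ[ℝ] V}
    (h : ∀ x z, F (x ⊗ₜ z) = G (x ⊗ₜ z)) (a : Os ⊗[ℝ] ℂ) : F a = G a :=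
  LinearMap.congr_fun (TensorProduct.ext' h) a

lemma tensor_induction₂ {V : Type*} [AddCommGroup V] [Module ℝ V]
    {F G : Os ⊗[ℝ] ℂ →ₗ[ℝ] Os ⊗[ℝ] ℂ →ₗ[ℝ] V}
    (h : ∀ x z y w, F (x ⊗ₜ z) (y ⊗ₜ w) = G (x ⊗ₜ z) (y ⊗ₜ w)) (a b : Os ⊗[ℝ] ℂ) :
    F a b = G a b :=
  LinearMap.congr_fun (tensor_induction (fun x z ↦ TensorProduct.ext' fun y w ↦ h x z y w) a) b

/-- Ψ_i multiplies the second factor of ι_j by a complex number c_j of norm 1, which preserves q'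
and t' and commutes with tri(pC). As the product of pC conjugates, the remaining condition is c₀ c₁
c₂ = 1, and indeed (-1)(-**i**)(-**i**) = 1. -/
lemma Psi_lie (i : Fin 3) (x y : E62) : Psi i ⁅x, y⁆ = ⁅Psi i x, Psi i y⁆ := by
  have hn (j : Fin 3) : Complex.normSq (if j = i then -1 else -Complex.I) = 1 := by
    split_ifs <;> simp
  rw [Psi_eq]
  refine blockMap_lie _ _ (fun _ _ ↦ rfl) (fun d j a ↦ ?_) (fun d j a ↦ ?_) (fun j a b ↦ ?_)
    (fun j a b ↦ ?_) (fun j a b ↦ ?_) x y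
  · refine tensor_induction (F := psiMap i j ∘ₗ act d j)
      (G := act (LinearMap.id (R := ℝ) d) j ∘ₗ psiMap i j) (fun x z ↦ rfl) a
  · refine tensor_induction (F := psiMap i j ∘ₗ act' d j)
      (G := act' d j ∘ₗ psiMap i j) (fun x z ↦ ?_) a
    simp only [LinearMap.comp_apply, act'_tmul, psiMap_tmul]
    congr 1
    rw [tri_apply d j z, tri_apply d j (_ * z), Complex.real_smul, Complex.real_smul]
    ring
  · refine tensor_induction₂ (F := (K paraOs paraC j).compr₂ LinearMap.id)
      (G := (K paraOs paraC j).compl₁₂ (psiMap i j) (psiMap i j)) (fun x z y w ↦ ?_) a b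
    rw [LinearMap.compr₂_apply, LinearMap.compl₁₂_apply, psiMap_tmul, psiMap_tmul, K_tmul, K_tmul,
      paraC_q_mul _ (hn j)]
    rfl
  · refine tensor_induction₂ (F := K' paraOs paraC j)
      (G := (K' paraOs paraC j).compl₁₂ (psiMap i j) (psiMap i j)) (fun x z y w ↦ ?_) a b
    rw [LinearMap.compl₁₂_apply, psiMap_tmul, psiMap_tmul, K'_tmul, K'_tmul, SymCompAlg.tPow,
      LinearMap.compr₂_apply, LinearMap.compr₂_apply, paraC_t_mul _ (hn j)]
  · refine tensor_induction₂ (F := (M paraOs paraC).compr₂ (psiMap i j))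
      (G := (M paraOs paraC).compl₁₂ (psiMap i (j + 1)) (psiMap i (j + 2))) (fun x z y w ↦ ?_) a b
    rw [LinearMap.compr₂_apply, LinearMap.compl₁₂_apply, psiMap_tmul, psiMap_tmul, M_tmul, M_tmul,
      psiMap_tmul, paraC_mul, paraC_mul, map_mul, map_mul]
    congr 1
    have hI := Complex.I_mul_I
    fin_cases i <;> fin_cases j <;> simp [Os.idx] <;> ring_nf <;> simp

lemma Psi_iota (i j : Fin 3) (x : Os) (z : ℂ) :
    Psi i (iota j (x ⊗ₜ z)) = iota j (x ⊗ₜ ((if j = i then -1 else -Complex.I) * z)) := by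
  rw [Psi_eq, blockMap_iota, psiMap_tmul]

lemma psiMap_pow_four (i j : Fin 3) (a : Os ⊗[ℝ] ℂ) :
    psiMap i j (psiMap i j (psiMap i j (psiMap i j a))) = a := by
  refine tensor_induction (F := psiMap i j ∘ₗ psiMap i j ∘ₗ psiMap i j ∘ₗ psiMap i j)
    (G := LinearMap.id) (fun x z ↦ ?_) a
  simp only [LinearMap.comp_apply, psiMap_tmul, LinearMap.id_apply]
  congr 1
  split_ifs
  · ring
  · linear_combination (z * (Complex.I * Complex.I) - z) * Complex.I_mul_I

/-- The scalars -1 and -**i** are fourth roots of unity, so the cube of Ψ_i is its inverse. -/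
lemma Psi_pow_four (i : Fin 3) (x : E62) : Psi i (Psi i (Psi i (Psi i x))) = x := by
  rw [Psi_eq]
  exact MagicAlg.ext' rfl rfl fun j ↦ psiMap_pow_four i j _

/-- The automorphism `Ψ_i`. -/
noncomputable def PsiEquiv (i : Fin 3) : E62 ≃ₗ⁅ℝ⁆ E62 where
  toFun := Psi i
  invFun x := Psi i (Psi i (Psi i x))
  map_add' := map_add _
  map_smul' := map_smul _
  map_lie' := Psi_lie i _ _
  left_inv := Psi_pow_four i
  right_inv := Psi_pow_four i

end E62

/-! ### Root systems generated by simple reflections. -/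

section RootSystems

open Module Matrix

variable {K V ι : Type*} [Field K] [CharZero K] [AddCommGroup V] [Module K V] [Fintype ι]
  [DecidableEq ι]

/-- A criterion for a set of vectors with integral coordinates with respect to a basis to be a root
system with that basis: it is stable under the reflections in the basis vectors, every element can
be moved to plus or minus a basis vector by such reflections, and the coroots are given by an
invariant form. -/
theorem isRootBasis_of_simple_reflections (β : Basis ι K V) (R : Set (ι → ℤ)) (hfin : R.Finite)
    (G : Matrix ι ι ℤ) (hG : Gᵀ = G) (cor : (ι → ℤ) → (ι → ℤ)) (C : Matrix ι ι ℤ)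
    (hcor : ∀ c ∈ R, (c ⬝ᵥ G *ᵥ c) • cor c = (2 : ℤ) • (G *ᵥ c))
    (hne : ∀ c ∈ R, c ⬝ᵥ G *ᵥ c ≠ 0)
    (hs : ∀ i, Pi.single i 1 ∈ R) (hC : ∀ i j, cor (Pi.single j 1) i = C i j)
    (hstep : ∀ c ∈ R, ∀ i, c - (c ⬝ᵥ cor (Pi.single i 1)) • Pi.single i 1 ∈ R)
    (ht : (ι → ℤ) → ℕ)
    (hgen : ∀ c ∈ R, (∃ i, c = Pi.single i 1 ∨ c = -Pi.single i 1) ∨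
      ∃ i, ht (c - (c ⬝ᵥ cor (Pi.single i 1)) • Pi.single i 1) < ht c)
    (hpos : ∀ c ∈ R, (∀ i, 0 ≤ c i) ∨ ∀ i, c i ≤ 0)
    (hred : ∀ i, ∀ d ∈ R, (Pi.single i 1 ⬝ᵥ cor d) * (d ⬝ᵥ cor (Pi.single i 1)) = 4 →
      d = Pi.single i 1 ∨ d = -Pi.single i 1) :
    IsRootBasis K {v | ∃ c ∈ R, v = ∑ i, (c i : K) • β i} β C := by
  set B : (ι → ℤ) → (ι → ℤ) → ℤ := fun c d ↦ c ⬝ᵥ G *ᵥ d with hB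
  have hBs (c d) : B c d = B d c := by
    simp only [hB]
    rw [dotProduct_mulVec, dotProduct_comm, ← mulVec_transpose, hG]
  have hBsub (c d e : ι → ℤ) (k : ℤ) : B c (d - k • e) = B c d - k * B c e := by
    simp only [hB, mulVec_sub, mulVec_smul, dotProduct_sub, dotProduct_smul, smul_eq_mul]
  have hBsub' (c d e : ι → ℤ) (k : ℤ) : B (d - k • e) c = B d c - k * B e c := by
    rw [hBs, hBsub, hBs c d, hBs c e]
  have hpair (c : ι → ℤ) (hc : c ∈ R) (d : ι → ℤ) : B c c * (d ⬝ᵥ cor c) = 2 * B d c := by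
    have := congrArg (d ⬝ᵥ ·) (hcor c hc)
    simpa only [dotProduct_smul, smul_eq_mul] using this
  have hself (c : ι → ℤ) (hc : c ∈ R) : c ⬝ᵥ cor c = 2 :=
    mul_left_cancel₀ (hne c hc) ((hpair c hc c).trans (mul_comm _ _))
  set s : ι → (ι → ℤ) → (ι → ℤ) := fun i c ↦
    c - (c ⬝ᵥ cor (Pi.single i 1)) • Pi.single i 1 with hsdef
  have hss (i : ι) (c : ι → ℤ) : s i (s i c) = c := by
    simp only [hsdef, sub_dotProduct, smul_dotProduct, smul_eq_mul, hself _ (hs i)]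
    module
  have hslin (i : ι) (c d : ι → ℤ) (k : ℤ) : s i (c - k • d) = s i c - k • s i d := by
    simp only [hsdef, sub_dotProduct, smul_dotProduct, smul_eq_mul]
    module
  have hsneg (i : ι) (c : ι → ℤ) : s i (-c) = -s i c := by
    simp only [hsdef, neg_dotProduct]
    module
  -- Simple reflections are isometries of the form. Since coroots are proportional to the form,
  -- pairings are invariant too, which is `hinv`.
  have hBinv (i : ι) (c d : ι → ℤ) : B (s i c) (s i d) = B c d := by
    have h1 := hpair _ (hs i) c
    have h2 := hpair _ (hs i) d
    simp only [hsdef, hBsub, hBsub', hBs (Pi.single i 1) d]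
    rw [hBs c (Pi.single i 1)] at h1
    rw [hBs c (Pi.single i 1)]
    have : (2 : ℤ) ≠ 0 := two_ne_zero
    refine mul_left_cancel₀ this ?_
    linear_combination (d ⬝ᵥ cor (Pi.single i 1)) * h1 + (c ⬝ᵥ cor (Pi.single i 1)) * h2
  have hinv (i : ι) (c : ι → ℤ) (hc : c ∈ R) (d : ι → ℤ) :
      s i d ⬝ᵥ cor (s i c) = d ⬝ᵥ cor c := by
    refine mul_left_cancel₀ (hne c hc) ?_
    have h1 := hpair _ (hstep c hc i) (s i d)
    change B (s i c) (s i c) * _ = 2 * B (s i d) (s i c) at h1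
    rw [hBinv, hBinv] at h1
    exact h1.trans (hpair c hc d).symm
  -- Induction on `ht`: stability under the reflection in `c` and reducedness at `c` hold for simple
  -- roots by hypothesis, pass to their negatives, and are carried from s_i(c) to c by the simple
  -- reflection s_i.
  have key (n : ℕ) : ∀ c ∈ R, ht c = n → (∀ d ∈ R, d - (d ⬝ᵥ cor c) • c ∈ R) ∧
      ∀ d ∈ R, (c ⬝ᵥ cor d) * (d ⬝ᵥ cor c) = 4 → c = d ∨ c = -d := by
    induction n using Nat.strong_induction_on with
    | _ n ih =>
      intro c hc hn
      rcases hgen c hc with ⟨i, h | h⟩ | ⟨i, hi⟩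
      · subst h
        refine ⟨fun d hd ↦ hstep d hd i, fun d hd h4 ↦ ?_⟩
        rcases hred i d hd h4 with h | h
        · exact Or.inl h.symm
        · exact Or.inr (by rw [h, neg_neg])
      · have hcn (d : ι → ℤ) : d ⬝ᵥ cor c = -(d ⬝ᵥ cor (Pi.single i 1)) := by
          refine mul_left_cancel₀ (hne c hc) ?_
          have h1 := hpair c hc d
          have h2 := hpair _ (hs i) d
          have e1 : B c c = B (Pi.single i 1) (Pi.single i 1) := by
            rw [h]; simp only [hB, mulVec_neg, dotProduct_neg, neg_dotProduct, neg_neg]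
          have e2 : B d c = - B d (Pi.single i 1) := by
            rw [h]; simp only [hB, mulVec_neg, dotProduct_neg]
          change B c c * _ = B c c * _
          rw [h1, e2, e1]
          linear_combination h2
        refine ⟨fun d hd ↦ ?_, fun d hd h4 ↦ ?_⟩
        · rw [hcn, h, neg_smul_neg]; exact hstep d hd i
        · rw [hcn, h, neg_dotProduct, neg_mul_neg] at h4
          rcases hred i d hd h4 with h' | h'
          · exact Or.inr (by rw [h, h'])
          · exact Or.inl (by rw [h, h'])
      · obtain ⟨k1, k2⟩ := ih _ (hn ▸ hi) _ (hstep c hc i) rfl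
        refine ⟨fun d hd ↦ ?_, fun d hd h4 ↦ ?_⟩
        · have h1 := hstep _ (k1 _ (hstep d hd i)) i
          change s i (s i d - (s i d ⬝ᵥ cor (s i c)) • s i c) ∈ R at h1
          rwa [hinv i c hc, hslin, hss, hss] at h1
        · have h1 : s i c = s i d ∨ s i c = -s i d := by
            refine k2 _ (hstep d hd i) ?_
            change (s i c ⬝ᵥ cor (s i d)) * (s i d ⬝ᵥ cor (s i c)) = 4
            rwa [hinv i d hd, hinv i c hc]
          rcases h1 with h1 | h1
          · exact Or.inl (by rw [← hss i c, h1, hss])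
          · exact Or.inr (by rw [← hss i c, h1, hsneg, hss])
  exact isRootBasis_of_coefficients β R hfin cor C hself (fun c hc ↦ (key _ c hc rfl).1) hs hC hpos
    fun c hc ↦ (key _ c hc rfl).2

end RootSystems

/-! ### The coefficient lists of F₄ and E₆. -/

section RootLists

open Matrix

/-- The coefficients of the positive roots of type `F₄` in terms of the simple roots. -/
def posF₄ : List (Fin 4 → ℤ) :=
  [![0, 0, 0, 1], ![0, 0, 1, 0], ![0, 1, 0, 0], ![1, 0, 0, 0], ![0, 0, 1, 1], ![0, 1, 1, 0],
    ![1, 1, 0, 0], ![0, 1, 1, 1], ![0, 1, 2, 0], ![1, 1, 1, 0], ![0, 1, 2, 1], ![1, 1, 1, 1],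
    ![1, 1, 2, 0], ![0, 1, 2, 2], ![1, 1, 2, 1], ![1, 2, 2, 0], ![1, 1, 2, 2], ![1, 2, 2, 1],
    ![1, 2, 2, 2], ![1, 2, 3, 1], ![1, 2, 3, 2], ![1, 2, 4, 2], ![1, 3, 4, 2], ![2, 3, 4, 2]]

/-- The coefficients of the roots of type `F₄`. -/
def rootsF₄ : List (Fin 4 → ℤ) := posF₄ ++ posF₄.map fun c ↦ -c

/-- The coefficients of the positive roots of type `E₆` in terms of the simple roots. -/
def posE₆ : List (Fin 6 → ℤ) :=
  [![0, 0, 0, 0, 0, 1], ![0, 0, 0, 0, 1, 0], ![0, 0, 0, 1, 0, 0], ![0, 0, 1, 0, 0, 0], ![0, 1,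
    0, 0, 0, 0], ![1, 0, 0, 0, 0, 0], ![0, 0, 0, 0, 1, 1], ![0, 0, 0, 1, 1, 0], ![0, 0, 1, 1, 0,
    0], ![0, 1, 0, 1, 0, 0], ![1, 0, 1, 0, 0, 0], ![0, 0, 0, 1, 1, 1], ![0, 0, 1, 1, 1, 0], ![0,
    1, 0, 1, 1, 0], ![0, 1, 1, 1, 0, 0], ![1, 0, 1, 1, 0, 0], ![0, 0, 1, 1, 1, 1], ![0, 1, 0, 1,
    1, 1], ![0, 1, 1, 1, 1, 0], ![1, 0, 1, 1, 1, 0], ![1, 1, 1, 1, 0, 0], ![0, 1, 1, 1, 1, 1],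
    ![0, 1, 1, 2, 1, 0], ![1, 0, 1, 1, 1, 1], ![1, 1, 1, 1, 1, 0], ![0, 1, 1, 2, 1, 1], ![1, 1,
    1, 1, 1, 1], ![1, 1, 1, 2, 1, 0], ![0, 1, 1, 2, 2, 1], ![1, 1, 1, 2, 1, 1], ![1, 1, 2, 2, 1,
    0], ![1, 1, 1, 2, 2, 1], ![1, 1, 2, 2, 1, 1], ![1, 1, 2, 2, 2, 1], ![1, 1, 2, 3, 2, 1], ![1,
    2, 2, 3, 2, 1]]

/-- The coefficients of the roots of type `E₆`. -/
def rootsE₆ : List (Fin 6 → ℤ) := posE₆ ++ posE₆.map fun c ↦ -c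

/-- The Gram matrix of the simple roots of type `F₄`. -/
def gramF₄ : Matrix (Fin 4) (Fin 4) ℤ :=
  !![4, -2, 0, 0; -2, 4, -2, 0; 0, -2, 2, -1; 0, 0, -1, 2]

/-- The coroot, in terms of the dual basis of the simple roots, of a root of type `F₄`. -/
def corF₄ (c : Fin 4 → ℤ) (i : Fin 4) : ℤ := 2 * (gramF₄ *ᵥ c) i / (c ⬝ᵥ gramF₄ *ᵥ c)

/-- The pairings of a vector with the simple coroots of type `F₄`. -/
def pairF₄ (c : Fin 4 → ℤ) : Fin 4 → ℤ :=
  ![2 * c 0 - c 1, 2 * c 1 - c 0 - c 2, 2 * c 2 - 2 * c 1 - c 3, 2 * c 3 - c 2]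

/-- The pairings of a vector with the simple coroots of type `E₆`. -/
def pairE₆ (c : Fin 6 → ℤ) : Fin 6 → ℤ :=
  ![2 * c 0 - c 2, 2 * c 1 - c 3, 2 * c 2 - c 0 - c 3, 2 * c 3 - c 1 - c 2 - c 4,
    2 * c 4 - c 3 - c 5, 2 * c 5 - c 4]

lemma dotProduct_corF₄ (c : Fin 4 → ℤ) (i : Fin 4) :
    c ⬝ᵥ corF₄ (Pi.single i 1) = pairF₄ c i := by
  have h : ∀ i j, corF₄ (Pi.single i 1) j = CartanMatrix.F₄ j i := by decide +kernel
  rw [show corF₄ (Pi.single i 1) = fun j ↦ CartanMatrix.F₄ j i from funext (h i), dotProduct,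
    Fin.sum_univ_four]
  fin_cases i <;> simp [CartanMatrix.F₄, pairF₄] <;> ring

lemma mulVec_E₆ (c : Fin 6 → ℤ) : CartanMatrix.E₆ *ᵥ c = pairE₆ c := by
  funext i
  rw [mulVec, dotProduct, Fin.sum_univ_six]
  fin_cases i <;> simp [CartanMatrix.E₆, pairE₆] <;> ring

lemma dotProduct_pairE₆ (c : Fin 6 → ℤ) (i : Fin 6) :
    c ⬝ᵥ pairE₆ (Pi.single i 1) = pairE₆ c i := by
  rw [← mulVec_E₆, dotProduct_mulVec, dotProduct_single, mul_one, ← mulVec_transpose,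
    CartanMatrix.E₆_transpose, mulVec_E₆]

/-- A simple reflection changes one coefficient only, so it decreases the sum of absolute values as
soon as that coefficient becomes smaller in absolute value. -/
lemma sub_smul_single {n : ℕ} (c : Fin n → ℤ) (i : Fin n) (k : ℤ) :
    c - k • Pi.single i 1 = Function.update c i (c i - k) := by
  funext j
  by_cases h : j = i
  · subst h; simp
  · simp [h]

lemma sum_natAbs_update_lt {n : ℕ} (c : Fin n → ℤ) {i : Fin n} {x : ℤ}
    (h : x.natAbs < (c i).natAbs) :
    ∑ j, (Function.update c i x j).natAbs < ∑ j, (c j).natAbs := by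
  refine Finset.sum_lt_sum (fun j _ ↦ ?_) ⟨i, Finset.mem_univ i, by simpa using h⟩
  by_cases hj : j = i
  · subst hj; simpa using h.le
  · simp [hj]

section

variable {K V : Type*} [Field K] [CharZero K] [AddCommGroup V] [Module K V]

/-- The height is the sum of the absolute values of the coefficients. As only simple reflections
occur, each hypothesis of the criterion is a check of single vectors of the list against the four
simple roots. -/
theorem isRootBasis_F₄ (β : Module.Basis (Fin 4) K V) :
    IsRootBasis K {v | ∃ c ∈ rootsF₄, v = ∑ i, (c i : K) • β i} β CartanMatrix.F₄ := by
  have hstep : ∀ c ∈ rootsF₄, ∀ i, Function.update c i (c i - pairF₄ c i) ∈ rootsF₄ := by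
    decide +kernel
  have hgen : ∀ c ∈ rootsF₄, (∃ i, (c i - pairF₄ c i).natAbs < (c i).natAbs) ∨
      ∃ i, c = Pi.single i 1 ∨ c = -Pi.single i 1 := by decide +kernel
  have hred : ∀ i, ∀ d ∈ rootsF₄, corF₄ d i * pairF₄ d i = 4 →
      d = Pi.single i 1 ∨ d = -Pi.single i 1 := by decide +kernel
  -- This includes the fact that the integer division in `corF₄` is exact on roots.
  have hcor : ∀ c ∈ rootsF₄, (c ⬝ᵥ gramF₄ *ᵥ c) • corF₄ c = (2 : ℤ) • (gramF₄ *ᵥ c) := by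
    decide +kernel
  have hne : ∀ c ∈ rootsF₄, c ⬝ᵥ gramF₄ *ᵥ c ≠ 0 := by decide +kernel
  have hs : ∀ i, Pi.single i 1 ∈ rootsF₄ := by decide +kernel
  have hC : ∀ j i : Fin 4, corF₄ (Pi.single j 1) i = CartanMatrix.F₄ i j := by decide +kernel
  have hpos : ∀ c ∈ rootsF₄, (∀ i, 0 ≤ c i) ∨ ∀ i, c i ≤ 0 := by decide +kernel
  refine isRootBasis_of_simple_reflections β {c | c ∈ rootsF₄} (List.finite_toSet _) gramF₄
    (by decide +kernel) corF₄ CartanMatrix.F₄ hcor hne hs (fun i j ↦ hC j i) (fun c hc i ↦ ?_)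
    (fun c ↦ ∑ j, (c j).natAbs) (fun c hc ↦ ?_) hpos (fun i d hd h ↦ ?_)
  · rw [dotProduct_corF₄, sub_smul_single]; exact hstep c hc i
  · simp only [dotProduct_corF₄, sub_smul_single]
    exact (hgen c hc).symm.imp_right fun ⟨i, hi⟩ ↦ ⟨i, sum_natAbs_update_lt c hi⟩
  · rw [single_dotProduct, one_mul, dotProduct_corF₄] at h; exact hred i d hd h

theorem isRootBasis_E₆ (β : Module.Basis (Fin 6) K V) :
    IsRootBasis K {v | ∃ c ∈ rootsE₆, v = ∑ i, (c i : K) • β i} β CartanMatrix.E₆ := by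
  have hstep : ∀ c ∈ rootsE₆, ∀ i, Function.update c i (c i - pairE₆ c i) ∈ rootsE₆ := by
    decide +kernel
  have hgen : ∀ c ∈ rootsE₆, (∃ i, (c i - pairE₆ c i).natAbs < (c i).natAbs) ∨
      ∃ i, c = Pi.single i 1 ∨ c = -Pi.single i 1 := by decide +kernel
  have hred : ∀ i, ∀ d ∈ rootsE₆, pairE₆ d i * pairE₆ d i = 4 →
      d = Pi.single i 1 ∨ d = -Pi.single i 1 := by decide +kernel
  -- All roots have the same length, so the Cartan matrix is itself the Gram matrix and the coroot
  -- map `pairE₆` is linear; no division is needed.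
  have hq : ∀ c ∈ rootsE₆, c ⬝ᵥ pairE₆ c = 2 := by decide +kernel
  have hs : ∀ i, Pi.single i 1 ∈ rootsE₆ := by decide +kernel
  have hC : ∀ j i : Fin 6, pairE₆ (Pi.single j 1) i = CartanMatrix.E₆ i j := by decide +kernel
  have hpos : ∀ c ∈ rootsE₆, (∀ i, 0 ≤ c i) ∨ ∀ i, c i ≤ 0 := by decide +kernel
  refine isRootBasis_of_simple_reflections β {c | c ∈ rootsE₆} (List.finite_toSet _)
    CartanMatrix.E₆ CartanMatrix.E₆_transpose pairE₆ CartanMatrix.E₆ (fun c hc ↦ ?_)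
    (fun c hc ↦ ?_) hs (fun i j ↦ hC j i) (fun c hc i ↦ ?_)
    (fun c ↦ ∑ j, (c j).natAbs) (fun c hc ↦ ?_) hpos (fun i d hd h ↦ ?_)
  · rw [mulVec_E₆, hq c hc]
  · rw [mulVec_E₆, hq c hc]; decide
  · rw [dotProduct_pairE₆, sub_smul_single]; exact hstep c hc i
  · simp only [dotProduct_pairE₆, sub_smul_single]
    exact (hgen c hc).symm.imp_right fun ⟨i, hi⟩ ↦ ⟨i, sum_natAbs_update_lt c hi⟩
  · rw [single_dotProduct, one_mul, dotProduct_pairE₆] at h; exact hred i d hd h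

end

end RootLists

/-! ### The sets Φ, Φ⁺ and Δ as sets of weights. -/

section WeightTables

open Os

/-- Half of an integral vector. -/
noncomputable def half {n : ℕ} (w : Fin n → ℤ) : Fin n → ℝ := fun k ↦ (w k : ℝ) / 2

lemma half_injective {n : ℕ} : Function.Injective (half (n := n)) := fun v w h ↦ by
  funext k
  have := congrFun h k
  simp only [half] at this
  exact_mod_cast (div_left_inj' (two_ne_zero (α := ℝ))).mp this

lemma half_neg {n : ℕ} (w : Fin n → ℤ) : half (-w) = -half w := by
  funext k; simp [half]; ring

lemma half_zero {n : ℕ} : half (0 : Fin n → ℤ) = 0 := by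
  funext k; simp [half]

lemma half_two_mul {n : ℕ} (w : Fin n → ℤ) : half (fun k ↦ 2 * w k) = fun k ↦ (w k : ℝ) := by
  funext k; simp [half]

/-- Positivity for the lexicographic order. -/
def LexPos (w : Fin 4 → ℤ) : Prop :=
  0 < w 0 ∨ w 0 = 0 ∧ (0 < w 1 ∨ w 1 = 0 ∧ (0 < w 2 ∨ w 2 = 0 ∧ 0 < w 3))

instance (w : Fin 4 → ℤ) : Decidable (LexPos w) := inferInstanceAs (Decidable (_ ∨ _))

lemma intCast_single {n : ℕ} (j : Fin n) (s : ℤ) :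
    (fun k ↦ ((Pi.single j s : Fin n → ℤ) k : ℝ)) = Pi.single j (s : ℝ) := by
  funext k
  by_cases h : k = j
  · subst h; simp
  · simp [h]

lemma half_single_add_single {n : ℕ} (j k : Fin n) (s r : ℤ) :
    half (fun m ↦ 2 * ((Pi.single j s : Fin n → ℤ) m + (Pi.single k r : Fin n → ℤ) m)) =
      Pi.single j (s : ℝ) + Pi.single k (r : ℝ) := by
  rw [half_two_mul, ← intCast_single, ← intCast_single]
  funext m
  simp

lemma exists_sign {s : ℝ} (h : s = 1 ∨ s = -1) : ∃ r ∈ ([1, -1] : List ℤ), s = r := by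
  rcases h with rfl | rfl
  · exact ⟨1, by simp, by simp⟩
  · exact ⟨-1, by simp, by simp⟩

lemma sign_cases {r : ℤ} (h : r ∈ ([1, -1] : List ℤ)) : (r : ℝ) = 1 ∨ (r : ℝ) = -1 := by
  simp only [List.mem_cons, List.not_mem_nil, or_false] at h
  rcases h with rfl | rfl <;> simp

/-- The weight of t_{b,c} is the sum of two weights of ι₀, that is, of two vectors ±w_j. It vanishes
exactly for dual vectors, and otherwise is a long root. -/
lemma mem_PhiLong_iff (v : Fin 4 → ℝ) : v ∈ PhiLong ↔
    ∃ b c : Fin 8, b < c ∧ triWeight b c ≠ 0 ∧ v = half (triWeight b c) := by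
  have h1 : ∀ j k : Fin 4, j ≠ k → ∀ s ∈ ([1, -1] : List ℤ), ∀ r ∈ ([1, -1] : List ℤ),
      ∃ b c : Fin 8, b < c ∧ triWeight b c ≠ 0 ∧ triWeight b c =
        fun m ↦ 2 * ((Pi.single j s : Fin 4 → ℤ) m + (Pi.single k r : Fin 4 → ℤ) m) := by
    decide +kernel
  have h2 : ∀ b c : Fin 8, b < c → triWeight b c ≠ 0 → ∃ j k : Fin 4, j ≠ k ∧
      ∃ s ∈ ([1, -1] : List ℤ), ∃ r ∈ ([1, -1] : List ℤ), triWeight b c =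
        fun m ↦ 2 * ((Pi.single j s : Fin 4 → ℤ) m + (Pi.single k r : Fin 4 → ℤ) m) := by
    decide +kernel
  constructor
  · rintro ⟨j, k, hjk, s, r, hs, hr, rfl⟩
    obtain ⟨s, hs', rfl⟩ := exists_sign hs
    obtain ⟨r, hr', rfl⟩ := exists_sign hr
    obtain ⟨b, c, hbc, h0, h⟩ := h1 j k hjk s hs' r hr'
    exact ⟨b, c, hbc, h0, by rw [h, half_single_add_single]⟩
  · rintro ⟨b, c, hbc, h0, rfl⟩
    obtain ⟨j, k, hjk, s, hs, r, hr, h⟩ := h2 b c hbc h0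
    exact ⟨j, k, hjk, s, r, sign_cases hs, sign_cases hr, by rw [h, half_single_add_single]⟩

lemma exists_signs {s : Fin 4 → ℝ} (h : ∀ i, s i = 1 ∨ s i = -1) :
    ∃ σ : Fin 4 → Fin 2, s = fun i ↦ (E62.sign (σ i) : ℝ) := by
  refine ⟨fun i ↦ if s i = 1 then 0 else 1, funext fun i ↦ ?_⟩
  rcases h i with h | h
  · simp [h, E62.sign]
  · have h1 : ¬(s i = 1) := by rw [h]; norm_num
    dsimp only
    rw [if_neg h1, h]
    simp [E62.sign]

lemma sign_eq (a : Fin 2) : (E62.sign a : ℝ) = 1 ∨ (E62.sign a : ℝ) = -1 := by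
  fin_cases a <;> simp [E62.sign]

lemma mem_PhiHalf_iff (c : ℤ) (v : Fin 4 → ℝ) : v ∈ PhiHalf c ↔
    ∃ σ : Fin 4 → Fin 2, ∏ i, E62.sign (σ i) = c ∧ v = half fun i ↦ E62.sign (σ i) := by
  constructor
  · rintro ⟨s, hs, hp, rfl⟩
    obtain ⟨σ, rfl⟩ := exists_signs hs
    dsimp only at hp
    refine ⟨σ, by exact_mod_cast hp, funext fun k ↦ ?_⟩
    simp only [half, Pi.smul_apply, smul_eq_mul]; ring
  · rintro ⟨σ, hp, rfl⟩
    refine ⟨fun i ↦ (E62.sign (σ i) : ℝ), fun i ↦ sign_eq _, ?_, funext fun k ↦ ?_⟩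
    · dsimp only; exact_mod_cast hp
    · simp only [half, Pi.smul_apply, smul_eq_mul]; ring

/-- Once real signs are replaced by integers, both inclusions compare finite tables: the short roots
in Φ_i are the weights of h₀ on ι_i. -/
lemma mem_PhiShort_iff (i : Fin 3) (v : Fin 4 → ℝ) :
    v ∈ PhiShort i ↔ ∃ b, v = half (weight i b) := by
  have h0 : ∀ j : Fin 4, ∀ s ∈ ([1, -1] : List ℤ), ∃ b,
      weight 0 b = fun m ↦ 2 * (Pi.single j s : Fin 4 → ℤ) m := by decide +kernel
  have h0' : ∀ b, ∃ j : Fin 4, ∃ s ∈ ([1, -1] : List ℤ),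
      weight 0 b = fun m ↦ 2 * (Pi.single j s : Fin 4 → ℤ) m := by decide +kernel
  have h1 : ∀ σ : Fin 4 → Fin 2, ∏ i, E62.sign (σ i) = 1 →
      ∃ b, weight 1 b = fun i ↦ E62.sign (σ i) := by decide +kernel
  have h1' : ∀ b, ∃ σ : Fin 4 → Fin 2, ∏ i, E62.sign (σ i) = 1 ∧
      weight 1 b = fun i ↦ E62.sign (σ i) := by decide +kernel
  have h2 : ∀ σ : Fin 4 → Fin 2, ∏ i, E62.sign (σ i) = -1 →
      ∃ b, weight 2 b = fun i ↦ E62.sign (σ i) := by decide +kernel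
  have h2' : ∀ b, ∃ σ : Fin 4 → Fin 2, ∏ i, E62.sign (σ i) = -1 ∧
      weight 2 b = fun i ↦ E62.sign (σ i) := by decide +kernel
  fin_cases i
  · change v ∈ PhiZero ↔ ∃ b, v = half (weight 0 b)
    constructor
    · rintro ⟨j, s, hs, rfl⟩
      obtain ⟨s, hs', rfl⟩ := exists_sign hs
      obtain ⟨b, hb⟩ := h0 j s hs'
      exact ⟨b, by rw [hb, half_two_mul, intCast_single]⟩
    · rintro ⟨b, rfl⟩
      obtain ⟨j, s, hs, h⟩ := h0' b
      exact ⟨j, s, sign_cases hs, by rw [h, half_two_mul, intCast_single]⟩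
  · change v ∈ PhiHalf 1 ↔ ∃ b, v = half (weight 1 b)
    rw [← Int.cast_one, mem_PhiHalf_iff]
    constructor
    · rintro ⟨σ, hσ, rfl⟩
      obtain ⟨b, hb⟩ := h1 σ hσ
      exact ⟨b, by rw [hb]⟩
    · rintro ⟨b, rfl⟩
      obtain ⟨σ, hσ, hb⟩ := h1' b
      exact ⟨σ, hσ, by rw [hb]⟩
  · change v ∈ PhiHalf (-1) ↔ ∃ b, v = half (weight 2 b)
    rw [show (-1 : ℝ) = ((-1 : ℤ) : ℝ) by norm_num, mem_PhiHalf_iff]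
    constructor
    · rintro ⟨σ, hσ, rfl⟩
      obtain ⟨b, hb⟩ := h2 σ hσ
      exact ⟨b, by rw [hb]⟩
    · rintro ⟨b, rfl⟩
      obtain ⟨σ, hσ, hb⟩ := h2' b
      exact ⟨σ, hσ, by rw [hb]⟩

lemma weight_ne_zero : ∀ i b, weight i b ≠ 0 := by decide +kernel

lemma mem_Phi_iff (v : Fin 4 → ℝ) :
    v ∈ Phi ↔ ∃ j : E62.Ind₀, E62.indWeight₀ j ≠ 0 ∧ v = half (E62.indWeight₀ j) := by
  rw [Phi, Set.mem_union, Set.mem_iUnion, mem_PhiLong_iff]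
  simp only [mem_PhiShort_iff]
  constructor
  · rintro (⟨b, c, h, h0, hv⟩ | ⟨i, b, hv⟩)
    · exact ⟨Sum.inl ⟨(b, c), h⟩, h0, hv⟩
    · exact ⟨Sum.inr (i, b), weight_ne_zero i b, hv⟩
  · rintro ⟨⟨⟨b, c⟩, h⟩ | ⟨i, b⟩, h0, hv⟩
    · exact Or.inl ⟨b, c, h, h0, hv⟩
    · exact Or.inr ⟨i, b, hv⟩

/-- Φ⁺ is the set of roots that are positive for the lexicographic order of w₁, …, w₄, which is
decidable on integral vectors. -/
lemma mem_PhiPos_iff (v : Fin 4 → ℝ) :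
    v ∈ PhiPos ↔ ∃ j : E62.Ind₀, LexPos (E62.indWeight₀ j) ∧ v = half (E62.indWeight₀ j) := by
  have h1 : ∀ j k : Fin 4, j < k → ∀ r ∈ ([1, -1] : List ℤ), ∃ b c : Fin 8, b < c ∧
      LexPos (triWeight b c) ∧ triWeight b c =
        fun m ↦ 2 * ((Pi.single j 1 : Fin 4 → ℤ) m + (Pi.single k r : Fin 4 → ℤ) m) := by
    decide +kernel
  have h1' : ∀ b c : Fin 8, b < c → LexPos (triWeight b c) → ∃ j k : Fin 4, j < k ∧
      ∃ r ∈ ([1, -1] : List ℤ), triWeight b c =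
        fun m ↦ 2 * ((Pi.single j 1 : Fin 4 → ℤ) m + (Pi.single k r : Fin 4 → ℤ) m) := by
    decide +kernel
  have h2 : ∀ j : Fin 4, ∃ b, LexPos (weight 0 b) ∧
      weight 0 b = fun m ↦ 2 * (Pi.single j 1 : Fin 4 → ℤ) m := by decide +kernel
  have h2' : ∀ b, LexPos (weight 0 b) → ∃ j : Fin 4,
      weight 0 b = fun m ↦ 2 * (Pi.single j 1 : Fin 4 → ℤ) m := by decide +kernel
  have h3 : ∀ σ : Fin 4 → Fin 2, E62.sign (σ 0) = 1 → ∃ i b, LexPos (weight i b) ∧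
      weight i b = fun k ↦ E62.sign (σ k) := by decide +kernel
  have h3' : ∀ i b, i ≠ 0 → LexPos (weight i b) → ∃ σ : Fin 4 → Fin 2, E62.sign (σ 0) = 1 ∧
      weight i b = fun k ↦ E62.sign (σ k) := by decide +kernel
  constructor
  · rintro ((⟨j, k, hjk, r, hr, rfl⟩ | ⟨j, rfl⟩) | ⟨s, hs0, hs, rfl⟩)
    · obtain ⟨r, hr', rfl⟩ := exists_sign hr
      obtain ⟨b, c, hbc, hp, h⟩ := h1 j k hjk r hr'
      refine ⟨Sum.inl ⟨(b, c), hbc⟩, hp, ?_⟩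
      change _ = half (triWeight b c)
      rw [h, half_single_add_single, Int.cast_one]
    · obtain ⟨b, hp, h⟩ := h2 j
      refine ⟨Sum.inr (0, b), hp, ?_⟩
      change _ = half (weight 0 b)
      rw [h, half_two_mul, intCast_single, Int.cast_one]
    · obtain ⟨σ, rfl⟩ := exists_signs hs
      dsimp only at hs0
      obtain ⟨i, b, hp, h⟩ := h3 σ (by exact_mod_cast hs0)
      refine ⟨Sum.inr (i, b), hp, ?_⟩
      change _ = half (weight i b)
      rw [h]
      funext k
      simp only [half, Pi.smul_apply, smul_eq_mul]; ring
  · rintro ⟨⟨⟨b, c⟩, hbc⟩ | ⟨i, b⟩, hp, rfl⟩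
    · obtain ⟨j, k, hjk, r, hr, h⟩ := h1' b c hbc hp
      refine Or.inl (Or.inl ⟨j, k, hjk, r, sign_cases hr, ?_⟩)
      change half (triWeight b c) = _
      rw [h, half_single_add_single, Int.cast_one]
    · change half (weight i b) ∈ _
      replace hp : LexPos (weight i b) := hp
      by_cases hi : i = 0
      · subst hi
        obtain ⟨j, h⟩ := h2' b hp
        refine Or.inl (Or.inr ⟨j, ?_⟩)
        rw [h, half_two_mul, intCast_single, Int.cast_one]
      · obtain ⟨σ, hσ, h⟩ := h3' i b hi hp
        refine Or.inr ⟨fun k ↦ (E62.sign (σ k) : ℝ), ?_, fun k ↦ sign_eq _, ?_⟩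
        · dsimp only; exact_mod_cast hσ
        · rw [h]
          funext k
          simp only [half, Pi.smul_apply, smul_eq_mul]; ring

lemma extend_half (w : Fin 4 → ℤ) (x y : ℂ) : extend (half w) x y =
    ![(w 0 : ℂ) * (1 / 2), (w 1 : ℂ) * (1 / 2), (w 2 : ℂ) * (1 / 2), (w 3 : ℂ) * (1 / 2), x, y] := by
  simp only [extend, half]
  push_cast
  simp only [div_eq_mul_inv, one_mul]

lemma indWeightC_mul_unit (j : E62.Ind) : (fun k ↦ (E62.indWeightC j k : ℂ) * E62.unit k) =
    extend (half (E62.indWeight j)) (E62.indWeightC' j 0 * (Complex.I / 2))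
      (E62.indWeightC' j 1 * (Complex.I / 2)) := by
  rw [extend_half]
  funext k
  fin_cases k <;> rfl

lemma mem_Delta_iff (v : Fin 6 → ℂ) :
    v ∈ Delta ↔ ∃ j : E62.Ind, E62.indWeightC j ≠ 0 ∧
      v = fun k ↦ (E62.indWeightC j k : ℂ) * E62.unit k := by
  have hI (s : ℂ) (hs : s = Complex.I ∨ s = -Complex.I) :
      ∃ k, s = (E62.sign k : ℂ) * Complex.I := by
    rcases hs with rfl | rfl
    · exact ⟨0, by simp [E62.sign]⟩
    · exact ⟨1, by simp [E62.sign]⟩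
  have hI' (k : Fin 2) : (E62.sign k : ℂ) * Complex.I = Complex.I ∨
      (E62.sign k : ℂ) * Complex.I = -Complex.I := by
    fin_cases k <;> simp [E62.sign]
  have hs (k : Fin 2) : (E62.sign (k + 1) : ℂ) = -E62.sign k := by
    fin_cases k <;> simp [E62.sign]
  have hne (i : Fin 3) (b : Fin 8) (k : Fin 2) :
      E62.indWeightC (Sum.inr (Sum.inr ⟨i, b, k⟩)) ≠ 0 := by
    revert i b k; decide +kernel
  have hne' (b c : Fin 8) (h : b < c) :
      E62.indWeightC (Sum.inl ⟨(b, c), h⟩) ≠ 0 ↔ triWeight b c ≠ 0 := by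
    revert b c; decide +kernel
  simp only [indWeightC_mul_unit]
  constructor
  · rintro (((⟨w, hw, rfl⟩ | ⟨w, hw, s, hs', rfl⟩) | ⟨w, hw, s, hs', rfl⟩) | ⟨w, hw, s, hs', rfl⟩)
    · obtain ⟨b, c, h, h0, rfl⟩ := (mem_PhiLong_iff w).mp hw
      refine ⟨Sum.inl ⟨(b, c), h⟩, (hne' b c h).mpr h0, ?_⟩
      simp [E62.indWeightC']; rfl
    · obtain ⟨b, rfl⟩ := (mem_PhiShort_iff _ w).mp hw
      obtain ⟨k, rfl⟩ := hI s hs'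
      refine ⟨Sum.inr (Sum.inr ⟨0, b, k⟩), hne _ _ _, ?_⟩
      change _ = extend (half (weight 0 b)) _ _
      congr 1 <;> simp [E62.indWeightC', E62.weightC] <;> ring
    · obtain ⟨b, rfl⟩ := (mem_PhiShort_iff _ w).mp hw
      obtain ⟨k, rfl⟩ := hI s hs'
      refine ⟨Sum.inr (Sum.inr ⟨1, b, k⟩), hne _ _ _, ?_⟩
      change _ = extend (half (weight 1 b)) _ _
      congr 1 <;> simp [E62.indWeightC', E62.weightC] <;> ring
    · obtain ⟨b, rfl⟩ := (mem_PhiShort_iff _ w).mp hw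
      obtain ⟨k, rfl⟩ := hI s hs'
      -- The weights of h₅, h₆ on ι₂ are proportional to (-2, 1), whereas the fourth family in
      -- `Delta` is written with (1, -1/2); the shift of `k` compensates for the sign.
      refine ⟨Sum.inr (Sum.inr ⟨2, b, k + 1⟩), hne _ _ _, ?_⟩
      change _ = extend (half (weight 2 b)) _ _
      congr 1 <;> simp [E62.indWeightC', E62.weightC, hs] <;> ring
  · rintro ⟨⟨⟨b, c⟩, h⟩ | k | ⟨i, b, k⟩, h0, rfl⟩
    · refine Or.inl (Or.inl (Or.inl ⟨half (triWeight b c),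
        (mem_PhiLong_iff _).mpr ⟨b, c, h, (hne' b c h).mp h0, rfl⟩, ?_⟩))
      simp [E62.indWeightC']; rfl
    · refine absurd ?_ h0
      revert k; decide +kernel
    · have hw := (mem_PhiShort_iff i (half (weight i b))).mpr ⟨b, rfl⟩
      fin_cases i
      · refine Or.inl (Or.inl (Or.inr ⟨_, hw, _, hI' k, ?_⟩))
        change extend (half (weight 0 b)) _ _ = _
        congr 1 <;> simp [E62.indWeightC', E62.weightC] <;> ring
      · refine Or.inl (Or.inr ⟨_, hw, _, hI' k, ?_⟩)
        change extend (half (weight 1 b)) _ _ = _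
        congr 1 <;> simp [E62.indWeightC', E62.weightC] <;> ring
      · refine Or.inr ⟨_, hw, _, hI' (k + 1), ?_⟩
        change extend (half (weight 2 b)) _ _ = _
        congr 1 <;> simp [E62.indWeightC', E62.weightC, hs] <;> ring

end WeightTables

/-! ### Weights in terms of simple roots. -/

section RootTables

open Os

/-- The vector with given coefficients in terms of the simple roots of type `F₄`, doubled. -/
def combF₄ (c : Fin 4 → ℤ) : Fin 4 → ℤ :=
  ![c 3, 2 * c 0 - c 3, 2 * c 1 - 2 * c 0 - c 3, 2 * c 2 - 2 * c 1 - c 3]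

/-- The inverse of `combF₄`. -/
def coefF₄ (n : Fin 4 → ℤ) : Fin 4 → ℤ :=
  ![(n 1 + n 0) / 2, (n 2 + n 1 + 2 * n 0) / 2, (n 3 + n 2 + n 1 + 3 * n 0) / 2, n 0]

/-- The vector with given coefficients in terms of the simple roots of type `E₆`, up to the factors
`unit`. -/
def combE₆ (c : Fin 6 → ℤ) : Fin 6 → ℤ :=
  ![c 0 + c 5, 2 * c 1 - c 0 - c 5, 2 * c 3 - 2 * c 1 - c 0 - c 5,
    2 * c 2 + 2 * c 4 - 2 * c 3 - c 0 - c 5, 2 * c 0 - c 2 + c 4 - 2 * c 5, c 4 + c 5 - c 0 - c 2]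

/-- The inverse of `combE₆`. -/
def coefE₆ (n : Fin 6 → ℤ) : Fin 6 → ℤ :=
  let a := (n 4 - n 5) / 3
  let s := (n 3 + n 2 + n 1 + 3 * n 0) / 2
  ![(n 0 + a) / 2, (n 1 + n 0) / 2, (s - n 5 - a) / 2, (n 2 + 2 * n 0 + n 1) / 2,
    (s + n 5 + a) / 2, (n 0 - a) / 2]

/-- This is one half of the comparison of the weight table with the root list: every listed
combination occurs as a weight. -/
lemma exists_of_mem_rootsF₄ : ∀ c ∈ rootsF₄, (∃ i b, weight i b = combF₄ c) ∨
    ∃ b c' : Fin 8, b < c' ∧ triWeight b c' ≠ 0 ∧ triWeight b c' = combF₄ c := by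
  decide +kernel

/-- The second conjunct shows that the integer divisions in `coefF₄` lose nothing on these weights.
-/
lemma coefF₄_weight : ∀ i b, coefF₄ (weight i b) ∈ rootsF₄ ∧
    combF₄ (coefF₄ (weight i b)) = weight i b := by decide +kernel

lemma coefF₄_triWeight : ∀ b c : Fin 8, b < c → triWeight b c ≠ 0 →
    coefF₄ (triWeight b c) ∈ rootsF₄ ∧ combF₄ (coefF₄ (triWeight b c)) = triWeight b c := by
  decide +kernel

/-- The weights on `ι_i(pO_s ⊗ pC)`, up to the factors `unit`. -/
def iotaWeightC (i : Fin 3) (b : Fin 8) (k : Fin 2) : Fin 6 → ℤ :=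
  ![weight i b 0, weight i b 1, weight i b 2, weight i b 3, E62.sign k * E62.weightC i 0,
    E62.sign k * E62.weightC i 1]

/-- The weights on `tri(pO_s)`, up to the factors `unit`. -/
def triWeightC (b c : Fin 8) : Fin 6 → ℤ :=
  ![triWeight b c 0, triWeight b c 1, triWeight b c 2, triWeight b c 3, 0, 0]

lemma exists_of_mem_rootsE₆ : ∀ c ∈ rootsE₆, (∃ i b k, iotaWeightC i b k = combE₆ c) ∨
    ∃ b c' : Fin 8, b < c' ∧ triWeight b c' ≠ 0 ∧ triWeightC b c' = combE₆ c := by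
  decide +kernel

lemma coefE₆_iotaWeightC : ∀ i b k, coefE₆ (iotaWeightC i b k) ∈ rootsE₆ ∧
    combE₆ (coefE₆ (iotaWeightC i b k)) = iotaWeightC i b k := by decide +kernel

lemma coefE₆_triWeightC : ∀ b c : Fin 8, b < c → triWeight b c ≠ 0 →
    coefE₆ (triWeightC b c) ∈ rootsE₆ ∧ combE₆ (coefE₆ (triWeightC b c)) = triWeightC b c := by
  decide +kernel

end RootTables

/-! ### The simple roots as bases. -/

section SimpleRoots

open Module

/-- The basis of `ℝ⁴` consisting of the simple roots of type `F₄`. -/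
noncomputable def simplePhiBasis : Basis (Fin 4) ℝ (Fin 4 → ℝ) := by
  refine basisOfLinearIndependentOfCardEqFinrank (b := simplePhi) ?_ (by simp)
  rw [Fintype.linearIndependent_iff]
  intro c hc
  rw [Fin.sum_univ_four] at hc
  have h0 := congrFun hc 0
  have h1 := congrFun hc 1
  have h2 := congrFun hc 2
  have h3 := congrFun hc 3
  simp [simplePhi] at h0 h1 h2 h3
  intro i
  fin_cases i
  · change c 0 = 0; linarith
  · change c 1 = 0; linarith
  · change c 2 = 0; linarith
  · change c 3 = 0; linarith

lemma simplePhiBasis_apply (i : Fin 4) : simplePhiBasis i = simplePhi i := by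
  rw [simplePhiBasis, coe_basisOfLinearIndependentOfCardEqFinrank]

lemma sum_simplePhi (c : Fin 4 → ℤ) : ∑ i, (c i : ℝ) • simplePhi i = half (combF₄ c) := by
  rw [Fin.sum_univ_four]
  funext k
  fin_cases k <;> simp [simplePhi, half, combF₄] <;> ring

/-- The basis of `ℂ⁶` consisting of the simple roots of type `E₆`. -/
noncomputable def simpleRootsBasis : Basis (Fin 6) ℂ (Fin 6 → ℂ) := by
  refine basisOfLinearIndependentOfCardEqFinrank (b := simpleRoots) ?_ (by simp)
  rw [Fintype.linearIndependent_iff]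
  intro c hc
  rw [Fin.sum_univ_six] at hc
  have h0 := congrFun hc 0
  have h1 := congrFun hc 1
  have h2 := congrFun hc 2
  have h3 := congrFun hc 3
  have h4 := congrFun hc 4
  have h5 := congrFun hc 5
  simp [simpleRoots] at h0 h1 h2 h3 h4 h5
  have hI := Complex.I_mul_I
  have e1 : c 1 = 0 := by linear_combination h1 + h0
  have e3 : c 3 = 0 := by linear_combination h2 + 2 * h0 + h1
  have a : c 0 + c 5 = 0 := by linear_combination 2 * h0
  have b : c 2 + c 4 = 0 := by linear_combination h3 + h0 + e3
  -- The difference of the fifth and sixth coordinate equations is (3/2) i (c₀ - c₅) = 0, so the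
  -- factor -(2/3) i isolates c₀ - c₅.
  have d : c 0 - c 5 = 0 := by
    linear_combination (-2 / 3 * Complex.I) * (h4 - h5) + (c 0 - c 5) * hI
  have e : c 4 - c 2 = 0 := by
    linear_combination (-2 * Complex.I) * h4 + (2 * c 0 - c 2 + c 4 - 2 * c 5) * hI - 2 * d
  intro i
  fin_cases i
  · change c 0 = 0; linear_combination (a + d) / 2
  · exact e1
  · change c 2 = 0; linear_combination (b - e) / 2
  · exact e3
  · change c 4 = 0; linear_combination (b + e) / 2
  · change c 5 = 0; linear_combination (a - d) / 2

lemma simpleRootsBasis_apply (i : Fin 6) : simpleRootsBasis i = simpleRoots i := by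
  rw [simpleRootsBasis, coe_basisOfLinearIndependentOfCardEqFinrank]

lemma sum_simpleRoots (c : Fin 6 → ℤ) :
    ∑ i, (c i : ℂ) • simpleRoots i = fun k ↦ (combE₆ c k : ℂ) * E62.unit k := by
  rw [Fin.sum_univ_six]
  funext k
  fin_cases k <;> simp [simpleRoots, E62.unit, combE₆] <;> ring

lemma mem_Phi_iff_rootsF₄ (v : Fin 4 → ℝ) :
    v ∈ Phi ↔ ∃ c ∈ rootsF₄, v = ∑ i, (c i : ℝ) • simplePhi i := by
  rw [mem_Phi_iff]
  simp only [sum_simplePhi]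
  constructor
  · rintro ⟨⟨⟨b, c⟩, h⟩ | ⟨i, b⟩, h0, rfl⟩
    · obtain ⟨h1, h2⟩ := coefF₄_triWeight b c h h0
      exact ⟨_, h1, by rw [h2]; rfl⟩
    · obtain ⟨h1, h2⟩ := coefF₄_weight i b
      exact ⟨_, h1, by rw [h2]; rfl⟩
  · rintro ⟨c, hc, rfl⟩
    rcases exists_of_mem_rootsF₄ c hc with ⟨i, b, h⟩ | ⟨b, c', hlt, h0, h⟩
    · exact ⟨Sum.inr (i, b), weight_ne_zero i b, by rw [← h]; rfl⟩
    · exact ⟨Sum.inl ⟨(b, c'), hlt⟩, h0, by rw [← h]; rfl⟩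

lemma mem_Delta_iff_rootsE₆ (v : Fin 6 → ℂ) :
    v ∈ Delta ↔ ∃ c ∈ rootsE₆, v = ∑ i, (c i : ℂ) • simpleRoots i := by
  rw [mem_Delta_iff]
  simp only [sum_simpleRoots]
  have hn : ∀ b c : Fin 8, Os.triWeight b c ≠ 0 → triWeightC b c ≠ 0 := by decide +kernel
  have hn' : ∀ b c : Fin 8, triWeightC b c ≠ 0 → Os.triWeight b c ≠ 0 := by decide +kernel
  have hn2 : ∀ i b k, iotaWeightC i b k ≠ 0 := by decide +kernel
  constructor
  · rintro ⟨⟨⟨b, c⟩, h⟩ | l | ⟨i, b, k⟩, h0, rfl⟩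
    · obtain ⟨h1, h2⟩ := coefE₆_triWeightC b c h (hn' b c h0)
      exact ⟨_, h1, by rw [h2]; rfl⟩
    · refine absurd ?_ h0
      revert l; decide +kernel
    · obtain ⟨h1, h2⟩ := coefE₆_iotaWeightC i b k
      exact ⟨_, h1, by rw [h2]; rfl⟩
  · rintro ⟨c, hc, rfl⟩
    rcases exists_of_mem_rootsE₆ c hc with ⟨i, b, k, h⟩ | ⟨b, c', hlt, h0, h⟩
    · exact ⟨Sum.inr (Sum.inr ⟨i, b, k⟩), hn2 i b k, by rw [← h]; rfl⟩
    · exact ⟨Sum.inl ⟨(b, c'), hlt⟩, hn b c' h0, by rw [← h]; rfl⟩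

end SimpleRoots

/-! ### The roots of g₀ and of the complexification of g, and the restricted roots. -/

namespace E62

open Module

lemma roots_real : roots h₀ = {lam | coords lam ∈ Phi} := by
  ext lam
  rw [isWeightBasis_real.mem_roots_iff, Set.mem_ofPred_eq, mem_Phi_iff, coords_eq]
  constructor
  · rintro ⟨p | k | ⟨i, b, k⟩, h0, h⟩
    · exact ⟨Sum.inl p, fun h' ↦ h0 (by funext k; simp [show indWeight (Sum.inl p) = 0 from h']),
        h.symm⟩
    · exact absurd (by funext k'; simp [indWeight]) h0
    · exact ⟨Sum.inr (i, b), weight_ne_zero i b, h.symm⟩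
  · rintro ⟨j, h0, h⟩
    exact ⟨j.toInd, fun h' ↦ h0 (half_injective (h'.trans half_zero.symm)), h.symm⟩

lemma roots_real₀ : roots h₀' = {lam | coords' lam ∈ Phi} := by
  ext lam
  rw [isWeightBasis_real₀.mem_roots_iff, Set.mem_ofPred_eq, mem_Phi_iff, coords'_eq]
  refine exists_congr fun j ↦ and_congr (not_congr ⟨fun h ↦ ?_, fun h ↦ ?_⟩) eq_comm
  · exact half_injective (h.trans half_zero.symm)
  · rw [h]; exact half_zero

lemma unit_ne_zero (k : Fin 6) : unit k ≠ 0 := by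
  fin_cases k <;> simp [unit]

lemma roots_complex : roots (hFull.baseChange ℂ) = {α | coordsC α ∈ Delta} := by
  ext lam
  rw [isWeightBasis_complex.mem_roots_iff, Set.mem_ofPred_eq, mem_Delta_iff, coordsC_eq]
  refine exists_congr fun j ↦ and_congr (not_congr ⟨fun h ↦ funext fun k ↦ ?_, fun h ↦ ?_⟩) eq_comm
  · have := congrFun h k
    simpa [unit_ne_zero k] using this
  · funext k; simp [h]

/-- The simple roots, as functionals on `h₀`. -/
noncomputable def simpleReal : Basis (Fin 4) ℝ (Dual ℝ h₀) :=
  simplePhiBasis.map (dualEquivFun realGen).symm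

lemma coords_simpleReal (i : Fin 4) : coords (simpleReal i) = simplePhi i := by
  rw [coords_eq, simpleReal, Basis.map_apply, LinearEquiv.apply_symm_apply, simplePhiBasis_apply]

/-- The simple roots, as functionals on `h₀` inside `g₀`. -/
noncomputable def simpleReal₀ : Basis (Fin 4) ℝ (Dual ℝ h₀') :=
  simplePhiBasis.map (dualEquivFun realGen₀).symm

lemma coords'_simpleReal₀ (i : Fin 4) : coords' (simpleReal₀ i) = simplePhi i := by
  rw [coords'_eq, simpleReal₀, Basis.map_apply, LinearEquiv.apply_symm_apply, simplePhiBasis_apply]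

/-- The simple roots, as functionals on `h^ℂ`. -/
noncomputable def simpleComplex : Basis (Fin 6) ℂ (Dual ℂ (hFull.baseChange ℂ)) :=
  simpleRootsBasis.map (dualEquivFun genC).symm

lemma coordsC_simpleComplex (i : Fin 6) : coordsC (simpleComplex i) = simpleRoots i := by
  rw [coordsC_eq, simpleComplex, Basis.map_apply, LinearEquiv.apply_symm_apply,
    simpleRootsBasis_apply]

lemma isRootBasis_real : IsRootBasis ℝ (roots h₀) simpleReal CartanMatrix.F₄ := by
  refine (isRootBasis_F₄ simpleReal).congr ?_ fun _ ↦ rfl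
  ext lam
  rw [roots_real, Set.mem_ofPred_eq, Set.mem_ofPred_eq, mem_Phi_iff_rootsF₄]
  refine exists_congr fun c ↦ and_congr_right fun _ ↦ ?_
  rw [← (dualEquivFun realGen).injective.eq_iff, ← coords_eq, map_sum]
  simp only [map_smul, ← coords_eq, coords_simpleReal]

lemma isRootBasis_real₀ : IsRootBasis ℝ (roots h₀') simpleReal₀ CartanMatrix.F₄ := by
  refine (isRootBasis_F₄ simpleReal₀).congr ?_ fun _ ↦ rfl
  ext lam
  rw [roots_real₀, Set.mem_ofPred_eq, Set.mem_ofPred_eq, mem_Phi_iff_rootsF₄]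
  refine exists_congr fun c ↦ and_congr_right fun _ ↦ ?_
  rw [← (dualEquivFun realGen₀).injective.eq_iff, ← coords'_eq, map_sum]
  simp only [map_smul, ← coords'_eq, coords'_simpleReal₀]

lemma roots_complex_eq : roots (hFull.baseChange ℂ) =
    {v | ∃ c ∈ {c | c ∈ rootsE₆}, v = ∑ i, (c i : ℂ) • simpleComplex i} := by
  ext lam
  rw [roots_complex, Set.mem_ofPred_eq, Set.mem_ofPred_eq, mem_Delta_iff_rootsE₆]
  refine exists_congr fun c ↦ and_congr_right fun _ ↦ ?_
  rw [← (dualEquivFun genC).injective.eq_iff, ← coordsC_eq, map_sum]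
  simp only [map_smul, ← coordsC_eq, coordsC_simpleComplex]

lemma isRootBasis_complex :
    IsRootBasis ℂ (roots (hFull.baseChange ℂ)) simpleComplex CartanMatrix.E₆ :=
  (isRootBasis_E₆ simpleComplex).congr roots_complex_eq.symm fun _ ↦ rfl

end E62

/-! ### Extension of involutions from g₀ to g. -/

namespace E62

open MagicAlg Module

lemma inTri₀_injective : Function.Injective inTri₀ := fun _ _ h ↦
  congrArg (fun x : g₀ ↦ (x : E62).1) h

lemma iota₀_injective (i : Fin 3) : Function.Injective (iota₀ i) := by
  intro x y h
  refine Os.basis.repr.injective (Finsupp.ext fun b ↦ ?_)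
  have key (x : Os) : basis₀.repr (iota₀ i x) (Sum.inr (i, b)) = Os.basis.repr x b := by
    have : Finsupp.lapply (Sum.inr (i, b)) ∘ₗ basis₀.repr.toLinearMap ∘ₗ iota₀ i =
        Finsupp.lapply b ∘ₗ Os.basis.repr.toLinearMap := by
      refine Os.basis.ext fun a ↦ ?_
      have h1 : iota₀ i (Os.basis a) = basis₀ (Sum.inr (i, a)) := by
        rw [basis₀, Basis.mk_apply]; rfl
      simp only [LinearMap.comp_apply, LinearEquiv.coe_coe, h1, Basis.repr_self,
        Finsupp.lapply_apply, Finsupp.single_apply, Sum.inr.injEq, Prod.mk.injEq, true_and]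
    exact LinearMap.congr_fun this x
  rw [← key, ← key, h]

lemma basis₀_inl (p : Os.Pairs) : basis₀ (Sum.inl p) = inTri₀ (Os.triBasis p) := by
  rw [basis₀, Basis.mk_apply]; rfl

lemma basis₀_inr (i : Fin 3) (b : Fin 8) : basis₀ (Sum.inr (i, b)) = iota₀ i (Os.std b) := by
  rw [basis₀, Basis.mk_apply, ← Os.basis_apply]; rfl

lemma lie_inTri₀ (d e : paraOs.tri) : ⁅inTri₀ d, inTri₀ e⁆ = inTri₀ ⁅d, e⁆ :=
  Subtype.ext (lie_inTri_inTri d e)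

lemma lie_inTri₀_iota₀ (d : paraOs.tri) (i : Fin 3) (x : Os) :
    ⁅inTri₀ d, iota₀ i x⁆ = iota₀ i (d.1 i x) :=
  Subtype.ext (lie_inTri_iota d i _)

lemma lie_iota₀_succ (i : Fin 3) (x y : Os) :
    ⁅iota₀ (i + 1) x, iota₀ (i + 2) y⁆ = iota₀ i (paraOs.mul x y) := by
  refine Subtype.ext ((lie_iota_succ i _ _).trans ?_)
  rw [iota₀_coe]
  change iota i (paraOs.mul x y ⊗ₜ paraC.mul 1 1) = _
  rw [paraC_mul, map_one, mul_one]

lemma paraC_t_self (z : ℂ) : paraC.t z z = 0 := by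
  have := paraC.t_swap z z
  linear_combination (norm := module) (2⁻¹ : ℝ) • this

/-- The factor 2 is q'(1, 1), and the component in tri(pC) disappears because t' is alternating. -/
lemma lie_iota₀_self (i : Fin 3) (x y : Os) :
    ⁅iota₀ i x, iota₀ i y⁆ = inTri₀ ((2 : ℝ) • paraOs.tPow i x y) := by
  refine Subtype.ext ((lie_iota_self i _ _).trans ?_)
  change inTri (paraC.q 1 1 • paraOs.tPow i x y) + inTri' (paraOs.q x y • paraC.tPow i 1 1) =
    inTri ((2 : ℝ) • paraOs.tPow i x y)
  have h1 : paraC.tPow i 1 1 = 0 := by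
    rw [SymCompAlg.tPow, LinearMap.compr₂_apply, paraC_t_self, map_zero]
  have h2 : inTri' 0 = 0 := rfl
  rw [h1, smul_zero, q_paraC, h2, add_zero]
  congr 2
  simp

variable (θ : g₀ ≃ₗ⁅ℝ⁆ g₀) (hneg : ∀ x ∈ h₀', θ x = -x)

include hneg in
-- An automorphism that is -1 on h₀ maps vectors of weight λ to vectors of weight -λ.
lemma indWeight₀_eq_neg {j j' : Ind₀} (h : basis₀.repr (θ (basis₀ j)) j' ≠ 0) :
    indWeight₀ j' = -indWeight₀ j := by
  funext k
  have h1 : ⁅(realGen₀ k : g₀), θ (basis₀ j)⁆ =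
      (-((indWeight₀ j k : ℝ) / 2)) • θ (basis₀ j) := by
    have h2 : (realGen₀ k : g₀) = -θ (realGen₀ k) := by rw [hneg _ (realGen₀ k).2, neg_neg]
    rw [h2, neg_lie, ← LieEquiv.map_lie, isWeightBasis_real₀.lie, map_smul, neg_smul]
  have h3 := isWeightBasis_real₀.repr_lie k (θ (basis₀ j)) j'
  rw [h1, map_smul, Finsupp.smul_apply, smul_eq_mul] at h3
  have h4 := mul_right_cancel₀ h h3
  have h5 : (indWeight₀ j' k : ℝ) = -indWeight₀ j k := by linarith
  exact_mod_cast h5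

lemma triWeight_ne_neg_weight : ∀ i b (b' c' : Fin 8), b' < c' →
    Os.triWeight b' c' ≠ -Os.weight i b := by decide +kernel

lemma weight_eq_neg_weight : ∀ i b i' b', Os.weight i' b' = -Os.weight i b →
    i' = i ∧ b' = b + 4 := by decide +kernel

include hneg in
-- The only standard basis vector of g₀ with the weight opposite to that of `std b` in ι_i is the
-- dual vector in the same ι_i.
lemma exists_apply_iota₀ (i : Fin 3) (b : Fin 8) :
    ∃ c : ℝ, θ (iota₀ i (Os.std b)) = c • iota₀ i (Os.std (b + 4)) := by
  refine ⟨basis₀.repr (θ (iota₀ i (Os.std b))) (Sum.inr (i, b + 4)),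
    basis₀.repr.injective (Finsupp.ext fun j ↦ ?_)⟩
  rw [map_smul, Finsupp.smul_apply, ← basis₀_inr i (b + 4), Basis.repr_self, Finsupp.single_apply]
  split_ifs with hj
  · rw [hj, smul_eq_mul, mul_one]
  · rw [smul_zero]
    by_contra h0
    rw [← basis₀_inr i b] at h0
    have := indWeight₀_eq_neg θ hneg h0
    rcases j with p | ⟨i', b'⟩
    · exact triWeight_ne_neg_weight i b p.1.1 p.1.2 p.2 this
    · obtain ⟨rfl, rfl⟩ := weight_eq_neg_weight i b i' b' this
      exact hj rfl

include hneg in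
-- No weight of some ι_i is opposite to a weight of tri(pO_s), zero included, so no component in ι_i
-- can occur.
lemma exists_apply_inTri₀ (p : Os.Pairs) : ∃ d, θ (inTri₀ (Os.triBasis p)) = inTri₀ d := by
  have h : θ (inTri₀ (Os.triBasis p)) ∈ Submodule.span ℝ (basis₀ '' Set.range Sum.inl) := by
    rw [Basis.mem_span_image]
    intro j hj
    rw [Finset.mem_coe, Finsupp.mem_support_iff, ← basis₀_inl] at hj
    have := indWeight₀_eq_neg θ hneg hj
    rcases j with p' | ⟨i', b'⟩
    · exact ⟨p', rfl⟩
    · exact absurd (by rw [this, neg_neg]) (triWeight_ne_neg_weight i' b' p.1.1 p.1.2 p.2 ∘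
        fun h : indWeight₀ (Sum.inl p) = -indWeight₀ (Sum.inr (i', b')) ↦ h)
  have h2 : Submodule.span ℝ (basis₀ '' Set.range Sum.inl) ≤ LinearMap.range inTri₀ := by
    refine Submodule.span_le.mpr ?_
    rintro _ ⟨_, ⟨p', rfl⟩, rfl⟩
    exact ⟨_, (basis₀_inl p').symm⟩
  obtain ⟨d, hd⟩ := h2 h
  exact ⟨d, hd.symm⟩

include hneg in
lemma exists_components : ∃ (F : paraOs.tri →ₗ[ℝ] paraOs.tri) (T : Fin 3 → Os →ₗ[ℝ] Os)
    (c : Fin 3 → Fin 8 → ℝ), (∀ d, θ (inTri₀ d) = inTri₀ (F d)) ∧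
    (∀ i x, θ (iota₀ i x) = iota₀ i (T i x)) ∧ ∀ i b, T i (Os.std b) = c i b • Os.std (b + 4) := by
  choose d hd using exists_apply_inTri₀ θ hneg
  choose c hc using exists_apply_iota₀ θ hneg
  have hT (i : Fin 3) (b : Fin 8) :
      Os.basis.constr ℝ (fun b ↦ c i b • Os.std (b + 4)) (Os.std b) = c i b • Os.std (b + 4) := by
    rw [← Os.basis_apply b, Basis.constr_basis]
  refine ⟨Os.triBasis.constr ℝ d, fun i ↦ Os.basis.constr ℝ fun b ↦ c i b • Os.std (b + 4), c,
    fun e ↦ ?_, fun i x ↦ ?_, hT⟩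
  · have : (θ : g₀ →ₗ[ℝ] g₀) ∘ₗ inTri₀ = inTri₀ ∘ₗ Os.triBasis.constr ℝ d := by
      refine Os.triBasis.ext fun p ↦ ?_
      rw [LinearMap.comp_apply, LinearMap.comp_apply, Basis.constr_basis]
      exact hd p
    exact LinearMap.congr_fun this e
  · have : (θ : g₀ →ₗ[ℝ] g₀) ∘ₗ iota₀ i =
        iota₀ i ∘ₗ Os.basis.constr ℝ fun b ↦ c i b • Os.std (b + 4) := by
      refine Os.basis.ext fun b ↦ ?_
      rw [LinearMap.comp_apply, LinearMap.comp_apply, Os.basis_apply, hT, map_smul]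
      exact hc i b
    exact LinearMap.congr_fun this x

lemma smul_std_add {b c : Fin 8} (h : b ≠ c) {x y : ℝ} (hxy : x • Os.std b + y • Os.std c = 0) :
    x = 0 := by
  have := congrArg (fun z ↦ Os.coordEquiv z b) hxy
  simpa [Os.coordEquiv_std, h.symm] using this

lemma tPow_self (i : Fin 3) (x y z : Os) :
    (paraOs.tPow i x y).1 i z = paraOs.q x z • y - paraOs.q y z • x := by
  rw [SymCompAlg.tPow_apply, sub_self, SymCompAlg.t_zero]

section

variable {F : paraOs.tri →ₗ[ℝ] paraOs.tri} {T : Fin 3 → Os →ₗ[ℝ] Os} {c : Fin 3 → Fin 8 → ℝ}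

/-- In g₀ the form `q` does not appear as a coefficient of tri(pC), since t'_{1,1} = 0, so its
invariance must be recovered from σ. Compatibility gives T σ_{x,y}(z) = σ_{Tx,Ty}(Tz), and comparing
the coefficients of the independent vectors Tx and Ty yields q(Tx, Tz) = q(x, z). -/
lemma q_map_map (h2 : ∀ d i x, T i (d.1 i x) = (F d).1 i (T i x))
    (h4 : ∀ i x y, F (paraOs.tPow i x y) = paraOs.tPow i (T i x) (T i y))
    (hT : ∀ i b, T i (Os.std b) = c i b • Os.std (b + 4)) (hc : ∀ i b, c i b ≠ 0) (i : Fin 3)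
    (x y : Os) : paraOs.q (T i x) (T i y) = paraOs.q x y := by
  have key : paraOs.q.compl₁₂ (T i) (T i) = paraOs.q := by
    refine LinearMap.ext_basis Os.basis Os.basis fun a b ↦ ?_
    rw [LinearMap.compl₁₂_apply, Os.basis_apply, Os.basis_apply]
    have h := h2 (paraOs.tPow i (Os.std a) (Os.std (a + 1))) i (Os.std b)
    rw [h4, tPow_self, tPow_self, map_sub, map_smul, map_smul, hT i (a + 1), hT i a] at h
    rw [hT i a]
    -- The index `a + 1` only serves as some index different from `a`, so that the two images are
    -- independent.
    have hne : a + 1 + 4 ≠ a + 4 := (by decide : ∀ a : Fin 8, a + 1 + 4 ≠ a + 4) a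
    have h5 := smul_std_add hne (x := (paraOs.q (Os.std a) (Os.std b) -
      paraOs.q (c i a • Os.std (a + 4)) (T i (Os.std b))) * c i (a + 1))
      (y := -(paraOs.q (Os.std (a + 1)) (Os.std b) -
      paraOs.q (c i (a + 1) • Os.std (a + 1 + 4)) (T i (Os.std b))) * c i a)
      (by linear_combination (norm := module) h)
    rcases mul_eq_zero.mp h5 with h6 | h6
    · linarith
    · exact absurd h6 (hc i (a + 1))
  exact LinearMap.congr_fun (LinearMap.congr_fun key x) y

/-- Acting on the first tensor factor only leaves all operations of pC untouched. Beyond what an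
automorphism of g₀ provides, invariance of `q` is needed for the brackets of ι_i with itself that
land in tri(pC). -/
lemma blockMap_rTensor_lie (h1 : ∀ d e, F ⁅d, e⁆ = ⁅F d, F e⁆)
    (h2 : ∀ d i x, T i (d.1 i x) = (F d).1 i (T i x))
    (h4 : ∀ i x y, F (paraOs.tPow i x y) = paraOs.tPow i (T i x) (T i y))
    (h6 : ∀ i x y, T i (paraOs.mul x y) = paraOs.mul (T (i + 1) x) (T (i + 2) y))
    (hq : ∀ i x y, paraOs.q (T i x) (T i y) = paraOs.q x y) (x y : E62) :
    blockMap F (fun i ↦ LinearMap.rTensor ℂ (T i)) ⁅x, y⁆ =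
      ⁅blockMap F (fun i ↦ LinearMap.rTensor ℂ (T i)) x,
        blockMap F (fun i ↦ LinearMap.rTensor ℂ (T i)) y⁆ := by
  generalize hA : (fun i ↦ LinearMap.rTensor ℂ (T i)) = A
  have hAt (i x) (z : ℂ) : A i (x ⊗ₜ z) = T i x ⊗ₜ z := by
    rw [← hA]; rfl
  refine blockMap_lie F A h1 (fun d i a ↦ ?_) (fun d i a ↦ ?_) (fun i a b ↦ ?_)
    (fun i a b ↦ ?_) (fun i a b ↦ ?_) x y
  · refine tensor_induction (F := A i ∘ₗ act d i) (G := act (F d) i ∘ₗ A i) (fun x z ↦ ?_) a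
    rw [LinearMap.comp_apply, LinearMap.comp_apply, act_tmul, hAt, hAt, act_tmul, h2]
  · refine tensor_induction (F := A i ∘ₗ act' d i) (G := act' d i ∘ₗ A i) (fun x z ↦ ?_) a
    rw [LinearMap.comp_apply, LinearMap.comp_apply, act'_tmul, hAt, hAt, act'_tmul]
  · refine tensor_induction₂ (F := (K paraOs paraC i).compr₂ F)
      (G := (K paraOs paraC i).compl₁₂ (A i) (A i)) (fun x z y w ↦ ?_) a b
    rw [LinearMap.compr₂_apply, LinearMap.compl₁₂_apply, hAt, hAt, K_tmul, K_tmul, map_smul, h4]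
  · refine tensor_induction₂ (F := K' paraOs paraC i)
      (G := (K' paraOs paraC i).compl₁₂ (A i) (A i)) (fun x z y w ↦ ?_) a b
    rw [LinearMap.compl₁₂_apply, hAt, hAt, K'_tmul, K'_tmul, hq]
  · refine tensor_induction₂ (F := (M paraOs paraC).compr₂ (A i))
      (G := (M paraOs paraC).compl₁₂ (A (i + 1)) (A (i + 2))) (fun x z y w ↦ ?_) a b
    rw [LinearMap.compr₂_apply, LinearMap.compl₁₂_apply, hAt, hAt, M_tmul, M_tmul, hAt, h6]

end

include hneg in
/-- An involution of `g₀` that is `-1` on `h₀` extends to `g`, trivially on the second factors. -/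
theorem exists_extension (hinv : ∀ x, θ (θ x) = x) : ∃ Θ : E62 ≃ₗ⁅ℝ⁆ E62,
    (∀ x : g₀, Θ x = θ x) ∧ (∀ d, Θ (inTri' d) = inTri' d) ∧ (∀ i x, Θ (Psi i x) = Psi i (Θ x)) ∧
    (∀ x, Θ (Θ x) = x) ∧
    ∀ i b, ∃ c : ℝ, ∀ z, Θ (iota i (Os.std b ⊗ₜ z)) = c • iota i (Os.std (b + 4) ⊗ₜ z) := by
  obtain ⟨F, T, c, hF, hT, hc⟩ := exists_components θ hneg
  have hFF (d) : F (F d) = d := inTri₀_injective (by rw [← hF, ← hF, hinv])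
  have hTT (i x) : T i (T i x) = x := iota₀_injective i (by rw [← hT, ← hT, hinv])
  have hc0 (i b) : c i b ≠ 0 := fun h ↦ by
    have := hTT i (Os.std b)
    rw [hc, h, zero_smul, map_zero, ← Os.basis_apply] at this
    exact Os.basis.ne_zero b this.symm
  -- The injective inclusions of the summands translate the automorphism property of θ, one kind of
  -- bracket at a time, into conditions on F and T.
  have h1 (d e) : F ⁅d, e⁆ = ⁅F d, F e⁆ := inTri₀_injective (by
    rw [← hF, ← lie_inTri₀, LieEquiv.map_lie, hF, hF, lie_inTri₀])
  have h2 (d : paraOs.tri) (i x) : T i (d.1 i x) = (F d).1 i (T i x) := iota₀_injective i (by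
    rw [← hT, ← lie_inTri₀_iota₀, LieEquiv.map_lie, hF, hT, lie_inTri₀_iota₀])
  have h4 (i x y) : F (paraOs.tPow i x y) = paraOs.tPow i (T i x) (T i y) := by
    have h : F ((2 : ℝ) • paraOs.tPow i x y) = (2 : ℝ) • paraOs.tPow i (T i x) (T i y) :=
      inTri₀_injective (by rw [← hF, ← lie_iota₀_self, LieEquiv.map_lie, hT, hT, lie_iota₀_self])
    rw [map_smul] at h
    exact smul_right_injective _ (two_ne_zero (α := ℝ)) h
  have h6 (i x y) : T i (paraOs.mul x y) = paraOs.mul (T (i + 1) x) (T (i + 2) y) :=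
    iota₀_injective i (by
      rw [← hT, ← lie_iota₀_succ, LieEquiv.map_lie, hT, hT, lie_iota₀_succ])
  have hq := q_map_map h2 h4 hc hc0
  have hlie := blockMap_rTensor_lie h1 h2 h4 h6 hq
  generalize hA : (fun i ↦ LinearMap.rTensor ℂ (T i)) = A at hlie
  have hAt (i x) (z : ℂ) : A i (x ⊗ₜ z) = T i x ⊗ₜ z := by
    rw [← hA]; rfl
  have hAA (i a) : A i (A i a) = a :=
    tensor_induction (F := A i ∘ₗ A i) (G := LinearMap.id) (fun x z ↦ by
      rw [LinearMap.comp_apply, hAt, hAt, hTT]; rfl) a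
  have hinv' (x : E62) : blockMap F A (blockMap F A x) = x :=
    MagicAlg.ext' (hFF _) rfl fun i ↦ hAA i _
  let Θ : E62 ≃ₗ⁅ℝ⁆ E62 :=
    { toFun := blockMap F A
      invFun := blockMap F A
      map_add' := map_add _
      map_smul' := map_smul _
      map_lie' := hlie _ _
      left_inv := hinv'
      right_inv := hinv' }
  have hΘ (x : E62) : Θ x = blockMap F A x := rfl
  refine ⟨Θ, fun x ↦ ?_, fun d ↦ blockMap_inTri' F A d, fun i x ↦ ?_, hinv', fun i b ↦
    ⟨c i b, fun z ↦ ?_⟩⟩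
  · have h0 (d) : Θ (inTri₀ d) = θ (inTri₀ d) := by
      rw [hF, hΘ]; exact blockMap_inTri F A d
    have h3 (i s) : Θ (iota₀ i s) = θ (iota₀ i s) := by
      rw [hT, hΘ, iota₀_coe, iota₀_coe, blockMap_iota, hAt]
    obtain ⟨d, s, rfl⟩ := exists_eq_sum x
    rw [map_add, map_add, map_add]
    push_cast
    simp only [map_add, h0, h3]
  -- Θ acts on the first tensor factor and Ψ_i on the second, so they commute.
  · rw [hΘ, hΘ, Psi_eq]
    refine MagicAlg.ext' rfl rfl fun j ↦ ?_
    exact tensor_induction (F := A j ∘ₗ psiMap i j) (G := psiMap i j ∘ₗ A j) (fun x z ↦ by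
      rw [LinearMap.comp_apply, LinearMap.comp_apply, psiMap_tmul, hAt, hAt, psiMap_tmul])
      (x.2.2 j)
  · rw [hΘ, blockMap_iota, hAt, hc, ← map_smul, TensorProduct.smul_tmul']

end E62

/-! ### The swap of dual basis vectors and the existence of Chevalley families. -/

namespace Os

/-- The automorphism of the split octonions that exchanges dual vectors of the standard basis. -/
noncomputable def swap : Os →ₗ[ℝ] Os where
  toFun x := (x.1.swap, x.2.swap)
  map_add' _ _ := rfl
  map_smul' _ _ := rfl

lemma swap_apply (x : Os) : swap x = (x.1.swap, x.2.swap) := rfl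

lemma swap_swap (x : Os) : swap (swap x) = x := rfl

lemma swap_std (b : Fin 8) : swap (std b) = std (b + 4) := by
  fin_cases b <;> rfl

lemma q_swap (x y : Os) : paraOs.q (swap x) (swap y) = paraOs.q x y := by
  rw [q_eq, q_eq]
  simp only [swap_apply, Prod.fst_swap, Prod.snd_swap]
  ring

lemma q_swap_left (x y : Os) : paraOs.q (swap x) y = paraOs.q x (swap y) := by
  rw [← q_swap, swap_swap]

lemma swap_mul (x y : Os) : swap (paraOs.mul x y) = paraOs.mul (swap x) (swap y) := by
  refine ext_coord ?_ ?_ (fun k ↦ ?_) (fun k ↦ ?_)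
  · change (paraOs.mul x y).1.2 = (paraOs.mul (swap x) (swap y)).1.1
    rw [mul_fst, mul_fst]; rfl
  · change (paraOs.mul x y).1.1 = (paraOs.mul (swap x) (swap y)).1.2
    rw [mul_fst, mul_fst]; rfl
  · change (paraOs.mul x y).2.2 k = (paraOs.mul (swap x) (swap y)).2.1 k
    rw [mul_snd_fst, mul_snd_snd]; rfl
  · change (paraOs.mul x y).2.1 k = (paraOs.mul (swap x) (swap y)).2.2 k
    rw [mul_snd_fst, mul_snd_snd]; rfl

/-- Conjugation by `swap`. -/
noncomputable def triSwap : paraOs.tri →ₗ[ℝ] paraOs.tri where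
  toFun d := ⟨fun i ↦ swap ∘ₗ d.1 i ∘ₗ swap, by
    refine ⟨fun i x y ↦ ?_, fun x y ↦ ?_⟩
    · simp only [LinearMap.comp_apply]
      rw [q_swap_left, ← q_swap_left x]
      exact d.2.1 i _ _
    · simp only [LinearMap.comp_apply]
      rw [swap_mul, d.2.2, map_add, swap_mul, swap_mul, swap_swap, swap_swap]⟩
  map_add' d e := SymCompAlg.tri_ext _ fun i z ↦ map_add swap _ _
  map_smul' c d := SymCompAlg.tri_ext _ fun i z ↦ map_smul swap c _

lemma triSwap_apply (d : paraOs.tri) (i : Fin 3) (z : Os) :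
    (triSwap d).1 i z = swap (d.1 i (swap z)) := rfl

lemma triSwap_triSwap (d : paraOs.tri) : triSwap (triSwap d) = d :=
  SymCompAlg.tri_ext _ fun i z ↦ by rw [triSwap_apply, triSwap_apply, swap_swap, swap_swap]

lemma triSwap_lie (d e : paraOs.tri) : triSwap ⁅d, e⁆ = ⁅triSwap d, triSwap e⁆ :=
  SymCompAlg.tri_ext _ fun i z ↦ by
    rw [triSwap_apply, SymCompAlg.tri_lie_apply, SymCompAlg.tri_lie_apply, map_sub]
    simp only [triSwap_apply, swap_swap]

lemma triSwap_t (x y : Os) : triSwap (paraOs.t x y) = paraOs.t (swap x) (swap y) := by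
  refine SymCompAlg.tri_ext _ fun i z ↦ ?_
  rw [triSwap_apply, t_apply, t_apply]
  fin_cases i
  · change swap (paraOs.q x (swap z) • y - paraOs.q y (swap z) • x) =
      paraOs.q (swap x) z • swap y - paraOs.q (swap y) z • swap x
    rw [map_sub, map_smul, map_smul, q_swap_left, q_swap_left]
  · change swap ((2⁻¹ * paraOs.q x y) • swap z - paraOs.mul (paraOs.mul y (swap z)) x) =
      (2⁻¹ * paraOs.q (swap x) (swap y)) • z - paraOs.mul (paraOs.mul (swap y) z) (swap x)
    rw [map_sub, map_smul, swap_mul, swap_mul, swap_swap, q_swap]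
  · change swap ((2⁻¹ * paraOs.q x y) • swap z - paraOs.mul x (paraOs.mul (swap z) y)) =
      (2⁻¹ * paraOs.q (swap x) (swap y)) • z - paraOs.mul (swap x) (paraOs.mul z (swap y))
    rw [map_sub, map_smul, swap_mul, swap_mul, swap_swap, q_swap]

lemma triSwap_tPow (i : Fin 3) (x y : Os) :
    triSwap (paraOs.tPow i x y) = paraOs.tPow i (swap x) (swap y) :=
  SymCompAlg.tri_ext _ fun j z ↦ by
    rw [triSwap_apply, SymCompAlg.tPow_apply, SymCompAlg.tPow_apply, ← triSwap_t, triSwap_apply]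

/-- The swap exchanges the two arguments of t_{b,b+4}, and `t` is alternating. -/
lemma triSwap_torus (k : Fin 4) : triSwap (torus k) = -torus k := by
  rw [torus, triSwap_t, swap_std, swap_std, add_four_add_four, paraOs.t_swap]

lemma t_std_apply_zero (b c a : Fin 8) : (paraOs.t (std b) (std c)).1 0 (std a) =
    (if a = b + 4 then (1 : ℝ) else 0) • std c - (if a = c + 4 then (1 : ℝ) else 0) • std b := by
  rw [SymCompAlg.t_zero, q_std, q_std]

/-- This is the normalization of an sl₂-triple for e = t_{b,c} and f = -t_{b+4,c+4}. The hypotheses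
say that t_{b,c} is neither zero nor of weight zero, and they make all but the needed pairings
vanish. -/
lemma lie_lie_t {b c : Fin 8} (hbc : b ≠ c) (hbc' : c ≠ b + 4) :
    ⁅⁅paraOs.t (std b) (std c), -paraOs.t (std (b + 4)) (std (c + 4))⁆, paraOs.t (std b) (std c)⁆ =
      (2 : ℝ) • paraOs.t (std b) (std c) := by
  have h1 : ∀ b c : Fin 8, b ≠ c → c ≠ b + 4 → b ≠ c + 4 ∧ b + 4 ≠ c + 4 ∧ c + 4 ≠ b + 4 ∧
      b ≠ b + 4 ∧ c ≠ c + 4 := by decide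
  obtain ⟨h2, h3, h4, h5, h6⟩ := h1 b c hbc hbc'
  rw [lie_neg, neg_lie, paraOs.lie_t _ (std (b + 4))]
  simp only [t_std_apply_zero, h3, h4, if_true, if_false, one_smul, zero_smul, sub_zero,
    zero_sub, map_neg]
  rw [add_lie, paraOs.lie_t, neg_lie, paraOs.lie_t]
  simp only [t_std_apply_zero, add_four_add_four, h2, h5, h6, hbc, hbc', hbc.symm,
    if_true, if_false, one_smul, zero_smul, sub_zero, zero_sub, map_neg,
    map_zero, LinearMap.zero_apply]
  module

end Os

namespace E62

open MagicAlg Module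

/-- The involution of `g` induced by `Os.swap`. -/
noncomputable def swapMap : E62 →ₗ[ℝ] E62 :=
  blockMap Os.triSwap fun _ ↦ LinearMap.rTensor ℂ Os.swap

lemma swapMap_lie (x y : E62) : swapMap ⁅x, y⁆ = ⁅swapMap x, swapMap y⁆ :=
  blockMap_rTensor_lie (F := Os.triSwap) (T := fun _ ↦ Os.swap) Os.triSwap_lie
    (fun d i x ↦ by rw [Os.triSwap_apply, Os.swap_swap]) Os.triSwap_tPow
    (fun _ ↦ Os.swap_mul) (fun _ ↦ Os.q_swap) x y

lemma swapMap_mem {x : E62} (hx : x ∈ g₀) : swapMap x ∈ g₀ := by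
  refine ⟨hx.1, fun i ↦ ?_⟩
  obtain ⟨s, hs⟩ := hx.2 i
  refine ⟨Os.swap s, ?_⟩
  rw [swapMap, blockMap_thd, ← hs]; rfl

lemma swapMap_swapMap (x : E62) : swapMap (swapMap x) = x :=
  MagicAlg.ext' (Os.triSwap_triSwap _) rfl fun _ ↦
    tensor_induction (F := LinearMap.rTensor ℂ Os.swap ∘ₗ LinearMap.rTensor ℂ Os.swap)
      (G := LinearMap.id) (fun _ _ ↦ rfl) _

/-- The involution of `g₀` induced by `Os.swap`. -/
noncomputable def swapEquiv : g₀ ≃ₗ⁅ℝ⁆ g₀ where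
  toFun x := ⟨swapMap x, swapMap_mem x.2⟩
  map_add' x y := Subtype.ext (map_add swapMap (x : E62) y)
  map_smul' c x := Subtype.ext (map_smul swapMap c (x : E62))
  map_lie' {x y} := Subtype.ext (swapMap_lie x y)
  invFun x := ⟨swapMap x, swapMap_mem x.2⟩
  left_inv x := Subtype.ext (swapMap_swapMap x)
  right_inv x := Subtype.ext (swapMap_swapMap x)

lemma swapEquiv_inTri₀ (d : paraOs.tri) : swapEquiv (inTri₀ d) = inTri₀ (Os.triSwap d) :=
  Subtype.ext (blockMap_inTri _ _ d)

lemma swapEquiv_iota₀ (i : Fin 3) (x : Os) : swapEquiv (iota₀ i x) = iota₀ i (Os.swap x) :=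
  Subtype.ext (blockMap_iota _ _ i (x ⊗ₜ 1))

lemma inTri₀_torus (k : Fin 4) : inTri₀ (Os.torus k) = realGen₀ k := by
  rw [realGen₀_apply]
  exact Subtype.ext (inTri_torus k)

lemma swapEquiv_h₀ {x : g₀} (hx : x ∈ h₀') : swapEquiv x = -x := by
  have : (swapEquiv : g₀ →ₗ[ℝ] g₀) ∘ₗ h₀'.subtype = -h₀'.subtype := by
    refine realGen₀.ext fun k ↦ ?_
    rw [LinearMap.comp_apply, LinearMap.neg_apply, Submodule.subtype_apply, ← inTri₀_torus]
    refine (swapEquiv_inTri₀ _).trans ?_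
    rw [Os.triSwap_torus, map_neg]
  exact LinearMap.congr_fun this ⟨x, hx⟩

lemma triWeight_eq_zero : ∀ b c : Fin 8, b < c → Os.triWeight b c = 0 →
    ∃ k : Fin 4, b = Fin.castLE (by decide) k ∧ c = Fin.castLE (by decide) k + 4 := by
  decide +kernel

lemma exists_basis₀_eq (j : Ind₀) (h : indWeight₀ j = 0) : ∃ k, basis₀ j = realGen₀ k := by
  rcases j with ⟨⟨b, c⟩, hbc⟩ | ⟨i, b⟩
  · obtain ⟨k, h1, h2⟩ := triWeight_eq_zero b c hbc h
    refine ⟨k, ?_⟩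
    rw [basis₀_inl, Os.triBasis_apply]
    dsimp only
    subst h1 h2
    exact inTri₀_torus k
  · exact absurd h (weight_ne_zero i b)

lemma basis₀_mem_h₀ (j : Ind₀) (h : indWeight₀ j = 0) : basis₀ j ∈ h₀' := by
  obtain ⟨k, hk⟩ := exists_basis₀_eq j h
  exact hk ▸ (realGen₀ k).2

lemma mem_h₀_of_lie {x : g₀} (hx : ∀ k, ⁅(realGen₀ k : g₀), x⁆ = 0) : x ∈ h₀' :=
  isWeightBasis_real₀.mem_of_lie_eq_zero (fun j hj ↦ basis₀_mem_h₀ j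
    (half_injective ((show half (indWeight₀ j) = 0 from hj).trans half_zero.symm))) hx

/-- The standard basis is already correctly normalized. On ι_i the factor 2 is q'(1, 1), and
σ_{x,-y}(x) = x when `x` is isotropic and q(x, y) = 1. -/
lemma lie_lie_basis₀ (j : Ind₀) (h : indWeight₀ j ≠ 0) :
    ⁅⁅basis₀ j, -swapEquiv (basis₀ j)⁆, basis₀ j⁆ = (2 : ℝ) • basis₀ j := by
  rcases j with ⟨⟨b, c⟩, hbc⟩ | ⟨i, b⟩
  · rw [basis₀_inl, swapEquiv_inTri₀, ← map_neg, lie_inTri₀, lie_inTri₀, Os.triBasis_apply,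
      Os.triSwap_t, Os.swap_std, Os.swap_std, Os.lie_lie_t (ne_of_lt hbc), map_smul]
    rintro h1
    dsimp only at h1 hbc
    refine h ?_
    change Os.triWeight b c = 0
    have : ∀ b : Fin 8, Os.triWeight b (b + 4) = 0 := by decide
    rw [h1, this]
  · have h1 : ∀ b : Fin 8, b ≠ b + 4 := by decide
    rw [basis₀_inr, swapEquiv_iota₀, Os.swap_std, ← map_neg, lie_iota₀_self, lie_inTri₀_iota₀]
    have h2 : ((2 : ℝ) • paraOs.tPow i (Os.std b) (-Os.std (b + 4))).1 i (Os.std b) =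
        (2 : ℝ) • (paraOs.tPow i (Os.std b) (-Os.std (b + 4))).1 i (Os.std b) := rfl
    rw [h2, tPow_self, map_neg, LinearMap.neg_apply, Os.q_std, Os.q_std, if_neg (h1 b),
      if_pos (Os.add_four_add_four b).symm, ← map_smul]
    congr 1
    module

/-- Take for `e` the basis vector of weight α and f = -swap(e). Then [e, f] has weight zero, hence
lies in h₀, and α([e, f]) = 2 is read off from [[e, f], e] = 2e. -/
lemma exists_rootVectors (α : Dual ℝ h₀') (hα : α ∈ positive) : ∃ e f : g₀,
    (e ∈ weightSpace h₀' α ∧ f ∈ weightSpace h₀' (-α) ∧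
      ∃ hm : ⁅e, f⁆ ∈ h₀', α ⟨⁅e, f⁆, hm⟩ = 2) ∧ swapEquiv e = -f := by
  obtain ⟨j, hj, hw⟩ := (mem_PhiPos_iff _).mp hα
  have hj0 : indWeight₀ j ≠ 0 := fun h ↦ by
    rw [h] at hj; exact absurd hj (by decide)
  rw [coords'_eq] at hw
  have he : basis₀ j ∈ weightSpace h₀' α :=
    isWeightBasis_real₀.basis_mem_weightSpace (show half (indWeight₀ j) = _ from hw.symm)
  have hf : -swapEquiv (basis₀ j) ∈ weightSpace h₀' (-α) := by
    refine neg_mem fun x ↦ ?_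
    have hx : (x : g₀) = swapEquiv (-x) := by rw [map_neg, swapEquiv_h₀ x.2, neg_neg]
    rw [hx, ← LieEquiv.map_lie, neg_lie, he, LinearMap.neg_apply, ← neg_smul, map_smul]
  have hm : ⁅basis₀ j, -swapEquiv (basis₀ j)⁆ ∈ h₀' := by
    refine mem_h₀_of_lie fun k ↦ ?_
    rw [leibniz_lie, he, hf, smul_lie, lie_smul, ← add_smul, LinearMap.neg_apply, add_neg_cancel,
      zero_smul]
  refine ⟨basis₀ j, -swapEquiv (basis₀ j), ⟨he, hf, hm, ?_⟩, (neg_neg _).symm⟩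
  have h1 := lie_lie_basis₀ j hj0
  rw [he ⟨_, hm⟩] at h1
  exact smul_left_injective ℝ (basis₀.ne_zero j) h1

theorem exists_isChevalleyFamily :
    ∃ e f : Dual ℝ h₀' → g₀, IsChevalleyFamily h₀' positive e f := by
  choose! e f h using exists_rootVectors
  exact ⟨e, f, fun α hα ↦ (h α hα).1, swapEquiv, fun x hx ↦ swapEquiv_h₀ hx,
    fun α hα ↦ (h α hα).2⟩

end E62

/-! ### Killing forms computed from weights. -/

namespace IsWeightBasis

open Module

variable {L : Type*} [LieRing L] [LieAlgebra ℝ L] {J : Type*} [Fintype J] {n : ℕ}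
  {H : Submodule ℝ L} {g : Fin n → H} {b : Basis J ℝ L} {wt : J → Fin n → ℝ}
  (hb : IsWeightBasis H g b wt)

include hb

lemma killingForm_gen (k l : Fin n) :
    killingForm ℝ L (g k : L) (g l : L) = ∑ j, wt j k * wt j l := by
  rw [killingForm_apply_apply]
  refine trace_eq_sum_of_eigenbasis b _ _ fun j ↦ ?_
  rw [LinearMap.comp_apply, LieAlgebra.ad_apply, LieAlgebra.ad_apply, hb.lie, lie_smul, hb.lie,
    smul_smul, mul_comm]

/-- κ(x, x) is the sum of the squares of the real eigenvalues of ad x, one of which is `a`. -/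
lemma killingForm_self_pos {x y : L} {a : ℝ} (hx : x ∈ H) (hy : y ≠ 0) (ha : a ≠ 0)
    (h : ⁅x, y⁆ = a • y) : 0 < killingForm ℝ L x x := by
  obtain ⟨c, hc⟩ := hb.exists_lie_eq hx
  have h1 : killingForm ℝ L x x = ∑ j, c j * c j := by
    rw [killingForm_apply_apply]
    refine trace_eq_sum_of_eigenbasis b _ _ fun j ↦ ?_
    rw [LinearMap.comp_apply, LieAlgebra.ad_apply, LieAlgebra.ad_apply, hc, lie_smul, hc,
      smul_smul]
  obtain ⟨j, hj⟩ : ∃ j, b.repr y j ≠ 0 := by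
    by_contra! h0
    exact hy (b.repr.injective (Finsupp.ext fun j ↦ by rw [h0, map_zero]; rfl))
  have h2 := repr_lie_of_forall hc y j
  rw [h, map_smul, Finsupp.smul_apply, smul_eq_mul] at h2
  have h3 : c j = a := (mul_right_cancel₀ hj h2).symm
  rw [h1]
  exact Finset.sum_pos' (fun j _ ↦ mul_self_nonneg _)
    ⟨j, Finset.mem_univ _, by rw [h3]; exact mul_self_pos.mpr ha⟩

lemma killingForm_pos_of_sl2 {e f : L} (he : e ≠ 0) (hm : ⁅e, f⁆ ∈ H)
    (h : ⁅⁅e, f⁆, e⁆ = (2 : ℝ) • e) : 0 < killingForm ℝ L e f := by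
  have h1 := hb.killingForm_self_pos hm he two_ne_zero h
  rw [← two_mul_killingForm_of_sl2 h] at h1
  linarith

omit [Fintype J] in
/-- Weight vectors for different weights are orthogonal for the form `κ(x, θ y)`. -/
lemma killingForm_apply_eq_zero (θ : L ≃ₗ⁅ℝ⁆ L) (hneg : ∀ x ∈ H, θ x = -x) {i j : J}
    (hij : wt i ≠ wt j) : killingForm ℝ L (b i) (θ (b j)) = 0 := by
  obtain ⟨k, hk⟩ := Function.ne_iff.mp hij
  refine killingForm_eq_zero_of_lie_smul (h := (g k : L)) (a := wt i k) (c := -wt j k)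
    (hb.lie k i) ?_ (by rwa [← sub_eq_add_neg, sub_ne_zero])
  have h2 : (g k : L) = -θ (g k) := by rw [hneg _ (g k).2, neg_neg]
  rw [h2, neg_lie, ← LieEquiv.map_lie, hb.lie, map_smul, neg_smul]

end IsWeightBasis

/-! ### Cartan involutions of g₀ and g. -/

namespace E62

open MagicAlg Module

lemma triWeight_injective : ∀ b c b' c' : Fin 8, b < c → b' < c' → Os.triWeight b c ≠ 0 →
    Os.triWeight b' c' = Os.triWeight b c → b' = b ∧ c' = c := by
  decide +kernel

lemma weight_injective : ∀ i b i' b', Os.weight i' b' = Os.weight i b → i' = i ∧ b' = b := by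
  decide +kernel

lemma triWeight_ne_weight : ∀ i b (b' c' : Fin 8), b' < c' →
    Os.triWeight b' c' ≠ Os.weight i b := by decide +kernel

/-- Root spaces of g₀ are one-dimensional, so root vectors are determined up to a scalar. -/
lemma indWeight₀_injective {j j' : Ind₀} (hj : indWeight₀ j ≠ 0)
    (h : indWeight₀ j' = indWeight₀ j) : j' = j := by
  rcases j with ⟨⟨b, c⟩, hbc⟩ | ⟨i, b⟩ <;> rcases j' with ⟨⟨b', c'⟩, hbc'⟩ | ⟨i', b'⟩
  · obtain ⟨rfl, rfl⟩ := triWeight_injective b c b' c' hbc hbc' hj h; rfl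
  · exact absurd h.symm (triWeight_ne_weight i' b' b c hbc)
  · exact absurd h (triWeight_ne_weight i b b' c' hbc')
  · obtain ⟨rfl, rfl⟩ := weight_injective i b i' b' h; rfl

lemma eq_smul_basis₀ {x : g₀} {lam : Dual ℝ h₀'} {j : Ind₀} (hx : x ∈ weightSpace h₀' lam)
    (hj : indWeight₀ j ≠ 0) (hw : coords' lam = half (indWeight₀ j)) : ∃ r : ℝ, x = r • basis₀ j := by
  refine ⟨basis₀.repr x j, basis₀.repr.injective (Finsupp.ext fun j' ↦ ?_)⟩
  rw [map_smul, Basis.repr_self, Finsupp.smul_apply, Finsupp.single_apply]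
  split_ifs with h
  · rw [h, smul_eq_mul, mul_one]
  · rw [smul_zero]
    by_contra h0
    have := (isWeightBasis_real₀.mem_weightSpace_iff lam x).mp hx j' h0
    rw [coords'_eq] at hw
    exact h (indWeight₀_injective hj (half_injective (this.trans hw))).symm

lemma lexPos_or_triWeight : ∀ b c : Fin 8, b < c → Os.triWeight b c ≠ 0 →
    LexPos (Os.triWeight b c) ∨ ∃ b' c' : Fin 8, b' < c' ∧
      Os.triWeight b' c' = -Os.triWeight b c ∧ LexPos (Os.triWeight b' c') := by decide +kernel

lemma lexPos_or_weight : ∀ i b, LexPos (Os.weight i b) ∨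
    LexPos (Os.weight i (b + 4)) := by decide +kernel

lemma weight_add_four : ∀ i b, Os.weight i (b + 4) = -Os.weight i b := by decide +kernel

lemma lexPos_or (j : Ind₀) (hj : indWeight₀ j ≠ 0) : LexPos (indWeight₀ j) ∨
    ∃ j' : Ind₀, indWeight₀ j' = -indWeight₀ j ∧ LexPos (indWeight₀ j') := by
  rcases j with ⟨⟨b, c⟩, hbc⟩ | ⟨i, b⟩
  · refine (lexPos_or_triWeight b c hbc hj).imp id ?_
    rintro ⟨b', c', h, h1, h2⟩
    exact ⟨Sum.inl ⟨(b', c'), h⟩, h1, h2⟩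
  · exact (lexPos_or_weight i b).imp id fun h ↦ ⟨Sum.inr (i, b + 4), weight_add_four i b, h⟩

lemma exists_coords'_eq (v : Fin 4 → ℝ) : ∃ lam, coords' lam = v :=
  ⟨(dualEquivFun realGen₀).symm v, by rw [coords'_eq, LinearEquiv.apply_symm_apply]⟩

lemma coords'_neg (lam : Dual ℝ h₀') : coords' (-lam) = -coords' lam := rfl

/-- The conditions on the root vectors in `IsChevalleyFamily`, for a given automorphism. -/
structure IsChevalley (e f : Dual ℝ h₀' → g₀) (θ : g₀ ≃ₗ⁅ℝ⁆ g₀) : Prop where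
  mem_e : ∀ α ∈ positive, e α ∈ weightSpace h₀' α
  mem_f : ∀ α ∈ positive, f α ∈ weightSpace h₀' (-α)
  lie_mem : ∀ α ∈ positive, ⁅e α, f α⁆ ∈ h₀'
  lie_lie : ∀ α ∈ positive, ⁅⁅e α, f α⁆, e α⁆ = (2 : ℝ) • e α
  lie_ne : ∀ α ∈ positive, ⁅e α, f α⁆ ≠ 0
  neg : ∀ x ∈ h₀', θ x = -x
  map_e : ∀ α ∈ positive, θ (e α) = -f α

lemma exists_isChevalley {e f : Dual ℝ h₀' → g₀} (h : IsChevalleyFamily h₀' positive e f) :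
    ∃ θ, IsChevalley e f θ := by
  obtain ⟨h1, θ, h2, h3⟩ := h
  refine ⟨θ, fun α hα ↦ (h1 α hα).1, fun α hα ↦ (h1 α hα).2.1, fun α hα ↦ (h1 α hα).2.2.1,
    fun α hα ↦ ?_, fun α hα h0 ↦ ?_, h2, h3⟩
  · obtain ⟨he, -, hm, h4⟩ := h1 α hα
    rw [he ⟨_, hm⟩, h4]
  · obtain ⟨-, -, hm, h4⟩ := h1 α hα
    have : (⟨⁅e α, f α⁆, hm⟩ : h₀') = 0 := Subtype.ext h0
    rw [this, map_zero] at h4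
    exact two_ne_zero h4.symm

namespace IsChevalley

variable {e f : Dual ℝ h₀' → g₀} {θ : g₀ ≃ₗ⁅ℝ⁆ g₀} (hC : IsChevalley e f θ)
include hC

lemma e_ne_zero {α : Dual ℝ h₀'} (hα : α ∈ positive) : e α ≠ 0 := fun h ↦
  hC.lie_ne α hα (by rw [h, zero_lie])

lemma f_ne_zero {α : Dual ℝ h₀'} (hα : α ∈ positive) : f α ≠ 0 := fun h ↦
  hC.lie_ne α hα (by rw [h, lie_zero])

/-- Root vectors are multiples of some `e α` or `f α`. -/
lemma exists_positive (j : Ind₀) (hj : indWeight₀ j ≠ 0) : ∃ α ∈ positive,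
    (coords' α = half (indWeight₀ j) ∨ coords' α = -half (indWeight₀ j)) ∧
      ∃ r : ℝ, basis₀ j = r • e α ∨ basis₀ j = r • f α := by
  have key {x : g₀} (hx : x ≠ 0) (h : ∃ r : ℝ, x = r • basis₀ j) :
      ∃ r : ℝ, basis₀ j = r • x := by
    obtain ⟨r, rfl⟩ := h
    have hr : r ≠ 0 := fun h ↦ hx (by rw [h, zero_smul])
    exact ⟨r⁻¹, (inv_smul_smul₀ hr _).symm⟩
  rcases lexPos_or j hj with h | ⟨j', h1, h2⟩
  · obtain ⟨α, hα⟩ := exists_coords'_eq (half (indWeight₀ j))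
    have hp : α ∈ positive := (mem_PhiPos_iff _).mpr ⟨j, h, hα⟩
    obtain ⟨r, hr⟩ := key (hC.e_ne_zero hp) (eq_smul_basis₀ (hC.mem_e α hp) hj hα)
    exact ⟨α, hp, Or.inl hα, r, Or.inl hr⟩
  · obtain ⟨α, hα⟩ := exists_coords'_eq (half (indWeight₀ j'))
    have hp : α ∈ positive := (mem_PhiPos_iff _).mpr ⟨j', h2, hα⟩
    rw [h1, half_neg] at hα
    obtain ⟨r, hr⟩ := key (hC.f_ne_zero hp) (eq_smul_basis₀ (hC.mem_f α hp) hj (by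
      rw [coords'_neg, hα, neg_neg]))
    exact ⟨α, hp, Or.inr hα, r, Or.inr hr⟩

/-- θ(f_α) is a multiple of e_α because the root space is a line, and θ([e_α, f_α]) = -[e_α, f_α] ≠
0 determines the multiple. -/
lemma map_f (α : Dual ℝ h₀') (hα : α ∈ positive) : θ (f α) = -e α := by
  obtain ⟨j, hj, hw⟩ := (mem_PhiPos_iff _).mp hα
  have hj0 : indWeight₀ j ≠ 0 := fun h ↦ by
    rw [h] at hj; exact absurd hj (by decide)
  have hm : θ (f α) ∈ weightSpace h₀' α := fun x ↦ by
    have hx : (x : g₀) = -θ x := by rw [hC.neg _ x.2, neg_neg]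
    rw [hx, neg_lie, ← LieEquiv.map_lie, hC.mem_f α hα, LinearMap.neg_apply, neg_smul, map_neg,
      neg_neg, map_smul]
  obtain ⟨r, hr⟩ := eq_smul_basis₀ (hC.mem_e α hα) hj0 hw
  obtain ⟨s, hs⟩ := eq_smul_basis₀ hm hj0 hw
  have hr0 : r ≠ 0 := fun h ↦ hC.e_ne_zero hα (by rw [hr, h, zero_smul])
  have h1 : θ (f α) = (s * r⁻¹) • e α := by
    rw [hr, smul_smul, mul_assoc, inv_mul_cancel₀ hr0, mul_one, hs]
  have h2 := hC.neg _ (hC.lie_mem α hα)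
  rw [LieEquiv.map_lie, hC.map_e α hα, h1, lie_smul, neg_lie, lie_skew] at h2
  have h3 : (s * r⁻¹ + 1) • ⁅e α, f α⁆ = 0 := by
    rw [add_smul, h2, one_smul, neg_add_cancel]
  have h4 : s * r⁻¹ = -1 := by
    linarith [(smul_eq_zero.mp h3).resolve_right (hC.lie_ne α hα)]
  rw [h1, h4, neg_one_smul]

lemma invol (x : g₀) : θ (θ x) = x := by
  have : (θ : g₀ →ₗ[ℝ] g₀) ∘ₗ (θ : g₀ →ₗ[ℝ] g₀) = LinearMap.id := by
    refine basis₀.ext fun j ↦ ?_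
    change θ (θ (basis₀ j)) = basis₀ j
    by_cases hj : indWeight₀ j = 0
    · have hm := basis₀_mem_h₀ j hj
      rw [hC.neg _ hm, map_neg, hC.neg _ hm, neg_neg]
    · obtain ⟨α, hα, -, r, h | h⟩ := hC.exists_positive j hj
      · rw [h, map_smul, map_smul, hC.map_e α hα, map_neg, hC.map_f α hα, neg_neg]
      · rw [h, map_smul, map_smul, hC.map_f α hα, map_neg, hC.map_e α hα, neg_neg]
  exact LinearMap.congr_fun this x

/-- Up to a positive square this is κ(e_α, -f_α), and κ(e_α, f_α) > 0 by the sl₂-relation. -/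
lemma killingForm_basis₀_neg (j : Ind₀) (hj : indWeight₀ j ≠ 0) :
    killingForm ℝ g₀ (basis₀ j) (θ (basis₀ j)) < 0 := by
  obtain ⟨α, hα, -, r, h⟩ := hC.exists_positive j hj
  have hr : r ≠ 0 := fun h0 ↦ basis₀.ne_zero j (by simpa [h0] using h)
  have hpos := isWeightBasis_real₀.killingForm_pos_of_sl2 (hC.e_ne_zero hα) (hC.lie_mem α hα)
    (hC.lie_lie α hα)
  have hr2 := mul_self_pos.mpr hr
  rcases h with h | h
  · rw [h, map_smul, map_smul, map_smul, LinearMap.smul_apply, hC.map_e α hα, map_neg, smul_eq_mul,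
      smul_eq_mul]
    nlinarith
  · rw [h, map_smul, map_smul, map_smul, LinearMap.smul_apply, hC.map_f α hα, map_neg, smul_eq_mul,
      smul_eq_mul, LieModule.traceForm_comm]
    nlinarith

end IsChevalley

/-- Up to the factor 1/4 this is the Gram matrix of h₁, …, h₄ for the Killing form of g₀; the next
lemma does the same for g. Orthogonality is what is needed, as h₀ is a weight space of dimension
greater than one. -/
lemma sum_indWeight₀ : ∀ k l, ∑ j : Ind₀, indWeight₀ j k * indWeight₀ j l =
    if k = l then 72 else 0 := by
  decide +kernel

lemma sum_indWeight : ∀ k l, ∑ j : Ind, indWeight j k * indWeight j l =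
    if k = l then 96 else 0 := by
  decide +kernel

end E62

namespace E62

open MagicAlg Module

lemma killingForm_realGen₀ (k l : Fin 4) :
    killingForm ℝ g₀ (realGen₀ k) (realGen₀ l) = if k = l then 18 else 0 := by
  have h : (∑ j : Ind₀, (indWeight₀ j k : ℝ) * indWeight₀ j l) = if k = l then 72 else 0 := by
    exact_mod_cast congrArg (Int.cast (R := ℝ)) (sum_indWeight₀ k l)
  rw [isWeightBasis_real₀.killingForm_gen]
  have h2 : ∑ j : Ind₀, (indWeight₀ j k : ℝ) / 2 * (indWeight₀ j l / 2) =
      4⁻¹ * ∑ j : Ind₀, (indWeight₀ j k : ℝ) * indWeight₀ j l := by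
    rw [Finset.mul_sum]
    exact Finset.sum_congr rfl fun j _ ↦ by ring
  rw [h2, h]
  split_ifs <;> norm_num

lemma killingForm_realGen (k l : Fin 4) :
    killingForm ℝ E62 (realGen k) (realGen l) = if k = l then 24 else 0 := by
  have h : (∑ j : Ind, (indWeight j k : ℝ) * indWeight j l) = if k = l then 96 else 0 := by
    exact_mod_cast congrArg (Int.cast (R := ℝ)) (sum_indWeight k l)
  rw [isWeightBasis_real.killingForm_gen]
  have h2 : ∑ j : Ind, (indWeight j k : ℝ) / 2 * (indWeight j l / 2) =
      4⁻¹ * ∑ j : Ind, (indWeight j k : ℝ) * indWeight j l := by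
    rw [Finset.mul_sum]
    exact Finset.sum_congr rfl fun j _ ↦ by ring
  rw [h2, h]
  split_ifs <;> norm_num

lemma half_ne_half {n : ℕ} {v w : Fin n → ℤ} (h : v ≠ w) : half v ≠ half w :=
  fun h' ↦ h (half_injective h')

namespace IsChevalley

variable {e f : Dual ℝ h₀' → g₀} {θ : g₀ ≃ₗ⁅ℝ⁆ g₀} (hC : IsChevalley e f θ)
include hC

/-- Vectors of different weights are orthogonal for κ(x, θ y), and nonzero weights have multiplicity
one, so only pairs inside h₀ need an explicit computation. -/
theorem isCartanInvolution : IsCartanInvolution θ := by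
  refine isCartanInvolution_of_orthogonal_basis basis₀ hC.invol (fun i j hij ↦ ?_) fun j ↦ ?_
  · by_cases h : indWeight₀ i = indWeight₀ j
    · by_cases hj : indWeight₀ j = 0
      · obtain ⟨k, hk⟩ := exists_basis₀_eq i (h.trans hj)
        obtain ⟨l, hl⟩ := exists_basis₀_eq j hj
        have hkl : k ≠ l := fun h' ↦ hij (basis₀.injective (by rw [hk, hl, h']))
        rw [hk, hl, hC.neg _ (realGen₀ l).2, map_neg, killingForm_realGen₀, if_neg hkl, neg_zero]
      · exact absurd (indWeight₀_injective hj h) hij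
    · exact isWeightBasis_real₀.killingForm_apply_eq_zero θ hC.neg (half_ne_half h)
  · by_cases hj : indWeight₀ j = 0
    · obtain ⟨l, hl⟩ := exists_basis₀_eq j hj
      rw [hl, hC.neg _ (realGen₀ l).2, map_neg, killingForm_realGen₀, if_pos rfl]
      norm_num
    · exact hC.killingForm_basis₀_neg j hj

end IsChevalley

section TriC

lemma lie_triC (d : paraC.tri) (i : Fin 3) (x : Os) (z : ℂ) :
    ⁅inTri' d, iota i (x ⊗ₜ z)⁆ = ((d.1 i 1).im / 2) • iota i (x ⊗ₜ (2 * Complex.I * z)) := by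
  rw [lie_inTri'_iota, act'_tmul, tri_apply, TensorProduct.tmul_smul, map_smul]

/-- A product of two rotation generators is a negative multiple of the product of their speeds, so
ad d ∘ ad d' is scalar on each ι_i, which has dimension 16, and zero on both triality algebras. -/
lemma killingForm_inTri' (d d' : paraC.tri) : killingForm ℝ E62 (inTri' d) (inTri' d') =
    -(16 * ∑ i, (d.1 i 1).im * (d'.1 i 1).im) := by
  rw [killingForm_apply_apply]
  have h := trace_eq_sum_of_eigenbasis basis
    (LieAlgebra.ad ℝ E62 (inTri' d) ∘ₗ LieAlgebra.ad ℝ E62 (inTri' d'))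
    (fun j : Ind ↦ Sum.elim (fun _ ↦ 0) (Sum.elim (fun _ ↦ 0)
      fun x ↦ -((d.1 x.1 1).im * (d'.1 x.1 1).im)) j) ?_
  · rw [h, Fintype.sum_sum_type, Fintype.sum_sum_type, Fintype.sum_sigma]
    simp only [Sum.elim_inl, Sum.elim_inr, Finset.sum_const_zero, zero_add, Finset.sum_const,
      Finset.card_univ, Fintype.card_prod, Fintype.card_fin, Finset.sum_neg_distrib, nsmul_eq_mul,
      Finset.mul_sum, mul_neg]
    norm_num
  · rintro (p | k | ⟨i, b, k⟩)
    · rw [LinearMap.comp_apply, LieAlgebra.ad_apply, LieAlgebra.ad_apply, basis_inl,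
        lie_inTri'_inTri, lie_zero, Sum.elim_inl, zero_smul]
    · rw [LinearMap.comp_apply, LieAlgebra.ad_apply, LieAlgebra.ad_apply, basis_inr_inl,
        lie_inTri'_inTri', lie_zero, Sum.elim_inr, Sum.elim_inl, zero_smul]
    · rw [LinearMap.comp_apply, LieAlgebra.ad_apply, LieAlgebra.ad_apply, basis_inr_inr,
        lie_triC, lie_smul, lie_triC, smul_smul, Sum.elim_inr, Sum.elim_inr]
      have h2 (z : ℂ) : 2 * Complex.I * (2 * Complex.I * z) = (-4 : ℝ) • z := by
        rw [Complex.real_smul]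
        push_cast
        linear_combination 4 * z * Complex.I_sq
      rw [h2, TensorProduct.tmul_smul, map_smul, smul_smul]
      congr 1
      dsimp only
      ring

lemma triCBasis_im (k : Fin 2) (i : Fin 3) :
    (((triCBasis k).1 i) 1).im = 2 * triCCoeff k i := by
  rw [triCBasis_apply, triC_apply]
  simp [mul_comm]

lemma killingForm_triCBasis (k l : Fin 2) :
    killingForm ℝ E62 (inTri' (triCBasis k)) (inTri' (triCBasis l)) =
      if k = l then ![-96, -128] k else 0 := by
  rw [killingForm_inTri']
  simp only [triCBasis_im, Fin.sum_univ_three]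
  fin_cases k <;> fin_cases l <;> simp [triCCoeff] <;> norm_num

end TriC

lemma killingForm_Psi (i : Fin 3) (x y : E62) :
    killingForm ℝ E62 (Psi i x) (Psi i y) = killingForm ℝ E62 x y :=
  LieAlgebra.killingForm_of_equiv_apply (PsiEquiv i) x y

lemma Psi_succ_iota (i : Fin 3) (x : Os) (z : ℂ) :
    Psi (i + 1) (iota i (x ⊗ₜ z)) = iota i (x ⊗ₜ (-Complex.I * z)) := by
  rw [Psi_iota, if_neg]
  revert i; decide

/-- An involution of `g` with the properties in `exists_extension`. -/
structure IsExtension (θ : g₀ ≃ₗ⁅ℝ⁆ g₀) (Θ : E62 ≃ₗ⁅ℝ⁆ E62) : Prop where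
  map_coe : ∀ x : g₀, Θ x = θ x
  map_inTri' : ∀ d, Θ (inTri' d) = inTri' d
  map_Psi : ∀ i x, Θ (Psi i x) = Psi i (Θ x)
  invol : ∀ x, Θ (Θ x) = x
  map_iota : ∀ i b, ∃ c : ℝ, ∀ z, Θ (iota i (Os.std b ⊗ₜ z)) = c • iota i (Os.std (b + 4) ⊗ₜ z)

namespace IsExtension

variable {θ : g₀ ≃ₗ⁅ℝ⁆ g₀} {Θ : E62 ≃ₗ⁅ℝ⁆ E62} (hE : IsExtension θ Θ)
include hE

lemma map_h₀ (hneg : ∀ x ∈ h₀', θ x = -x) {x : E62} (hx : x ∈ h₀) : Θ x = -x := by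
  have h1 := hE.map_coe ⟨x, h₀_le_g₀ hx⟩
  rw [hneg _ hx] at h1
  exact h1

/-- The rotation Ψ makes κ(x ⊗ 1, y ⊗ **i**) antisymmetric in x and y. Θ exchanges the dual vectors
up to scalars with product 1, and so makes the same quantity symmetric; hence it vanishes. -/
lemma killingForm_one_I (i : Fin 3) (b : Fin 8) : killingForm ℝ E62 (iota i (Os.std b ⊗ₜ 1))
    (iota i (Os.std (b + 4) ⊗ₜ Complex.I)) = 0 := by
  have key (x y : Os) : killingForm ℝ E62 (iota i (x ⊗ₜ 1)) (iota i (y ⊗ₜ Complex.I)) =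
      -killingForm ℝ E62 (iota i (y ⊗ₜ 1)) (iota i (x ⊗ₜ Complex.I)) := by
    rw [← killingForm_Psi (i + 1), Psi_succ_iota, Psi_succ_iota, mul_one, neg_mul,
      Complex.I_mul_I, neg_neg, TensorProduct.tmul_neg, map_neg, map_neg, LinearMap.neg_apply,
      LieModule.traceForm_comm]
  obtain ⟨c, hc⟩ := hE.map_iota i b
  obtain ⟨c', hc'⟩ := hE.map_iota i (b + 4)
  rw [Os.add_four_add_four] at hc'
  have h1 := hE.invol (iota i (Os.std b ⊗ₜ 1))
  rw [hc, map_smul, hc', smul_smul] at h1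
  have h2 : c * c' = 1 := by
    have h3 : basis (Sum.inr (Sum.inr ⟨i, b, 0⟩)) = iota i (Os.std b ⊗ₜ 1) := by
      rw [basis_inr_inr]; rfl
    rw [← h3] at h1
    exact smul_left_injective ℝ (basis.ne_zero _) (h1.trans (one_smul ℝ _).symm)
  have h3 := LieAlgebra.killingForm_of_equiv_apply Θ (iota i (Os.std b ⊗ₜ 1))
    (iota i (Os.std (b + 4) ⊗ₜ Complex.I))
  rw [hc, hc', map_smul, map_smul, LinearMap.smul_apply, smul_eq_mul, smul_eq_mul, ← mul_assoc,
    mul_comm c', h2, one_mul, key] at h3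
  linarith

end IsExtension

end E62

/-! ### The Cartan decomposition of g. -/

namespace E62

open MagicAlg Module

lemma basis_inr_inr_zero (i : Fin 3) (b : Fin 8) :
    basis (Sum.inr (Sum.inr ⟨i, b, 0⟩)) = iota i (Os.std b ⊗ₜ 1) := by
  rw [basis_inr_inr]; rfl

lemma basis_inr_inr_one (i : Fin 3) (b : Fin 8) :
    basis (Sum.inr (Sum.inr ⟨i, b, 1⟩)) = iota i (Os.std b ⊗ₜ Complex.I) := by
  rw [basis_inr_inr]; rfl

lemma basis_inl_eq (p : Os.Pairs) : basis (Sum.inl p) = basis₀ (Sum.inl p) :=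
  (basis₀_coe (Sum.inl p)).symm

lemma iota_one_eq (i : Fin 3) (b : Fin 8) :
    iota i (Os.std b ⊗ₜ 1) = basis₀ (Sum.inr (i, b)) := by
  rw [basis₀_inr, iota₀_coe]

/-- The vectors `ι_i(x ⊗ i)` in terms of `ι_i(x ⊗ 1)`. -/
lemma iota_I_eq (i : Fin 3) (b : Fin 8) :
    iota i (Os.std b ⊗ₜ Complex.I) = -Psi (i + 1) (basis₀ (Sum.inr (i, b)) : g₀) := by
  rw [← iota_one_eq, Psi_succ_iota, mul_one, TensorProduct.tmul_neg, map_neg, neg_neg]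

lemma exists_basis_eq_realGen (p : Os.Pairs) (h : Os.triWeight p.1.1 p.1.2 = 0) :
    ∃ k, basis (Sum.inl p) = (realGen k : E62) := by
  obtain ⟨k, hk⟩ := exists_basis₀_eq (Sum.inl p) h
  refine ⟨k, ?_⟩
  rw [basis_inl_eq, hk, realGen₀_apply, realGen_apply]

namespace IsChevalley

variable {e f : Dual ℝ h₀' → g₀} {θ : g₀ ≃ₗ⁅ℝ⁆ g₀} (hC : IsChevalley e f θ)
  {Θ : E62 ≃ₗ⁅ℝ⁆ E62} (hE : IsExtension θ Θ)
include hC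

lemma exists_isExtension : ∃ Θ, IsExtension θ Θ := by
  obtain ⟨Θ, h1, h2, h3, h4, h5⟩ := exists_extension θ hC.neg hC.invol
  exact ⟨Θ, h1, h2, h3, h4, h5⟩

lemma coe_mem_h₀ {α : Dual ℝ h₀'} (hα : α ∈ positive) : ⁅(e α : E62), (f α : E62)⁆ ∈ h₀ :=
  hC.lie_mem α hα

include hE

/-- The argument for g₀ applies with the Killing form of g, because [e_α, f_α] lies in h₀, which
acts diagonally with real eigenvalues on all of g. -/
lemma killingForm_coe_basis₀_neg (j : Ind₀) (hj : indWeight₀ j ≠ 0) :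
    killingForm ℝ E62 (basis₀ j : g₀) (Θ (basis₀ j : g₀)) < 0 := by
  obtain ⟨α, hα, -, r, h⟩ := hC.exists_positive j hj
  have hr : r ≠ 0 := fun h0 ↦ basis₀.ne_zero j (by simpa [h0] using h)
  have he : (e α : E62) ≠ 0 := fun h0 ↦ hC.e_ne_zero hα (Subtype.ext h0)
  have hl : ⁅⁅(e α : E62), (f α : E62)⁆, (e α : E62)⁆ = (2 : ℝ) • (e α : E62) :=
    congrArg Subtype.val (hC.lie_lie α hα)
  have hpos := isWeightBasis_real.killingForm_pos_of_sl2 he (hC.coe_mem_h₀ hα) hl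
  have hr2 := mul_self_pos.mpr hr
  have hc (x : g₀) : ((r • x : g₀) : E62) = r • (x : E62) := rfl
  have hn (x : g₀) : ((-x : g₀) : E62) = -(x : E62) := rfl
  rcases h with h | h
  · rw [h, hE.map_coe, map_smul, hC.map_e α hα, hc, hc, hn, map_smul, map_smul,
      LinearMap.smul_apply, map_neg, smul_eq_mul, smul_eq_mul]
    nlinarith
  · rw [h, hE.map_coe, map_smul, hC.map_f α hα, hc, hc, hn, map_smul, map_smul,
      LinearMap.smul_apply, map_neg, smul_eq_mul, smul_eq_mul, LieModule.traceForm_comm]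
    nlinarith

/-- Θ is -1 on h₀ and the identity on tri(pC), and it preserves the Killing form. -/
lemma killingForm_triPC (k : Fin 4) (d : paraC.tri) :
    killingForm ℝ E62 (realGen k : E62) (inTri' d) = 0 := by
  have h := LieAlgebra.killingForm_of_equiv_apply Θ (realGen k : E62) (inTri' d)
  rw [hE.map_h₀ hC.neg (realGen k).2, hE.map_inTri', map_neg, LinearMap.neg_apply] at h
  linarith

lemma killingForm_basis_eq_zero_of_weight {i j : Ind} (h : indWeight i ≠ indWeight j) :
    killingForm ℝ E62 (basis i) (Θ (basis j)) = 0 :=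
  isWeightBasis_real.killingForm_apply_eq_zero Θ (fun _ hx ↦ hE.map_h₀ hC.neg hx) (half_ne_half h)

lemma killingForm_inl_inr (p : Os.Pairs) (d : paraC.tri) :
    killingForm ℝ E62 (basis (Sum.inl p)) (inTri' d) = 0 := by
  by_cases h : Os.triWeight p.1.1 p.1.2 = 0
  · obtain ⟨k, hk⟩ := exists_basis_eq_realGen p h
    rw [hk, hC.killingForm_triPC hE]
  · have h1 : d ∈ Submodule.span ℝ (Set.range triCBasis) := by
      rw [triCBasis.span_eq]; exact Submodule.mem_top
    have h2 (k : Fin 2) : killingForm ℝ E62 (basis (Sum.inl p)) (inTri' (triCBasis k)) = 0 := by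
      rw [← hE.map_inTri', ← basis_inr_inl]
      exact hC.killingForm_basis_eq_zero_of_weight hE h
    have h3 : killingForm ℝ E62 (basis (Sum.inl p)) ∘ₗ inTri'ₗ = 0 :=
      triCBasis.ext fun k ↦ h2 k
    exact LinearMap.congr_fun h3 d

/-- Equal weights leave three situations: two vectors in h₀ + tri(pC), the same vector of tri(pO_s),
excluded by `hij`, and the pair ι_i(x ⊗ 1), ι_i(x ⊗ **i**), which is handled by `killingForm_one_I`.
-/
lemma killingForm_basis_eq_zero {i j : Ind} (hij : i ≠ j) :
    killingForm ℝ E62 (basis i) (Θ (basis j)) = 0 := by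
  by_cases h : indWeight i = indWeight j
  · rcases i with p | k | ⟨i, b, k⟩ <;> rcases j with p' | k' | ⟨i', b', k'⟩
    · by_cases hp : Os.triWeight p.1.1 p.1.2 = 0
      · obtain ⟨k, hk⟩ := exists_basis_eq_realGen p hp
        obtain ⟨l, hl⟩ := exists_basis_eq_realGen p' (h.symm.trans hp)
        have hkl : k ≠ l := fun h' ↦ hij (basis.injective (by rw [hk, hl, h']))
        rw [hk, hl, hE.map_h₀ hC.neg (realGen l).2, map_neg, killingForm_realGen, if_neg hkl,
          neg_zero]
      · have : (Sum.inl p' : Ind₀) = Sum.inl p := indWeight₀_injective hp h.symm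
        exact absurd (congrArg Sum.inl (Sum.inl.inj this)).symm hij
    · rw [basis_inr_inl, hE.map_inTri', hC.killingForm_inl_inr hE]
    · exact absurd h (triWeight_ne_weight _ _ _ _ p.2)
    · rw [← LieAlgebra.killingForm_of_equiv_apply Θ, hE.invol, basis_inr_inl, hE.map_inTri',
        LieModule.traceForm_comm]
      exact hC.killingForm_inl_inr hE p' _
    · rw [basis_inr_inl, basis_inr_inl, hE.map_inTri', killingForm_triCBasis, if_neg]
      rintro rfl
      exact hij rfl
    · exact absurd h.symm (weight_ne_zero i' b')
    · exact absurd h.symm (triWeight_ne_weight _ _ _ _ p'.2)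
    · exact absurd h (weight_ne_zero i b)
    · obtain ⟨rfl, rfl⟩ := weight_injective i b i' b' h.symm
      obtain ⟨c, hc⟩ := hE.map_iota i' b'
      have h01 : ∀ k k' : Fin 2, k ≠ k' → k = 0 ∧ k' = 1 ∨ k = 1 ∧ k' = 0 := by decide
      rcases h01 k k' (fun hk ↦ hij (by rw [hk])) with ⟨rfl, rfl⟩ | ⟨rfl, rfl⟩
      · rw [basis_inr_inr_zero, basis_inr_inr_one, hc, map_smul, hE.killingForm_one_I, smul_zero]
      · rw [basis_inr_inr_zero, basis_inr_inr_one, hc, map_smul, LieModule.traceForm_comm]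
        have := hE.killingForm_one_I i' (b' + 4)
        rw [Os.add_four_add_four] at this
        rw [this, smul_zero]
  · exact hC.killingForm_basis_eq_zero_of_weight hE h

lemma killingForm_basis_neg (j : Ind) : killingForm ℝ E62 (basis j) (Θ (basis j)) < 0 := by
  rcases j with p | k | ⟨i, b, k⟩
  · by_cases hp : Os.triWeight p.1.1 p.1.2 = 0
    · obtain ⟨k, hk⟩ := exists_basis_eq_realGen p hp
      rw [hk, hE.map_h₀ hC.neg (realGen k).2, map_neg, killingForm_realGen, if_pos rfl]
      norm_num
    · rw [basis_inl_eq]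
      exact hC.killingForm_coe_basis₀_neg hE _ hp
  · rw [basis_inr_inl, hE.map_inTri', killingForm_triCBasis, if_pos rfl]
    fin_cases k <;> norm_num
  · have h0 := hC.killingForm_coe_basis₀_neg hE (Sum.inr (i, b)) (weight_ne_zero i b)
    have h01 : ∀ k : Fin 2, k = 0 ∨ k = 1 := by decide
    rcases h01 k with rfl | rfl
    · rw [basis_inr_inr_zero, iota_one_eq]
      exact h0
    -- Ψ_{i+1} commutes with Θ and preserves κ, so the value at ι_i(x ⊗ **i**) equals the one at
    -- ι_i(x ⊗ 1).
    · rw [basis_inr_inr_one, iota_I_eq, map_neg, map_neg, map_neg, LinearMap.neg_apply, neg_neg,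
        hE.map_Psi, killingForm_Psi]
      exact h0

theorem isCartanInvolution_extension : IsCartanInvolution Θ :=
  isCartanInvolution_of_orthogonal_basis basis hE.invol
    (fun _ _ hij ↦ hC.killingForm_basis_eq_zero hE hij) (hC.killingForm_basis_neg hE)

omit hE

lemma mem_sup_of_basis₀ {V W : Submodule ℝ g₀} (h0 : h₀' ≤ W)
    (h1 : ∀ α ∈ positive, e α - f α ∈ V) (h2 : ∀ α ∈ positive, e α + f α ∈ W) : V ⊔ W = ⊤ := by
  rw [eq_top_iff, ← basis₀.span_eq, Submodule.span_le]
  rintro _ ⟨j, rfl⟩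
  by_cases hj : indWeight₀ j = 0
  · exact Submodule.mem_sup_right (h0 (basis₀_mem_h₀ j hj))
  · obtain ⟨α, hα, -, r, h⟩ := hC.exists_positive j hj
    have h3 := Submodule.mem_sup_left (T := W) (h1 α hα)
    have h4 := Submodule.mem_sup_right (S := V) (h2 α hα)
    rcases h with h | h
    · have h5 : basis₀ j = (r / 2) • (e α - f α) + (r / 2) • (e α + f α) := by
        rw [h]; module
      rw [h5]
      exact add_mem (Submodule.smul_mem _ _ h3) (Submodule.smul_mem _ _ h4)
    · have h5 : basis₀ j = -((r / 2) • (e α - f α)) + (r / 2) • (e α + f α) := by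
        rw [h]; module
      rw [h5]
      exact add_mem (neg_mem (Submodule.smul_mem _ _ h3)) (Submodule.smul_mem _ _ h4)

lemma sub_mem_fixedSpace {α : Dual ℝ h₀'} (hα : α ∈ positive) : e α - f α ∈ fixedSpace θ := by
  rw [mem_fixedSpace, map_sub, hC.map_e α hα, hC.map_f α hα]; abel

lemma add_mem_antiSpace {α : Dual ℝ h₀'} (hα : α ∈ positive) : e α + f α ∈ antiSpace θ := by
  rw [mem_antiSpace, map_add, hC.map_e α hα, hC.map_f α hα]; abel

lemma t₀_le : t₀ e f ≤ fixedSpace θ := by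
  refine Submodule.span_le.mpr ?_
  rintro _ ⟨α, hα, rfl⟩
  exact hC.sub_mem_fixedSpace hα

lemma p₀_le : p₀ e f ≤ antiSpace θ := by
  refine sup_le (fun x hx ↦ hC.neg x hx) (Submodule.span_le.mpr ?_)
  rintro _ ⟨α, hα, rfl⟩
  exact hC.add_mem_antiSpace hα

lemma t₀_sup_p₀ : t₀ e f ⊔ p₀ e f = ⊤ :=
  hC.mem_sup_of_basis₀ le_sup_left (fun α hα ↦ Submodule.subset_span ⟨α, hα, rfl⟩)
    fun α hα ↦ Submodule.mem_sup_right (Submodule.subset_span ⟨α, hα, rfl⟩)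

omit hC in
-- The two eigenspaces meet in zero, so subspaces of them that together span cannot be proper. This
-- identifies t and p without a count of dimensions.
lemma eq_of_le_of_sup_eq_top {L : Type*} [LieRing L] [LieAlgebra ℝ L] {θ : L ≃ₗ⁅ℝ⁆ L}
    {V W : Submodule ℝ L} (hV : V ≤ fixedSpace θ) (hW : W ≤ antiSpace θ) (h : V ⊔ W = ⊤) :
    V = fixedSpace θ ∧ W = antiSpace θ := by
  refine ⟨le_antisymm hV fun x hx ↦ ?_, le_antisymm hW fun x hx ↦ ?_⟩
  · obtain ⟨v, hv, w, hw, rfl⟩ := Submodule.mem_sup.mp (h ▸ Submodule.mem_top (x := x))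
    have h1 : w ∈ fixedSpace θ := by
      have := sub_mem hx (hV hv)
      rwa [add_sub_cancel_left] at this
    rw [eq_zero_of_fixed_of_anti h1 (hW hw), add_zero]
    exact hv
  · obtain ⟨v, hv, w, hw, rfl⟩ := Submodule.mem_sup.mp (h ▸ Submodule.mem_top (x := x))
    have h1 : v ∈ antiSpace θ := by
      have := sub_mem hx (hW hw)
      rwa [add_sub_cancel_right] at this
    rw [eq_zero_of_fixed_of_anti (hV hv) h1, zero_add]
    exact hw

theorem isCartanDecomposition₀ : IsCartanDecomposition (t₀ e f) (p₀ e f) := by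
  obtain ⟨h1, h2⟩ := eq_of_le_of_sup_eq_top hC.t₀_le hC.p₀_le hC.t₀_sup_p₀
  rw [h1, h2]
  exact hC.isCartanInvolution.isCartanDecomposition

include hE

omit hC in
lemma coe_mem_fixedSpace {x : g₀} (hx : x ∈ fixedSpace θ) : (x : E62) ∈ fixedSpace Θ := by
  rw [mem_fixedSpace, hE.map_coe, mem_fixedSpace.mp hx]

omit hC in
lemma coe_mem_antiSpace {x : g₀} (hx : x ∈ antiSpace θ) : (x : E62) ∈ antiSpace Θ := by
  rw [mem_antiSpace, hE.map_coe, mem_antiSpace.mp hx]; rfl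

lemma t_le : t e f ≤ fixedSpace Θ := by
  refine sup_le (sup_le (Submodule.span_le.mpr ?_) (Submodule.map_le_iff_le_comap.mpr
    fun x hx ↦ coe_mem_fixedSpace hE (hC.t₀_le hx))) (iSup_le fun i ↦ Submodule.span_le.mpr ?_)
  · rintro _ ⟨d, rfl⟩
    exact hE.map_inTri' d
  · rintro _ ⟨α, hα, -, rfl⟩
    have := coe_mem_fixedSpace hE (hC.sub_mem_fixedSpace hα)
    change Θ _ = _
    rw [hE.map_Psi, mem_fixedSpace.mp this]

lemma p_le : p e f ≤ antiSpace Θ := by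
  refine sup_le (Submodule.map_le_iff_le_comap.mpr
    fun x hx ↦ coe_mem_antiSpace hE (hC.p₀_le hx)) (iSup_le fun i ↦ Submodule.span_le.mpr ?_)
  rintro _ ⟨α, hα, -, rfl⟩
  have := coe_mem_antiSpace hE (hC.add_mem_antiSpace hα)
  change Θ _ = -_
  rw [hE.map_Psi, mem_antiSpace.mp this, map_neg]

omit hE

omit hC in
lemma coords'_mem_PhiShort {i : Fin 3} {b : Fin 8} {v : Fin 4 → ℝ}
    (h : v = half (Os.weight i b) ∨ v = -half (Os.weight i b)) : v ∈ PhiShort i := by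
  refine (mem_PhiShort_iff i v).mpr ?_
  rcases h with h | h
  · exact ⟨b, h⟩
  · exact ⟨b + 4, by rw [h, weight_add_four, half_neg]⟩

lemma t_sup_p : t e f ⊔ p e f = ⊤ := by
  have hg (x : g₀) : (x : E62) ∈ t e f ⊔ p e f := by
    obtain ⟨y, hy, z, hz, rfl⟩ :=
      Submodule.mem_sup.mp (hC.t₀_sup_p₀ ▸ Submodule.mem_top (x := x))
    refine add_mem (Submodule.mem_sup_left (Submodule.mem_sup_left (Submodule.mem_sup_right ?_)))
      (Submodule.mem_sup_right (Submodule.mem_sup_left ?_))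
    · exact Submodule.mem_map_of_mem (f := g₀.toSubmodule.subtype) hy
    · exact Submodule.mem_map_of_mem (f := g₀.toSubmodule.subtype) hz
  rw [eq_top_iff, ← basis.span_eq, Submodule.span_le]
  rintro _ ⟨p' | k | ⟨i, b, k⟩, rfl⟩
  · rw [basis_inl_eq]; exact hg _
  · rw [basis_inr_inl]
    exact Submodule.mem_sup_left (Submodule.mem_sup_left (Submodule.mem_sup_left
      (Submodule.subset_span ⟨_, rfl⟩)))
  · have h01 : ∀ k : Fin 2, k = 0 ∨ k = 1 := by decide
    rcases h01 k with rfl | rfl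
    · rw [basis_inr_inr_zero, iota_one_eq]; exact hg _
    · have h2 : ∀ i : Fin 3, i + 2 ≠ i ∧ i = i + 2 + 1 := by decide
      have h3 : iota i (Os.std b ⊗ₜ Complex.I) = -Psi (i + 2) (basis₀ (Sum.inr (i, b)) : g₀) := by
        rw [← iota_one_eq, Psi_iota, if_neg (h2 i).1.symm, mul_one, TensorProduct.tmul_neg,
          map_neg, neg_neg]
      rw [basis_inr_inr_one, h3]
      refine neg_mem ?_
      obtain ⟨α, hα, hv, r, h⟩ := hC.exists_positive (Sum.inr (i, b)) (weight_ne_zero i b)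
      have hs : coords' α ∈ PhiShort (i + 2 + 1) := by
        rw [← (h2 i).2]
        exact coords'_mem_PhiShort hv
      have h4 : Psi (i + 2) (e α - f α : g₀) ∈ t e f ⊔ p e f :=
        Submodule.mem_sup_left (Submodule.mem_sup_right
          (Submodule.mem_iSup_of_mem (i + 2) (Submodule.subset_span ⟨α, hα, hs, rfl⟩)))
      have h5 : Psi (i + 2) (e α + f α : g₀) ∈ t e f ⊔ p e f :=
        Submodule.mem_sup_right (Submodule.mem_sup_right
          (Submodule.mem_iSup_of_mem (i + 2) (Submodule.subset_span ⟨α, hα, hs, rfl⟩)))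
      have hsub (x y : g₀) : ((x - y : g₀) : E62) = (x : E62) - y := rfl
      have hadd (x y : g₀) : ((x + y : g₀) : E62) = (x : E62) + y := rfl
      have hsmul (x : g₀) : ((r • x : g₀) : E62) = r • (x : E62) := rfl
      rw [hsub, map_sub] at h4
      rw [hadd, map_add] at h5
      rcases h with h | h
      · have h6 : Psi (i + 2) (basis₀ (Sum.inr (i, b)) : g₀) =
            (r / 2) • (Psi (i + 2) (e α) - Psi (i + 2) (f α)) +
              (r / 2) • (Psi (i + 2) (e α) + Psi (i + 2) (f α)) := by
          rw [h, hsmul, map_smul]; module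
        rw [h6]
        exact add_mem (Submodule.smul_mem _ _ h4) (Submodule.smul_mem _ _ h5)
      · have h6 : Psi (i + 2) (basis₀ (Sum.inr (i, b)) : g₀) =
            -((r / 2) • (Psi (i + 2) (e α) - Psi (i + 2) (f α))) +
              (r / 2) • (Psi (i + 2) (e α) + Psi (i + 2) (f α)) := by
          rw [h, hsmul, map_smul]; module
        rw [h6]
        exact add_mem (neg_mem (Submodule.smul_mem _ _ h4)) (Submodule.smul_mem _ _ h5)

include hE

lemma t_eq : t e f = fixedSpace Θ :=
  (eq_of_le_of_sup_eq_top (hC.t_le hE) (hC.p_le hE) hC.t_sup_p).1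

lemma p_eq : p e f = antiSpace Θ :=
  (eq_of_le_of_sup_eq_top (hC.t_le hE) (hC.p_le hE) hC.t_sup_p).2

theorem isCartanDecomposition : IsCartanDecomposition (t e f) (p e f) := by
  rw [hC.t_eq hE, hC.p_eq hE]
  exact (hC.isCartanInvolution_extension hE).isCartanDecomposition

/-- Θ reverses weights, so only basis vectors of weight zero contribute to the trace: -1 for each of
the four in h₀ and +1 for each of the two in tri(pC). -/
lemma trace_extension : LinearMap.trace ℝ E62 (Θ.toLinearEquiv : E62 →ₗ[ℝ] E62) = -2 := by
  rw [LinearMap.trace_eq_matrix_trace ℝ basis, Matrix.trace]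
  have h : ∀ j : Ind, (LinearMap.toMatrix basis basis (Θ.toLinearEquiv : E62 →ₗ[ℝ] E62)).diag j =
      Sum.elim (fun p : Os.Pairs ↦ if Os.triWeight p.1.1 p.1.2 = 0 then (-1 : ℝ) else 0)
        (Sum.elim (fun _ ↦ 1) fun _ ↦ 0) j := by
    intro j
    rw [Matrix.diag_apply, LinearMap.toMatrix_apply]
    change basis.repr (Θ (basis j)) j = _
    have hz (hj : indWeight j ≠ 0) : basis.repr (Θ (basis j)) j = 0 := by
      obtain ⟨k, hk⟩ := Function.ne_iff.mp hj
      have h2 : (realGen k : E62) = -Θ (realGen k) := by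
        rw [hE.map_h₀ hC.neg (realGen k).2, neg_neg]
      have h1 := isWeightBasis_real.repr_lie k (Θ (basis j)) j
      rw [h2, neg_lie, ← LieEquiv.map_lie, isWeightBasis_real.lie, map_smul, map_neg, map_smul,
        Finsupp.neg_apply, Finsupp.smul_apply, smul_eq_mul] at h1
      have h3 : (indWeight j k : ℝ) ≠ 0 := by exact_mod_cast hk
      have h4 : (indWeight j k : ℝ) * basis.repr (Θ (basis j)) j = 0 := by linarith
      exact (mul_eq_zero.mp h4).resolve_left h3
    rcases j with p | k | ⟨i, b, k⟩
    · rw [Sum.elim_inl]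
      split_ifs with hp
      · obtain ⟨k, hk⟩ := exists_basis_eq_realGen p hp
        have h2 : Θ (basis (Sum.inl p)) = -basis (Sum.inl p) := by
          rw [hk, hE.map_h₀ hC.neg (realGen k).2]
        rw [h2, map_neg, Finsupp.neg_apply, Basis.repr_self, Finsupp.single_eq_same]
      · exact hz hp
    · rw [basis_inr_inl, hE.map_inTri', ← basis_inr_inl, Basis.repr_self, Finsupp.single_eq_same]
      rfl
    · exact hz (weight_ne_zero i b)
  rw [Finset.sum_congr rfl fun j _ ↦ h j, Fintype.sum_sum_type, Fintype.sum_sum_type]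
  simp only [Sum.elim_inl, Sum.elim_inr, Finset.sum_const_zero, add_zero, Finset.sum_ite,
    Finset.sum_const]
  have hcard : (Finset.univ.filter fun p : Os.Pairs ↦ Os.triWeight p.1.1 p.1.2 = 0).card = 4 := by
    decide +kernel
  rw [hcard]
  norm_num

lemma finrank_t : finrank ℝ (t e f) = 38 := by
  have h := (hC.isCartanInvolution_extension hE).two_mul_finrank_fixedSpace
  rw [hC.trace_extension hE, finrank_eq, ← hC.t_eq hE] at h
  have : (finrank ℝ (t e f) : ℝ) = 38 := by push_cast at h; linarith
  exact_mod_cast this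

lemma finrank_p : finrank ℝ (p e f) = 40 := by
  have h := Submodule.finrank_add_eq_of_isCompl (hC.isCartanInvolution_extension hE).isCompl
  rw [← hC.t_eq hE, ← hC.p_eq hE, hC.finrank_t hE, finrank_eq] at h
  omega

lemma killingSignature_eq_two : killingSignature E62 = 2 := by
  rw [(hC.isCartanInvolution_extension hE).killingSignature_eq, ← hC.t_eq hE, ← hC.p_eq hE,
    hC.finrank_t hE, hC.finrank_p hE]
  norm_num

/-- h is the sum of h₀, where Θ is -1, and tri(pC), where it is 1, so its parts in the two
eigenspaces are these summands. -/
lemma mem_t_of_mem_hFull {x : E62} (hx : x ∈ hFull) :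
    (x ∈ t e f → x ∈ triPC) ∧ (x ∈ p e f → x ∈ h₀) := by
  rw [hC.t_eq hE, hC.p_eq hE]
  rw [hFull_eq] at hx
  obtain ⟨y, hy, z, hz, rfl⟩ := Submodule.mem_sup.mp hx
  have h1 : Θ y = -y := hE.map_h₀ hC.neg hy
  have h2 : z ∈ fixedSpace Θ := by
    refine (Submodule.span_le.mpr ?_ : triPC ≤ fixedSpace Θ) hz
    rintro _ ⟨d, rfl⟩
    exact hE.map_inTri' d
  refine ⟨fun h ↦ ?_, fun h ↦ ?_⟩
  · have h3 : Θ y = y := by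
      have := sub_mem h h2
      rwa [add_sub_cancel_right] at this
    rw [eq_zero_of_fixed_of_anti h3 h1, zero_add]
    exact hz
  · have h3 : z ∈ antiSpace Θ := by
      have := sub_mem h (mem_antiSpace.mpr h1)
      rwa [add_sub_cancel_left] at this
    rw [eq_zero_of_fixed_of_anti h2 h3, add_zero]
    exact hy

lemma hFull_inf_t : hFull ⊓ t e f = triPC := by
  refine le_antisymm (fun x hx ↦ (hC.mem_t_of_mem_hFull hE hx.1).1 hx.2) (le_inf ?_ ?_)
  · rw [hFull_eq]; exact le_sup_right
  · exact le_sup_left.trans le_sup_left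

lemma hFull_inf_p : hFull ⊓ p e f = h₀ := by
  refine le_antisymm (fun x hx ↦ (hC.mem_t_of_mem_hFull hE hx.1).2 hx.2) (le_inf ?_ ?_)
  · rw [hFull_eq]; exact le_sup_left
  · rw [hC.p_eq hE]
    exact fun x hx ↦ hE.map_h₀ hC.neg hx

end IsChevalley

end E62

/-! ### Simplicity from a connected Dynkin diagram. -/

section Simplicity

open Module LieAlgebra LieModule

variable {K L : Type*} [Field K] [CharZero K] [IsAlgClosed K] [LieRing L] [LieAlgebra K L]
  [FiniteDimensional K L]

/-- The roots of `rootSystem` come from generalized weight spaces; in a Killing algebra H acts on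
them by honest eigenvalues, so they are the elements of `roots`. -/
lemma exists_root_iff [IsKilling K L] (H : LieSubalgebra K L) [H.IsCartanSubalgebra]
    (χ : Dual K H) : (∃ α, (IsKilling.rootSystem H).root α = χ) ↔ χ ∈ roots H.toSubmodule := by
  constructor
  · rintro ⟨⟨α, hα⟩, rfl⟩
    have h0 : α.IsNonZero := H.isNonZero_coe_root ⟨α, hα⟩
    refine ⟨fun h ↦ h0 (funext fun x ↦ LinearMap.congr_fun h x), ?_⟩
    obtain ⟨x, hx, hx0⟩ := α.exists_ne_zero
    exact (Submodule.ne_bot_iff _).mpr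
      ⟨x, fun h ↦ IsKilling.lie_eq_smul_of_mem_rootSpace hx h, hx0⟩
  · rintro ⟨h0, h1⟩
    obtain ⟨x, hx, hx0⟩ := Submodule.exists_mem_ne_zero_of_ne_bot h1
    have hx' : x ∈ genWeightSpace L (χ : H → K) :=
      weightSpace_le_genWeightSpace L _ ((LieModule.mem_weightSpace _ _).mpr fun h ↦ hx h)
    have hb : genWeightSpace L (χ : H → K) ≠ ⊥ := fun h ↦ hx0 (by
      rw [h] at hx'; exact (LieSubmodule.mem_bot _).mp hx')
    let α : Weight K H L := ⟨χ, hb⟩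
    have hα : α ∈ H.root := by
      rw [LieSubalgebra.root, Finset.mem_filter]
      exact ⟨Finset.mem_univ _, fun h ↦ h0 (LinearMap.ext fun x ↦ congrFun h x)⟩
    exact ⟨⟨α, hα⟩, LinearMap.ext fun x ↦ rfl⟩

/-- A semisimple Lie algebra with a connected Dynkin diagram is simple. -/
theorem isSimple_of_roots [IsKilling K L] {H : Submodule K L} (hH : IsCartanSubspace H) {n : ℕ}
    [NeZero n] (β : Basis (Fin n) K (Dual K H)) (R : Set (Fin n → ℤ))
    (hR : roots H = {v | ∃ c ∈ R, v = ∑ i, (c i : K) • β i})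
    (hs : ∀ i, Pi.single i 1 ∈ R) (hs' : ∀ i, -Pi.single i 1 ∈ R)
    (h1 : ∀ c ∈ R, ∃ i, c = Pi.single i 1 ∨ c = -Pi.single i 1 ∨ c + Pi.single i 1 ∈ R ∨
      c + -Pi.single i 1 ∈ R)
    (h2 : ∀ i j, Relation.ReflTransGen (fun i j ↦ Pi.single i 1 + Pi.single j 1 ∈ R) i j) :
    IsSimple K L := by
  obtain ⟨H, rfl, hC⟩ := hH
  set comb : (Fin n → ℤ) → Dual K H := fun c ↦ ∑ i, (c i : K) • β i with hcomb
  have hadd (c d) : comb (c + d) = comb c + comb d := by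
    simp only [hcomb, Pi.add_apply, Int.cast_add, add_smul, Finset.sum_add_distrib]
  have hneg (c) : comb (-c) = -comb c := by
    refine eq_neg_of_add_eq_zero_left ?_
    rw [← hadd, neg_add_cancel]
    simp only [hcomb, Pi.zero_apply, Int.cast_zero, zero_smul, Finset.sum_const_zero]
  have hsingle (i) : comb (Pi.single i 1) = β i := by
    simp only [hcomb]
    rw [Finset.sum_eq_single i (fun j _ hj ↦ by rw [Pi.single_eq_of_ne hj]; simp) (by simp)]
    simp
  have hroot (χ : Dual K H) :
      (∃ α, (IsKilling.rootSystem H).root α = χ) ↔ ∃ c ∈ R, χ = comb c := by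
    rw [exists_root_iff H χ]
    exact Set.ext_iff.mp hR χ
  have : Nontrivial (Dual K H) := ⟨β 0, 0, β.ne_zero 0⟩
  refine IsKilling.isSimple_iff_isIrreducible (H := H).mp
    (RootPairing.IsIrreducible.mk' _ fun q hq hq0 ↦ ?_)
  let q' : (IsKilling.rootSystem H).invtRootSubmodule :=
    ⟨q, (IsKilling.rootSystem H).mem_invtRootSubmodule_iff.mpr hq⟩
  -- If the sum of two roots is a root, an invariant subspace contains both of them or neither.
  have step {c d : Fin n → ℤ} (hc : c ∈ R) (hd : d ∈ R) (hcd : c + d ∈ R) :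
      comb c ∈ q ↔ comb d ∈ q := by
    obtain ⟨i, hi⟩ := (hroot _).mpr ⟨c, hc, rfl⟩
    obtain ⟨j, hj⟩ := (hroot _).mpr ⟨d, hd, rfl⟩
    obtain ⟨k, hk⟩ := (hroot _).mpr ⟨_, hcd, rfl⟩
    have := RootPairing.root_mem_submodule_iff_of_add_mem_invtSubmodule q' (i := i) (j := j)
      ⟨k, by rw [hk, hi, hj, hadd]⟩
    rwa [hi, hj] at this
  -- A nonzero invariant subspace contains a root. By `h1` it then contains a simple root, and by
  -- connectedness all of them.
  have hne : ∃ c ∈ R, comb c ∈ q := by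
    by_contra! h
    refine hq0 (congrArg Subtype.val
      ((RootPairing.invtRootSubmodule.eq_bot_iff q').mpr fun i hi ↦ ?_) : q = ⊥)
    obtain ⟨c, hc, h3⟩ := (hroot _).mp ⟨i, rfl⟩
    exact h c hc (h3 ▸ hi)
  obtain ⟨c, hc, hcq⟩ := hne
  have hi : ∃ i, comb (Pi.single i 1) ∈ q := by
    obtain ⟨i, h | h | h | h⟩ := h1 c hc
    · exact ⟨i, h ▸ hcq⟩
    · rw [h, hneg] at hcq
      exact ⟨i, q.neg_mem_iff.mp hcq⟩
    · exact ⟨i, (step hc (hs i) h).mp hcq⟩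
    · have h3 := (step hc (hs' i) h).mp hcq
      rw [hneg] at h3
      exact ⟨i, q.neg_mem_iff.mp h3⟩
  obtain ⟨i, hi⟩ := hi
  have hall (j) : comb (Pi.single j 1) ∈ q := by
    induction h2 i j with
    | refl => exact hi
    | tail _ h ih => exact (step (hs _) (hs _) h).mp ih
  rw [eq_top_iff, ← β.span_eq, Submodule.span_le]
  rintro _ ⟨j, rfl⟩
  rw [← hsingle]
  exact hall j

end Simplicity

/-! ### Centralizers, Cartan subalgebras and simplicity of the complexification. -/

namespace E62

open MagicAlg Module

lemma lie_eq_zero_of_span_eq_top {K L ι : Type*} [Field K] [LieRing L] [LieAlgebra K L]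
    {H : Submodule K L} {g : ι → H} (hs : Submodule.span K (Set.range g) = ⊤)
    (hg : ∀ k l, ⁅(g k : L), (g l : L)⁆ = 0) : ∀ x ∈ H, ∀ y ∈ H, ⁅x, y⁆ = 0 := by
  have key (x y : H) : ⁅(x : L), (y : L)⁆ = 0 := by
    have hx : x ∈ Submodule.span K (Set.range g) := hs ▸ Submodule.mem_top
    have hy : y ∈ Submodule.span K (Set.range g) := hs ▸ Submodule.mem_top
    induction hx, hy using Submodule.span_induction₂ with
    | mem_mem x y hx hy =>
      obtain ⟨k, rfl⟩ := hx
      obtain ⟨l, rfl⟩ := hy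
      exact hg k l
    | zero_left y hy => exact zero_lie _
    | zero_right x hx => exact lie_zero _
    | add_left x y z _ _ _ h1 h2 => rw [Submodule.coe_add, add_lie, h1, h2, add_zero]
    | add_right x y z _ _ _ h1 h2 => rw [Submodule.coe_add, lie_add, h1, h2, add_zero]
    | smul_left r x y _ _ h => rw [Submodule.coe_smul, smul_lie, h, smul_zero]
    | smul_right r x y _ _ h => rw [Submodule.coe_smul, lie_smul, h, smul_zero]
  exact fun x hx y hy ↦ key ⟨x, hx⟩ ⟨y, hy⟩

lemma lie_hReal_hReal (k l : Fin 4) : ⁅hReal k, hReal l⁆ = 0 := by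
  have h0 : ∀ k : Fin 4, Os.triWeight (Fin.castLE (by decide) k)
      (Fin.castLE (by decide) k + 4) = 0 := by decide
  rw [← inTri_torus l, Os.torus, lie_hReal_inTri, h0]
  simp

lemma h_cases (k : Fin 6) : (∃ i, h k = hReal i) ∨ ∃ i, h k = inTri' (torusC i) := by
  fin_cases k
  · exact Or.inl ⟨0, rfl⟩
  · exact Or.inl ⟨1, rfl⟩
  · exact Or.inl ⟨2, rfl⟩
  · exact Or.inl ⟨3, rfl⟩
  · exact Or.inr ⟨0, rfl⟩
  · exact Or.inr ⟨1, rfl⟩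

lemma lie_h_h (k l : Fin 6) : ⁅h k, h l⁆ = 0 := by
  rcases h_cases k with ⟨i, hi⟩ | ⟨i, hi⟩ <;> rcases h_cases l with ⟨j, hj⟩ | ⟨j, hj⟩ <;> rw [hi, hj]
  · exact lie_hReal_hReal i j
  · exact lie_hReal_inTri' i _
  · rw [← lie_skew, lie_hReal_inTri', neg_zero]
  · exact lie_inTri'_inTri' _ _

lemma lie_hFull : ∀ x ∈ hFull, ∀ y ∈ hFull, ⁅x, y⁆ = 0 :=
  lie_eq_zero_of_span_eq_top gen.span_eq fun k l ↦ by
    rw [gen_apply, gen_apply]; exact lie_h_h k l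

lemma h₀_le_hFull : h₀ ≤ hFull := by
  rw [hFull_eq]; exact le_sup_left

lemma isSplitCartan_h₀ : IsSplitCartan h₀' :=
  isWeightBasis_real₀.isSplitCartan (fun j hj ↦ basis₀_mem_h₀ j
    (half_injective ((show half (indWeight₀ j) = 0 from hj).trans half_zero.symm)))
    fun _ hx _ hy ↦ Subtype.ext (lie_hFull _ (h₀_le_hFull hx) _ (h₀_le_hFull hy))

lemma basis_mem_hFull (j : Ind) (hj : indWeight j = 0) : basis j ∈ hFull := by
  rcases j with p | k | ⟨i, b, k⟩
  · obtain ⟨k, hk⟩ := exists_basis_eq_realGen p hj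
    rw [hk]
    exact h₀_le_hFull (realGen k).2
  · rw [basis_inr_inl, hFull_eq]
    exact Submodule.mem_sup_right (Submodule.subset_span ⟨_, rfl⟩)
  · exact absurd hj (weight_ne_zero i b)

/-- The centralizer of h₀ in g is spanned by the basis vectors of weight zero, all of which lie in
h. Both maximality statements rest on this. -/
lemma mem_hFull_of_lie {x : E62} (hx : ∀ k, ⁅hReal k, x⁆ = 0) : x ∈ hFull := by
  have h1 : x ∈ weightSpace h₀ (0 : Dual ℝ h₀) :=
    (isWeightBasis_real.mem_weightSpace_iff_lie _ _).mpr fun k ↦ by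
      rw [realGen_apply, hx]; simp
  rw [isWeightBasis_real.weightSpace_eq_span] at h1
  refine Submodule.span_le.mpr ?_ h1
  rintro _ ⟨j, hj, rfl⟩
  exact basis_mem_hFull j
    (half_injective ((show half (indWeight j) = 0 from hj).trans half_zero.symm))

lemma indWeight_eq_zero {j : Ind} (h : ∀ k : Fin 4, indWeightC j (Fin.castLE (by decide) k) = 0) :
    indWeight j = 0 := by
  funext k
  fin_cases k
  exacts [h 0, h 1, h 2, h 3]

/-- Weights on ι_i never vanish on h₀, and tri(pC) acts trivially on the two triality algebras.
Hence no root vanishes on h₀. -/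
lemma indWeightC_eq_zero {j : Ind} (h : indWeight j = 0) : indWeightC j = 0 := by
  rcases j with p | k | ⟨i, b, k⟩
  · change Os.triWeight p.1.1 p.1.2 = 0 at h
    funext k
    fin_cases k
    exacts [congrFun h 0, congrFun h 1, congrFun h 2, congrFun h 3, rfl, rfl]
  · funext k'
    fin_cases k' <;> rfl
  · exact absurd h (weight_ne_zero i b)

lemma basisC_mem (j : Ind) (hj : indWeightC j = 0) : basisC j ∈ hFull.baseChange ℂ := by
  have h0 : indWeight j = 0 := indWeight_eq_zero fun k ↦ congrFun hj _
  have h1 := Submodule.tmul_mem_baseChange_of_mem (1 : ℂ) (basis_mem_hFull j h0)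
  rw [basisC_apply]
  rcases j with p | k | ⟨i, b, k⟩
  · exact h1
  · exact h1
  · exact absurd h0 (weight_ne_zero i b)

lemma isCartanSubspace_complex : IsCartanSubspace (hFull.baseChange ℂ) := by
  refine isWeightBasis_complex.isCartanSubspace (fun j hj ↦ basisC_mem j (funext fun k ↦ ?_)) ?_
  · have := (mul_eq_zero.mp (congrFun hj k)).resolve_right (unit_ne_zero k)
    exact_mod_cast this
  · refine lie_eq_zero_of_span_eq_top genC.span_eq fun k l ↦ ?_
    rw [genC_apply, genC_apply]
    change ⁅(1 : ℂ) ⊗ₜ[ℝ] h k, (1 : ℂ) ⊗ₜ[ℝ] h l⁆ = 0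
    rw [LieAlgebra.ExtendScalars.bracket_tmul, lie_h_h, TensorProduct.tmul_zero]

theorem isSimple_complex [LieAlgebra.IsKilling ℝ E62] : LieAlgebra.IsSimple ℂ (ℂ ⊗[ℝ] E62) := by
  have := isKilling_complexification (L := E62)
  have hs : ∀ i, Pi.single i 1 ∈ rootsE₆ := by decide +kernel
  have hs' : ∀ i, -Pi.single i 1 ∈ rootsE₆ := by decide +kernel
  have h1 : ∀ c ∈ rootsE₆, ∃ i, c = Pi.single i 1 ∨ c = -Pi.single i 1 ∨
      c + Pi.single i 1 ∈ rootsE₆ ∨ c + -Pi.single i 1 ∈ rootsE₆ := by decide +kernel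
  refine isSimple_of_roots isCartanSubspace_complex simpleComplex {c | c ∈ rootsE₆}
    roots_complex_eq hs hs' h1 fun i j ↦ ?_
  -- These are the edges of the E₆ diagram; the index 3, that is α₄, is the branch node through
  -- which all paths are composed.
  have h2 : ∀ i j : Fin 6, s(i, j) ∈ [s(0, 2), s(2, 3), s(3, 4), s(4, 5), s(1, 3)] →
      Pi.single i 1 + Pi.single j 1 ∈ rootsE₆ := by decide +kernel
  have h3 (i j : Fin 6) (h : s(i, j) ∈ [s(0, 2), s(2, 3), s(3, 4), s(4, 5), s(1, 3)]) :
      Relation.ReflTransGen (fun i j ↦ Pi.single i 1 + Pi.single j 1 ∈ {c | c ∈ rootsE₆}) i j :=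
    .single (h2 i j h)
  have h4 (i : Fin 6) :
      Relation.ReflTransGen (fun i j ↦ Pi.single i 1 + Pi.single j 1 ∈ {c | c ∈ rootsE₆}) i 3 := by
    fin_cases i
    · exact (h3 0 2 (by decide)).trans (h3 2 3 (by decide))
    · exact h3 1 3 (by decide)
    · exact h3 2 3 (by decide)
    · exact .refl
    · exact h3 4 3 (by decide)
    · exact (h3 5 4 (by decide)).trans (h3 4 3 (by decide))
  have h5 (i : Fin 6) :
      Relation.ReflTransGen (fun i j ↦ Pi.single i 1 + Pi.single j 1 ∈ {c | c ∈ rootsE₆}) 3 i := by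
    fin_cases i
    · exact (h3 3 2 (by decide)).trans (h3 2 0 (by decide))
    · exact h3 3 1 (by decide)
    · exact h3 3 2 (by decide)
    · exact .refl
    · exact h3 3 4 (by decide)
    · exact (h3 3 4 (by decide)).trans (h3 4 5 (by decide))
  exact (h4 i).trans (h5 j)

end E62

/-! ### The Satake diagram and the restricted roots. -/

namespace E62

open MagicAlg Module

/-- The functionals on `h^ℂ`, as real linear maps on `h`. -/
noncomputable def dualToComplex (α : Dual ℂ (hFull.baseChange ℂ)) : hFull →ₗ[ℝ] ℂ :=
  α.restrictScalars ℝ ∘ₗ (hFull.toBaseChange ℂ).restrictScalars ℝ ∘ₗ TensorProduct.mk ℝ ℂ hFull 1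

lemma dualToComplex_apply (α : Dual ℂ (hFull.baseChange ℂ)) (x : hFull) :
    dualToComplex α x = α (toComplex x) := rfl

/-- The functionals on `h^ℂ` and on `h₀` in terms of the values at `h₁, …, h₄`. -/
lemma exists_real_coordinates (x : hFull) (hx : (x : E62) ∈ h₀) : ∃ c : Fin 4 → ℝ,
    (∀ α, α (toComplex x) = ∑ k, (c k : ℂ) * coordsC α (Fin.castLE (by decide) k)) ∧
    ∀ lam : Dual ℝ h₀, lam ⟨x, hx⟩ = ∑ k, c k * coords lam k := by
  have h1 := realGen.sum_repr ⟨x, hx⟩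
  generalize realGen.repr ⟨x, hx⟩ = c at h1
  refine ⟨c, fun α ↦ ?_, fun lam ↦ ?_⟩
  · have h2 : x = ∑ k, c k • gen (Fin.castLE (by decide) k) := by
      refine Subtype.ext ?_
      have h3 := congrArg Subtype.val h1
      rw [Submodule.coe_sum] at h3 ⊢
      refine h3.symm.trans (Finset.sum_congr rfl fun k _ ↦ ?_)
      rw [Submodule.coe_smul, Submodule.coe_smul, realGen_apply, gen_apply]; rfl
    rw [← dualToComplex_apply]
    conv_lhs => rw [h2]
    rw [map_sum]
    refine Finset.sum_congr rfl fun k _ ↦ ?_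
    rw [map_smul, Complex.real_smul, dualToComplex_apply, gen_apply]; rfl
  · rw [← h1, map_sum]
    refine Finset.sum_congr rfl fun k _ ↦ ?_
    rw [map_smul, smul_eq_mul, coords_eq, dualEquivFun_apply]

lemma sameRestriction_iff (α β : Dual ℂ (hFull.baseChange ℂ)) : SameRestriction h₀ α β ↔
    ∀ k : Fin 4, coordsC α (Fin.castLE (by decide) k) = coordsC β (Fin.castLE (by decide) k) := by
  refine ⟨fun h k ↦ h _ (Submodule.subset_span ⟨k, rfl⟩), fun h x hx ↦ ?_⟩
  obtain ⟨c, hc, -⟩ := exists_real_coordinates x hx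
  rw [hc, hc]
  exact Finset.sum_congr rfl fun k _ ↦ by rw [h]

lemma isRestriction_of_coords {α : Dual ℂ (hFull.baseChange ℂ)} {lam : Dual ℝ h₀}
    (h : ∀ k : Fin 4, coordsC α (Fin.castLE (by decide) k) = (coords lam k : ℂ)) :
    IsRestriction α lam := by
  refine ⟨h₀_le_hFull, fun x hx ↦ ?_⟩
  obtain ⟨c, h1, h2⟩ := exists_real_coordinates x hx
  rw [h1, h2]
  push_cast
  exact Finset.sum_congr rfl fun k _ ↦ by rw [h]

lemma unit_castLE (k : Fin 4) : unit (Fin.castLE (by decide) k) = 1 / 2 := by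
  fin_cases k <;> rfl

/-- Twice the coordinates of the restrictions of the simple roots. -/
def restrictedWeight (i : Fin 6) (k : Fin 4) : ℤ :=
  combE₆ (Pi.single i 1) (Fin.castLE (by decide) k)

lemma coordsC_simpleComplex_castLE (i : Fin 6) (k : Fin 4) :
    coordsC (simpleComplex i) (Fin.castLE (by decide) k) = (restrictedWeight i k : ℂ) * (1 / 2) := by
  have h := sum_simpleRoots (Pi.single i 1)
  rw [Finset.sum_eq_single i (fun j _ hj ↦ by rw [Pi.single_eq_of_ne hj]; simp) (by simp),
    Pi.single_eq_same, Int.cast_one, one_smul] at h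
  rw [coordsC_simpleComplex, h, ← unit_castLE k]; rfl

lemma sameRestriction_simple_iff (i j : Fin 6) :
    SameRestriction h₀ (simpleComplex i) (simpleComplex j) ↔
      restrictedWeight i = restrictedWeight j := by
  rw [sameRestriction_iff, funext_iff]
  refine forall_congr' fun k ↦ ?_
  rw [coordsC_simpleComplex_castLE, coordsC_simpleComplex_castLE]
  rw [mul_left_inj' (by norm_num)]
  exact Int.cast_inj

lemma not_sameRestriction_zero {α : Dual ℂ (hFull.baseChange ℂ)}
    (hα : α ∈ roots (hFull.baseChange ℂ)) : ¬ SameRestriction h₀ α 0 := by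
  intro h
  rw [sameRestriction_iff] at h
  rw [roots_complex, Set.mem_ofPred_eq, mem_Delta_iff] at hα
  obtain ⟨j, hj, hv⟩ := hα
  refine hj (indWeightC_eq_zero (indWeight_eq_zero fun k ↦ ?_))
  have h1 := h k
  rw [hv] at h1
  have h2 : (indWeightC j (Fin.castLE (by decide) k) : ℂ) * unit (Fin.castLE (by decide) k) = 0 := h1
  have h3 := (mul_eq_zero.mp h2).resolve_right (unit_ne_zero _)
  exact_mod_cast h3

lemma simpleComplex_mem_roots (i : Fin 6) : simpleComplex i ∈ roots (hFull.baseChange ℂ) := by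
  have hs : ∀ i, Pi.single i 1 ∈ rootsE₆ := by decide +kernel
  rw [roots_complex_eq]
  refine ⟨_, hs i, ?_⟩
  rw [Finset.sum_eq_single i (fun j _ hj ↦ by rw [Pi.single_eq_of_ne hj]; simp) (by simp),
    Pi.single_eq_same, Int.cast_one, one_smul]

/-- An abelian subspace containing h centralizes h₀, hence is contained in h. -/
lemma isMaximalAbelianIn_hFull : IsMaximalAbelianIn ⊤ hFull := by
  refine ⟨⟨le_top, lie_hFull⟩, fun b ⟨_, hb⟩ hle x hx ↦ mem_hFull_of_lie fun k ↦ ?_⟩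
  exact hb _ (hle (h₀_le_hFull (Submodule.subset_span ⟨k, rfl⟩))) _ hx

namespace IsChevalley

variable {e f : Dual ℝ h₀' → g₀} {θ : g₀ ≃ₗ⁅ℝ⁆ g₀} (hC : IsChevalley e f θ)
  {Θ : E62 ≃ₗ⁅ℝ⁆ E62} (hE : IsExtension θ Θ)
include hC hE

/-- An abelian subspace of p containing h₀ centralizes h₀, hence lies in the intersection of h and
p, which is h₀. -/
lemma isMaximalAbelianIn_h₀ : IsMaximalAbelianIn (p e f) h₀ := by
  refine ⟨⟨(hC.hFull_inf_p hE).symm.le.trans inf_le_right, fun x hx y hy ↦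
    lie_hFull x (h₀_le_hFull hx) y (h₀_le_hFull hy)⟩, fun b ⟨hbp, hb⟩ hle x hx ↦ ?_⟩
  rw [← hC.hFull_inf_p hE]
  exact ⟨mem_hFull_of_lie fun k ↦ hb _ (hle (Submodule.subset_span ⟨k, rfl⟩)) _ hx, hbp hx⟩

theorem isSatakeDiagram : IsSatakeDiagram (t e f) (p e f) h₀ hFull simpleComplex CartanMatrix.E₆
    ∅ {s(0, 5), s(2, 4)} where
  cartan := hC.isCartanDecomposition hE
  maximal_a := hC.isMaximalAbelianIn_h₀ hE
  le_h := h₀_le_hFull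
  maximal_h := isMaximalAbelianIn_hFull
  basis := isRootBasis_complex
  -- No root vanishes on h₀, so this condition is vacuous and there are no black nodes.
  adapted β hβ h := absurd h (not_sameRestriction_zero hβ)
  black_iff i := ⟨fun h ↦ absurd h (Set.notMem_empty i),
    fun h ↦ absurd h (not_sameRestriction_zero (simpleComplex_mem_roots i))⟩
  arrow_iff i j := by
    -- With indices from 0, the arrows join α₁ to α₆ and α₃ to α₅: these pairs differ only in their
    -- values at h₅ and h₆.
    have key : ∀ i j : Fin 6, (s(i, j) = s(0, 5) ∨ s(i, j) = s(2, 4)) ↔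
        i ≠ j ∧ restrictedWeight i = restrictedWeight j := by decide +kernel
    rw [sameRestriction_simple_iff, Set.mem_insert_iff, Set.mem_singleton_iff, key]
    simp

end IsChevalley

/-- The restrictions of the simple roots. -/
noncomputable def restrictedRoot : Fin 6 → Dual ℝ h₀ :=
  ![simpleReal 3, simpleReal 0, simpleReal 2, simpleReal 1, simpleReal 2, simpleReal 3]

lemma isRestriction_simpleComplex (i : Fin 6) :
    IsRestriction (simpleComplex i) (restrictedRoot i) := by
  refine isRestriction_of_coords fun k ↦ ?_
  rw [coordsC_simpleComplex]
  fin_cases i <;> simp only [restrictedRoot] <;> fin_cases k <;>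
    simp [coords_simpleReal, simplePhi, simpleRoots]

/-- A long root occurs once, in tri(pO_s), while a short root occurs on both ι_i(x ⊗ 1) and ι_i(x ⊗
**i**). The multiplicities are counts of indices in the weight table. -/
lemma finrank_weightSpace_simpleReal (i : Fin 4) :
    finrank ℝ (weightSpace h₀ (simpleReal i)) = ![1, 1, 2, 2] i := by
  have h1 : simplePhi i = half (combF₄ (Pi.single i 1)) := by
    rw [← sum_simplePhi, Finset.sum_eq_single i
      (fun j _ hj ↦ by rw [Pi.single_eq_of_ne hj]; simp) (by simp), Pi.single_eq_same,
      Int.cast_one, one_smul]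
  have h2 : ∀ i : Fin 4, Fintype.card {j : Ind // indWeight j = combF₄ (Pi.single i 1)} =
      ![1, 1, 2, 2] i := by decide +kernel
  rw [isWeightBasis_real.finrank_weightSpace, ← h2, ← Nat.card_eq_fintype_card]
  refine Nat.card_congr (Equiv.subtypeEquivRight fun j ↦ ?_)
  have h3 : (fun k ↦ simpleReal i (realGen k)) = half (combF₄ (Pi.single i 1)) := by
    rw [← h1, ← coords_simpleReal, coords_eq]; rfl
  rw [Set.mem_ofPred_eq, h3]
  exact half_injective.eq_iff

end E62

theorem mainTheorem3 :
    -- `g` is semisimple, a real form of the complex simple Lie algebra of type `E₆` (see the root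
    -- system below), of signature 2
    LieAlgebra.IsKilling ℝ E62 ∧ LieAlgebra.IsSimple ℂ (ℂ ⊗[ℝ] E62) ∧ killingSignature E62 = 2 ∧
    -- the maps `Ψᵢ` are automorphisms
    (∀ i, ∃ φ : E62 ≃ₗ⁅ℝ⁆ E62, ∀ x, φ x = E62.Psi i x) ∧
    -- `g₀` is split of type `F₄`, with Cartan subalgebra `h₀`
    LieAlgebra.IsKilling ℝ E62.g₀ ∧ IsSplitCartan E62.h₀' ∧
    roots E62.h₀' = {lam | E62.coords' lam ∈ Phi} ∧
    (∃ β : Fin 4 → Module.Dual ℝ E62.h₀', (∀ i, E62.coords' (β i) = simplePhi i) ∧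
      IsRootBasis ℝ (roots E62.h₀') β CartanMatrix.F₄) ∧
    -- normalized root vectors exist
    (∃ e f : Module.Dual ℝ E62.h₀' → E62.g₀, IsChevalleyFamily E62.h₀' E62.positive e f) ∧
    -- `h = h₀ ⊕ tri(pC)` with basis `h₁, …, h₆`, and `h^ℂ` is a Cartan subalgebra with roots `Δ`
    LinearIndependent ℝ E62.h ∧ E62.hFull = E62.h₀ ⊔ E62.triPC ∧
    Module.finrank ℝ E62.h₀ = 4 ∧
    IsCartanSubspace (E62.hFull.baseChange ℂ) ∧
    roots (E62.hFull.baseChange ℂ) = {α | E62.coordsC α ∈ Delta} ∧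
    ∃ α : Fin 6 → Module.Dual ℂ (E62.hFull.baseChange ℂ),
      (∀ i, E62.coordsC (α i) = simpleRoots i) ∧
      -- the Cartan decomposition and the Satake diagram
      (∀ e f : Module.Dual ℝ E62.h₀' → E62.g₀, IsChevalleyFamily E62.h₀' E62.positive e f →
        IsCartanDecomposition (E62.t₀ e f) (E62.p₀ e f) ∧
        IsCartanDecomposition (E62.t e f) (E62.p e f) ∧
        Module.finrank ℝ (E62.t e f) = 38 ∧ Module.finrank ℝ (E62.p e f) = 40 ∧
        E62.hFull ⊓ E62.t e f = E62.triPC ∧ E62.hFull ⊓ E62.p e f = E62.h₀ ∧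
        IsSatakeDiagram (E62.t e f) (E62.p e f) E62.h₀ E62.hFull α CartanMatrix.E₆ ∅
          {s(0, 5), s(2, 4)}) ∧
      -- the restricted roots
      roots E62.h₀ = {lam | E62.coords lam ∈ Phi} ∧
      ∃ lam : Fin 6 → Module.Dual ℝ E62.h₀, (∀ i, IsRestriction (α i) (lam i)) ∧
        IsRootBasis ℝ (roots E62.h₀) ![lam 1, lam 3, lam 2, lam 0] CartanMatrix.F₄ ∧
        Module.finrank ℝ (weightSpace E62.h₀ (lam 0)) = 2 ∧
        Module.finrank ℝ (weightSpace E62.h₀ (lam 1)) = 1 ∧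
        Module.finrank ℝ (weightSpace E62.h₀ (lam 2)) = 2 ∧
        Module.finrank ℝ (weightSpace E62.h₀ (lam 3)) = 1 := by
  -- A single Chevalley family supplies the Cartan involutions needed for semisimplicity and the
  -- signature, which do not depend on the choice.
  obtain ⟨e, f, hef⟩ := E62.exists_isChevalleyFamily
  obtain ⟨θ, hC⟩ := E62.exists_isChevalley hef
  obtain ⟨Θ, hE⟩ := hC.exists_isExtension
  have hK : LieAlgebra.IsKilling ℝ E62 := (hC.isCartanInvolution_extension hE).isKilling
  refine ⟨hK, E62.isSimple_complex, hC.killingSignature_eq_two hE,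
    fun i ↦ ⟨E62.PsiEquiv i, fun _ ↦ rfl⟩, hC.isCartanInvolution.isKilling, E62.isSplitCartan_h₀,
    E62.roots_real₀, ⟨E62.simpleReal₀, E62.coords'_simpleReal₀, E62.isRootBasis_real₀⟩,
    ⟨e, f, hef⟩, E62.linearIndependent_h, E62.hFull_eq, E62.finrank_h₀,
    E62.isCartanSubspace_complex, E62.roots_complex, E62.simpleComplex, E62.coordsC_simpleComplex,
    fun e f hef ↦ ?_, E62.roots_real, E62.restrictedRoot, E62.isRestriction_simpleComplex,
    E62.isRootBasis_real.congr rfl fun i ↦ ?_, E62.finrank_weightSpace_simpleReal 3,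
    E62.finrank_weightSpace_simpleReal 0, E62.finrank_weightSpace_simpleReal 2,
    E62.finrank_weightSpace_simpleReal 1⟩
  · obtain ⟨θ, hC⟩ := E62.exists_isChevalley hef
    obtain ⟨Θ, hE⟩ := hC.exists_isExtension
    exact ⟨hC.isCartanDecomposition₀, hC.isCartanDecomposition hE, hC.finrank_t hE,
      hC.finrank_p hE, hC.hFull_inf_t hE, hC.hFull_inf_p hE, hC.isSatakeDiagram hE⟩
  · fin_cases i <;> rfl
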